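/- **Setting.** Let $(a_{ij})_{1\le i,j\le n}$ ($n\ge 1$) be a Cartan matrix of finite type ($a_{ii}=2$, $a_{ij}\le 0$ for $i\ne j$), $d_i$ relatively prime positive integers with $(d_ia_{ij})$ symmetric and positive definite, $\mathbf P$ the weight lattice with fundamental weights $\varpi_i$, simple roots $\alpha_j=\sum_i a_{ij}\varpi_i$, root lattice $\mathbf Q$, and $(\ ,\ )$ the $\mathbb Q$-valued bilinear form on $\mathbf P$ with $(\varpi_i,\alpha_j)=\delta_{ij}d_i$. Fix a lattice $\mathbf Q\subset\mathbf L\subset\mathbf P$ and put $\mathbf L^+=\{\Lambda\in\mathbf L:\Lambda=\sum_i m_i\varpi_i,\ m_i\ge 0\}$. Let $\hbar\in\mathbb C$, $q^x=\exp(-x\hbar/2)$, and assume that $q=q^1$ is not a root of unity; $q_i=q^{d_i}$. Let $p:\mathbf L\times\mathbf L\to\mathbb C^*$ be an antisymmetric bicharacter (multiplicative in both entries, $p(\mu,\mu)=1$). **The Hopf algebras.** $U_q(\mathfrak g)$ is generated by $k_\lambda$ ($\lambda\in\mathbf L$), $e_i,f_i$ with relations $k_0=1$, $k_\lambda k_\mu=k_{\lambda+\mu}$,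 $k_\lambda e_j=q^{(\lambda,\alpha_j)}e_jk_\lambda$, $k_\lambda f_j=q^{-(\lambda,\alpha_j)}f_jk_\lambda$, $e_if_j-f_je_i=\delta_{ij}(q_i-q_i^{-1})^{-1}(k_{\alpha_i}-k_{\alpha_i}^{-1})$ and the quantum Serre relations, with $\Delta k_\lambda=k_\lambda\otimes k_\lambda$, $\Delta e_i=e_i\otimes1+k_{\alpha_i}\otimes e_i$, $\Delta f_i=f_i\otimes k_{\alpha_i}^{-1}+1\otimes f_i$. The double $D_q(\mathfrak g)$ has generators $s_\lambda,t_\lambda$ ($\lambda\in\mathbf L$; commuting, $s_0=t_0=1$, $s_\lambda s_\mu=s_{\lambda+\mu}$, $t_\lambda t_\mu=t_{\lambda+\mu}$), $e_i,f_i$; $s_\lambda$ and $t_\lambda$ satisfy the same relations with $e_j,f_j$ as $k_\lambda$ does; $e_if_j-f_je_i=\delta_{ij}(q_i-q_i^{-1})^{-1}(s_{\alpha_i}-t_{\alpha_i}^{-1})$; and the Serre relations hold. Its coproduct is $\Delta s_\lambda=s_\lambda\otimes s_\lambda$, $\Delta t_\lambda=t_\lambda\otimes t_\lambda$, $\Delta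 e_i=e_i\otimes1+s_{\alpha_i}\otimes e_i$, $\Delta f_i=f_i\otimes t_{\alpha_i}^{-1}+1\otimes f_i$. Let $\pi:D_q(\mathfrak g)\to U_q(\mathfrak g)$ be the map $s_\lambda,t_\lambda\mapsto k_\lambda$, $e_i\mapsto e_i$, $f_i\mapsto f_i$. $D_q(\mathfrak g)$ is $\mathbf L\times\mathbf L$-graded with $s_\lambda,t_\lambda,e_i,f_i$ of degrees $(-\lambda,\lambda),(\lambda,-\lambda),(-\alpha_i,0),(0,\alpha_i)$. **The categories and the function algebra.** For a $U_q(\mathfrak g)$-module $M$ put $M_\mu=\{x: k_\lambda x=q^{(\lambda,\mu)}x\ \forall\lambda\in\mathbf L\}$. $\mathcal C_q$ is the full subcategory of finite dimensional $U_q(\mathfrak g)$-modules that are finite direct sums of modules $L(\Lambda)$, $\Lambda\in\mathbf L^+$, where $L(\Lambda)$ is the finite dimensional simple module of highest weight $\Lambda$; then $M=\bigoplus_{\mu\in\mathbf L}M_\mu$ for $M\in\mathcal C_q$. For a class of finite dimensional modules over a Hopf algebra $H$, its restricted dual is the subalgebra of $H^*$ (with the product dual to $\Delta$) generated by the coordinate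 functions $c_{f,v}(u)=f(uv)$, $v\in M$, $f\in M^*$, $M$ in the class; its coproduct and counit are dual to the product and unit of $H$. $\mathbb C_q[G]$ is the restricted dual of $\mathcal C_q$, and $\langle a,u\rangle=a(\pi u)$ for $a\in\mathbb C_q[G]$, $u\in D_q(\mathfrak g)$. It is graded by $\mathbb C_q[G]_{\lambda,\mu}=\{c: c(k_\nu u)=q^{-(\nu,\lambda)}c(u),\ c(uk_\nu)=q^{(\nu,\mu)}c(u)\ \forall \nu\in\mathbf L,\,u\in U_q(\mathfrak g)\}$. **Twists.** For an $\mathbf L$-bigraded bialgebra or Hopf algebra $A=\bigoplus A_{\lambda,\mu}$, $A_p$ is $A$ with the same coproduct, counit (and antipode) and the new product $a\cdot b=p(\lambda,\lambda')p(\mu,\mu')^{-1}ab$ for $a\in A_{\lambda,\mu}$, $b\in A_{\lambda',\mu'}$. Put $\mathbb C_{q,p}[G]=\mathbb C_q[G]_p$, $D_{q,p^{-1}}(\mathfrak g)=D_q(\mathfrak g)_{p^{-1}}$, and $$\langle a,u\rangle_p=p(\lambda,\gamma)\,p(\mu,\delta)\,\langle a,u\rangle\qquad (a\in\mathbb C_{q,p}[G]_{\lambda,\mu},\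 u\in D_{q,p^{-1}}(\mathfrak g)_{\gamma,\delta}).$$ For $M\in\mathcal C_q$ let $\breve M$ be the space $M$ with the $D_{q,p^{-1}}(\mathfrak g)$-action $$u\cdot x=p(\lambda,\delta-\gamma)\,p(\delta,\gamma)\,\pi(u)x\qquad(u\in D_{q,p^{-1}}(\mathfrak g)_{\gamma,\delta},\ x\in M_\lambda),$$ and let $\mathcal C_{q,p}$ be the full subcategory of $D_{q,p^{-1}}(\mathfrak g)$-modules isomorphic to some $\breve M$, $M\in\mathcal C_q$. **Theorem 3.7.** 1. $\mathcal C_q$ and $\mathcal C_{q,p}$ are closed under tensor products and contain the trivial module, they are rigid monoidal categories (with the tensor product of modules), and the functor $M\mapsto\breve M$, the identity on underlying linear maps, from $\mathcal C_q$ to $\mathcal C_{q,p}$ is an equivalence of (rigid) monoidal categories: it is an equivalence of categories and it admits the structure of a (strong) monoidal functor. 2. The Hopf pairing $\langle\ ,\ \rangle_p$ identifies the Hopf algebra $\mathbb C_{q,p}[G]$ with the restricted dual of $\mathcal C_{q,p}$, the Hopf algebra of coordinate functions on the objects of $\mathcal C_{q,p}$. That is, $a\mapsto\langle a,\cdot\rangle_p$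 is an isomorphism of bialgebras from $\mathbb C_{q,p}[G]$ onto the restricted dual of $\mathcal C_{q,p}$; under it $c_{f,v}$ goes to the coordinate function of $\breve M$: $\langle c_{f,v},u\rangle_p=f(u\cdot v)$ for all $M\in\mathcal C_q$, $f\in M^*$, $v\in M$, $u\in D_{q,p^{-1}}(\mathfrak g)$; both bialgebras have antipodes, the isomorphism intertwines them, and $\langle S(a),u\rangle_p=\langle a,S(u)\rangle_p$. -/

import Mathlib

open scoped TensorProduct DirectSum

noncomputable section

namespace QG

/-! ### Rescaling a bilinear map along gradings -/

section TwistBilin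

variable {K A B C G G' : Type*} [Field K] [AddCommGroup A] [Module K A] [AddCommGroup B] [Module K B]
  [AddCommGroup C] [Module K C] [DecidableEq G] [DecidableEq G']

/-- The bilinear map `(a, b) ↦ w(g, h) β(a, b)` for `a` of degree `g` and `b` of degree `h`. -/
def twistBilin (𝒜 : G → Submodule K A) [DirectSum.Decomposition 𝒜]
    (ℬ : G' → Submodule K B) [DirectSum.Decomposition ℬ]
    (β : A →ₗ[K] B →ₗ[K] C) (w : G → G' → K) : A →ₗ[K] B →ₗ[K] C :=
  (DirectSum.toModule K G (B →ₗ[K] C) fun g =>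
      LinearMap.flip ((DirectSum.toModule K G' (𝒜 g →ₗ[K] C) fun h =>
        w g h • ((β ∘ₗ (𝒜 g).subtype).flip ∘ₗ (ℬ h).subtype)) ∘ₗ
          (DirectSum.decomposeLinearEquiv ℬ).toLinearMap)) ∘ₗ
    (DirectSum.decomposeLinearEquiv 𝒜).toLinearMap

variable (𝒜 : G → Submodule K A) [DirectSum.Decomposition 𝒜]
    (ℬ : G' → Submodule K B) [DirectSum.Decomposition ℬ]

theorem twistBilin_apply (β : A →ₗ[K] B →ₗ[K] C) (w : G → G' → K) {g : G} {h : G'} {a : A} {b : B}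
    (ha : a ∈ 𝒜 g) (hb : b ∈ ℬ h) : twistBilin 𝒜 ℬ β w a b = w g h • β a b := by
  simp only [twistBilin, LinearMap.coe_comp, Function.comp_apply, LinearEquiv.coe_coe,
    DirectSum.decomposeLinearEquiv_apply]
  rw [DirectSum.decompose_of_mem 𝒜 ha]
  rw [← DirectSum.lof_eq_of K, DirectSum.toModule_lof]
  simp only [LinearMap.flip_apply, LinearMap.coe_comp, Function.comp_apply, LinearEquiv.coe_coe,
    DirectSum.decomposeLinearEquiv_apply]
  rw [DirectSum.decompose_of_mem ℬ hb]
  rw [← DirectSum.lof_eq_of K, DirectSum.toModule_lof]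
  simp

/-- Two linear maps that agree on homogeneous elements are equal. -/
theorem hom_ext_of_homogeneous {f f' : A →ₗ[K] C}
    (h : ∀ g, ∀ a ∈ 𝒜 g, f a = f' a) : f = f' := by
  ext a
  induction a using DirectSum.Decomposition.inductionOn 𝒜 with
  | zero => simp
  | homogeneous m => exact h _ _ m.2
  | add m m' h1 h2 => simp [h1, h2]

end TwistBilin

/-! ### Antisymmetric bicharacters and twists of bigraded bialgebras -/

/-- An antisymmetric bicharacter on the abelian group `L` with values in `K`: a map
`p : L × L → Kˣ`, multiplicative in both entries, with `p(μ, μ) = 1`. -/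
structure Bichar (L K : Type*) [AddCommGroup L] [Field K] where
  toFun : L → L → Kˣ
  map_add_left : ∀ a b c, toFun (a + b) c = toFun a c * toFun b c
  map_add_right : ∀ a b c, toFun a (b + c) = toFun a b * toFun a c
  self_eq_one : ∀ a, toFun a a = 1

namespace Bichar

variable {L K : Type*} [AddCommGroup L] [Field K] (p : Bichar L K)

instance : CoeFun (Bichar L K) fun _ => L → L → Kˣ := ⟨Bichar.toFun⟩

/-- The inverse bicharacter `p⁻¹`. -/
instance : Inv (Bichar L K) where
  inv p :=
    { toFun := fun a b => (p a b)⁻¹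
      map_add_left := fun a b c => by rw [p.map_add_left, mul_inv]
      map_add_right := fun a b c => by rw [p.map_add_right, mul_inv]
      self_eq_one := fun a => by rw [p.self_eq_one, inv_one] }

theorem inv_apply (a b : L) : p⁻¹ a b = (p a b)⁻¹ := rfl

theorem add_left (a b c : L) : p (a + b) c = p a c * p b c := p.map_add_left a b c
theorem add_right (a b c : L) : p a (b + c) = p a b * p a c := p.map_add_right a b c
theorem zero_left (c : L) : p 0 c = 1 := by
  have h := p.add_left 0 0 c
  rw [add_zero] at h
  exact (mul_eq_left.mp h.symm)
theorem zero_right (c : L) : p c 0 = 1 := by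
  have h := p.add_right c 0 0
  rw [add_zero] at h
  exact (mul_eq_left.mp h.symm)
theorem neg_left (a c : L) : p (-a) c = (p a c)⁻¹ := by
  rw [eq_inv_iff_mul_eq_one, ← p.add_left, neg_add_cancel, p.zero_left]
theorem neg_right (a c : L) : p a (-c) = (p a c)⁻¹ := by
  rw [eq_inv_iff_mul_eq_one, ← p.add_right, neg_add_cancel, p.zero_right]
theorem sub_left (a b c : L) : p (a - b) c = p a c * (p b c)⁻¹ := by
  rw [sub_eq_add_neg, p.add_left, p.neg_left]
theorem sub_right (a b c : L) : p a (b - c) = p a b * (p a c)⁻¹ := by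
  rw [sub_eq_add_neg, p.add_right, p.neg_right]
theorem swap (a b : L) : p a b = (p b a)⁻¹ := by
  have h := p.self_eq_one (a + b)
  rw [p.add_left, p.add_right, p.add_right, p.self_eq_one, p.self_eq_one, one_mul, mul_one] at h
  exact eq_inv_of_mul_eq_one_left h

/-- The cocycle `p̃((λ, μ), (λ', μ')) = p(λ, λ') p(μ, μ')⁻¹` on `L × L`. -/
def tilde (g h : L × L) : Kˣ := p g.1 h.1 * (p g.2 h.2)⁻¹

theorem tilde_add_left (g g' h : L × L) : p.tilde (g + g') h = p.tilde g h * p.tilde g' h := by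
  simp only [tilde, Prod.fst_add, Prod.snd_add, p.add_left, mul_inv]
  exact mul_mul_mul_comm _ _ _ _
theorem tilde_add_right (g h h' : L × L) : p.tilde g (h + h') = p.tilde g h * p.tilde g h' := by
  simp only [tilde, Prod.fst_add, Prod.snd_add, p.add_right, mul_inv]
  exact mul_mul_mul_comm _ _ _ _
theorem tilde_zero_left (g : L × L) : p.tilde 0 g = 1 := by
  simp [tilde, p.zero_left]
theorem tilde_zero_right (g : L × L) : p.tilde g 0 = 1 := by
  simp [tilde, p.zero_right]

end Bichar

section Bigraded

variable {L K A : Type*} [AddCommGroup L] [DecidableEq L] [Field K] [Ring A]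

/-- The subspace `∑_ν A_{λ,ν} ⊗ A_{-ν,μ}` of `A ⊗ A`. -/
def bigradedTensor [Algebra K A] (𝒜 : L × L → Submodule K A) (l m : L) : Submodule K (A ⊗[K] A) :=
  Submodule.span K {z | ∃ n, ∃ x ∈ 𝒜 (l, n), ∃ y ∈ 𝒜 (-n, m), z = x ⊗ₜ[K] y}

/-- The algebra grading `A = ⨁ A_{λ,μ}` makes the bialgebra `A` an `L`-bigraded bialgebra. -/
class IsBigraded [Bialgebra K A] (𝒜 : L × L → Submodule K A) [GradedAlgebra 𝒜] : Prop where
  comul_mem : ∀ l m, ∀ a ∈ 𝒜 (l, m), Coalgebra.comul (R := K) a ∈ bigradedTensor 𝒜 l m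
  counit_eq_zero : ∀ l m, ∀ a ∈ 𝒜 (l, m), l ≠ -m → Coalgebra.counit (R := K) a = 0

/-- The remaining condition for an `L`-bigraded Hopf algebra: `S(A_{λ,μ}) ⊆ A_{μ,λ}`. -/
class IsBigradedHopf [HopfAlgebra K A] (𝒜 : L × L → Submodule K A) [GradedAlgebra 𝒜] : Prop
    extends IsBigraded 𝒜 where
  antipode_mem : ∀ l m, ∀ a ∈ 𝒜 (l, m), HopfAlgebra.antipode K a ∈ 𝒜 (m, l)

/-- The twist `A_p` of a bigraded algebra `A` by the cocycle `p̃`. As a vector space it is `A`. -/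
def Twist [Algebra K A] (_𝒜 : L × L → Submodule K A) (_p : Bichar L K) : Type _ := A

namespace Twist

section Alg

variable [Algebra K A] (𝒜 : L × L → Submodule K A) (p : Bichar L K)

instance : AddCommGroup (Twist 𝒜 p) := inferInstanceAs (AddCommGroup A)
instance : Module K (Twist 𝒜 p) := inferInstanceAs (Module K A)

/-- The identity map, as a linear isomorphism `A ≃ A_p`. -/
def of : A ≃ₗ[K] Twist 𝒜 p := LinearEquiv.refl K A

variable [GradedAlgebra 𝒜]

/-- The twisted product: `a · b = p(λ, λ') p(μ, μ')⁻¹ a b` for `a ∈ A_{λ,μ}`, `b ∈ A_{λ',μ'}`. -/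
def mulMap : A →ₗ[K] A →ₗ[K] A :=
  twistBilin 𝒜 𝒜 (LinearMap.mul K A) fun g h => (p.tilde g h : K)

theorem mulMap_apply {g h : L × L} {a b : A} (ha : a ∈ 𝒜 g) (hb : b ∈ 𝒜 h) :
    mulMap 𝒜 p a b = (p.tilde g h : K) • (a * b) :=
  twistBilin_apply 𝒜 𝒜 _ _ ha hb

theorem mulMap_assoc (a b c : A) :
    mulMap 𝒜 p (mulMap 𝒜 p a b) c = mulMap 𝒜 p a (mulMap 𝒜 p b c) := by
  induction a using DirectSum.Decomposition.inductionOn 𝒜 with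
  | zero => simp
  | add m m' h1 h2 => simp [h1, h2]
  | @homogeneous g a =>
  induction b using DirectSum.Decomposition.inductionOn 𝒜 with
  | zero => simp
  | add m m' h1 h2 => simp [h1, h2]
  | @homogeneous h b =>
  induction c using DirectSum.Decomposition.inductionOn 𝒜 with
  | zero => simp
  | add m m' h1 h2 => simp [h1, h2]
  | @homogeneous k c =>
  rw [mulMap_apply 𝒜 p a.2 b.2, mulMap_apply 𝒜 p b.2 c.2, map_smul, map_smul, LinearMap.smul_apply,
    mulMap_apply 𝒜 p (SetLike.mul_mem_graded a.2 b.2) c.2,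
    mulMap_apply 𝒜 p a.2 (SetLike.mul_mem_graded b.2 c.2), p.tilde_add_left, p.tilde_add_right,
    smul_smul, smul_smul, mul_assoc]
  congr 1
  push_cast
  ring

theorem one_mulMap (a : A) : mulMap 𝒜 p 1 a = a := by
  induction a using DirectSum.Decomposition.inductionOn 𝒜 with
  | zero => simp
  | add m m' h1 h2 => simp [h1, h2]
  | homogeneous a =>
    rw [mulMap_apply 𝒜 p SetLike.GradedOne.one_mem a.2, p.tilde_zero_left]; simp

theorem mulMap_one (a : A) : mulMap 𝒜 p a 1 = a := by
  induction a using DirectSum.Decomposition.inductionOn 𝒜 with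
  | zero => simp
  | add m m' h1 h2 => simp [h1, h2]
  | homogeneous a =>
    rw [mulMap_apply 𝒜 p a.2 SetLike.GradedOne.one_mem, p.tilde_zero_right]; simp

instance : Ring (Twist 𝒜 p) :=
  { (inferInstance : AddCommGroup (Twist 𝒜 p)) with
    one := of 𝒜 p 1
    mul := fun a b => of 𝒜 p (mulMap 𝒜 p ((of 𝒜 p).symm a) ((of 𝒜 p).symm b))
    left_distrib := fun a b c => by
      change of 𝒜 p _ = of 𝒜 p _ + of 𝒜 p _
      rw [map_add, map_add, map_add]
    right_distrib := fun a b c => by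
      change of 𝒜 p _ = of 𝒜 p _ + of 𝒜 p _
      rw [map_add, map_add, LinearMap.add_apply, map_add]
    zero_mul := fun a => by
      change of 𝒜 p (mulMap 𝒜 p ((of 𝒜 p).symm 0) _) = 0
      simp
    mul_zero := fun a => by
      change of 𝒜 p (mulMap 𝒜 p _ ((of 𝒜 p).symm 0)) = 0
      simp
    mul_assoc := fun a b c => mulMap_assoc 𝒜 p a b c
    one_mul := fun a => one_mulMap 𝒜 p a
    mul_one := fun a => mulMap_one 𝒜 p a
    }

theorem of_mul (a b : A) : of 𝒜 p a * of 𝒜 p b = of 𝒜 p (mulMap 𝒜 p a b) := rfl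
theorem one_def : (1 : Twist 𝒜 p) = of 𝒜 p 1 := rfl

theorem of_mul_of {g h : L × L} {a b : A} (ha : a ∈ 𝒜 g) (hb : b ∈ 𝒜 h) :
    of 𝒜 p a * of 𝒜 p b = (p.tilde g h : K) • of 𝒜 p (a * b) := by
  rw [of_mul, mulMap_apply 𝒜 p ha hb, map_smul]

instance : Algebra K (Twist 𝒜 p) :=
  Algebra.ofModule
    (fun r a b => by
      change of 𝒜 p (mulMap 𝒜 p (r • (of 𝒜 p).symm a) _) = r • of 𝒜 p _
      rw [map_smul, LinearMap.smul_apply, map_smul])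
    (fun r a b => by
      change of 𝒜 p (mulMap 𝒜 p _ (r • (of 𝒜 p).symm b)) = r • of 𝒜 p _
      rw [map_smul, map_smul])

theorem algebraMap_def (r : K) : algebraMap K (Twist 𝒜 p) r = of 𝒜 p (algebraMap K A r) := by
  rw [Algebra.algebraMap_eq_smul_one, Algebra.algebraMap_eq_smul_one, map_smul, one_def]

end Alg

section Bialg

variable [Bialgebra K A] (𝒜 : L × L → Submodule K A) (p : Bichar L K)

instance : Coalgebra K (Twist 𝒜 p) := inferInstanceAs (Coalgebra K A)

variable [GradedAlgebra 𝒜]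

theorem comul_of (a : A) : Coalgebra.comul (R := K) (of 𝒜 p a) =
    TensorProduct.map (of 𝒜 p).toLinearMap (of 𝒜 p).toLinearMap (Coalgebra.comul (R := K) a) := by
  change Coalgebra.comul (R := K) a = TensorProduct.map LinearMap.id LinearMap.id _
  simp

theorem counit_of (a : A) : Coalgebra.counit (R := K) (of 𝒜 p a) = Coalgebra.counit (R := K) a :=
  rfl

variable [IsBigraded 𝒜]

theorem counit_mul_of (a b : A) : Coalgebra.counit (R := K) (of 𝒜 p a * of 𝒜 p b) =
    Coalgebra.counit (R := K) a * Coalgebra.counit (R := K) b := by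
  induction a using DirectSum.Decomposition.inductionOn 𝒜 with
  | zero => simp
  | add m m' h1 h2 => simp only [map_add, add_mul, h1, h2]
  | @homogeneous g a =>
  induction b using DirectSum.Decomposition.inductionOn 𝒜 with
  | zero => simp
  | add m m' h1 h2 => simp only [map_add, mul_add, h1, h2]
  | @homogeneous h b =>
  rw [of_mul_of 𝒜 p a.2 b.2, map_smul, counit_of, Bialgebra.counit_mul]
  by_cases h1 : g.1 = -g.2
  · by_cases h2 : h.1 = -h.2
    · simp only [Bichar.tilde, h1, h2, p.neg_left, p.neg_right, inv_inv, mul_inv_cancel]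
      simp
    · rw [IsBigraded.counit_eq_zero (𝒜 := 𝒜) h.1 h.2 _ b.2 h2]; simp
  · rw [IsBigraded.counit_eq_zero (𝒜 := 𝒜) g.1 g.2 _ a.2 h1]; simp

theorem tensor_mul_of {l m l' m' : L} {z z' : A ⊗[K] A} (hz : z ∈ bigradedTensor 𝒜 l m)
    (hz' : z' ∈ bigradedTensor 𝒜 l' m') :
    TensorProduct.map (of 𝒜 p).toLinearMap (of 𝒜 p).toLinearMap z *
      TensorProduct.map (of 𝒜 p).toLinearMap (of 𝒜 p).toLinearMap z' =
    (p.tilde (l, m) (l', m') : K) •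
      TensorProduct.map (of 𝒜 p).toLinearMap (of 𝒜 p).toLinearMap (z * z') := by
  induction hz using Submodule.span_induction with
  | zero => simp
  | add x y _ _ h1 h2 => simp only [map_add, add_mul, h1, h2, smul_add]
  | smul r x _ h => rw [map_smul, smul_mul_assoc, h, smul_mul_assoc, map_smul, smul_comm]
  | mem z hz =>
  induction hz' using Submodule.span_induction with
  | zero => simp
  | add x y _ _ h1 h2 => simp only [map_add, mul_add, h1, h2, smul_add]
  | smul r x _ h => rw [map_smul, mul_smul_comm, h, mul_smul_comm, map_smul, smul_comm]
  | mem z' hz' =>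
  obtain ⟨n, x, hx, y, hy, rfl⟩ := hz
  obtain ⟨n', x', hx', y', hy', rfl⟩ := hz'
  simp only [TensorProduct.map_tmul, LinearEquiv.coe_coe, Algebra.TensorProduct.tmul_mul_tmul]
  rw [of_mul_of 𝒜 p hx hx', of_mul_of 𝒜 p hy hy', TensorProduct.smul_tmul_smul]
  congr 1
  simp only [Bichar.tilde, p.neg_left, p.neg_right, inv_inv]
  rw [← Units.val_mul]
  congr 1
  rw [mul_assoc, inv_mul_cancel_left]

theorem comul_mul_of (a b : A) : Coalgebra.comul (R := K) (of 𝒜 p a * of 𝒜 p b) =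
    Coalgebra.comul (R := K) (of 𝒜 p a) * Coalgebra.comul (R := K) (of 𝒜 p b) := by
  induction a using DirectSum.Decomposition.inductionOn 𝒜 with
  | zero => simp
  | add m m' h1 h2 => simp only [map_add, add_mul, h1, h2]
  | @homogeneous g a =>
  induction b using DirectSum.Decomposition.inductionOn 𝒜 with
  | zero => simp
  | add m m' h1 h2 => simp only [map_add, mul_add, h1, h2]
  | @homogeneous h b =>
  rw [comul_of, comul_of, tensor_mul_of 𝒜 p (IsBigraded.comul_mem g.1 g.2 _ a.2)
    (IsBigraded.comul_mem h.1 h.2 _ b.2), of_mul_of 𝒜 p a.2 b.2, map_smul, comul_of,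
    Bialgebra.comul_mul]

/-- `A_p` is a bialgebra, with the coalgebra structure of `A`. -/
instance : Bialgebra K (Twist 𝒜 p) :=
  Bialgebra.mk' K (Twist 𝒜 p)
    (by rw [one_def, counit_of, Bialgebra.counit_one])
    (fun {a b} => counit_mul_of 𝒜 p ((of 𝒜 p).symm a) ((of 𝒜 p).symm b))
    (by rw [one_def, comul_of, Bialgebra.comul_one]; rfl)
    (fun {a b} => comul_mul_of 𝒜 p ((of 𝒜 p).symm a) ((of 𝒜 p).symm b))

end Bialg

section Hopf

variable [HopfAlgebra K A] (𝒜 : L × L → Submodule K A) (p : Bichar L K) [GradedAlgebra 𝒜]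
  [IsBigradedHopf 𝒜]

/-- The antipode of `A_p` is that of `A`. -/
def antipodeMap : Twist 𝒜 p →ₗ[K] Twist 𝒜 p :=
  (of 𝒜 p).toLinearMap ∘ₗ HopfAlgebra.antipode K ∘ₗ (of 𝒜 p).symm.toLinearMap

theorem antipodeMap_of (a : A) :
    antipodeMap 𝒜 p (of 𝒜 p a) = of 𝒜 p (HopfAlgebra.antipode K a) := rfl

theorem antipode_left_aux {l m : L} {z : A ⊗[K] A} (hz : z ∈ bigradedTensor 𝒜 l m) :
    LinearMap.mul' K (Twist 𝒜 p) ((antipodeMap 𝒜 p).rTensor _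
      (TensorProduct.map (of 𝒜 p).toLinearMap (of 𝒜 p).toLinearMap z)) =
    ((p l m)⁻¹ : Kˣ) • of 𝒜 p (LinearMap.mul' K A ((HopfAlgebra.antipode K).rTensor A z)) := by
  induction hz using Submodule.span_induction with
  | zero => simp
  | add x y _ _ h1 h2 => simp only [map_add, h1, h2, smul_add]
  | smul r x _ h => simp only [map_smul, h]; rw [smul_comm]
  | mem z hz =>
  obtain ⟨n, x, hx, y, hy, rfl⟩ := hz
  simp only [TensorProduct.map_tmul, LinearEquiv.coe_coe, LinearMap.rTensor_tmul, antipodeMap_of,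
    LinearMap.mul'_apply]
  rw [of_mul_of 𝒜 p (IsBigradedHopf.antipode_mem _ _ _ hx) hy, Units.smul_def]
  congr 2
  simp only [Bichar.tilde, p.neg_right, p.self_eq_one, inv_one, one_mul]

theorem antipode_right_aux {l m : L} {z : A ⊗[K] A} (hz : z ∈ bigradedTensor 𝒜 l m) :
    LinearMap.mul' K (Twist 𝒜 p) ((antipodeMap 𝒜 p).lTensor _
      (TensorProduct.map (of 𝒜 p).toLinearMap (of 𝒜 p).toLinearMap z)) =
    (p l m : Kˣ) • of 𝒜 p (LinearMap.mul' K A ((HopfAlgebra.antipode K).lTensor A z)) := by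
  induction hz using Submodule.span_induction with
  | zero => simp
  | add x y _ _ h1 h2 => simp only [map_add, h1, h2, smul_add]
  | smul r x _ h => simp only [map_smul, h]; rw [smul_comm]
  | mem z hz =>
  obtain ⟨n, x, hx, y, hy, rfl⟩ := hz
  simp only [TensorProduct.map_tmul, LinearEquiv.coe_coe, LinearMap.lTensor_tmul, antipodeMap_of,
    LinearMap.mul'_apply]
  rw [of_mul_of 𝒜 p hx (IsBigradedHopf.antipode_mem _ _ _ hy), Units.smul_def]
  congr 2
  simp only [Bichar.tilde, p.neg_right, p.self_eq_one, inv_one, mul_one]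

theorem smul_counit_aux {l m : L} {a : A} (ha : a ∈ 𝒜 (l, m)) (u : Kˣ) (hu : l = -m → u = 1) :
    u • of 𝒜 p (algebraMap K A (Coalgebra.counit a)) =
      algebraMap K (Twist 𝒜 p) (Coalgebra.counit (R := K) (of 𝒜 p a)) := by
  rw [algebraMap_def, counit_of]
  by_cases h : l = -m
  · rw [hu h, one_smul]
  · rw [IsBigraded.counit_eq_zero (𝒜 := 𝒜) l m _ ha h]; simp

/-- `A_p` is a Hopf algebra. -/
instance : HopfAlgebra K (Twist 𝒜 p) :=
  { (inferInstance : Bialgebra K (Twist 𝒜 p)) with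
    antipode := antipodeMap 𝒜 p
    mul_antipode_rTensor_comul := by
      refine LinearMap.ext fun a' => ?_
      obtain ⟨a, rfl⟩ := (of 𝒜 p).surjective a'
      simp only [LinearMap.comp_apply, Algebra.linearMap_apply]
      induction a using DirectSum.Decomposition.inductionOn 𝒜 with
      | zero => simp
      | add m m' h1 h2 => simp only [map_add, h1, h2]
      | @homogeneous g a =>
      rw [comul_of, antipode_left_aux 𝒜 p (IsBigraded.comul_mem g.1 g.2 _ a.2),
        HopfAlgebra.mul_antipode_rTensor_comul_apply]
      exact smul_counit_aux 𝒜 p a.2 _ fun h => by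
        rw [h, p.neg_left, inv_inv, p.self_eq_one]
    mul_antipode_lTensor_comul := by
      refine LinearMap.ext fun a' => ?_
      obtain ⟨a, rfl⟩ := (of 𝒜 p).surjective a'
      simp only [LinearMap.comp_apply, Algebra.linearMap_apply]
      induction a using DirectSum.Decomposition.inductionOn 𝒜 with
      | zero => simp
      | add m m' h1 h2 => simp only [map_add, h1, h2]
      | @homogeneous g a =>
      rw [comul_of, antipode_right_aux 𝒜 p (IsBigraded.comul_mem g.1 g.2 _ a.2),
        HopfAlgebra.mul_antipode_lTensor_comul_apply]
      exact smul_counit_aux 𝒜 p a.2 _ fun h => by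
        rw [h, p.neg_left, p.self_eq_one, inv_one] }

end Hopf

end Twist

end Bigraded

/-! ### Quantum Serre polynomials -/

/-- `[m]_t = (t - t⁻¹) ⋯ (t^m - t^{-m})`. -/
def qFact (t : ℂ) (m : ℕ) : ℂ := ∏ s ∈ Finset.range m, (t ^ (s + 1) - t⁻¹ ^ (s + 1))

/-- The Gaussian binomial coefficient `[m]_t / ([k]_t [m-k]_t)` (for `k ≤ m`). -/
def qBinom (t : ℂ) (m k : ℕ) : ℂ := qFact t m / (qFact t k * qFact t (m - k))

section Serre

variable {B : Type*} [Ring B] [Algebra ℂ B]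

/-- `∑_{k=0}^m (-1)^k [m choose k]_t x^{m-k} y x^k`. -/
def serre (t : ℂ) (m : ℕ) (x y : B) : B :=
  ∑ k ∈ Finset.range (m + 1), ((-1 : ℂ) ^ k * qBinom t m k) • (x ^ (m - k) * y * x ^ k)

/-- Iterated `c`-commutators with `x`, starting from `y`. -/
def serreIter (c : ℕ → ℂ) (x y : B) : ℕ → B
  | 0 => y
  | s + 1 => x * serreIter c x y s - c s • (serreIter c x y s * x)

theorem qFact_ne_zero {t : ℂ} (h0 : t ≠ 0) (ht : ∀ m : ℕ, 0 < m → t ^ m ≠ 1) (m : ℕ) :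
    qFact t m ≠ 0 := by
  refine Finset.prod_ne_zero_iff.mpr fun s _ h => ht (2 * (s + 1)) (by omega) ?_
  rw [sub_eq_zero, inv_pow] at h
  rw [two_mul, pow_add]
  nth_rewrite 1 [h]
  exact inv_mul_cancel₀ (pow_ne_zero _ h0)

theorem qFact_succ (t : ℂ) (m : ℕ) :
    qFact t (m + 1) = qFact t m * (t ^ (m + 1) - t⁻¹ ^ (m + 1)) := by
  rw [qFact, Finset.prod_range_succ, ← qFact]

theorem qFact_inv (t : ℂ) (m : ℕ) : qFact t⁻¹ m = (-1) ^ m * qFact t m := by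
  induction m with
  | zero => simp [qFact]
  | succ m ih => rw [qFact_succ, qFact_succ, ih, inv_inv]; ring

theorem qBinom_inv (t : ℂ) {m k : ℕ} (hk : k ≤ m) : qBinom t⁻¹ m k = qBinom t m k := by
  obtain ⟨l, rfl⟩ := Nat.exists_eq_add_of_le hk
  simp only [qBinom, qFact_inv, Nat.add_sub_cancel_left]
  rw [show (-1 : ℂ) ^ k * qFact t k * ((-1) ^ l * qFact t l) =
    (-1) ^ (k + l) * (qFact t k * qFact t l) by ring]
  exact mul_div_mul_left _ _ (pow_ne_zero _ (by norm_num))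

theorem serre_inv (t : ℂ) (m : ℕ) (x y : B) : serre t⁻¹ m x y = serre t m x y := by
  refine Finset.sum_congr rfl fun k hk => ?_
  rw [qBinom_inv t (Nat.lt_succ_iff.mp (Finset.mem_range.mp hk))]

theorem qBinom_zero {t : ℂ} (h0 : t ≠ 0) (ht : ∀ m : ℕ, 0 < m → t ^ m ≠ 1) (m : ℕ) :
    qBinom t m 0 = 1 := by
  have := qFact_ne_zero h0 ht m
  simp only [qBinom, Nat.sub_zero]
  rw [show qFact t 0 = 1 by simp [qFact], one_mul, div_self this]

theorem qBinom_self {t : ℂ} (h0 : t ≠ 0) (ht : ∀ m : ℕ, 0 < m → t ^ m ≠ 1) (m : ℕ) :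
    qBinom t m m = 1 := by
  have := qFact_ne_zero h0 ht m
  simp only [qBinom, Nat.sub_self]
  rw [show qFact t 0 = 1 by simp [qFact], mul_one, div_self this]

theorem qBinom_pascal {t : ℂ} (h0 : t ≠ 0) (ht : ∀ m : ℕ, 0 < m → t ^ m ≠ 1) {m k : ℕ}
    (hk : k < m) :
    qBinom t (m + 1) (k + 1) * t ^ ((k + 1) * m) =
      qBinom t m (k + 1) * t ^ ((k + 1) * (m - 1)) +
        t ^ (2 * m) * (qBinom t m k * t ^ (k * (m - 1))) := by
  obtain ⟨l, rfl⟩ := Nat.exists_eq_add_of_lt hk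
  have e1 : k + l + 1 + 1 - (k + 1) = l + 1 := by omega
  have e2 : k + l + 1 - (k + 1) = l := by omega
  have e3 : k + l + 1 - k = l + 1 := by omega
  have n1 := qFact_ne_zero h0 ht k
  have n2 := qFact_ne_zero h0 ht l
  have n3 := qFact_ne_zero h0 ht (k + 1)
  have n4 := qFact_ne_zero h0 ht (l + 1)
  rw [qFact_succ] at n3 n4
  have n5 := right_ne_zero_of_mul n3
  have n6 := right_ne_zero_of_mul n4
  simp only [qBinom, e1, e2, e3, Nat.add_sub_cancel]
  rw [qFact_succ t k, qFact_succ t l, qFact_succ t (k + l + 1)]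
  generalize qFact t (k + l + 1) = F
  rw [show F * (t ^ (k + l + 1 + 1) - t⁻¹ ^ (k + l + 1 + 1)) /
      (qFact t k * (t ^ (k + 1) - t⁻¹ ^ (k + 1)) * (qFact t l * (t ^ (l + 1) - t⁻¹ ^ (l + 1)))) *
      t ^ ((k + 1) * (k + l + 1)) =
      F / (qFact t k * (t ^ (k + 1) - t⁻¹ ^ (k + 1)) *
        (qFact t l * (t ^ (l + 1) - t⁻¹ ^ (l + 1)))) *
      ((t ^ (k + l + 1 + 1) - t⁻¹ ^ (k + l + 1 + 1)) * t ^ ((k + 1) * (k + l + 1))) by ring]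
  rw [show F / (qFact t k * (t ^ (k + 1) - t⁻¹ ^ (k + 1)) * qFact t l) =
      F / (qFact t k * (t ^ (k + 1) - t⁻¹ ^ (k + 1)) *
        (qFact t l * (t ^ (l + 1) - t⁻¹ ^ (l + 1)))) * (t ^ (l + 1) - t⁻¹ ^ (l + 1)) by
      generalize t ^ (l + 1) - t⁻¹ ^ (l + 1) = z at *
      generalize t ^ (k + 1) - t⁻¹ ^ (k + 1) = z' at *
      field_simp]
  rw [show F / (qFact t k * (qFact t l * (t ^ (l + 1) - t⁻¹ ^ (l + 1)))) =
      F / (qFact t k * (t ^ (k + 1) - t⁻¹ ^ (k + 1)) *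
        (qFact t l * (t ^ (l + 1) - t⁻¹ ^ (l + 1)))) * (t ^ (k + 1) - t⁻¹ ^ (k + 1)) by
      generalize t ^ (l + 1) - t⁻¹ ^ (l + 1) = z at *
      generalize t ^ (k + 1) - t⁻¹ ^ (k + 1) = z' at *
      field_simp]
  generalize F / (qFact t k * (t ^ (k + 1) - t⁻¹ ^ (k + 1)) *
        (qFact t l * (t ^ (l + 1) - t⁻¹ ^ (l + 1)))) = D
  have key : (t ^ (k + l + 1 + 1) - t⁻¹ ^ (k + l + 1 + 1)) * t ^ ((k + 1) * (k + l + 1)) =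
      (t ^ (l + 1) - t⁻¹ ^ (l + 1)) * t ^ ((k + 1) * (k + l)) +
      t ^ (2 * (k + l + 1)) * ((t ^ (k + 1) - t⁻¹ ^ (k + 1)) * t ^ (k * (k + l))) := by
    simp only [inv_pow]
    field_simp
    ring
  linear_combination D * key

theorem serreIter_eq {t : ℂ} (h0 : t ≠ 0) (ht : ∀ m : ℕ, 0 < m → t ^ m ≠ 1) (u : ℂ) (x y : B)
    (m : ℕ) : serreIter (fun s => t ^ (2 * s) * u) x y m =
      ∑ k ∈ Finset.range (m + 1), ((-1 : ℂ) ^ k * (qBinom t m k * t ^ (k * (m - 1))) * u ^ k) •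
        (x ^ (m - k) * y * x ^ k) := by
  induction m with
  | zero => simp [serreIter, qBinom_self h0 ht]
  | succ m ih =>
    have hA : ∀ k, k < m → x * (((-1 : ℂ) ^ (k + 1) * (qBinom t m (k + 1) *
        t ^ ((k + 1) * (m - 1))) * u ^ (k + 1)) • (x ^ (m - (k + 1)) * y * x ^ (k + 1))) =
        ((-1 : ℂ) ^ (k + 1) * (qBinom t m (k + 1) *
        t ^ ((k + 1) * (m - 1))) * u ^ (k + 1)) • (x ^ (m + 1 - (k + 1)) * y * x ^ (k + 1)) := by
      intro k hk
      rw [mul_smul_comm]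
      congr 1
      rw [← mul_assoc, ← mul_assoc, ← pow_succ', ← Nat.sub_add_comm hk]
    have hB : ∀ k, k ≤ m → (t ^ (2 * m) * u) • (((-1 : ℂ) ^ k * (qBinom t m k *
        t ^ (k * (m - 1))) * u ^ k) • (x ^ (m - k) * y * x ^ k) * x) =
        (-((-1 : ℂ) ^ (k + 1) * (t ^ (2 * m) * (qBinom t m k * t ^ (k * (m - 1)))) * u ^ (k + 1))) •
        (x ^ (m + 1 - (k + 1)) * y * x ^ (k + 1)) := by
      intro k hk
      rw [smul_mul_assoc, smul_smul, mul_assoc _ (x ^ k) x, ← pow_succ, Nat.add_sub_add_right]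
      congr 1
      ring
    have hC : ∀ k, k < m → ((-1 : ℂ) ^ (k + 1) * (qBinom t (m + 1) (k + 1) *
        t ^ ((k + 1) * (m + 1 - 1))) * u ^ (k + 1)) • (x ^ (m + 1 - (k + 1)) * y * x ^ (k + 1)) =
        ((-1 : ℂ) ^ (k + 1) * (qBinom t m (k + 1) *
        t ^ ((k + 1) * (m - 1))) * u ^ (k + 1)) • (x ^ (m + 1 - (k + 1)) * y * x ^ (k + 1)) -
        (-((-1 : ℂ) ^ (k + 1) * (t ^ (2 * m) * (qBinom t m k * t ^ (k * (m - 1)))) * u ^ (k + 1))) •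
        (x ^ (m + 1 - (k + 1)) * y * x ^ (k + 1)) := by
      intro k hk
      rw [← sub_smul]
      congr 1
      rw [Nat.add_sub_cancel, qBinom_pascal h0 ht hk]
      ring
    have e : t ^ (2 * m) * (1 * t ^ (m * (m - 1))) = 1 * t ^ ((m + 1) * (m + 1 - 1)) := by
      rw [one_mul, one_mul, ← pow_add]
      congr 1
      rcases m with _ | m
      · rfl
      · simp only [Nat.add_sub_cancel]; ring
    rw [serreIter, ih, Finset.mul_sum, Finset.sum_mul, Finset.smul_sum,
      Finset.sum_range_succ _ (m + 1), Finset.sum_range_succ' _ m]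
    rw [Finset.sum_range_succ (fun k => (t ^ (2 * m) * u) • _) m]
    rw [Finset.sum_range_succ' (fun k => _ • (x ^ (m + 1 - k) * y * x ^ k)) m]
    rw [Finset.sum_congr rfl fun k hk => hA k (Finset.mem_range.mp hk),
      Finset.sum_congr rfl fun k hk => hB k (Finset.mem_range.mp hk).le, hB m le_rfl,
      Finset.sum_congr rfl fun k hk => hC k (Finset.mem_range.mp hk), Finset.sum_sub_distrib]
    simp only [qBinom_self h0 ht, qBinom_zero h0 ht]
    rw [e]
    simp only [Nat.sub_zero, pow_zero, mul_one, zero_mul, one_smul, one_mul, pow_succ' x m,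
      mul_assoc, neg_smul]
    abel

theorem serre_eq_iter {t : ℂ} (h0 : t ≠ 0) (ht : ∀ m : ℕ, 0 < m → t ^ m ≠ 1) (x y : B) (m : ℕ) :
    serre t m x y = serreIter (fun s => t ^ ((1 : ℤ) - m + 2 * s)) x y m := by
  have hc : (fun s : ℕ => t ^ ((1 : ℤ) - m + 2 * s)) =
      fun s : ℕ => t ^ (2 * s) * t ^ ((1 : ℤ) - m) := by
    funext s
    rw [zpow_add₀ h0, mul_comm]
    norm_cast
  rw [hc, serreIter_eq h0 ht, serre]
  refine Finset.sum_congr rfl fun k _ => ?_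
  congr 1
  rw [mul_assoc, mul_assoc]
  congr 1
  rw [← zpow_natCast, ← zpow_natCast, ← zpow_mul, ← zpow_add₀ h0]
  rcases m with _ | m
  · have : k = 0 := by rename_i h; simpa using h
    simp [this]
  · rw [show ((k * (m + 1 - 1) : ℕ) : ℤ) + (1 - ((m + 1 : ℕ) : ℤ)) * k = 0 by
      rw [Nat.add_sub_cancel]; push_cast; ring]
    simp

theorem serre_eq_iter' {t : ℂ} (h0 : t ≠ 0) (ht : ∀ m : ℕ, 0 < m → t ^ m ≠ 1) (x y : B) (m : ℕ) :
    serre t m x y = serreIter (fun s => t ^ (-((1 : ℤ) - m + 2 * s))) x y m := by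
  rw [← serre_inv, serre_eq_iter (inv_ne_zero h0) (fun k hk h => ht k hk (by simpa using h))]
  congr 1
  funext s
  rw [inv_zpow, zpow_neg]

theorem serre_add_right (t : ℂ) (m : ℕ) (x y y' : B) :
    serre t m x (y + y') = serre t m x y + serre t m x y' := by
  simp only [serre, mul_add, add_mul, smul_add, Finset.sum_add_distrib]

theorem map_serre {B' : Type*} [Ring B'] [Algebra ℂ B'] (f : B →ₐ[ℂ] B') (t : ℂ) (m : ℕ)
    (x y : B) : f (serre t m x y) = serre t m (f x) (f y) := by
  simp only [serre, map_sum, map_smul, map_mul, map_pow]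

theorem serreIter_aux {c : ℕ → ℂ} {d : ℂ} (hc : ∀ s, c (s + 1) = d * c s) {X Y X' : B}
    (h1 : Y * X = d • (X * Y)) (h2 : Y * X' = c 0 • (X' * Y)) (s : ℕ) :
    serreIter c (X + Y) X' s = serreIter c X X' s ∧
      Y * serreIter c X X' s = c s • (serreIter c X X' s * Y) := by
  induction s with
  | zero => exact ⟨rfl, h2⟩
  | succ s ih =>
    obtain ⟨i1, i2⟩ := ih
    constructor
    · rw [serreIter, i1, add_mul, i2, mul_add, serreIter, smul_add]; abel
    · rw [serreIter, mul_sub, ← mul_assoc, h1, smul_mul_assoc, mul_assoc, i2, mul_smul_comm,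
        mul_smul_comm, ← mul_assoc Y, i2, smul_mul_assoc, mul_assoc _ Y X, h1, mul_smul_comm,
        sub_mul, smul_sub, hc, smul_mul_assoc]
      simp only [smul_smul, mul_assoc]
      congr 2
      ring

/-- The quantum Serre polynomial is additive on suitably `t`-commuting elements. -/
theorem serre_add_add {t : ℂ} (h0 : t ≠ 0) (ht : ∀ m : ℕ, 0 < m → t ^ m ≠ 1) (m : ℕ)
    {X Y X' Y' : B} (h1 : Y * X = t ^ (2 : ℤ) • (X * Y)) (h2 : Y * X' = t ^ (1 - m : ℤ) • (X' * Y))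
    (h3 : Y' * X = t ^ (1 - m : ℤ) • (X * Y')) :
    serre t m (X + Y) (X' + Y') = serre t m X X' + serre t m Y Y' := by
  rw [serre_add_right, serre_eq_iter h0 ht, serre_eq_iter' h0 ht (X + Y) Y', serre_eq_iter h0 ht,
    serre_eq_iter' h0 ht Y Y']
  have hz : ∀ (z : ℤ) (b : B), t ^ (-z) • t ^ z • b = b := fun z b => by
    rw [smul_smul, ← zpow_add₀ h0]; simp
  congr 1
  · refine (serreIter_aux (d := t ^ (2 : ℤ)) (fun s => ?_) h1 (by simpa using h2) m).1
    rw [← zpow_add₀ h0]; congr 1; push_cast; ring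
  · rw [add_comm X Y]
    refine (serreIter_aux (d := t ^ (-2 : ℤ)) (fun s => ?_) ?_ ?_ m).1
    · rw [← zpow_add₀ h0]; congr 1; push_cast; ring
    · rw [h1, hz]
    · rw [h3]
      have := hz (1 - m : ℤ) (X * Y')
      simpa only [Nat.cast_zero, mul_zero, add_zero] using this.symm

theorem serre_tmul_of_commute {B' : Type*} [Ring B'] [Algebra ℂ B'] (t : ℂ) (m : ℕ) {P P' : B}
    (hP : Commute P P') (x y : B') :
    serre t m (P ⊗ₜ[ℂ] x) (P' ⊗ₜ[ℂ] y) = (P ^ m * P') ⊗ₜ[ℂ] serre t m x y := by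
  simp only [serre, TensorProduct.tmul_sum]
  refine Finset.sum_congr rfl fun k hk => ?_
  simp only [Algebra.TensorProduct.tmul_pow, Algebra.TensorProduct.tmul_mul_tmul,
    TensorProduct.tmul_smul]
  rw [mul_assoc (P ^ (m - k)), ← (hP.pow_left k).eq, ← mul_assoc (P ^ (m - k)), ← pow_add,
    Nat.sub_add_cancel (Nat.lt_succ_iff.mp (Finset.mem_range.mp hk))]

theorem serre_tmul_of_commute' {B' : Type*} [Ring B'] [Algebra ℂ B'] (t : ℂ) (m : ℕ) {P P' : B'}
    (hP : Commute P P') (x y : B) :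
    serre t m (x ⊗ₜ[ℂ] P) (y ⊗ₜ[ℂ] P') = serre t m x y ⊗ₜ[ℂ] (P ^ m * P') := by
  simp only [serre, TensorProduct.sum_tmul]
  refine Finset.sum_congr rfl fun k hk => ?_
  simp only [Algebra.TensorProduct.tmul_pow, Algebra.TensorProduct.tmul_mul_tmul,
    TensorProduct.smul_tmul']
  rw [mul_assoc (P ^ (m - k)), ← (hP.pow_left k).eq, ← mul_assoc (P ^ (m - k)), ← pow_add,
    Nat.sub_add_cancel (Nat.lt_succ_iff.mp (Finset.mem_range.mp hk))]

theorem serreIter_op (c : ℕ → ℂ) (hc : ∀ s, c s ≠ 0) (x y : B) (s : ℕ) :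
    ∃ r : ℂ, serreIter c (MulOpposite.op x) (MulOpposite.op y) s =
      r • MulOpposite.op (serreIter (fun i => (c i)⁻¹) x y s) := by
  induction s with
  | zero => exact ⟨1, by simp [serreIter]⟩
  | succ s ih =>
    obtain ⟨r, hr⟩ := ih
    refine ⟨-(r * c s), ?_⟩
    rw [serreIter, hr, serreIter, mul_smul_comm, smul_mul_assoc, ← MulOpposite.op_mul,
      ← MulOpposite.op_mul, MulOpposite.op_sub, MulOpposite.op_smul, smul_sub]
    simp only [smul_smul]
    rw [neg_mul, mul_assoc, mul_inv_cancel₀ (hc s), mul_comm (c s) r]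
    module

theorem serre_op_eq_zero {t : ℂ} (h0 : t ≠ 0) (ht : ∀ m : ℕ, 0 < m → t ^ m ≠ 1) (m : ℕ) {x y : B}
    (h : serre t m x y = 0) : serre t m (MulOpposite.op x) (MulOpposite.op y) = 0 := by
  obtain ⟨r, hr⟩ := serreIter_op (fun s => t ^ ((1 : ℤ) - m + 2 * s)) (fun s => zpow_ne_zero _ h0)
    x y m
  rw [serre_eq_iter h0 ht, hr]
  rw [serre_eq_iter' h0 ht] at h
  simp only [← zpow_neg, h]
  simp

theorem serreIter_twist (c : ℕ → ℂ) {x y u u' : B} {α β r r' : ℂ}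
    (h1 : x * u = α • (u * x)) (h2 : x * u' = β • (u' * x)) (h3 : y * u = β • (u * y))
    (h4 : Commute u u') (s : ℕ) :
    (serreIter c x y s * u = (α ^ s * β) • (u * serreIter c x y s)) ∧
    ∃ C : ℂ, serreIter c (r • (u * x)) (r' • (u' * y)) s = C • (u ^ s * u' * serreIter c x y s) := by
  have hpow : ∀ s, x * u ^ s = α ^ s • (u ^ s * x) := by
    intro s
    induction s with
    | zero => simp
    | succ s ih =>
      rw [pow_succ, ← mul_assoc, ih, smul_mul_assoc, mul_assoc, h1, mul_smul_comm, smul_smul,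
        pow_succ, mul_assoc]
  induction s with
  | zero => exact ⟨by simpa [serreIter] using h3, r', by simp [serreIter]⟩
  | succ s ih =>
    obtain ⟨i1, C, i2⟩ := ih
    constructor
    · rw [serreIter, sub_mul, mul_sub, smul_sub, mul_assoc, i1, mul_smul_comm, ← mul_assoc, h1,
        smul_mul_assoc, smul_mul_assoc, mul_assoc _ x u, h1, mul_smul_comm, ← mul_assoc _ u x, i1,
        smul_mul_assoc, mul_smul_comm]
      simp only [smul_smul, mul_assoc]
      congr 2
      · ring
      · ring
    · refine ⟨r * C * (α ^ s * β), ?_⟩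
      set w := serreIter c x y s with hw
      have e1 : u * x * (u ^ s * u' * w) = (α ^ s * β) • (u ^ (s + 1) * u' * (x * w)) := by
        rw [mul_assoc u x, ← mul_assoc x, ← mul_assoc x, hpow, smul_mul_assoc, mul_assoc (u ^ s) x,
          h2, mul_smul_comm, smul_smul, smul_mul_assoc, mul_smul_comm, pow_succ']
        simp only [mul_assoc]
      have e2 : u ^ s * u' * w * (u * x) = (α ^ s * β) • (u ^ (s + 1) * u' * (w * x)) := by
        rw [mul_assoc _ w, ← mul_assoc w, i1, smul_mul_assoc, mul_smul_comm, mul_assoc u w x,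
          ← mul_assoc (u ^ s * u') u, mul_assoc (u ^ s) u' u, ← h4.eq, ← mul_assoc (u ^ s) u,
          ← pow_succ]
      rw [serreIter, i2, serreIter, ← hw, smul_mul_smul_comm, smul_mul_smul_comm, e1, e2, mul_sub,
        mul_smul_comm, smul_sub]
      simp only [smul_smul]
      congr 2
      ring

theorem serre_twist_eq_zero {t : ℂ} (h0 : t ≠ 0) (ht : ∀ m : ℕ, 0 < m → t ^ m ≠ 1) (m : ℕ)
    {x y u u' : B} {α β r r' : ℂ}
    (h1 : x * u = α • (u * x)) (h2 : x * u' = β • (u' * x)) (h3 : y * u = β • (u * y))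
    (h4 : Commute u u') (h : serre t m x y = 0) :
    serre t m (r • (u * x)) (r' • (u' * y)) = 0 := by
  rw [serre_eq_iter h0 ht] at h ⊢
  obtain ⟨C, hC⟩ := (serreIter_twist (fun s => t ^ ((1 : ℤ) - m + 2 * s)) (r := r) (r' := r')
    h1 h2 h3 h4 m).2
  rw [hC, h, mul_zero, smul_zero]

end Serre

/-! ### The quantized enveloping algebra attached to a torus lattice -/

/-- Parameters for a quantized enveloping algebra with torus part the group algebra of an abelian
group `Γ`: the Cartan matrix `a`, the scalars `t i = q_i`, the characters `χ · j` giving the weight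
of `e_j`, and the elements `κ i`, `κ' i` of `Γ` for which
`e_i f_i - f_i e_i = (q_i - q_i⁻¹)⁻¹ (k_{κ i} - k_{κ' i}⁻¹)`. Both `U_q(𝔤)` (with `Γ = L`) and
the double `D_q(𝔤)` (with `Γ = L × L`) are of this kind. -/
structure QParam (n : ℕ) where
  a : Matrix (Fin n) (Fin n) ℤ
  t : Fin n → ℂ
  Γ : Type
  [grp : AddCommGroup Γ]
  χ : Γ → Fin n → ℂ
  κ : Fin n → Γ
  κ' : Fin n → Γ
  a_diag : ∀ i, a i i = 2
  a_le : ∀ i j, i ≠ j → a i j ≤ 0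
  t_ne_zero : ∀ i, t i ≠ 0
  t_pow_ne_one : ∀ i (m : ℕ), 0 < m → t i ^ m ≠ 1
  t_symm : ∀ i j, t i ^ a i j = t j ^ a j i
  χ_zero : ∀ j, χ 0 j = 1
  χ_add : ∀ g h j, χ (g + h) j = χ g j * χ h j
  χ_κ : ∀ i j, χ (κ i) j = t i ^ a i j
  χ_κ' : ∀ i j, χ (κ' i) j = t i ^ a i j

/-- The generators `k_γ`, `e_i`, `f_i`. -/
inductive Gen (n : ℕ) (Γ : Type) : Type
  | k (g : Γ)
  | e (i : Fin n)
  | f (i : Fin n)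

namespace QParam

attribute [instance] QParam.grp

variable {n : ℕ} (P : QParam n)

/-- The elements `k`, `e`, `f` of the algebra `B` satisfy the defining relations. -/
structure IsRep {B : Type*} [Ring B] [Algebra ℂ B] (k : P.Γ → B) (e f : Fin n → B) : Prop where
  k_zero : k 0 = 1
  k_add : ∀ g h, k (g + h) = k g * k h
  k_e : ∀ g j, k g * e j = P.χ g j • (e j * k g)
  k_f : ∀ g j, k g * f j = (P.χ g j)⁻¹ • (f j * k g)
  e_f : ∀ i j, e i * f j - f j * e i =
    if i = j then (P.t i - (P.t i)⁻¹)⁻¹ • (k (P.κ i) - k (-P.κ' i)) else 0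
  serre_e : ∀ i j, i ≠ j → serre (P.t i) (1 - P.a i j).toNat (e i) (e j) = 0
  serre_f : ∀ i j, i ≠ j → serre (P.t i) (1 - P.a i j).toNat (f i) (f j) = 0

/-- The free algebra on the generators. -/
abbrev Free : Type := FreeAlgebra ℂ (Gen n P.Γ)

/-- The defining relations. -/
inductive Rel : P.Free → P.Free → Prop
  | k_zero : Rel (FreeAlgebra.ι ℂ (Gen.k 0)) 1
  | k_add (g h : P.Γ) : Rel (FreeAlgebra.ι ℂ (Gen.k (g + h)))
      (FreeAlgebra.ι ℂ (Gen.k g) * FreeAlgebra.ι ℂ (Gen.k h))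
  | k_e (g : P.Γ) (j : Fin n) : Rel (FreeAlgebra.ι ℂ (Gen.k g) * FreeAlgebra.ι ℂ (Gen.e j))
      (P.χ g j • (FreeAlgebra.ι ℂ (Gen.e j) * FreeAlgebra.ι ℂ (Gen.k g)))
  | k_f (g : P.Γ) (j : Fin n) : Rel (FreeAlgebra.ι ℂ (Gen.k g) * FreeAlgebra.ι ℂ (Gen.f j))
      ((P.χ g j)⁻¹ • (FreeAlgebra.ι ℂ (Gen.f j) * FreeAlgebra.ι ℂ (Gen.k g)))
  | e_f (i j : Fin n) : Rel
      (FreeAlgebra.ι ℂ (Gen.e i) * FreeAlgebra.ι ℂ (Gen.f j) -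
        FreeAlgebra.ι ℂ (Gen.f j) * FreeAlgebra.ι ℂ (Gen.e i))
      (if i = j then (P.t i - (P.t i)⁻¹)⁻¹ • (FreeAlgebra.ι ℂ (Gen.k (P.κ i)) -
        FreeAlgebra.ι ℂ (Gen.k (-P.κ' i))) else 0)
  | serre_e (i j : Fin n) (hij : i ≠ j) : Rel (serre (P.t i) (1 - P.a i j).toNat
      (FreeAlgebra.ι ℂ (Gen.e i)) (FreeAlgebra.ι ℂ (Gen.e j))) 0
  | serre_f (i j : Fin n) (hij : i ≠ j) : Rel (serre (P.t i) (1 - P.a i j).toNat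
      (FreeAlgebra.ι ℂ (Gen.f i)) (FreeAlgebra.ι ℂ (Gen.f j))) 0

/-- The algebra with generators `k_γ`, `e_i`, `f_i` and the defining relations. -/
def Alg : Type := RingQuot P.Rel

instance : Ring P.Alg := inferInstanceAs (Ring (RingQuot P.Rel))
instance : Algebra ℂ P.Alg := inferInstanceAs (Algebra ℂ (RingQuot P.Rel))

/-- The quotient map from the free algebra. -/
def quot : P.Free →ₐ[ℂ] P.Alg := RingQuot.mkAlgHom ℂ P.Rel

/-- The generator `k_γ`. -/
def k (g : P.Γ) : P.Alg := P.quot (FreeAlgebra.ι ℂ (Gen.k g))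
/-- The generator `e_i`. -/
def e (i : Fin n) : P.Alg := P.quot (FreeAlgebra.ι ℂ (Gen.e i))
/-- The generator `f_i`. -/
def f (i : Fin n) : P.Alg := P.quot (FreeAlgebra.ι ℂ (Gen.f i))

theorem quot_rel {x y : P.Free} (h : P.Rel x y) : P.quot x = P.quot y := RingQuot.mkAlgHom_rel ℂ h

theorem isRep : P.IsRep P.k P.e P.f where
  k_zero := by simpa [k] using P.quot_rel Rel.k_zero
  k_add g h := by simpa [k] using P.quot_rel (Rel.k_add g h)
  k_e g j := by simpa [k, e] using P.quot_rel (Rel.k_e g j)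
  k_f g j := by simpa [k, f] using P.quot_rel (Rel.k_f g j)
  e_f i j := by
    have := P.quot_rel (Rel.e_f i j)
    split_ifs at this ⊢ <;> simpa [k, e, f] using this
  serre_e i j h := by simpa [map_serre, e] using P.quot_rel (Rel.serre_e i j h)
  serre_f i j h := by simpa [map_serre, f] using P.quot_rel (Rel.serre_f i j h)

section Lift

variable {P} {B : Type*} [Ring B] [Algebra ℂ B] {k : P.Γ → B} {e f : Fin n → B}

/-- The images of the generators under a prospective algebra map. -/
def genMap {n : ℕ} {Γ : Type} {B : Type*} (k : Γ → B) (e f : Fin n → B) : Gen n Γ → B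
  | .k g => k g
  | .e i => e i
  | .f i => f i

/-- The universal property of the presentation. -/
def lift (h : P.IsRep k e f) : P.Alg →ₐ[ℂ] B :=
  RingQuot.liftAlgHom ℂ ⟨FreeAlgebra.lift ℂ (genMap k e f), fun x y hxy => by
    induction hxy with
    | k_zero => simpa [genMap] using h.k_zero
    | k_add g g' => simpa [genMap] using h.k_add g g'
    | k_e g j => simpa [genMap] using h.k_e g j
    | k_f g j => simpa [genMap] using h.k_f g j
    | e_f i j =>
      have := h.e_f i j
      split_ifs at this ⊢ <;> simpa [genMap] using this
    | serre_e i j hij => simpa [genMap, map_serre] using h.serre_e i j hij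
    | serre_f i j hij => simpa [genMap, map_serre] using h.serre_f i j hij⟩

theorem lift_quot (h : P.IsRep k e f) (x : P.Free) :
    lift h (P.quot x) = FreeAlgebra.lift ℂ (genMap k e f) x := by
  simp only [lift, quot]
  exact RingQuot.liftAlgHom_mkAlgHom_apply ℂ _ _ _

@[simp] theorem lift_k (h : P.IsRep k e f) (g : P.Γ) : lift h (P.k g) = k g := by
  rw [QParam.k, lift_quot, FreeAlgebra.lift_ι_apply]; rfl
@[simp] theorem lift_e (h : P.IsRep k e f) (i : Fin n) : lift h (P.e i) = e i := by
  rw [QParam.e, lift_quot, FreeAlgebra.lift_ι_apply]; rfl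
@[simp] theorem lift_f (h : P.IsRep k e f) (i : Fin n) : lift h (P.f i) = f i := by
  rw [QParam.f, lift_quot, FreeAlgebra.lift_ι_apply]; rfl

end Lift

/-- Induction over the algebra. -/
theorem alg_induction {C : P.Alg → Prop} (hr : ∀ r : ℂ, C (algebraMap ℂ P.Alg r))
    (hk : ∀ g, C (P.k g)) (he : ∀ i, C (P.e i)) (hf : ∀ i, C (P.f i))
    (hmul : ∀ x y, C x → C y → C (x * y)) (hadd : ∀ x y, C x → C y → C (x + y))
    (x : P.Alg) : C x := by
  obtain ⟨y, rfl⟩ := RingQuot.mkAlgHom_surjective ℂ P.Rel x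
  change C (P.quot y)
  induction y using FreeAlgebra.induction with
  | grade0 r => rw [AlgHom.commutes]; exact hr r
  | grade1 z =>
    cases z with
    | k g => exact hk g
    | e i => exact he i
    | f i => exact hf i
  | mul x y hx hy => rw [map_mul]; exact hmul _ _ hx hy
  | add x y hx hy => rw [map_add]; exact hadd _ _ hx hy

theorem algHom_ext {B : Type*} [Ring B] [Algebra ℂ B] {φ ψ : P.Alg →ₐ[ℂ] B}
    (hk : ∀ g, φ (P.k g) = ψ (P.k g)) (he : ∀ i, φ (P.e i) = ψ (P.e i))
    (hf : ∀ i, φ (P.f i) = ψ (P.f i)) : φ = ψ := by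
  ext x
  induction x using P.alg_induction with
  | hr r => simp
  | hk g => exact hk g
  | he i => exact he i
  | hf i => exact hf i
  | hmul x y hx hy => rw [map_mul, map_mul, hx, hy]
  | hadd x y hx hy => rw [map_add, map_add, hx, hy]

theorem χ_neg (g : P.Γ) (j : Fin n) : P.χ (-g) j = (P.χ g j)⁻¹ := by
  refine eq_inv_of_mul_eq_one_left ?_
  rw [← P.χ_add, neg_add_cancel, P.χ_zero]

theorem χ_ne_zero (g : P.Γ) (j : Fin n) : P.χ g j ≠ 0 := by
  intro h
  have := P.χ_add g (-g) j
  rw [h, add_neg_cancel, P.χ_zero, zero_mul] at this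
  exact one_ne_zero this

theorem k_commute (g h : P.Γ) : Commute (P.k g) (P.k h) := by
  rw [Commute, SemiconjBy, ← P.isRep.k_add, ← P.isRep.k_add, add_comm]

theorem k_neg_mul (g : P.Γ) : P.k (-g) * P.k g = 1 := by
  rw [← P.isRep.k_add, neg_add_cancel, P.isRep.k_zero]

theorem k_mul_neg (g : P.Γ) : P.k g * P.k (-g) = 1 := by
  rw [← P.isRep.k_add, add_neg_cancel, P.isRep.k_zero]

theorem e_mul_k (g : P.Γ) (j : Fin n) : P.e j * P.k g = (P.χ g j)⁻¹ • (P.k g * P.e j) := by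
  rw [P.isRep.k_e, smul_smul, inv_mul_cancel₀ (P.χ_ne_zero g j), one_smul]

theorem f_mul_k (g : P.Γ) (j : Fin n) : P.f j * P.k g = P.χ g j • (P.k g * P.f j) := by
  rw [P.isRep.k_f, smul_smul, mul_inv_cancel₀ (P.χ_ne_zero g j), one_smul]

theorem t_aij {i j : Fin n} (hij : i ≠ j) :
    (P.t i) ^ (1 - ((1 - P.a i j).toNat : ℤ)) = P.t i ^ P.a i j := by
  have := P.a_le i j hij
  congr 1
  omega

/-! ### The Hopf algebra structure -/

/-- `Δ(k_γ) = k_γ ⊗ k_γ`, `Δ(e_i) = e_i ⊗ 1 + k_{κ i} ⊗ e_i`, `Δ(f_i) = f_i ⊗ k_{κ' i}⁻¹ + 1 ⊗ f_i`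
satisfy the defining relations. -/
theorem isRep_comul : P.IsRep (B := P.Alg ⊗[ℂ] P.Alg) (fun g => P.k g ⊗ₜ P.k g)
    (fun i => P.e i ⊗ₜ 1 + P.k (P.κ i) ⊗ₜ P.e i)
    (fun i => P.f i ⊗ₜ P.k (-P.κ' i) + 1 ⊗ₜ P.f i) where
  k_zero := by simp only [P.isRep.k_zero, Algebra.TensorProduct.one_def]
  k_add g h := by simp only [P.isRep.k_add, Algebra.TensorProduct.tmul_mul_tmul]
  k_e g j := by
    simp only [mul_add, add_mul, Algebra.TensorProduct.tmul_mul_tmul, P.isRep.k_e, mul_one, one_mul,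
      (P.k_commute g _).eq, smul_add, TensorProduct.smul_tmul', TensorProduct.tmul_smul]
  k_f g j := by
    simp only [mul_add, add_mul, Algebra.TensorProduct.tmul_mul_tmul, P.isRep.k_f, mul_one, one_mul,
      (P.k_commute g _).eq, smul_add, TensorProduct.smul_tmul', TensorProduct.tmul_smul]
  e_f i j := by
    have h1 : P.k (P.κ i) * P.f j = (P.t i ^ P.a i j)⁻¹ • (P.f j * P.k (P.κ i)) := by
      rw [P.isRep.k_f, P.χ_κ]
    have h2 : P.k (-P.κ' j) * P.e i = (P.t i ^ P.a i j)⁻¹ • (P.e i * P.k (-P.κ' j)) := by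
      rw [P.isRep.k_e, P.χ_neg, P.χ_κ', P.t_symm]
    have h3 := P.isRep.e_f i j
    rw [sub_eq_iff_eq_add] at h3
    simp only [mul_add, add_mul, Algebra.TensorProduct.tmul_mul_tmul, mul_one, one_mul, h1, h2,
      h3, TensorProduct.smul_tmul', TensorProduct.tmul_smul, TensorProduct.add_tmul,
      TensorProduct.tmul_add]
    split_ifs with h
    · subst h
      simp only [← TensorProduct.smul_tmul', TensorProduct.tmul_smul, TensorProduct.sub_tmul,
        TensorProduct.tmul_sub]
      module
    · simp only [TensorProduct.zero_tmul, TensorProduct.tmul_zero]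
      abel
  serre_e i j hij := by
    have h0 := P.t_ne_zero i
    have ht := P.t_pow_ne_one i
    rw [serre_add_add h0 ht]
    · have h1 := map_serre (Algebra.TensorProduct.includeLeft (R := ℂ) (S := ℂ) (A := P.Alg)
        (B := P.Alg)) (P.t i) (1 - P.a i j).toNat (P.e i) (P.e j)
      simp only [Algebra.TensorProduct.includeLeft_apply] at h1
      rw [← h1, P.isRep.serre_e i j hij, serre_tmul_of_commute _ _ (P.k_commute _ _),
        P.isRep.serre_e i j hij]
      simp
    · simp only [Algebra.TensorProduct.tmul_mul_tmul, mul_one, one_mul, P.isRep.k_e, P.χ_κ,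
        P.a_diag, TensorProduct.smul_tmul']
    · simp only [Algebra.TensorProduct.tmul_mul_tmul, mul_one, one_mul, P.isRep.k_e, P.χ_κ,
        P.t_aij hij, TensorProduct.smul_tmul']
    · simp only [Algebra.TensorProduct.tmul_mul_tmul, mul_one, one_mul, P.isRep.k_e, P.χ_κ,
        P.t_aij hij, TensorProduct.smul_tmul', P.t_symm j i]
  serre_f i j hij := by
    have h0 := P.t_ne_zero i
    have ht := P.t_pow_ne_one i
    have hk : ∀ i j, P.k (-P.κ' i) * P.f j = (P.t i ^ P.a i j) • (P.f j * P.k (-P.κ' i)) := by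
      intro i j
      rw [P.isRep.k_f, P.χ_neg, inv_inv, P.χ_κ']
    rw [add_comm (P.f i ⊗ₜ[ℂ] P.k (-P.κ' i)), add_comm (P.f j ⊗ₜ[ℂ] P.k (-P.κ' j)),
      serre_add_add h0 ht]
    · have h1 := map_serre (Algebra.TensorProduct.includeRight (R := ℂ) (A := P.Alg)
        (B := P.Alg)) (P.t i) (1 - P.a i j).toNat (P.f i) (P.f j)
      simp only [Algebra.TensorProduct.includeRight_apply] at h1
      rw [← h1, P.isRep.serre_f i j hij, serre_tmul_of_commute' _ _ (P.k_commute _ _),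
        P.isRep.serre_f i j hij]
      simp
    · simp only [Algebra.TensorProduct.tmul_mul_tmul, mul_one, one_mul, hk,
        P.a_diag, TensorProduct.tmul_smul]
    · simp only [Algebra.TensorProduct.tmul_mul_tmul, mul_one, one_mul, hk,
        P.t_aij hij, TensorProduct.tmul_smul]
    · simp only [Algebra.TensorProduct.tmul_mul_tmul, mul_one, one_mul, hk,
        P.t_aij hij, TensorProduct.tmul_smul, P.t_symm j i]

theorem isRep_counit : P.IsRep (B := ℂ) (fun _ => 1) (fun _ => 0) (fun _ => 0) where
  k_zero := rfl
  k_add g h := by simp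
  k_e g j := by simp
  k_f g j := by simp
  e_f i j := by simp
  serre_e i j hij := by simp [serre]
  serre_f i j hij := by simp [serre]

instance : Bialgebra ℂ P.Alg :=
  Bialgebra.ofAlgHom (lift P.isRep_comul) (lift P.isRep_counit)
    (P.algHom_ext (fun g => by simp)
      (fun i => by
        simp [TensorProduct.add_tmul, TensorProduct.tmul_add, Algebra.TensorProduct.one_def,
          add_assoc])
      (fun i => by
        simp [TensorProduct.add_tmul, TensorProduct.tmul_add, Algebra.TensorProduct.one_def,
          add_assoc]))
    (P.algHom_ext (fun g => by simp) (fun i => by simp) (fun i => by simp))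
    (P.algHom_ext (fun g => by simp) (fun i => by simp) (fun i => by simp))

@[simp] theorem comul_k (g : P.Γ) :
    Coalgebra.comul (R := ℂ) (P.k g) = P.k g ⊗ₜ[ℂ] P.k g := lift_k P.isRep_comul g
@[simp] theorem comul_e (i : Fin n) : Coalgebra.comul (R := ℂ) (P.e i) =
    P.e i ⊗ₜ[ℂ] 1 + P.k (P.κ i) ⊗ₜ[ℂ] P.e i := lift_e P.isRep_comul i
@[simp] theorem comul_f (i : Fin n) : Coalgebra.comul (R := ℂ) (P.f i) =
    P.f i ⊗ₜ[ℂ] P.k (-P.κ' i) + 1 ⊗ₜ[ℂ] P.f i := lift_f P.isRep_comul i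
@[simp] theorem counit_k (g : P.Γ) : Coalgebra.counit (R := ℂ) (P.k g) = 1 :=
  lift_k P.isRep_counit g
@[simp] theorem counit_e (i : Fin n) : Coalgebra.counit (R := ℂ) (P.e i) = 0 :=
  lift_e P.isRep_counit i
@[simp] theorem counit_f (i : Fin n) : Coalgebra.counit (R := ℂ) (P.f i) = 0 :=
  lift_f P.isRep_counit i

/-- `S(k_γ) = k_γ⁻¹`, `S(e_i) = -k_{κ i}⁻¹ e_i`, `S(f_i) = -f_i k_{κ' i}` satisfy the defining
relations in the opposite algebra. -/
theorem isRep_antipode : P.IsRep (B := P.Algᵐᵒᵖ) (fun g => MulOpposite.op (P.k (-g)))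
    (fun i => MulOpposite.op (-(P.k (-P.κ i) * P.e i)))
    (fun i => MulOpposite.op (-(P.f i * P.k (P.κ' i)))) where
  k_zero := by simp [P.isRep.k_zero]
  k_add g h := by rw [← MulOpposite.op_mul, ← P.isRep.k_add]; congr 2; abel
  k_e g j := by
    rw [← MulOpposite.op_mul, ← MulOpposite.op_mul, ← MulOpposite.op_smul, neg_mul, mul_neg,
      mul_assoc, P.e_mul_k, P.χ_neg, inv_inv, mul_smul_comm, smul_neg, ← mul_assoc, ← mul_assoc,
      (P.k_commute _ _).eq]
  k_f g j := by
    rw [← MulOpposite.op_mul, ← MulOpposite.op_mul, ← MulOpposite.op_smul, neg_mul, mul_neg,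
      mul_assoc, (P.k_commute _ _).eq, ← mul_assoc, P.f_mul_k, P.χ_neg, smul_mul_assoc, smul_neg,
      mul_assoc]
  e_f i j := by
    have h3 := P.isRep.e_f i j
    have e1 : P.f j * P.k (P.κ' j) * (P.k (-P.κ i) * P.e i) =
        P.k (-P.κ i) * (P.f j * P.e i) * P.k (P.κ' j) := by
      rw [mul_assoc, ← mul_assoc (P.k _) (P.k _), (P.k_commute _ _).eq, mul_assoc (P.k _) (P.k _),
        P.isRep.k_e, ← mul_assoc, P.f_mul_k, P.χ_κ', P.χ_neg, P.χ_κ, P.t_symm j i]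
      simp only [smul_mul_assoc, mul_smul_comm, smul_smul, mul_assoc]
      rw [mul_inv_cancel₀ (zpow_ne_zero _ (P.t_ne_zero i)), one_smul]
    have e2 : P.k (-P.κ i) * P.e i * (P.f j * P.k (P.κ' j)) =
        P.k (-P.κ i) * (P.e i * P.f j) * P.k (P.κ' j) := by
      simp only [mul_assoc]
    have e3 : (-(P.f j * P.k (P.κ' j))) * (-(P.k (-P.κ i) * P.e i)) -
        (-(P.k (-P.κ i) * P.e i)) * (-(P.f j * P.k (P.κ' j))) =
        -(P.k (-P.κ i) * (P.e i * P.f j - P.f j * P.e i) * P.k (P.κ' j)) := by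
      rw [neg_mul_neg, neg_mul_neg, e1, e2, mul_sub, sub_mul, neg_sub]
    rw [← MulOpposite.op_mul, ← MulOpposite.op_mul, ← MulOpposite.op_sub, e3, h3]
    split_ifs with h
    · subst h
      rw [← MulOpposite.op_sub, ← MulOpposite.op_smul]
      congr 1
      rw [mul_smul_comm, smul_mul_assoc, mul_sub, sub_mul, P.k_neg_mul, one_mul, mul_assoc,
        P.k_neg_mul, mul_one, neg_neg, ← smul_neg, neg_sub]
    · simp
  serre_e i j hij := by
    have h0 := P.t_ne_zero i
    have ht := P.t_pow_ne_one i
    have hr : ∀ i, MulOpposite.op (-(P.k (-P.κ i) * P.e i)) = (-P.χ (-P.κ i) i) •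
        (MulOpposite.op (P.k (-P.κ i)) * MulOpposite.op (P.e i)) := by
      intro i
      rw [P.isRep.k_e, ← MulOpposite.op_mul, ← MulOpposite.op_smul, neg_smul]
    rw [hr, hr]
    have hc : ∀ i j, MulOpposite.op (P.e j) * MulOpposite.op (P.k (-P.κ i)) =
        (P.t i ^ P.a i j)⁻¹ • (MulOpposite.op (P.k (-P.κ i)) * MulOpposite.op (P.e j)) := by
      intro i j
      rw [← MulOpposite.op_mul, P.isRep.k_e, P.χ_neg, P.χ_κ, MulOpposite.op_smul,
        MulOpposite.op_mul]
    refine serre_twist_eq_zero h0 ht _ (hc i i) (hc j i) ?_ ?_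
      (serre_op_eq_zero h0 ht _ (P.isRep.serre_e i j hij))
    · rw [hc, P.t_symm]
    · rw [Commute, SemiconjBy, ← MulOpposite.op_mul, ← MulOpposite.op_mul, (P.k_commute _ _).eq]
  serre_f i j hij := by
    have h0 := P.t_ne_zero i
    have ht := P.t_pow_ne_one i
    have hr : ∀ i, MulOpposite.op (-(P.f i * P.k (P.κ' i))) = (-1 : ℂ) •
        (MulOpposite.op (P.k (P.κ' i)) * MulOpposite.op (P.f i)) := by
      intro i
      rw [← MulOpposite.op_mul, ← MulOpposite.op_smul, neg_smul, one_smul]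
    rw [hr, hr]
    have hc : ∀ i j, MulOpposite.op (P.f j) * MulOpposite.op (P.k (P.κ' i)) =
        (P.t i ^ P.a i j)⁻¹ • (MulOpposite.op (P.k (P.κ' i)) * MulOpposite.op (P.f j)) := by
      intro i j
      rw [← MulOpposite.op_mul, P.isRep.k_f, P.χ_κ', MulOpposite.op_smul, MulOpposite.op_mul]
    refine serre_twist_eq_zero h0 ht _ (hc i i) (hc j i) ?_ ?_
      (serre_op_eq_zero h0 ht _ (P.isRep.serre_f i j hij))
    · rw [hc, P.t_symm]
    · rw [Commute, SemiconjBy, ← MulOpposite.op_mul, ← MulOpposite.op_mul, (P.k_commute _ _).eq]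

/-- The antipode. -/
def antipodeMap : P.Alg →ₗ[ℂ] P.Alg :=
  (MulOpposite.opLinearEquiv ℂ).symm.toLinearMap ∘ₗ (lift P.isRep_antipode).toLinearMap

theorem antipodeMap_mul (x y : P.Alg) :
    P.antipodeMap (x * y) = P.antipodeMap y * P.antipodeMap x := by
  simp [antipodeMap]
theorem antipodeMap_one : P.antipodeMap 1 = 1 := by simp [antipodeMap]
theorem antipodeMap_k (g : P.Γ) : P.antipodeMap (P.k g) = P.k (-g) := by simp [antipodeMap]
theorem antipodeMap_e (i : Fin n) : P.antipodeMap (P.e i) = -(P.k (-P.κ i) * P.e i) := by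
  simp [antipodeMap]
theorem antipodeMap_f (i : Fin n) : P.antipodeMap (P.f i) = -(P.f i * P.k (P.κ' i)) := by
  simp [antipodeMap]

/-- The map `x ⊗ y ↦ S(x) y`. -/
def antipodeL : P.Alg ⊗[ℂ] P.Alg →ₗ[ℂ] P.Alg :=
  LinearMap.mul' ℂ P.Alg ∘ₗ P.antipodeMap.rTensor P.Alg
/-- The map `x ⊗ y ↦ x S(y)`. -/
def antipodeR : P.Alg ⊗[ℂ] P.Alg →ₗ[ℂ] P.Alg :=
  LinearMap.mul' ℂ P.Alg ∘ₗ P.antipodeMap.lTensor P.Alg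

theorem antipodeL_tmul (x y : P.Alg) : P.antipodeL (x ⊗ₜ y) = P.antipodeMap x * y := by
  simp [antipodeL]
theorem antipodeR_tmul (x y : P.Alg) : P.antipodeR (x ⊗ₜ y) = x * P.antipodeMap y := by
  simp [antipodeR]

theorem antipodeL_mul (z : P.Alg ⊗[ℂ] P.Alg) (r : ℂ) (hz : P.antipodeL z = algebraMap ℂ _ r)
    (w : P.Alg ⊗[ℂ] P.Alg) : P.antipodeL (z * w) = r • P.antipodeL w := by
  have key : ∀ x y, P.antipodeL (z * (x ⊗ₜ y)) = P.antipodeMap x * P.antipodeL z * y := by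
    intro x y
    clear hz
    induction z using TensorProduct.induction_on with
    | zero => simp
    | tmul a b => simp only [Algebra.TensorProduct.tmul_mul_tmul, antipodeL_tmul, antipodeMap_mul,
        mul_assoc]
    | add a b ha hb => simp only [add_mul, mul_add, map_add, ha, hb]
  induction w using TensorProduct.induction_on with
  | zero => simp
  | tmul a b =>
    rw [key, hz, antipodeL_tmul, Algebra.algebraMap_eq_smul_one, mul_smul_comm, mul_one,
      smul_mul_assoc]
  | add a b ha hb => simp only [mul_add, map_add, ha, hb, smul_add]

theorem antipodeR_mul (z w : P.Alg ⊗[ℂ] P.Alg) (r : ℂ) (hw : P.antipodeR w = algebraMap ℂ _ r) :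
    P.antipodeR (z * w) = r • P.antipodeR z := by
  have key : ∀ x y, P.antipodeR ((x ⊗ₜ y) * w) = x * P.antipodeR w * P.antipodeMap y := by
    intro x y
    clear hw
    induction w using TensorProduct.induction_on with
    | zero => simp
    | tmul a b => simp only [Algebra.TensorProduct.tmul_mul_tmul, antipodeR_tmul, antipodeMap_mul,
        mul_assoc]
    | add a b ha hb => simp only [add_mul, mul_add, map_add, ha, hb]
  induction z using TensorProduct.induction_on with
  | zero => simp
  | tmul a b =>
    rw [key, hw, antipodeR_tmul, Algebra.algebraMap_eq_smul_one, mul_smul_comm, mul_one,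
      smul_mul_assoc]
  | add a b ha hb => simp only [add_mul, map_add, ha, hb, smul_add]

instance : HopfAlgebra ℂ P.Alg :=
  { (inferInstance : Bialgebra ℂ P.Alg) with
    antipode := P.antipodeMap
    mul_antipode_rTensor_comul := by
      ext x
      change P.antipodeL (Coalgebra.comul x) = algebraMap ℂ _ (Coalgebra.counit x)
      induction x using P.alg_induction with
      | hr r => simp [Algebra.algebraMap_eq_smul_one, Algebra.TensorProduct.one_def,
          antipodeL_tmul, antipodeMap_one]
      | hk g => simp [antipodeL_tmul, antipodeMap_k, k_neg_mul]
      | he i => simp [antipodeL_tmul, antipodeMap_e, antipodeMap_k]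
      | hf i => simp [antipodeL_tmul, antipodeMap_f, antipodeMap_one, mul_assoc, k_mul_neg]
      | hmul x y hx hy =>
        rw [Bialgebra.comul_mul, P.antipodeL_mul _ _ hx, hy, Bialgebra.counit_mul, map_mul,
          Algebra.smul_def]
      | hadd x y hx hy => simp only [map_add, hx, hy]
    mul_antipode_lTensor_comul := by
      ext x
      change P.antipodeR (Coalgebra.comul x) = algebraMap ℂ _ (Coalgebra.counit x)
      induction x using P.alg_induction with
      | hr r => simp [Algebra.algebraMap_eq_smul_one, Algebra.TensorProduct.one_def,
          antipodeR_tmul, antipodeMap_one]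
      | hk g => simp [antipodeR_tmul, antipodeMap_k, k_mul_neg]
      | he i => simp [antipodeR_tmul, antipodeMap_e, antipodeMap_one, ← mul_assoc, k_mul_neg]
      | hf i => simp [antipodeR_tmul, antipodeMap_f, antipodeMap_k]
      | hmul x y hx hy =>
        rw [Bialgebra.comul_mul, P.antipodeR_mul _ _ _ hy, hx, Bialgebra.counit_mul, map_mul,
          Algebra.smul_def, ← Algebra.commutes]
      | hadd x y hx hy => simp only [map_add, hx, hy] }

end QParam

namespace QParam

variable {n : ℕ} (P : QParam n)

/-! ### Bigradings -/

/-- Data of a bigrading by `L`: a homomorphism `θ : Γ → L` and elements `α_i` of `L`, such that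
`k_γ`, `e_i`, `f_i` can be given the degrees `(-θ γ, θ γ)`, `(-α_i, 0)`, `(0, α_i)`. -/
structure BiDegree (L : Type) [AddCommGroup L] where
  θ : P.Γ →+ L
  α : Fin n → L
  θ_κ : ∀ i, θ (P.κ i) = α i
  θ_κ' : ∀ i, θ (P.κ' i) = -α i

namespace BiDegree

variable {P} {L : Type} [AddCommGroup L] [DecidableEq L] (d : P.BiDegree L)

theorem serre_single {B G : Type} [Ring B] [Algebra ℂ B] [AddCommGroup G] (t : ℂ) (m : ℕ)
    (x y : B) (g h : G) :
    serre t m (AddMonoidAlgebra.single g x) (AddMonoidAlgebra.single h y) =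
      AddMonoidAlgebra.single (m • g + h) (serre t m x y) := by
  simp only [serre, AddMonoidAlgebra.single_pow, AddMonoidAlgebra.single_mul_single,
    AddMonoidAlgebra.smul_single]
  rw [← AddMonoidAlgebra.singleAddHom_apply, map_sum]
  refine Finset.sum_congr rfl fun k hk => ?_
  rw [AddMonoidAlgebra.singleAddHom_apply]
  congr 1
  obtain ⟨l, rfl⟩ := Nat.exists_eq_add_of_le (Nat.lt_succ_iff.mp (Finset.mem_range.mp hk))
  rw [Nat.add_sub_cancel_left, add_smul]
  abel

theorem single_sub {B G : Type} [Ring B] (g : G) (x y : B) :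
    AddMonoidAlgebra.single g (x - y) =
      AddMonoidAlgebra.single g x - AddMonoidAlgebra.single g y := by
  rw [eq_sub_iff_add_eq, ← AddMonoidAlgebra.single_add, sub_add_cancel]

theorem isRep_coaction : P.IsRep (B := AddMonoidAlgebra P.Alg (L × L))
    (fun g => AddMonoidAlgebra.single (-d.θ g, d.θ g) (P.k g))
    (fun i => AddMonoidAlgebra.single (-d.α i, 0) (P.e i))
    (fun i => AddMonoidAlgebra.single (0, d.α i) (P.f i)) where
  k_zero := by rw [P.isRep.k_zero, map_zero, neg_zero]; rfl
  k_add g h := by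
    rw [AddMonoidAlgebra.single_mul_single, P.isRep.k_add, map_add, Prod.mk_add_mk, neg_add]
  k_e g j := by
    rw [AddMonoidAlgebra.single_mul_single, AddMonoidAlgebra.single_mul_single,
      AddMonoidAlgebra.smul_single, P.isRep.k_e, add_comm]
  k_f g j := by
    rw [AddMonoidAlgebra.single_mul_single, AddMonoidAlgebra.single_mul_single,
      AddMonoidAlgebra.smul_single, P.isRep.k_f, add_comm]
  e_f i j := by
    have h := P.isRep.e_f i j
    rw [AddMonoidAlgebra.single_mul_single, AddMonoidAlgebra.single_mul_single,
      add_comm (0, d.α j), ← single_sub, h]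
    split_ifs with hij
    · subst hij
      have e : (-d.θ (-P.κ' i), d.θ (-P.κ' i)) = (-d.α i, d.α i) := by
        simp only [map_neg, d.θ_κ', neg_neg]
      rw [e, d.θ_κ, ← single_sub, AddMonoidAlgebra.smul_single]
      simp
    · simp
  serre_e i j hij := by
    rw [serre_single, P.isRep.serre_e i j hij]; simp
  serre_f i j hij := by
    rw [serre_single, P.isRep.serre_f i j hij]; simp

/-- The algebra map `a ↦ ∑_g a_g g` recording the homogeneous components: it sends each generator
`x` of degree `g` to `x g`. -/
def coaction : P.Alg →ₐ[ℂ] AddMonoidAlgebra P.Alg (L × L) := lift d.isRep_coaction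

theorem coaction_def (x : P.Alg) : d.coaction x = lift d.isRep_coaction x := rfl

/-- The homogeneous subspaces: those of the algebra grading for which `k_γ`, `e_i`, `f_i` are
homogeneous of degrees `(-θ γ, θ γ)`, `(-α_i, 0)`, `(0, α_i)`. -/
def grading (g : L × L) : Submodule ℂ P.Alg where
  carrier := {a | d.coaction a = AddMonoidAlgebra.single g a}
  zero_mem' := by simp
  add_mem' := fun {a b} ha hb => by
    simp only [Set.mem_ofPred_eq] at *
    rw [map_add, ha, hb, AddMonoidAlgebra.single_add]
  smul_mem' := fun r a ha => by
    simp only [Set.mem_ofPred_eq] at *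
    rw [map_smul, ha, AddMonoidAlgebra.smul_single]

theorem mem_grading {g : L × L} {a : P.Alg} :
    a ∈ d.grading g ↔ d.coaction a = AddMonoidAlgebra.single g a := Iff.rfl

theorem k_mem (g : P.Γ) : P.k g ∈ d.grading (-d.θ g, d.θ g) := lift_k d.isRep_coaction g
theorem e_mem (i : Fin n) : P.e i ∈ d.grading (-d.α i, 0) := lift_e d.isRep_coaction i
theorem f_mem (i : Fin n) : P.f i ∈ d.grading (0, d.α i) := lift_f d.isRep_coaction i

instance : SetLike.GradedMonoid d.grading where
  one_mem := by rw [mem_grading, map_one]; rfl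
  mul_mem g h a b ha hb := by
    rw [mem_grading] at *
    rw [map_mul, ha, hb, AddMonoidAlgebra.single_mul_single]

/-- Induction on homogeneous components. -/
theorem component_induction {C : L × L → P.Alg → Prop} (h0 : ∀ g, C g 0) (h1 : C 0 1)
    (hk : ∀ g, C (-d.θ g, d.θ g) (P.k g)) (he : ∀ i, C (-d.α i, 0) (P.e i))
    (hf : ∀ i, C (0, d.α i) (P.f i))
    (hmul : ∀ g h x y, C g x → C h y → C (g + h) (x * y))
    (hadd : ∀ g x y, C g x → C g y → C g (x + y)) (hsmul : ∀ g (r : ℂ) x, C g x → C g (r • x))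
    (x : P.Alg) (g : L × L) : C g ((d.coaction x).coeff g) := by
  have hs : ∀ g h x, C g x → C h ((AddMonoidAlgebra.single g x).coeff h) := by
    intro g h x hx
    rw [AddMonoidAlgebra.coeff_single, Finsupp.single_apply]
    split_ifs with e
    · subst e; exact hx
    · exact h0 _
  induction x using P.alg_induction generalizing g with
  | hr r =>
    rw [Algebra.algebraMap_eq_smul_one, map_smul, map_one, AddMonoidAlgebra.coeff_smul_apply]
    exact hsmul _ _ _ (hs 0 g 1 h1)
  | hk γ => rw [coaction_def, lift_k]; exact hs _ _ _ (hk γ)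
  | he i => rw [coaction_def, lift_e]; exact hs _ _ _ (he i)
  | hf i => rw [coaction_def, lift_f]; exact hs _ _ _ (hf i)
  | hmul x y hx hy =>
    rw [map_mul, AddMonoidAlgebra.coeff_mul]
    refine Finset.sum_induction _ (C g) (hadd g) (h0 g) fun a _ => ?_
    refine Finset.sum_induction _ (C g) (hadd g) (h0 g) fun b _ => ?_
    dsimp only
    split_ifs with e
    · subst e; exact hmul _ _ _ _ (hx a) (hy b)
    · exact h0 g
  | hadd x y hx hy =>
    rw [map_add, AddMonoidAlgebra.coeff_add, Finsupp.add_apply]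
    exact hadd _ _ _ (hx g) (hy g)

theorem component_mem (x : P.Alg) (g : L × L) : (d.coaction x).coeff g ∈ d.grading g :=
  d.component_induction (C := fun g x => x ∈ d.grading g) (fun g => zero_mem _)
    SetLike.GradedOne.one_mem d.k_mem d.e_mem d.f_mem
    (fun _ _ _ _ hx hy => SetLike.mul_mem_graded hx hy) (fun _ _ _ hx hy => add_mem hx hy)
    (fun _ r _ hx => Submodule.smul_mem _ r hx) x g

/-- Induction on homogeneous elements. -/
theorem grading_induction {C : L × L → P.Alg → Prop} (h0 : ∀ g, C g 0) (h1 : C 0 1)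
    (hk : ∀ g, C (-d.θ g, d.θ g) (P.k g)) (he : ∀ i, C (-d.α i, 0) (P.e i))
    (hf : ∀ i, C (0, d.α i) (P.f i))
    (hmul : ∀ g h x y, C g x → C h y → C (g + h) (x * y))
    (hadd : ∀ g x y, C g x → C g y → C g (x + y)) (hsmul : ∀ g (r : ℂ) x, C g x → C g (r • x))
    {x : P.Alg} {g : L × L} (hx : x ∈ d.grading g) : C g x := by
  have := d.component_induction (C := C) h0 h1 hk he hf hmul hadd hsmul x g
  rw [d.mem_grading.mp hx] at this
  rwa [AddMonoidAlgebra.coeff_single, Finsupp.single_apply, if_pos rfl] at this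

theorem coeff_coe (y : ⨁ g, d.grading g) (g : L × L) :
    (d.coaction (DirectSum.coeAddMonoidHom d.grading y)).coeff g = (y g : P.Alg) := by
  induction y using DirectSum.induction_on with
  | zero => simp
  | of h a =>
    rw [DirectSum.coeAddMonoidHom_of, d.mem_grading.mp a.2, AddMonoidAlgebra.coeff_single, Finsupp.single_apply,
      DirectSum.coe_of_apply]
    split_ifs <;> rfl
  | add y z hy hz => simp [hy, hz]

theorem sum_component (x : P.Alg) :
    (AddMonoidAlgebra.coeff (d.coaction x)).sum (fun _ a => a) = x := by
  have hadd : ∀ u v : AddMonoidAlgebra P.Alg (L × L),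
      (AddMonoidAlgebra.coeff (u + v)).sum (fun _ a => a) =
        (AddMonoidAlgebra.coeff u).sum (fun _ a => a) +
          (AddMonoidAlgebra.coeff v).sum (fun _ a => a) := fun u v =>
    Finsupp.sum_add_index' (fun _ => rfl) (fun _ _ _ => rfl)
  have hs : ∀ (g : L × L) (a : P.Alg),
      (AddMonoidAlgebra.coeff (AddMonoidAlgebra.single g a)).sum (fun _ a => a) = a := fun g a =>
    Finsupp.sum_single_index rfl
  have hm : ∀ u v : AddMonoidAlgebra P.Alg (L × L),
      (AddMonoidAlgebra.coeff (u * v)).sum (fun _ a => a) =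
        (AddMonoidAlgebra.coeff u).sum (fun _ a => a) *
          (AddMonoidAlgebra.coeff v).sum (fun _ a => a) := by
    intro u v
    induction u using AddMonoidAlgebra.induction_linear with
    | zero => simp
    | add u u' hu hu' => rw [add_mul, hadd, hadd, hu, hu', add_mul]
    | single g a =>
      induction v using AddMonoidAlgebra.induction_linear with
      | zero => simp
      | add v v' hv hv' => rw [mul_add, hadd, hadd, hv, hv', mul_add]
      | single h b => rw [AddMonoidAlgebra.single_mul_single, hs, hs, hs]
  induction x using P.alg_induction with
  | hr r =>
    rw [AlgHom.commutes, Algebra.algebraMap_eq_smul_one, Algebra.algebraMap_eq_smul_one,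
      AddMonoidAlgebra.one_def, AddMonoidAlgebra.smul_single, hs]
  | hk γ => rw [coaction_def, lift_k, hs]
  | he i => rw [coaction_def, lift_e, hs]
  | hf i => rw [coaction_def, lift_f, hs]
  | hmul x y hx hy => rw [map_mul, hm, hx, hy]
  | hadd x y hx hy => rw [map_add, hadd, hx, hy]

theorem coaction_injective : Function.Injective d.coaction := fun x y h => by
  rw [← d.sum_component x, h, d.sum_component]

/-- The family of homogeneous components. -/
def components (x : P.Alg) : ⨁ g, d.grading g :=
  DirectSum.mk (fun g => d.grading g) (d.coaction x).coeff.support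
    fun g => ⟨(d.coaction x).coeff g, d.component_mem x g⟩

theorem components_apply (x : P.Alg) (g : L × L) :
    (d.components x g : P.Alg) = (d.coaction x).coeff g := by
  by_cases h : g ∈ (d.coaction x).coeff.support
  · rw [components, DirectSum.mk_apply_of_mem h]
  · rw [components, DirectSum.mk_apply_of_notMem h, Finsupp.notMem_support_iff.mp h]; rfl

instance : DirectSum.Decomposition d.grading where
  decompose' := d.components
  left_inv x := by
    refine d.coaction_injective ?_
    ext g
    rw [d.coeff_coe, d.components_apply]
  right_inv y := by
    refine DFinsupp.ext fun g => Subtype.ext ?_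
    rw [d.components_apply, d.coeff_coe y g]

instance : GradedAlgebra d.grading where

theorem counit_eq_zero {g : L × L} {a : P.Alg} (ha : a ∈ d.grading g) :
    g.1 ≠ -g.2 → Coalgebra.counit (R := ℂ) a = 0 := by
  refine d.grading_induction (C := fun g a => g.1 ≠ -g.2 → Coalgebra.counit (R := ℂ) a = 0)
    ?_ ?_ ?_ ?_ ?_ ?_ ?_ ?_ ha
  · intro g _; simp
  · intro h; simp at h
  · intro γ h; simp at h
  · intro i _; simp
  · intro i _; simp
  · intro g h x y hx hy hgh
    rw [Bialgebra.counit_mul]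
    by_cases h1 : g.1 = -g.2
    · rw [hy, mul_zero]
      intro h2
      apply hgh
      rw [Prod.fst_add, Prod.snd_add, h1, h2, neg_add]
    · rw [hx h1, zero_mul]
  · intro g x y hx hy h; rw [map_add, hx h, hy h, add_zero]
  · intro g r x hx h; rw [map_smul, hx h, smul_zero]

theorem comul_mem {g : L × L} {a : P.Alg} (ha : a ∈ d.grading g) :
    Coalgebra.comul (R := ℂ) a ∈ bigradedTensor d.grading g.1 g.2 := by
  have mem : ∀ {l m : L} (n : L) {x y : P.Alg}, x ∈ d.grading (l, n) → y ∈ d.grading (-n, m) →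
      x ⊗ₜ[ℂ] y ∈ bigradedTensor d.grading l m := fun n x y hx hy =>
    Submodule.subset_span ⟨n, _, hx, _, hy, rfl⟩
  refine d.grading_induction
    (C := fun g a => Coalgebra.comul (R := ℂ) a ∈ bigradedTensor d.grading g.1 g.2)
    ?_ ?_ ?_ ?_ ?_ ?_ ?_ ?_ ha
  · intro g; rw [map_zero]; exact zero_mem _
  · rw [Bialgebra.comul_one, Algebra.TensorProduct.one_def]
    exact mem 0 SetLike.GradedOne.one_mem (by rw [neg_zero]; exact SetLike.GradedOne.one_mem)
  · intro γ; rw [comul_k]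
    exact mem _ (d.k_mem γ) (d.k_mem γ)
  · intro i; rw [comul_e]
    refine add_mem (mem 0 (d.e_mem i) (by rw [neg_zero]; exact SetLike.GradedOne.one_mem))
      (mem (d.α i) ?_ (d.e_mem i))
    have := d.k_mem (P.κ i)
    rwa [d.θ_κ] at this
  · intro i; rw [comul_f]
    refine add_mem (mem (d.α i) (d.f_mem i) ?_) (mem 0 SetLike.GradedOne.one_mem ?_)
    · have := d.k_mem (-P.κ' i)
      simp only [map_neg, d.θ_κ', neg_neg] at this
      exact this
    · rw [neg_zero]; exact d.f_mem i
  · intro g h x y hx hy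
    rw [Bialgebra.comul_mul]
    generalize Coalgebra.comul (R := ℂ) x = X at hx ⊢
    generalize Coalgebra.comul (R := ℂ) y = Y at hy ⊢
    clear x y
    unfold bigradedTensor at hx hy
    induction hx using Submodule.span_induction with
    | zero => rw [zero_mul]; exact zero_mem _
    | add x y _ _ h1 h2 => rw [add_mul]; exact add_mem h1 h2
    | smul r x _ h => rw [smul_mul_assoc]; exact Submodule.smul_mem _ _ h
    | mem z hz =>
    induction hy using Submodule.span_induction with
    | zero => rw [mul_zero]; exact zero_mem _
    | add x y _ _ h1 h2 => rw [mul_add]; exact add_mem h1 h2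
    | smul r x _ h => rw [mul_smul_comm]; exact Submodule.smul_mem _ _ h
    | mem z' hz' =>
    obtain ⟨n, x, hx, y, hy, rfl⟩ := hz
    obtain ⟨n', x', hx', y', hy', rfl⟩ := hz'
    rw [Algebra.TensorProduct.tmul_mul_tmul]
    refine mem (n + n') (SetLike.mul_mem_graded hx hx') ?_
    rw [neg_add]
    exact SetLike.mul_mem_graded hy hy'
  · intro g x y hx hy; rw [map_add]; exact add_mem hx hy
  · intro g r x hx; rw [map_smul]; exact Submodule.smul_mem _ _ hx

theorem antipode_mem {g : L × L} {a : P.Alg} (ha : a ∈ d.grading g) :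
    P.antipodeMap a ∈ d.grading (g.2, g.1) := by
  refine d.grading_induction
    (C := fun g a => P.antipodeMap a ∈ d.grading (g.2, g.1)) ?_ ?_ ?_ ?_ ?_ ?_ ?_ ?_ ha
  · intro g; rw [map_zero]; exact zero_mem _
  · rw [antipodeMap_one]; exact SetLike.GradedOne.one_mem
  · intro γ; rw [antipodeMap_k]
    have := d.k_mem (-γ)
    rwa [map_neg, neg_neg] at this
  · intro i; rw [antipodeMap_e]
    refine neg_mem ?_
    have := SetLike.mul_mem_graded (d.k_mem (-P.κ i)) (d.e_mem i)
    rw [map_neg, d.θ_κ] at this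
    simpa using this
  · intro i; rw [antipodeMap_f]
    refine neg_mem ?_
    have := SetLike.mul_mem_graded (d.f_mem i) (d.k_mem (P.κ' i))
    rw [d.θ_κ'] at this
    simpa using this
  · intro g h x y hx hy
    have h1 := SetLike.mul_mem_graded hy hx
    have e1 : (h.2, h.1) + (g.2, g.1) = ((g + h).2, (g + h).1) :=
      Prod.ext (add_comm _ _) (add_comm _ _)
    rw [e1] at h1
    rw [antipodeMap_mul]
    exact h1
  · intro g x y hx hy; rw [map_add]; exact add_mem hx hy
  · intro g r x hx; rw [map_smul]; exact Submodule.smul_mem _ _ hx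

theorem antipode_eq (a : P.Alg) : HopfAlgebra.antipode ℂ a = P.antipodeMap a := rfl

instance : IsBigradedHopf d.grading where
  comul_mem l m _ ha := d.comul_mem (g := (l, m)) ha
  counit_eq_zero l m _ ha h := d.counit_eq_zero (g := (l, m)) ha h
  antipode_mem l m a ha := by
    rw [antipode_eq]
    exact d.antipode_mem (g := (l, m)) ha

end BiDegree

end QParam

open CategoryTheory

/-! ### The monoidal category of modules over a bialgebra -/

/-- A left module over the `K`-algebra `H`, as a `K`-vector space with an action of `H`. -/
structure HRep (K H : Type) [Field K] [Ring H] [Algebra K H] where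
  /-- the underlying vector space -/
  V : ModuleCat.{0} K
  /-- the action -/
  ρ : H →ₐ[K] Module.End K V

namespace HRep

variable {K H : Type} [Field K]

section Category

variable [Ring H] [Algebra K H]

/-- An `H`-linear map. -/
structure Hom (X Y : HRep K H) where
  hom : X.V ⟶ Y.V
  comm : ∀ (u : H) (x : X.V), hom.hom (X.ρ u x) = Y.ρ u (hom.hom x)

instance : Category (HRep K H) where
  Hom := Hom
  id X := ⟨𝟙 X.V, fun _ _ => rfl⟩
  comp f g := ⟨f.hom ≫ g.hom, fun u x => by
    simp only [ModuleCat.hom_comp, LinearMap.comp_apply, f.comm, g.comm]⟩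

@[ext] theorem hom_ext {X Y : HRep K H} {f g : X ⟶ Y} (h : f.hom = g.hom) : f = g := by
  have h' : ∀ f g : Hom X Y, f.hom = g.hom → f = g := by
    rintro ⟨f, _⟩ ⟨g, _⟩ h
    cases h
    rfl
  exact h' f g h

@[simp] theorem id_hom (X : HRep K H) : Hom.hom (𝟙 X) = 𝟙 X.V := rfl
@[simp] theorem comp_hom {X Y Z : HRep K H} (f : X ⟶ Y) (g : Y ⟶ Z) :
    (f ≫ g).hom = f.hom ≫ g.hom := rfl

/-- The forgetful functor to vector spaces. -/
def forget (K H : Type) [Field K] [Ring H] [Algebra K H] : HRep K H ⥤ ModuleCat.{0} K where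
  obj X := X.V
  map f := f.hom

instance : (forget K H).Faithful where
  map_injective h := hom_ext h

/-- An isomorphism of modules from an equivariant isomorphism of vector spaces. -/
def mkIso {X Y : HRep K H} (e : X.V ≅ Y.V)
    (h : ∀ (u : H) (x : X.V), e.hom.hom (X.ρ u x) = Y.ρ u (e.hom.hom x)) : X ≅ Y where
  hom := ⟨e.hom, h⟩
  inv := ⟨e.inv, fun u y => by
    have h1 : ∀ z, e.hom.hom (e.inv.hom z) = z := fun z => by
      rw [← LinearMap.comp_apply, ← ModuleCat.hom_comp, e.inv_hom_id]; rfl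
    have h2 : ∀ z, e.inv.hom (e.hom.hom z) = z := fun z => by
      rw [← LinearMap.comp_apply, ← ModuleCat.hom_comp, e.hom_inv_id]; rfl
    conv_lhs => rw [← h1 y]
    rw [← h, h2]⟩
  hom_inv_id := hom_ext e.hom_inv_id
  inv_hom_id := hom_ext e.inv_hom_id

end Category

section Monoidal

variable [Ring H] [Bialgebra K H]

/-- The action of `H` on `V ⊗ W` through the comultiplication. -/
def tensorρ {V W : Type} [AddCommGroup V] [Module K V] [AddCommGroup W] [Module K W]
    (ρ : H →ₐ[K] Module.End K V) (σ : H →ₐ[K] Module.End K W) :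
    H →ₐ[K] Module.End K (V ⊗[K] W) :=
  ((Module.endTensorEndAlgHom (R := K) (S := K) (A := K) (M := V) (N := W)).comp
    (Algebra.TensorProduct.map ρ σ)).comp (Bialgebra.comulAlgHom K H)

/-- The action of `H ⊗ H` on `V ⊗ W`. -/
def act₂ {V W : Type} [AddCommGroup V] [Module K V] [AddCommGroup W] [Module K W]
    (ρ : H →ₐ[K] Module.End K V) (σ : H →ₐ[K] Module.End K W) :
    H ⊗[K] H →ₐ[K] Module.End K (V ⊗[K] W) :=
  (Module.endTensorEndAlgHom (R := K) (S := K) (A := K) (M := V) (N := W)).comp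
    (Algebra.TensorProduct.map ρ σ)

theorem act₂_tmul {V W : Type} [AddCommGroup V] [Module K V] [AddCommGroup W] [Module K W]
    (ρ : H →ₐ[K] Module.End K V) (σ : H →ₐ[K] Module.End K W) (x y : H) :
    act₂ ρ σ (x ⊗ₜ y) = TensorProduct.map (ρ x) (σ y) := by
  simp [act₂, Module.endTensorEndAlgHom_apply, TensorProduct.AlgebraTensorModule.map_eq]

theorem tensorρ_apply {V W : Type} [AddCommGroup V] [Module K V] [AddCommGroup W] [Module K W]
    (ρ : H →ₐ[K] Module.End K V) (σ : H →ₐ[K] Module.End K W) (u : H) :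
    tensorρ ρ σ u = act₂ ρ σ (Coalgebra.comul (R := K) u) := rfl

theorem tensorρ_natural {V W V' W' : Type} [AddCommGroup V] [Module K V] [AddCommGroup W]
    [Module K W] [AddCommGroup V'] [Module K V'] [AddCommGroup W'] [Module K W']
    {ρ : H →ₐ[K] Module.End K V} {σ : H →ₐ[K] Module.End K W}
    {ρ' : H →ₐ[K] Module.End K V'} {σ' : H →ₐ[K] Module.End K W'}
    (f : V →ₗ[K] V') (g : W →ₗ[K] W') (hf : ∀ u x, f (ρ u x) = ρ' u (f x))
    (hg : ∀ u x, g (σ u x) = σ' u (g x)) (u : H) (z : V ⊗[K] W) :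
    TensorProduct.map f g (tensorρ ρ σ u z) = tensorρ ρ' σ' u (TensorProduct.map f g z) := by
  rw [tensorρ_apply, tensorρ_apply]
  generalize Coalgebra.comul (R := K) u = w
  induction w using TensorProduct.induction_on with
  | zero => simp
  | add a b ha hb => simp only [map_add, LinearMap.add_apply, ha, hb]
  | tmul a b =>
  rw [act₂_tmul, act₂_tmul]
  induction z using TensorProduct.induction_on with
  | zero => simp
  | add x y hx hy => simp only [map_add, hx, hy]
  | tmul x y => simp only [TensorProduct.map_tmul, hf, hg]

theorem tensorρ_assoc {V W X : Type} [AddCommGroup V] [Module K V] [AddCommGroup W]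
    [Module K W] [AddCommGroup X] [Module K X]
    (ρ : H →ₐ[K] Module.End K V) (σ : H →ₐ[K] Module.End K W) (τ : H →ₐ[K] Module.End K X)
    (u : H) (z : (V ⊗[K] W) ⊗[K] X) :
    TensorProduct.assoc K V W X (tensorρ (tensorρ ρ σ) τ u z) =
      tensorρ ρ (tensorρ σ τ) u (TensorProduct.assoc K V W X z) := by
  have key : ∀ (w : (H ⊗[K] H) ⊗[K] H) (z : (V ⊗[K] W) ⊗[K] X),
      TensorProduct.assoc K V W X ((Module.endTensorEndAlgHom (R := K) (S := K) (A := K)).comp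
        (Algebra.TensorProduct.map (act₂ ρ σ) τ) w z) =
      (Module.endTensorEndAlgHom (R := K) (S := K) (A := K)).comp
        (Algebra.TensorProduct.map ρ (act₂ σ τ)) (TensorProduct.assoc K H H H w)
        (TensorProduct.assoc K V W X z) := by
    intro w z
    induction w using TensorProduct.induction_on with
    | zero => simp
    | add a b ha hb => simp only [map_add, LinearMap.add_apply, ha, hb]
    | tmul w c =>
    induction w using TensorProduct.induction_on with
    | zero => simp
    | add a b ha hb =>
      simp only [TensorProduct.add_tmul, map_add, LinearMap.add_apply, ha, hb]
    | tmul a b =>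
    induction z using TensorProduct.induction_on with
    | zero => simp
    | add x y hx hy => simp only [map_add, hx, hy]
    | tmul z y =>
    induction z using TensorProduct.induction_on with
    | zero => simp
    | add x y hx hy => simp only [TensorProduct.add_tmul, map_add, hx, hy]
    | tmul x x' =>
      simp [Module.endTensorEndAlgHom_apply, act₂_tmul]
  have h1 : ∀ v : H ⊗[K] H, act₂ (tensorρ ρ σ) τ v =
      (Module.endTensorEndAlgHom (R := K) (S := K) (A := K)).comp
        (Algebra.TensorProduct.map (act₂ ρ σ) τ)
        ((Coalgebra.comul (R := K)).rTensor H v) := by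
    intro v
    induction v using TensorProduct.induction_on with
    | zero => simp
    | add a b ha hb => simp only [map_add, ha, hb]
    | tmul a b =>
      simp [act₂_tmul, tensorρ_apply, Module.endTensorEndAlgHom_apply,
        TensorProduct.AlgebraTensorModule.map_eq]
  have h2 : ∀ v : H ⊗[K] H, act₂ ρ (tensorρ σ τ) v =
      (Module.endTensorEndAlgHom (R := K) (S := K) (A := K)).comp
        (Algebra.TensorProduct.map ρ (act₂ σ τ))
        ((Coalgebra.comul (R := K)).lTensor H v) := by
    intro v
    induction v using TensorProduct.induction_on with
    | zero => simp
    | add a b ha hb => simp only [map_add, ha, hb]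
    | tmul a b =>
      simp [act₂_tmul, tensorρ_apply, Module.endTensorEndAlgHom_apply,
        TensorProduct.AlgebraTensorModule.map_eq]
  rw [tensorρ_apply, tensorρ_apply, h1, h2, key, Coalgebra.coassoc_apply]

/-- The action of `H` on `K` through the counit. -/
def unitρ (K H : Type) [Field K] [Ring H] [Bialgebra K H] : H →ₐ[K] Module.End K K :=
  (Algebra.lmul K K).comp (Bialgebra.counitAlgHom K H)

theorem unitρ_apply (u : H) (r : K) : unitρ K H u r = Coalgebra.counit (R := K) u * r := rfl

theorem tensorρ_unit_left {V : Type} [AddCommGroup V] [Module K V] (ρ : H →ₐ[K] Module.End K V)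
    (u : H) (z : K ⊗[K] V) : TensorProduct.lid K V (tensorρ (unitρ K H) ρ u z) =
      ρ u (TensorProduct.lid K V z) := by
  have h : ∀ w : H ⊗[K] H, TensorProduct.lid K V (act₂ (unitρ K H) ρ w z) =
      ρ (TensorProduct.lid K H ((Coalgebra.counit (R := K)).rTensor H w))
        (TensorProduct.lid K V z) := by
    intro w
    induction w using TensorProduct.induction_on with
    | zero => simp
    | add a b ha hb => simp only [map_add, LinearMap.add_apply, ha, hb]
    | tmul a b =>
    induction z using TensorProduct.induction_on with
    | zero => simp
    | add x y hx hy => simp only [map_add, hx, hy]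
    | tmul x y => simp [act₂_tmul, unitρ_apply, smul_smul, mul_comm]
  rw [tensorρ_apply, h, Coalgebra.rTensor_counit_comul]
  simp

theorem tensorρ_unit_right {V : Type} [AddCommGroup V] [Module K V] (ρ : H →ₐ[K] Module.End K V)
    (u : H) (z : V ⊗[K] K) : TensorProduct.rid K V (tensorρ ρ (unitρ K H) u z) =
      ρ u (TensorProduct.rid K V z) := by
  have h : ∀ w : H ⊗[K] H, TensorProduct.rid K V (act₂ ρ (unitρ K H) w z) =
      ρ (TensorProduct.rid K H ((Coalgebra.counit (R := K)).lTensor H w))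
        (TensorProduct.rid K V z) := by
    intro w
    induction w using TensorProduct.induction_on with
    | zero => simp
    | add a b ha hb => simp only [map_add, LinearMap.add_apply, ha, hb]
    | tmul a b =>
    induction z using TensorProduct.induction_on with
    | zero => simp
    | add x y hx hy => simp only [map_add, hx, hy]
    | tmul x y => simp [act₂_tmul, unitρ_apply, smul_smul, mul_comm]
  rw [tensorρ_apply, h, Coalgebra.lTensor_counit_comul]
  simp

open MonoidalCategory

instance : MonoidalCategoryStruct (HRep K H) where
  tensorObj X Y := ⟨X.V ⊗ Y.V, tensorρ X.ρ Y.ρ⟩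
  whiskerLeft X _ _ f := ⟨X.V ◁ f.hom,
    tensorρ_natural LinearMap.id f.hom.hom (fun _ _ => rfl) f.comm⟩
  whiskerRight f Y := ⟨f.hom ▷ Y.V,
    tensorρ_natural f.hom.hom LinearMap.id f.comm (fun _ _ => rfl)⟩
  tensorHom f g := ⟨f.hom ⊗ₘ g.hom, tensorρ_natural f.hom.hom g.hom.hom f.comm g.comm⟩
  tensorUnit := ⟨𝟙_ (ModuleCat K), unitρ K H⟩
  associator X Y Z := mkIso (α_ X.V Y.V Z.V) (tensorρ_assoc X.ρ Y.ρ Z.ρ)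
  leftUnitor X := mkIso (λ_ X.V) (tensorρ_unit_left X.ρ)
  rightUnitor X := mkIso (ρ_ X.V) (tensorρ_unit_right X.ρ)

theorem assoc_aux {C : Type*} [Category C] [MonoidalCategory C] (X Y Z : C) : (α_ X Y Z).hom =
    ((((Iso.refl ((X ⊗ Y) ⊗ Z)).symm ≪≫ ((Iso.refl (X ⊗ Y)).symm ⊗ᵢ Iso.refl Z)) ≪≫ α_ X Y Z ≪≫
      ((Iso.refl X ⊗ᵢ Iso.refl (Y ⊗ Z)) ≪≫ Iso.refl (X ⊗ Y ⊗ Z)))).hom := by simp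

theorem left_aux {C : Type*} [Category C] [MonoidalCategory C] (X : C) : (λ_ X).hom =
    (((Iso.refl (𝟙_ C ⊗ X)).symm ≪≫ ((Iso.refl (𝟙_ C)).symm ⊗ᵢ Iso.refl X)) ≪≫ λ_ X).hom := by simp

theorem right_aux {C : Type*} [Category C] [MonoidalCategory C] (X : C) : (ρ_ X).hom =
    (((Iso.refl (X ⊗ 𝟙_ C)).symm ≪≫ (Iso.refl X ⊗ᵢ (Iso.refl (𝟙_ C)).symm)) ≪≫ ρ_ X).hom := by simp

/-- The tensor product of modules, its unit and its structure maps are those of vector spaces, with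
`H` acting through its comultiplication and counit. -/
instance : MonoidalCategory (HRep K H) :=
  Monoidal.induced (forget K H)
    { μIso := fun _ _ => Iso.refl _
      εIso := Iso.refl _
      whiskerLeft_eq := fun X _ _ f => by
        simp only [Iso.refl_inv, Iso.refl_hom]
        exact ((Category.id_comp _).trans (Category.comp_id (X.V ◁ f.hom))).symm
      whiskerRight_eq := fun f X => by
        simp only [Iso.refl_inv, Iso.refl_hom]
        exact ((Category.id_comp _).trans (Category.comp_id (f.hom ▷ X.V))).symm
      tensorHom_eq := fun f g => by
        simp only [Iso.refl_inv, Iso.refl_hom]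
        exact ((Category.id_comp _).trans (Category.comp_id (f.hom ⊗ₘ g.hom))).symm
      associator_eq := fun X Y Z => assoc_aux X.V Y.V Z.V
      leftUnitor_eq := fun X => left_aux X.V
      rightUnitor_eq := fun X => right_aux X.V }

end Monoidal

end HRep

/-! ### Coordinate functions and restricted duals -/

section RestrictedDual

variable {K H : Type} [Field K] [Ring H] [Bialgebra K H]

/-- The coordinate function `c_{f,v} ∈ H^*`, `c_{f,v}(u) = f(u v)`. Here `H^*` carries the
convolution product. -/
def coord (X : HRep K H) (f : Module.Dual K X.V) (v : X.V) : WithConv (H →ₗ[K] K) :=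
  WithConv.toConv (f ∘ₗ X.ρ.toLinearMap.flip v)

theorem coord_apply (X : HRep K H) (f : Module.Dual K X.V) (v : X.V) (u : H) :
    (coord X f v).ofConv u = f (X.ρ u v) := rfl

/-- The subalgebra of the convolution
algebra `H^*` generated by the coordinate functions `c_{f,v}` of the finite dimensional modules
in `Q`. -/
def coordAlg (Q : ObjectProperty (HRep K H)) : Subalgebra K (WithConv (H →ₗ[K] K)) :=
  Algebra.adjoin K {c | ∃ X : HRep K H, Q X ∧ Module.Finite K X.V ∧
    ∃ (f : Module.Dual K X.V) (v : X.V), c = coord X f v}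

theorem coord_mem {Q : ObjectProperty (HRep K H)} {X : HRep K H} (hX : Q X)
    (hfin : Module.Finite K X.V) (f : Module.Dual K X.V) (v : X.V) :
    coord X f v ∈ coordAlg Q :=
  Algebra.subset_adjoin ⟨X, hX, hfin, f, v, rfl⟩

/-- The restricted dual of a class `Q` of finite dimensional `H`-modules, i.e. the algebra of
coordinate functions on the modules in `Q`. -/
def RestrictedDual (Q : ObjectProperty (HRep K H)) : Type := coordAlg Q

instance (Q : ObjectProperty (HRep K H)) : Ring (RestrictedDual Q) :=
  inferInstanceAs (Ring (coordAlg Q))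
instance (Q : ObjectProperty (HRep K H)) : Algebra K (RestrictedDual Q) :=
  inferInstanceAs (Algebra K (coordAlg Q))

/-- The coordinate function `c_{f,v}` as an element of the restricted dual. -/
def RestrictedDual.coord {Q : ObjectProperty (HRep K H)} {X : HRep K H} (hX : Q X)
    (hfin : Module.Finite K X.V) (f : Module.Dual K X.V) (v : X.V) : RestrictedDual Q :=
  ⟨QG.coord X f v, coord_mem hX hfin f v⟩

namespace RestrictedDual

variable (Q : ObjectProperty (HRep K H))

/-- The pairing of the restricted dual with `H`. -/
def eval : RestrictedDual Q →ₗ[K] H →ₗ[K] K where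
  toFun c := c.1.ofConv
  map_add' _ _ := rfl
  map_smul' _ _ := rfl

theorem eval_injective : Function.Injective (eval Q) := fun _ _ h =>
  Subtype.ext (WithConv.ofConv_injective h)

theorem eval_apply (c : RestrictedDual Q) (u : H) : eval Q c u = c.1.ofConv u := rfl

theorem eval_coord {X : HRep K H} (hX : Q X) (hfin : Module.Finite K X.V)
    (f : Module.Dual K X.V) (v : X.V) (u : H) :
    eval Q (RestrictedDual.coord hX hfin f v) u = f (X.ρ u v) := rfl

theorem eval_one (u : H) : eval Q 1 u = Coalgebra.counit (R := K) u := rfl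

theorem eval_mul (c c' : RestrictedDual Q) (u : H) {ι : Type*} (r : Coalgebra.Repr K u ι) :
    eval Q (c * c') u = ∑ i ∈ r.index, eval Q c (r.left i) * eval Q c' (r.right i) :=
  r.convMul_apply c.1 c'.1

theorem eval_ext {c c' : RestrictedDual Q} (h : ∀ u, eval Q c u = eval Q c' u) : c = c' :=
  eval_injective Q (LinearMap.ext h)

/-- Evaluation of the left factor of `R ⊗ W`. -/
def evL (W : Type*) [AddCommGroup W] [Module K W] (u : H) : RestrictedDual Q ⊗[K] W →ₗ[K] W :=
  TensorProduct.lid K W ∘ₗ ((eval Q).flip u).rTensor W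

theorem evL_tmul {W : Type*} [AddCommGroup W] [Module K W] (u : H) (c : RestrictedDual Q) (w : W) :
    evL Q W u (c ⊗ₜ w) = eval Q c u • w := by
  simp [evL]

theorem evL_eq_zero {W : Type*} [AddCommGroup W] [Module K W] (z : RestrictedDual Q ⊗[K] W)
    (h : ∀ u, evL Q W u z = 0) : z = 0 := by
  classical
  let b := Module.Basis.ofVectorSpace K W
  have key : ∀ (z : RestrictedDual Q ⊗[K] W) (u : H) (i : _),
      b.repr (evL Q W u z) i = eval Q (TensorProduct.equivFinsuppOfBasisRight b z i) u := by
    intro z u i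
    induction z using TensorProduct.induction_on with
    | zero => simp
    | add x y hx hy => simp only [map_add, Finsupp.add_apply, LinearMap.add_apply, hx, hy]
    | tmul c w =>
      rw [evL_tmul, TensorProduct.equivFinsuppOfBasisRight_apply_tmul_apply]
      simp [mul_comm]
  apply (TensorProduct.equivFinsuppOfBasisRight b).injective
  ext1 i
  refine eval_ext Q fun u => ?_
  rw [← key, h]
  simp

theorem evL_ext {W : Type*} [AddCommGroup W] [Module K W] {z z' : RestrictedDual Q ⊗[K] W}
    (h : ∀ u, evL Q W u z = evL Q W u z') : z = z' := by
  rw [← sub_eq_zero]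
  exact evL_eq_zero Q _ fun u => by rw [map_sub, h, sub_self]

/-- The map `R ⊗ R → (H × H → K)`. -/
def ev₂ : RestrictedDual Q ⊗[K] RestrictedDual Q →ₗ[K] H → H → K where
  toFun z u v := eval Q (evL Q _ u z) v
  map_add' _ _ := by funext u v; simp
  map_smul' _ _ := by funext u v; simp

theorem ev₂_apply (z : RestrictedDual Q ⊗[K] RestrictedDual Q) (u v : H) :
    ev₂ Q z u v = eval Q (evL Q _ u z) v := rfl

theorem ev₂_tmul (c d : RestrictedDual Q) (u v : H) :
    ev₂ Q (c ⊗ₜ d) u v = eval Q c u * eval Q d v := by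
  rw [ev₂_apply, evL_tmul]; simp

theorem ev₂_injective : Function.Injective (ev₂ Q) := fun z z' h =>
  evL_ext Q fun u => eval_ext Q fun v => congrFun (congrFun h u) v

theorem ev₂_mul (z z' : RestrictedDual Q ⊗[K] RestrictedDual Q) (u v : H) {ι κ : Type*}
    (r : Coalgebra.Repr K u ι) (s : Coalgebra.Repr K v κ) :
    ev₂ Q (z * z') u v = ∑ i ∈ r.index, ∑ j ∈ s.index,
      ev₂ Q z (r.left i) (s.left j) * ev₂ Q z' (r.right i) (s.right j) := by
  induction z using TensorProduct.induction_on with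
  | zero => simp
  | add x y hx hy => simp only [add_mul, map_add, Pi.add_apply, hx, hy, Finset.sum_add_distrib]
  | tmul a b =>
  induction z' using TensorProduct.induction_on with
  | zero => simp
  | add x y hx hy => simp only [mul_add, map_add, Pi.add_apply, hx, hy, Finset.sum_add_distrib]
  | tmul a' b' =>
  rw [Algebra.TensorProduct.tmul_mul_tmul, ev₂_tmul, eval_mul Q a a' u r, eval_mul Q b b' v s,
    Finset.sum_mul_sum]
  refine Finset.sum_congr rfl fun i _ => Finset.sum_congr rfl fun j _ => ?_
  rw [ev₂_tmul, ev₂_tmul]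
  ring

/-- The map `c ↦ ((u, v) ↦ c(u v))`. -/
def mulDual : RestrictedDual Q →ₗ[K] H → H → K where
  toFun c u v := eval Q c (u * v)
  map_add' _ _ := rfl
  map_smul' _ _ := rfl

theorem mulDual_apply (c : RestrictedDual Q) (u v : H) : mulDual Q c u v = eval Q c (u * v) := rfl

theorem mulDual_mul (c c' : RestrictedDual Q) (u v : H) {ι κ : Type*}
    (r : Coalgebra.Repr K u ι) (s : Coalgebra.Repr K v κ) :
    mulDual Q (c * c') u v = ∑ i ∈ r.index, ∑ j ∈ s.index,
      mulDual Q c (r.left i) (s.left j) * mulDual Q c' (r.right i) (s.right j) := by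
  have h : eval Q (c * c') (u * v) = LinearMap.mul' K K
      (TensorProduct.map (eval Q c) (eval Q c') (Coalgebra.comul (R := K) (u * v))) := rfl
  rw [mulDual_apply, h, Bialgebra.comul_mul, ← r.eq, ← s.eq, Finset.sum_mul_sum]
  simp only [map_sum, Algebra.TensorProduct.tmul_mul_tmul, TensorProduct.map_tmul,
    LinearMap.mul'_apply]
  rfl

theorem mulDual_one (u v : H) :
    mulDual Q 1 u v = Coalgebra.counit (R := K) u * Coalgebra.counit (R := K) v := by
  rw [mulDual_apply, eval_one, Bialgebra.counit_mul]

theorem induction {C : RestrictedDual Q → Prop}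
    (hc : ∀ (X : HRep K H) (hX : Q X) (hfin : Module.Finite K X.V) (f : Module.Dual K X.V) (v : X.V),
      C (RestrictedDual.coord hX hfin f v))
    (hr : ∀ r : K, C (algebraMap K _ r)) (hadd : ∀ x y, C x → C y → C (x + y))
    (hmul : ∀ x y, C x → C y → C (x * y)) (c : RestrictedDual Q) : C c := by
  obtain ⟨c, h⟩ := c
  refine Algebra.adjoin_induction (p := fun c h => C ⟨c, h⟩) ?_ (fun r => hr r)
    (fun x y hx hy h1 h2 => hadd ⟨x, hx⟩ ⟨y, hy⟩ h1 h2)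
    (fun x y hx hy h1 h2 => hmul ⟨x, hx⟩ ⟨y, hy⟩ h1 h2) h
  rintro _ ⟨X, hX, hfin, f, v, rfl⟩
  exact hc X hX hfin f v

theorem exists_ev₂ (c : RestrictedDual Q) : ∃ z, ev₂ Q z = mulDual Q c := by
  induction c using RestrictedDual.induction with
  | hc X hX hfin f v =>
    have b := Module.finBasis K X.V
    refine ⟨∑ i, (RestrictedDual.coord hX hfin f (b i)) ⊗ₜ[K]
      (RestrictedDual.coord hX hfin (b.coord i) v), ?_⟩
    funext u w
    rw [map_sum, Finset.sum_apply, Finset.sum_apply]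
    simp only [ev₂_tmul, eval_coord]
    change _ = f (X.ρ (u * w) v)
    rw [map_mul, Module.End.mul_apply]
    conv_rhs => rw [← b.sum_repr (X.ρ w v)]
    simp only [map_sum, map_smul, smul_eq_mul]
    exact Finset.sum_congr rfl fun i _ => mul_comm _ _
  | hr r =>
    refine ⟨r • (1 ⊗ₜ 1), ?_⟩
    funext u v
    rw [Algebra.algebraMap_eq_smul_one, map_smul, map_smul, Pi.smul_apply, Pi.smul_apply,
      Pi.smul_apply, Pi.smul_apply, mulDual_one, ev₂_tmul, eval_one, eval_one]
  | hadd x y h1 h2 =>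
    obtain ⟨z, hz⟩ := h1
    obtain ⟨z', hz'⟩ := h2
    exact ⟨z + z', by rw [map_add, hz, hz', ← map_add]⟩
  | hmul x y h1 h2 =>
    obtain ⟨z, hz⟩ := h1
    obtain ⟨z', hz'⟩ := h2
    refine ⟨z * z', ?_⟩
    funext u v
    rw [ev₂_mul Q z z' u v (Coalgebra.Repr.arbitrary K u) (Coalgebra.Repr.arbitrary K v), hz, hz']
    exact (mulDual_mul Q x y u v _ _).symm

/-- The comultiplication, dual to the multiplication of `H`. -/
def comulMap : RestrictedDual Q →ₗ[K] RestrictedDual Q ⊗[K] RestrictedDual Q :=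
  (LinearEquiv.ofInjective (ev₂ Q) (ev₂_injective Q)).symm.toLinearMap ∘ₗ
    (mulDual Q).codRestrict (LinearMap.range (ev₂ Q)) (exists_ev₂ Q)

theorem ev₂_comulMap (c : RestrictedDual Q) : ev₂ Q (comulMap Q c) = mulDual Q c := by
  have := (LinearEquiv.ofInjective (ev₂ Q) (ev₂_injective Q)).apply_symm_apply
    ((mulDual Q).codRestrict (LinearMap.range (ev₂ Q)) (exists_ev₂ Q) c)
  exact congrArg Subtype.val this

theorem eval_evL_comulMap (c : RestrictedDual Q) (u v : H) :
    eval Q (evL Q _ u (comulMap Q c)) v = eval Q c (u * v) :=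
  congrFun (congrFun (ev₂_comulMap Q c) u) v

/-- The counit, dual to the unit of `H`. -/
def counitMap : RestrictedDual Q →ₗ[K] K := (eval Q).flip 1

theorem counitMap_apply (c : RestrictedDual Q) : counitMap Q c = eval Q c 1 := rfl

theorem coassoc_aux (z : RestrictedDual Q ⊗[K] RestrictedDual Q) (u v : H) :
    evL Q _ v (evL Q _ u (TensorProduct.assoc K _ _ _ ((comulMap Q).rTensor _ z))) =
      evL Q _ (u * v) z := by
  induction z using TensorProduct.induction_on with
  | zero => simp
  | add x y hx hy => simp only [map_add, hx, hy]
  | tmul a b =>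
  rw [LinearMap.rTensor_tmul, evL_tmul, ← eval_evL_comulMap]
  generalize comulMap Q a = w
  induction w using TensorProduct.induction_on with
  | zero => simp
  | add x y hx hy => simp only [TensorProduct.add_tmul, map_add, hx, hy, LinearMap.add_apply,
      add_smul]
  | tmul c d =>
    rw [TensorProduct.assoc_tmul, evL_tmul, map_smul, evL_tmul, evL_tmul, map_smul, smul_smul]
    rfl

theorem coassoc_aux' (z : RestrictedDual Q ⊗[K] RestrictedDual Q) (u : H) :
    evL Q _ u ((comulMap Q).lTensor _ z) = comulMap Q (evL Q _ u z) := by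
  induction z using TensorProduct.induction_on with
  | zero => simp
  | add x y hx hy => simp only [map_add, hx, hy]
  | tmul a b => rw [LinearMap.lTensor_tmul, evL_tmul, evL_tmul, map_smul]

instance : Coalgebra K (RestrictedDual Q) where
  comul := comulMap Q
  counit := counitMap Q
  coassoc := by
    refine LinearMap.ext fun c => evL_ext Q fun u => evL_ext Q fun v => eval_ext Q fun w => ?_
    simp only [LinearMap.comp_apply, LinearEquiv.coe_coe]
    rw [coassoc_aux, coassoc_aux', eval_evL_comulMap, eval_evL_comulMap, eval_evL_comulMap,
      mul_assoc]
  rTensor_counit_comp_comul := by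
    refine LinearMap.ext fun c => (TensorProduct.lid K _).injective (eval_ext Q fun u => ?_)
    have := eval_evL_comulMap Q c 1 u
    rw [one_mul] at this
    simpa [evL, counitMap] using this
  lTensor_counit_comp_comul := by
    refine LinearMap.ext fun c => evL_ext Q fun u => ?_
    have h : ∀ z : RestrictedDual Q ⊗[K] RestrictedDual Q,
        evL Q K u ((counitMap Q).lTensor _ z) = eval Q (evL Q _ u z) 1 := by
      intro z
      induction z using TensorProduct.induction_on with
      | zero => simp
      | add x y hx hy => simp only [map_add, hx, hy, LinearMap.add_apply]
      | tmul a b => rw [LinearMap.lTensor_tmul, evL_tmul, evL_tmul, map_smul]; rfl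
    rw [LinearMap.comp_apply, h, eval_evL_comulMap, mul_one]
    simp [evL_tmul]

theorem eval_evL_comul (c : RestrictedDual Q) (u v : H) :
    eval Q (evL Q _ u (Coalgebra.comul (R := K) c)) v = eval Q c (u * v) :=
  eval_evL_comulMap Q c u v

theorem ev₂_comul (c : RestrictedDual Q) (u v : H) :
    ev₂ Q (Coalgebra.comul (R := K) c) u v = eval Q c (u * v) :=
  eval_evL_comulMap Q c u v

theorem counit_apply (c : RestrictedDual Q) : Coalgebra.counit (R := K) c = eval Q c 1 := rfl

instance : Bialgebra K (RestrictedDual Q) :=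
  Bialgebra.mk' K (RestrictedDual Q)
    (by rw [counit_apply, eval_one, Bialgebra.counit_one])
    (fun {a b} => by
      rw [counit_apply]
      change LinearMap.mul' K K (TensorProduct.map (eval Q a) (eval Q b)
        (Coalgebra.comul (R := K) (1 : H))) = _
      rw [Bialgebra.comul_one, Algebra.TensorProduct.one_def]
      rfl)
    (by
      refine ev₂_injective Q ?_
      funext u v
      rw [ev₂_comul, Algebra.TensorProduct.one_def, ev₂_tmul]
      exact mulDual_one Q u v)
    (fun {a b} => by
      refine ev₂_injective Q ?_
      funext u v
      have r := Coalgebra.Repr.arbitrary K u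
      have s := Coalgebra.Repr.arbitrary K v
      rw [ev₂_comul, ev₂_mul Q _ _ u v r s]
      refine (mulDual_mul Q a b u v r s).trans ?_
      simp only [ev₂_comul, mulDual_apply])

end RestrictedDual

end RestrictedDual

/-! ### The data of the one-parameter quantum group -/

/-- A Cartan matrix `(a_ij)` of finite type with its relatively prime symmetrizing integers `d_i`,
a lattice `L` between the root lattice `Q` and the weight lattice `P`, and a complex number `ħ` such
that `q = exp(-ħ/2)` is not a root of unity. Weights are written in the basis of fundamental
weights, so that `P = ℤⁿ` and `α_j` is the `j`-th column of the Cartan matrix. -/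
structure Datum (n : ℕ) where
  a : Matrix (Fin n) (Fin n) ℤ
  d : Fin n → ℕ
  a_diag : ∀ i, a i i = 2
  a_le : ∀ i j, i ≠ j → a i j ≤ 0
  d_pos : ∀ i, 0 < d i
  d_gcd : Finset.univ.gcd d = 1
  symm : ∀ i j, (d i : ℤ) * a i j = d j * a j i
  posDef : (Matrix.of fun i j => ((d i : ℝ) * (a i j : ℝ))).PosDef
  L : AddSubgroup (Fin n → ℤ)
  root_mem : ∀ j, (fun i => a i j) ∈ L
  ħ : ℂ
  not_root_of_unity : ∀ m : ℕ, 0 < m → Complex.exp (-ħ / 2) ^ m ≠ 1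

namespace Datum

variable {n : ℕ} (R : Datum n)

/-- The simple root `α_j`, as an element of `L`. -/
def α (j : Fin n) : R.L := ⟨fun i => R.a i j, R.root_mem j⟩

/-- The dominant weights `Λ ∈ L⁺ = L ∩ P⁺`. -/
def IsDominant (l : R.L) : Prop := ∀ i, 0 ≤ (l : Fin n → ℤ) i

/-- The Cartan matrix over `ℚ`. -/
def aℚ : Matrix (Fin n) (Fin n) ℚ := R.a.map (Int.cast : ℤ → ℚ)

/-- The bilinear form on `P` with `(ϖ_i, α_j) = δ_ij d_i`. -/
def form (l m : Fin n → ℤ) : ℚ :=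
  ∑ i, (l i : ℚ) * R.d i * (R.aℚ⁻¹.mulVec fun j => (m j : ℚ)) i

/-- `q^x = exp(-xħ/2)`. -/
def qpow (x : ℚ) : ℂ := Complex.exp (-(x : ℂ) * R.ħ / 2)

theorem qpow_zero : R.qpow 0 = 1 := by simp [qpow]
theorem qpow_add (x y : ℚ) : R.qpow (x + y) = R.qpow x * R.qpow y := by
  rw [qpow, qpow, qpow, ← Complex.exp_add]; congr 1; push_cast; ring
theorem qpow_ne_zero (x : ℚ) : R.qpow x ≠ 0 := Complex.exp_ne_zero _
theorem qpow_neg (x : ℚ) : R.qpow (-x) = (R.qpow x)⁻¹ := by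
  rw [qpow, qpow, ← Complex.exp_neg]; congr 1; push_cast; ring
theorem qpow_zpow (x : ℚ) (m : ℤ) : R.qpow x ^ m = R.qpow (x * m) := by
  rw [qpow, qpow, ← Complex.exp_int_mul]; congr 1; push_cast; ring
theorem qpow_natCast_ne_one {m : ℕ} (hm : 0 < m) : R.qpow m ≠ 1 := by
  have h := R.not_root_of_unity m hm
  rw [← Complex.exp_nat_mul] at h
  rw [qpow]
  convert h using 2
  push_cast; ring
theorem qpow_intCast_ne_one {m : ℤ} (hm : m ≠ 0) : R.qpow m ≠ 1 := by
  intro h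
  rcases Int.natAbs_eq m with e | e
  · refine R.qpow_natCast_ne_one (m := m.natAbs) (by omega) ?_
    rw [e] at h
    simpa using h
  · refine R.qpow_natCast_ne_one (m := m.natAbs) (by omega) ?_
    rw [e] at h
    push_cast at h
    rw [R.qpow_neg, inv_eq_one] at h
    simpa using h

theorem form_add_left (l l' m : Fin n → ℤ) : R.form (l + l') m = R.form l m + R.form l' m := by
  simp [form, add_mul, Finset.sum_add_distrib]
theorem form_zero_left (m : Fin n → ℤ) : R.form 0 m = 0 := by simp [form]
theorem form_neg_left (l m : Fin n → ℤ) : R.form (-l) m = -R.form l m := by simp [form]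
theorem form_add_right (l m m' : Fin n → ℤ) : R.form l (m + m') = R.form l m + R.form l m' := by
  have h : (fun j => ((m + m') j : ℚ)) = (fun j => (m j : ℚ)) + fun j => (m' j : ℚ) := by
    funext j; simp
  rw [form, h, Matrix.mulVec_add]
  simp only [form, Pi.add_apply, mul_add, Finset.sum_add_distrib]
theorem form_zero_right (l : Fin n → ℤ) : R.form l 0 = 0 := by
  have h := R.form_add_right l 0 0
  rw [add_zero] at h
  linarith
theorem form_neg_right (l m : Fin n → ℤ) : R.form l (-m) = -R.form l m := by
  have h := R.form_add_right l m (-m)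
  rw [add_neg_cancel, R.form_zero_right] at h
  linarith

theorem isUnit_det : IsUnit R.aℚ.det := by
  rw [isUnit_iff_ne_zero]
  intro h
  have hp := R.posDef.det_pos
  have e : (Matrix.of fun i j => ((R.d i : ℝ) * (R.a i j : ℝ))) =
      Matrix.diagonal (fun i => (R.d i : ℝ)) * R.aℚ.map (Rat.castHom ℝ) := by
    ext i j
    simp [Matrix.diagonal_mul, aℚ]
  rw [e, Matrix.det_mul, ← RingHom.mapMatrix_apply, ← RingHom.map_det, h, map_zero, mul_zero] at hp
  exact lt_irrefl _ hp

theorem aℚ_col (j : Fin n) : (fun i => ((R.α j : Fin n → ℤ) i : ℚ)) = R.aℚ.col j := rfl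

/-- `(λ, α_j) = d_j λ_j`. -/
theorem form_root_right (l : Fin n → ℤ) (j : Fin n) : R.form l (R.α j) = R.d j * l j := by
  have h : R.aℚ⁻¹.mulVec (fun i => ((R.α j : Fin n → ℤ) i : ℚ)) = Pi.single j 1 := by
    rw [R.aℚ_col, ← Matrix.mulVec_single_one, Matrix.mulVec_mulVec,
      Matrix.nonsing_inv_mul _ R.isUnit_det, Matrix.one_mulVec]
  rw [form, h, Finset.sum_eq_single j]
  · simp [mul_comm]
  · intro i _ hij; simp [hij]
  · simp

/-- `(α_i, μ) = d_i μ_i`. -/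
theorem form_root_left (i : Fin n) (m : Fin n → ℤ) : R.form (R.α i) m = R.d i * m i := by
  have e : ∀ k, ((R.α i : Fin n → ℤ) k : ℚ) * R.d k = R.d i * R.aℚ i k := by
    intro k
    have := R.symm k i
    have h : ((R.d k : ℤ) * R.a k i : ℚ) = R.d i * R.a i k := by exact_mod_cast this
    simp only [α, aℚ, Matrix.map_apply]
    rw [mul_comm]
    simpa using h
  have h2 := congrArg (fun M : Matrix (Fin n) (Fin n) ℚ => M.mulVec (fun j => (m j : ℚ)) i)
      (Matrix.mul_nonsing_inv _ R.isUnit_det)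
  simp only [← Matrix.mulVec_mulVec, Matrix.one_mulVec] at h2
  simp only [form, e, mul_assoc]
  rw [← Finset.mul_sum]
  congr 1

/-- `q^{(λ, μ)}` for `λ, μ ∈ L`. -/
def χ (l m : R.L) : ℂ := R.qpow (R.form l m)

theorem χ_ne_zero (l m : R.L) : R.χ l m ≠ 0 := R.qpow_ne_zero _
theorem χ_add_left (l l' m : R.L) : R.χ (l + l') m = R.χ l m * R.χ l' m := by
  rw [χ, AddSubgroup.coe_add, R.form_add_left, R.qpow_add]; rfl
theorem χ_add_right (l m m' : R.L) : R.χ l (m + m') = R.χ l m * R.χ l m' := by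
  rw [χ, AddSubgroup.coe_add, R.form_add_right, R.qpow_add]; rfl
theorem χ_zero_left (m : R.L) : R.χ 0 m = 1 := by
  rw [χ, AddSubgroup.coe_zero, R.form_zero_left, R.qpow_zero]
theorem χ_zero_right (l : R.L) : R.χ l 0 = 1 := by
  rw [χ, AddSubgroup.coe_zero, R.form_zero_right, R.qpow_zero]
theorem χ_neg_left (l m : R.L) : R.χ (-l) m = (R.χ l m)⁻¹ := by
  rw [χ, AddSubgroup.coe_neg, R.form_neg_left, R.qpow_neg]; rfl
theorem χ_neg_right (l m : R.L) : R.χ l (-m) = (R.χ l m)⁻¹ := by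
  rw [χ, AddSubgroup.coe_neg, R.form_neg_right, R.qpow_neg]; rfl
theorem χ_separates {m m' : R.L} (h : ∀ l, R.χ l m = R.χ l m') : m = m' := by
  rw [← sub_eq_zero]
  ext i
  by_contra hi
  have h1 : R.χ (R.α i) (m - m') = 1 := by
    rw [sub_eq_add_neg, R.χ_add_right, R.χ_neg_right, h, mul_inv_cancel₀ (R.χ_ne_zero _ _)]
  rw [χ, R.form_root_left] at h1
  refine R.qpow_intCast_ne_one (m := R.d i * ((m - m' : R.L) : Fin n → ℤ) i) ?_ ?_
  · refine mul_ne_zero ?_ ?_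
    · exact_mod_cast (R.d_pos i).ne'
    · simpa using hi
  · rw [← h1]; congr 1; push_cast; rfl
theorem χ_root (i j : Fin n) : R.χ (R.α i) (R.α j) = R.qpow (R.d i) ^ R.a i j := by
  rw [χ, R.form_root_left, R.qpow_zpow]; rfl

theorem qpow_d_pow_ne_one (i : Fin n) (m : ℕ) (hm : 0 < m) : R.qpow (R.d i) ^ m ≠ 1 := by
  have := R.qpow_natCast_ne_one (m := R.d i * m) (Nat.mul_pos (R.d_pos i) hm)
  rw [← zpow_natCast, R.qpow_zpow]
  simpa using this

theorem qpow_symm (i j : Fin n) : R.qpow (R.d i) ^ R.a i j = R.qpow (R.d j) ^ R.a j i := by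
  rw [R.qpow_zpow, R.qpow_zpow]
  congr 1
  exact_mod_cast R.symm i j

/-- The parameters of `U_q(𝔤)`: the torus part is `L`, `k_λ e_j = q^{(λ, α_j)} e_j k_λ` and
`e_i f_i - f_i e_i = (q_i - q_i⁻¹)⁻¹ (k_{α_i} - k_{α_i}⁻¹)`. -/
def paramU : QParam n where
  a := R.a
  t i := R.qpow (R.d i)
  Γ := R.L
  χ l j := R.χ l (R.α j)
  κ := R.α
  κ' := R.α
  a_diag := R.a_diag
  a_le := R.a_le
  t_ne_zero _ := R.qpow_ne_zero _
  t_pow_ne_one := R.qpow_d_pow_ne_one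
  t_symm := R.qpow_symm
  χ_zero j := R.χ_zero_left _
  χ_add g h j := R.χ_add_left g h _
  χ_κ := R.χ_root
  χ_κ' := R.χ_root

/-- The parameters of the double `D_q(𝔤)`: the torus part is `L × L`, with
`s_λ = k_{(λ,0)}`, `t_λ = k_{(0,λ)}`, both acting on `e_j` with weight `q^{(λ, α_j)}`, and
`e_i f_i - f_i e_i = (q_i - q_i⁻¹)⁻¹ (s_{α_i} - t_{α_i}⁻¹)`. -/
def paramD : QParam n where
  a := R.a
  t i := R.qpow (R.d i)
  Γ := R.L × R.L
  χ l j := R.χ l.1 (R.α j) * R.χ l.2 (R.α j)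
  κ i := (R.α i, 0)
  κ' i := (0, R.α i)
  a_diag := R.a_diag
  a_le := R.a_le
  t_ne_zero _ := R.qpow_ne_zero _
  t_pow_ne_one := R.qpow_d_pow_ne_one
  t_symm := R.qpow_symm
  χ_zero j := by rw [Prod.fst_zero, Prod.snd_zero, R.χ_zero_left, mul_one]
  χ_add g h j := by
    rw [Prod.fst_add, Prod.snd_add, R.χ_add_left, R.χ_add_left]; exact mul_mul_mul_comm _ _ _ _
  χ_κ _ _ := by rw [R.χ_zero_left, mul_one, R.χ_root]
  χ_κ' _ _ := by rw [R.χ_zero_left, one_mul, R.χ_root]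

/-- The Hopf algebra `U_q(𝔤)`. -/
abbrev U : Type := R.paramU.Alg

/-- The Hopf algebra `D_q(𝔤)`, the double of `U_q(𝔟⁺)` and `U_q(𝔟⁻)`. -/
abbrev D : Type := R.paramD.Alg

/-- The generator `k_λ` of `U_q(𝔤)`. -/
abbrev k (l : R.L) : R.U := R.paramU.k l

/-- The bigrading of `D_q(𝔤)`: `s_λ`, `t_λ`, `e_i`, `f_i` have degrees `(-λ, λ)`, `(λ, -λ)`,
`(-α_i, 0)`, `(0, α_i)`. -/
def degD : R.paramD.BiDegree R.L where
  θ := AddMonoidHom.fst R.L R.L - AddMonoidHom.snd R.L R.L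
  α := R.α
  θ_κ i := by
    change R.α i - 0 = R.α i
    rw [sub_zero]
  θ_κ' i := by
    change 0 - R.α i = -R.α i
    rw [zero_sub]

theorem isRep_π : R.paramD.IsRep (B := R.U) (fun l => R.paramU.k (l.1 + l.2 : R.L))
    R.paramU.e R.paramU.f where
  k_zero := by
    change R.paramU.k (0 + 0) = 1
    rw [add_zero, R.paramU.isRep.k_zero]
  k_add g h := (congrArg R.paramU.k (add_add_add_comm g.1 h.1 g.2 h.2)).trans
    (R.paramU.isRep.k_add (g.1 + g.2 : R.L) (h.1 + h.2 : R.L))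
  k_e g j := (R.paramU.isRep.k_e (g.1 + g.2 : R.L) j).trans
    (congrArg (fun r : ℂ => r • (R.paramU.e j * R.paramU.k (g.1 + g.2 : R.L)))
      (R.χ_add_left g.1 g.2 (R.α j)))
  k_f g j := (R.paramU.isRep.k_f (g.1 + g.2 : R.L) j).trans
    (congrArg (fun r : ℂ => r⁻¹ • (R.paramU.f j * R.paramU.k (g.1 + g.2 : R.L)))
      (R.χ_add_left g.1 g.2 (R.α j)))
  e_f i j := by
    rw [R.paramU.isRep.e_f]
    have h1 : R.paramU.k ((R.paramD.κ i).1 + (R.paramD.κ i).2 : R.L) =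
        R.paramU.k (R.paramU.κ i) := congrArg R.paramU.k (add_zero (R.α i))
    have h2 : R.paramU.k ((-R.paramD.κ' i).1 + (-R.paramD.κ' i).2 : R.L) =
        R.paramU.k (-R.paramU.κ' i) := by
      refine congrArg R.paramU.k ?_
      change -(0 : R.L) + -R.α i = -R.α i
      rw [neg_zero, zero_add]
    rw [h1, h2]
    rfl
  serre_e := R.paramU.isRep.serre_e
  serre_f := R.paramU.isRep.serre_f

/-- The projection `D_q(𝔤) → U_q(𝔤)`, `s_λ, t_λ ↦ k_λ`, `e_i ↦ e_i`, `f_i ↦ f_i`. -/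
def π : R.D →ₐ[ℂ] R.U := QParam.lift R.isRep_π

theorem π_k (g : R.L × R.L) : R.π (R.paramD.k g) = R.paramU.k (g.1 + g.2 : R.L) :=
  QParam.lift_k R.isRep_π g
theorem π_e (i : Fin n) : R.π (R.paramD.e i) = R.paramU.e i := QParam.lift_e R.isRep_π i
theorem π_f (i : Fin n) : R.π (R.paramD.f i) = R.paramU.f i := QParam.lift_f R.isRep_π i

end Datum

/-! ### Simultaneous eigenspaces -/

namespace Datum

variable {n : ℕ} (R : Datum n)

/-- The simultaneous eigenspace `{x | T_λ x = q^{(λ, μ)} x for all λ ∈ L}`. -/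
def eigen {V : Type*} [AddCommGroup V] [Module ℂ V] (T : R.L → Module.End ℂ V) (m : R.L) :
    Submodule ℂ V where
  carrier := {x | ∀ l, T l x = R.χ l m • x}
  zero_mem' := fun l => by simp
  add_mem' := fun {x y} hx hy l => by rw [map_add, hx l, hy l, smul_add]
  smul_mem' := fun r x hx l => by rw [map_smul, hx l, smul_comm]

theorem mem_eigen {V : Type*} [AddCommGroup V] [Module ℂ V] {T : R.L → Module.End ℂ V} {m : R.L}
    {x : V} : x ∈ R.eigen T m ↔ ∀ l, T l x = R.χ l m • x := Iff.rfl

theorem iSupIndep_eigen {V : Type*} [AddCommGroup V] [Module ℂ V] (T : R.L → Module.End ℂ V)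
    (hT : ∀ l l', Commute (T l) (T l')) : iSupIndep (R.eigen T) := by
  have h := Module.End.independent_iInf_maxGenEigenspace_of_forall_mapsTo T
    (fun i j φ => Module.End.mapsTo_maxGenEigenspace_of_comm (hT j i) φ)
  have hinj : Function.Injective fun (m l : R.L) => R.χ l m := fun m m' hm =>
    R.χ_separates fun l => congrFun hm l
  refine (h.comp hinj).mono fun m x hx => ?_
  simp only [Function.comp_apply, Submodule.mem_iInf]
  exact fun l => Module.End.mem_maxGenEigenspace _ _ _ |>.mpr ⟨1, by
    simp [hx l]⟩

/-- The two-sided version: `{x | T_λ x = q^{-(λ, μ)} x, T'_λ x = q^{(λ, μ')} x}`. -/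
def eigen₂ {V : Type*} [AddCommGroup V] [Module ℂ V] (T T' : R.L → Module.End ℂ V)
    (g : R.L × R.L) : Submodule ℂ V :=
  R.eigen T (-g.1) ⊓ R.eigen T' g.2

theorem iSupIndep_eigen₂ {V : Type*} [AddCommGroup V] [Module ℂ V] (T T' : R.L → Module.End ℂ V)
    (hT : ∀ l l', Commute (T l) (T l')) (hT' : ∀ l l', Commute (T' l) (T' l'))
    (hTT' : ∀ l l', Commute (T l) (T' l')) : iSupIndep (R.eigen₂ T T') := by
  have hc : ∀ i j : R.L ⊕ R.L, Commute (Sum.elim T T' i) (Sum.elim T T' j) := by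
    rintro (i | i) (j | j)
    exacts [hT i j, hTT' i j, (hTT' j i).symm, hT' i j]
  have h := Module.End.independent_iInf_maxGenEigenspace_of_forall_mapsTo (Sum.elim T T')
    (fun i j φ => Module.End.mapsTo_maxGenEigenspace_of_comm (hc j i) φ)
  have hinj : Function.Injective fun (g : R.L × R.L) =>
      Sum.elim (fun l => R.χ l (-g.1)) (fun l => R.χ l g.2) := fun g g' hg =>
    Prod.ext (neg_injective (R.χ_separates fun l => congrFun hg (Sum.inl l)))
      (R.χ_separates fun l => congrFun hg (Sum.inr l))
  refine (h.comp hinj).mono fun g x hx => ?_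
  simp only [Function.comp_apply, Submodule.mem_iInf]
  rintro (l | l)
  · exact Module.End.mem_maxGenEigenspace _ _ _ |>.mpr ⟨1, by
      have := R.mem_eigen.mp hx.1 l
      simp [this]⟩
  · exact Module.End.mem_maxGenEigenspace _ _ _ |>.mpr ⟨1, by
      have := R.mem_eigen.mp hx.2 l
      simp [this]⟩

/-! ### The category `𝒞_q` -/

/-- The weight space `M_μ = {x | k_λ x = q^{(λ, μ)} x for all λ ∈ L}`. -/
def wt (X : HRep ℂ R.U) (m : R.L) : Submodule ℂ X.V := R.eigen (fun l => X.ρ (R.k l)) m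

theorem mem_wt {X : HRep ℂ R.U} {m : R.L} {x : X.V} :
    x ∈ R.wt X m ↔ ∀ l, X.ρ (R.k l) x = R.χ l m • x := Iff.rfl

theorem iSupIndep_wt (X : HRep ℂ R.U) : iSupIndep (R.wt X) :=
  R.iSupIndep_eigen _ fun l l' => by
    rw [Commute, SemiconjBy, ← map_mul, ← map_mul, (R.paramU.k_commute l l').eq]

/-- The subspace `W` is a submodule. -/
def IsInvariant (X : HRep ℂ R.U) (W : Submodule ℂ X.V) : Prop :=
  ∀ (u : R.U), ∀ x ∈ W, X.ρ u x ∈ W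

/-- The subspace `W` is a simple submodule isomorphic to `L(Λ)`, i.e. with a highest weight vector
of weight `Λ`. -/
structure IsSimpleHW (X : HRep ℂ R.U) (W : Submodule ℂ X.V) (l : R.L) : Prop where
  invariant : R.IsInvariant X W
  simple : ∀ N ≤ W, R.IsInvariant X N → N = ⊥ ∨ N = W
  highest : ∃ v ∈ W, v ≠ 0 ∧ v ∈ R.wt X l ∧ ∀ i, X.ρ (R.paramU.e i) v = 0

/-- The category `𝒞_q` of finite dimensional `U_q(𝔤)`-modules that are finite direct sums of
modules `L(Λ)`, `Λ ∈ L⁺`. -/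
def Cq : ObjectProperty (HRep ℂ R.U) := fun X => Module.Finite ℂ X.V ∧
  ∃ (r : ℕ) (W : Fin r → Submodule ℂ X.V) (l : Fin r → R.L), DirectSum.IsInternal W ∧
    ∀ s, R.IsDominant (l s) ∧ R.IsSimpleHW X (W s) (l s)

theorem k_mem_wt {X : HRep ℂ R.U} {m : R.L} {x : X.V} (hx : x ∈ R.wt X m) (l : R.L) :
    X.ρ (R.k l) x ∈ R.wt X m := by
  rw [R.mem_wt.mp hx l]
  exact Submodule.smul_mem _ _ hx

theorem e_mem_wt {X : HRep ℂ R.U} {m : R.L} {x : X.V} (hx : x ∈ R.wt X m) (i : Fin n) :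
    X.ρ (R.paramU.e i) x ∈ R.wt X (m + R.α i) := by
  intro l
  have h := congrArg (fun u => X.ρ u x) (R.paramU.isRep.k_e l i)
  simp only [map_mul, map_smul, Module.End.mul_apply, LinearMap.smul_apply] at h
  refine h.trans ?_
  rw [R.mem_wt.mp hx l, map_smul, smul_smul, R.χ_add_right, mul_comm]
  rfl

theorem f_mem_wt {X : HRep ℂ R.U} {m : R.L} {x : X.V} (hx : x ∈ R.wt X m) (i : Fin n) :
    X.ρ (R.paramU.f i) x ∈ R.wt X (m - R.α i) := by
  intro l
  have h := congrArg (fun u => X.ρ u x) (R.paramU.isRep.k_f l i)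
  simp only [map_mul, map_smul, Module.End.mul_apply, LinearMap.smul_apply] at h
  refine h.trans ?_
  rw [R.mem_wt.mp hx l, map_smul, smul_smul, sub_eq_add_neg, R.χ_add_right, R.χ_neg_right, mul_comm]
  rfl

theorem isInvariant_iSup_wt (X : HRep ℂ R.U) : R.IsInvariant X (⨆ m, R.wt X m) := by
  intro u
  have h : ∀ u : R.U, (∀ m, ∀ x ∈ R.wt X m, X.ρ u x ∈ ⨆ m, R.wt X m) →
      ∀ x ∈ ⨆ m, R.wt X m, X.ρ u x ∈ ⨆ m, R.wt X m := by
    intro u hu x hx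
    have : (⨆ m, R.wt X m) ≤ (⨆ m, R.wt X m).comap (X.ρ u) := iSup_le hu
    exact this hx
  induction u using R.paramU.alg_induction with
  | hr r =>
    intro x hx
    rw [AlgHom.commutes]
    exact Submodule.smul_mem _ r hx
  | hk l => exact h _ fun m x hx => Submodule.mem_iSup_of_mem m (R.k_mem_wt hx l)
  | he i => exact h _ fun m x hx => Submodule.mem_iSup_of_mem _ (R.e_mem_wt hx i)
  | hf i => exact h _ fun m x hx => Submodule.mem_iSup_of_mem _ (R.f_mem_wt hx i)
  | hmul u v hu hv =>
    intro x hx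
    rw [map_mul]
    exact hu _ (hv x hx)
  | hadd u v hu hv =>
    intro x hx
    rw [map_add]
    exact add_mem (hu x hx) (hv x hx)

theorem Cq.iSup_wt {X : HRep ℂ R.U} (hX : R.Cq X) : ⨆ m, R.wt X m = ⊤ := by
  obtain ⟨_, r, W, l, hW, h⟩ := hX
  rw [eq_top_iff, ← hW.submodule_iSup_eq_top]
  refine iSup_le fun s => ?_
  obtain ⟨v, hv, hv0, hvl, _⟩ := (h s).2.highest
  have hinv : R.IsInvariant X (W s ⊓ ⨆ m, R.wt X m) := fun u x hx =>
    ⟨(h s).2.invariant u x hx.1, R.isInvariant_iSup_wt X u x hx.2⟩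
  rcases (h s).2.simple _ inf_le_left hinv with h0 | h0
  · exfalso
    have hm : v ∈ W s ⊓ ⨆ m, R.wt X m := ⟨hv, Submodule.mem_iSup_of_mem _ hvl⟩
    rw [h0] at hm
    exact hv0 (by simpa using hm)
  · exact inf_eq_left.mp h0

theorem Cq.isInternal_wt {X : HRep ℂ R.U} (hX : R.Cq X) : DirectSum.IsInternal (R.wt X) :=
  DirectSum.isInternal_submodule_of_iSupIndep_of_iSup_eq_top (R.iSupIndep_wt X) (Cq.iSup_wt R hX)

/-- The weight decomposition `M = ⨁ M_μ`. -/
@[reducible]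
def Cq.decomposition {X : HRep ℂ R.U} (hX : R.Cq X) : DirectSum.Decomposition (R.wt X) :=
  (Cq.isInternal_wt R hX).chooseDecomposition

/-- `u M_λ ⊆ M_{λ-γ-δ}` for `u ∈ D_q(𝔤)_{γ,δ}`. -/
theorem π_mem_wt (X : HRep ℂ R.U) {g : R.L × R.L} {u : R.D} (hu : u ∈ R.degD.grading g) :
    ∀ {m : R.L} {x : X.V}, x ∈ R.wt X m → X.ρ (R.π u) x ∈ R.wt X (m - g.1 - g.2) := by
  refine R.degD.grading_induction (C := fun g u => ∀ {m : R.L} {x : X.V}, x ∈ R.wt X m →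
    X.ρ (R.π u) x ∈ R.wt X (m - g.1 - g.2)) ?_ ?_ ?_ ?_ ?_ ?_ ?_ ?_ hu
  · intro g m x _
    rw [map_zero, map_zero]; exact zero_mem _
  · intro m x hx
    rw [map_one, map_one, Prod.fst_zero, Prod.snd_zero, sub_zero, sub_zero]; exact hx
  · intro g m x hx
    rw [show R.π (R.paramD.k g) = _ from R.π_k g]
    have e : m - -R.degD.θ g - R.degD.θ g = m := by abel
    dsimp only
    rw [e]
    exact R.k_mem_wt hx _
  · intro i m x hx
    rw [R.π_e]
    have e : m - -R.degD.α i - 0 = m + R.α i := by rw [sub_neg_eq_add, sub_zero]; rfl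
    dsimp only
    rw [e]
    exact R.e_mem_wt hx i
  · intro i m x hx
    rw [R.π_f]
    have e : m - 0 - R.degD.α i = m - R.α i := by rw [sub_zero]; rfl
    dsimp only
    rw [e]
    exact R.f_mem_wt hx i
  · intro g h u v hu hv m x hx
    rw [map_mul, map_mul]
    have := hu (hv hx)
    have e : m - h.1 - h.2 - g.1 - g.2 = m - (g + h).1 - (g + h).2 := by
      rw [Prod.fst_add, Prod.snd_add]; abel
    rw [e] at this
    exact this
  · intro g u v hu hv m x hx
    rw [map_add, map_add]
    exact add_mem (hu hx) (hv hx)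
  · intro g r u hu m x hx
    rw [map_smul, map_smul]
    exact Submodule.smul_mem _ r (hu hx)

end Datum

/-! ### Twisting modules -/

section TwistRep

variable {L K A V : Type*} [AddCommGroup L] [DecidableEq L] [Field K] [Ring A] [Algebra K A]
  [AddCommGroup V] [Module K V] (𝒜 : L × L → Submodule K A) [GradedAlgebra 𝒜]
  (ℬ : L → Submodule K V) [DirectSum.Decomposition ℬ] (ρ : A →ₐ[K] Module.End K V)
  (p : Bichar L K)

/-- The bilinear map `(u, x) ↦ p(λ, δ - γ) p(δ, γ) u x` for `u ∈ A_{γ,δ}`, `x ∈ V_λ`. -/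
def twistAct : A →ₗ[K] V →ₗ[K] V :=
  twistBilin 𝒜 ℬ ρ.toLinearMap fun g l => ((p l (g.2 - g.1) * p g.2 g.1 : Kˣ) : K)

theorem twistAct_apply {g : L × L} {l : L} {u : A} {x : V} (hu : u ∈ 𝒜 g) (hx : x ∈ ℬ l) :
    twistAct 𝒜 ℬ ρ p u x = ((p l (g.2 - g.1) * p g.2 g.1 : Kˣ) : K) • ρ u x :=
  twistBilin_apply 𝒜 ℬ _ _ hu hx

theorem twistAct_one (x : V) : twistAct 𝒜 ℬ ρ p 1 x = x := by
  induction x using DirectSum.Decomposition.inductionOn ℬ with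
  | zero => simp
  | add m m' h1 h2 => simp only [map_add, h1, h2]
  | homogeneous x =>
    rw [twistAct_apply 𝒜 ℬ ρ p SetLike.GradedOne.one_mem x.2]
    simp [p.zero_right]

theorem twist_cocycle (l γ δ γ' δ' : L) :
    (p⁻¹).tilde (γ, δ) (γ', δ') * (p l ((δ + δ') - (γ + γ')) * p (δ + δ') (γ + γ')) =
      p (l - γ' - δ') (δ - γ) * p δ γ * (p l (δ' - γ') * p δ' γ') := by
  simp only [Bichar.tilde, Bichar.inv_apply, p.add_left, p.add_right, p.sub_left, p.sub_right]
  rw [p.swap γ' δ, p.swap γ γ', p.swap δ' δ]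
  have h0 : ∀ u : Kˣ, (u : K) ≠ 0 := fun u => u.ne_zero
  refine Units.ext ?_
  push_cast
  have := h0 (p δ γ')
  have := h0 (p γ' γ)
  have := h0 (p δ δ')
  have := h0 (p δ' γ)
  have := h0 (p l γ)
  have := h0 (p l γ')
  field_simp

theorem twistAct_mul (h : ∀ g, ∀ u ∈ 𝒜 g, ∀ l, ∀ x ∈ ℬ l, ρ u x ∈ ℬ (l - g.1 - g.2)) (u v : A)
    (x : V) : twistAct 𝒜 ℬ ρ p (Twist.mulMap 𝒜 p⁻¹ u v) x =
      twistAct 𝒜 ℬ ρ p u (twistAct 𝒜 ℬ ρ p v x) := by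
  induction u using DirectSum.Decomposition.inductionOn 𝒜 with
  | zero => simp
  | add m m' h1 h2 => simp only [map_add, LinearMap.add_apply, h1, h2]
  | @homogeneous g u =>
  induction v using DirectSum.Decomposition.inductionOn 𝒜 with
  | zero => simp
  | add m m' h1 h2 => simp only [map_add, LinearMap.add_apply, h1, h2]
  | @homogeneous g' v =>
  induction x using DirectSum.Decomposition.inductionOn ℬ with
  | zero => simp
  | add m m' h1 h2 => simp only [map_add, h1, h2]
  | @homogeneous l x =>
  rw [Twist.mulMap_apply 𝒜 p⁻¹ u.2 v.2, map_smul, LinearMap.smul_apply,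
    twistAct_apply 𝒜 ℬ ρ p (SetLike.mul_mem_graded u.2 v.2) x.2, twistAct_apply 𝒜 ℬ ρ p v.2 x.2,
    map_smul, twistAct_apply 𝒜 ℬ ρ p u.2 (h _ _ v.2 _ _ x.2), smul_smul, smul_smul, map_mul,
    Module.End.mul_apply]
  congr 1
  have := congrArg (Units.val) (twist_cocycle p l g.1 g.2 g'.1 g'.2)
  push_cast at this ⊢
  rw [mul_comm ((p l _ : K) * _)]
  exact this

/-- The action of `A_{p⁻¹}` on a graded module `V`, with
`u · x = p(λ, δ - γ) p(δ, γ) u x` for `u ∈ A_{γ,δ}`, `x ∈ V_λ`. -/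
def twistRep (h : ∀ g, ∀ u ∈ 𝒜 g, ∀ l, ∀ x ∈ ℬ l, ρ u x ∈ ℬ (l - g.1 - g.2)) :
    Twist 𝒜 p⁻¹ →ₐ[K] Module.End K V :=
  AlgHom.ofLinearMap (twistAct 𝒜 ℬ ρ p ∘ₗ (Twist.of 𝒜 p⁻¹).symm.toLinearMap)
    (LinearMap.ext fun x => twistAct_one 𝒜 ℬ ρ p x)
    (fun u v => LinearMap.ext fun x => twistAct_mul 𝒜 ℬ ρ p h ((Twist.of 𝒜 p⁻¹).symm u)
      ((Twist.of 𝒜 p⁻¹).symm v) x)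

theorem twistRep_of (h : ∀ g, ∀ u ∈ 𝒜 g, ∀ l, ∀ x ∈ ℬ l, ρ u x ∈ ℬ (l - g.1 - g.2)) (u : A)
    (x : V) : twistRep 𝒜 ℬ ρ p h (Twist.of 𝒜 p⁻¹ u) x = twistAct 𝒜 ℬ ρ p u x := rfl

theorem twistAct_natural {W : Type*} [AddCommGroup W] [Module K W] (ℬ' : L → Submodule K W)
    [DirectSum.Decomposition ℬ'] (ρ' : A →ₐ[K] Module.End K W) (f : V →ₗ[K] W)
    (hf : ∀ u x, f (ρ u x) = ρ' u (f x)) (hℬ : ∀ l, ∀ x ∈ ℬ l, f x ∈ ℬ' l) (u : A) (x : V) :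
    f (twistAct 𝒜 ℬ ρ p u x) = twistAct 𝒜 ℬ' ρ' p u (f x) := by
  induction u using DirectSum.Decomposition.inductionOn 𝒜 with
  | zero => simp
  | add m m' h1 h2 => simp only [map_add, LinearMap.add_apply, h1, h2]
  | @homogeneous g u =>
  induction x using DirectSum.Decomposition.inductionOn ℬ with
  | zero => simp
  | add m m' h1 h2 => simp only [map_add, h1, h2]
  | @homogeneous l x =>
  rw [twistAct_apply 𝒜 ℬ ρ p u.2 x.2, twistAct_apply 𝒜 ℬ' ρ' p u.2 (hℬ l x x.2), map_smul, hf]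

end TwistRep

namespace Datum

variable {n : ℕ} (R : Datum n) (p : Bichar R.L ℂ)

/-- The Hopf algebra `D_{q,p⁻¹}(𝔤)`. -/
abbrev Dp : Type := Twist R.degD.grading p⁻¹

theorem ρπ_mem_wt (X : HRep ℂ R.U) : ∀ g, ∀ u ∈ R.degD.grading g, ∀ l, ∀ x ∈ R.wt X l,
    (X.ρ.comp R.π) u x ∈ R.wt X (l - g.1 - g.2) := fun _ _ hu _ _ hx => R.π_mem_wt X hu hx

/-- The module `M̆` over `D_{q,p⁻¹}(𝔤)`, for `M` in `𝒞_q`. -/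
def breveObj (X : HRep ℂ R.U) (hX : R.Cq X) : HRep ℂ (R.Dp p) where
  V := X.V
  ρ :=
    letI := Cq.decomposition R hX
    twistRep R.degD.grading (R.wt X) (X.ρ.comp R.π) p (R.ρπ_mem_wt X)

/-- The defining formula `u · x = p(λ, δ - γ) p(δ, γ) u x`. -/
theorem breveObj_apply {X : HRep ℂ R.U} (hX : R.Cq X) {g : R.L × R.L} {l : R.L} {u : R.D} {x : X.V}
    (hu : u ∈ R.degD.grading g) (hx : x ∈ R.wt X l) :
    (R.breveObj p X hX).ρ (Twist.of _ _ u) x =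
      ((p l (g.2 - g.1) * p g.2 g.1 : ℂˣ) : ℂ) • X.ρ (R.π u) x := by
  let _ := Cq.decomposition R hX
  exact twistAct_apply R.degD.grading (R.wt X) (X.ρ.comp R.π) p hu hx

theorem map_mem_wt {X Y : HRep ℂ R.U} (f : X ⟶ Y) {l : R.L} {x : X.V} (hx : x ∈ R.wt X l) :
    f.hom.hom x ∈ R.wt Y l := fun m => by
  rw [← f.comm, R.mem_wt.mp hx m, map_smul]

/-- The deformation functor `M ↦ M̆`, the identity on underlying linear maps. -/
def breve : (R.Cq).FullSubcategory ⥤ HRep ℂ (R.Dp p) where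
  obj X := R.breveObj p X.obj X.property
  map {X Y} f := ⟨f.hom.hom, fun u x =>
    let _ := Cq.decomposition R X.property
    let _ := Cq.decomposition R Y.property
    twistAct_natural R.degD.grading (R.wt X.obj) (X.obj.ρ.comp R.π) p (R.wt Y.obj)
      (Y.obj.ρ.comp R.π) f.hom.hom.hom (fun u x => f.hom.comm (R.π u) x)
      (fun _ _ hx => R.map_mem_wt f.hom hx) ((Twist.of R.degD.grading p⁻¹).symm u) x⟩
  map_id _ := rfl
  map_comp _ _ := rfl

/-- The category `𝒞_{q,p}` of the `D_{q,p⁻¹}(𝔤)`-modules (isomorphic to) `M̆`, for `M` in `𝒞_q`. -/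
abbrev Cqp : ObjectProperty (HRep ℂ (R.Dp p)) := (R.breve p).essImage

/-- The functor `M ↦ M̆` from `𝒞_q` to `𝒞_{q,p}`. -/
abbrev breveFunctor : (R.Cq).FullSubcategory ⥤ (R.Cqp p).FullSubcategory := (R.breve p).toEssImage

end Datum

theorem mul_mem_bigradedTensor {L K A : Type*} [AddCommGroup L] [DecidableEq L] [Field K] [Ring A]
    [Algebra K A] (𝒜 : L × L → Submodule K A) [SetLike.GradedMonoid 𝒜] {g h : L × L}
    {z w : A ⊗[K] A} (hz : z ∈ bigradedTensor 𝒜 g.1 g.2) (hw : w ∈ bigradedTensor 𝒜 h.1 h.2) :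
    z * w ∈ bigradedTensor 𝒜 (g + h).1 (g + h).2 := by
  unfold bigradedTensor at hz hw
  induction hz using Submodule.span_induction with
  | zero => rw [zero_mul]; exact zero_mem _
  | add x y _ _ h1 h2 => rw [add_mul]; exact add_mem h1 h2
  | smul r x _ h => rw [smul_mul_assoc]; exact Submodule.smul_mem _ _ h
  | mem z hz =>
  induction hw using Submodule.span_induction with
  | zero => rw [mul_zero]; exact zero_mem _
  | add x y _ _ h1 h2 => rw [mul_add]; exact add_mem h1 h2
  | smul r x _ h => rw [mul_smul_comm]; exact Submodule.smul_mem _ _ h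
  | mem z' hz' =>
  obtain ⟨n, x, hx, y, hy, rfl⟩ := hz
  obtain ⟨n', x', hx', y', hy', rfl⟩ := hz'
  rw [Algebra.TensorProduct.tmul_mul_tmul]
  refine Submodule.subset_span ⟨n + n', _, SetLike.mul_mem_graded hx hx', _, ?_, rfl⟩
  rw [neg_add]
  exact SetLike.mul_mem_graded hy hy'

namespace RestrictedDual

variable {K H : Type} [Field K] [Ring H] [Bialgebra K H] (Q : ObjectProperty (HRep K H))

/-- The left translation `c ↦ c(u ·)`. -/
def transL (u : H) : Module.End K (RestrictedDual Q) := evL Q _ u ∘ₗ Coalgebra.comul (R := K)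

/-- The right translation `c ↦ c(· u)`. -/
def transR (u : H) : Module.End K (RestrictedDual Q) :=
  (TensorProduct.rid K _).toLinearMap ∘ₗ ((eval Q).flip u).lTensor _ ∘ₗ Coalgebra.comul (R := K)

theorem eval_transL (u v : H) (c : RestrictedDual Q) :
    eval Q (transL Q u c) v = eval Q c (u * v) := eval_evL_comul Q c u v

theorem eval_transR (u v : H) (c : RestrictedDual Q) :
    eval Q (transR Q u c) v = eval Q c (v * u) := by
  rw [← ev₂_comul, transR]
  simp only [LinearMap.comp_apply, LinearEquiv.coe_coe]
  generalize Coalgebra.comul (R := K) c = z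
  induction z using TensorProduct.induction_on with
  | zero => simp
  | add x y hx hy => simp only [map_add, LinearMap.add_apply, Pi.add_apply, hx, hy]
  | tmul a b => simp [ev₂_tmul, mul_comm]

end RestrictedDual

namespace Datum

variable {n : ℕ} (R : Datum n)

theorem Cq.finite {X : HRep ℂ R.U} (hX : R.Cq X) : Module.Finite ℂ X.V := hX.1

theorem comul_k (l : R.L) : Coalgebra.comul (R := ℂ) (R.k l) = R.k l ⊗ₜ[ℂ] R.k l :=
  R.paramU.comul_k l
theorem counit_k (l : R.L) : Coalgebra.counit (R := ℂ) (R.k l) = 1 := R.paramU.counit_k l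

/-- The quantized function algebra `ℂ_q[G]`, the restricted dual of `𝒞_q`. -/
abbrev Cfun : Type := RestrictedDual R.Cq

/-- The homogeneous component `ℂ_q[G]_{λ,μ}`, consisting of the `c` with
`c(k_ν u) = q^{-(ν, λ)} c(u)` and `c(u k_ν) = q^{(ν, μ)} c(u)`. It is spanned by the coordinate
functions `c_{f,v}` with `f ∈ M^*_λ` and `v ∈ M_μ`. -/
def gradC (g : R.L × R.L) : Submodule ℂ R.Cfun :=
  R.eigen₂ (fun l => RestrictedDual.transL R.Cq (R.k l))
    (fun l => RestrictedDual.transR R.Cq (R.k l)) g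

theorem mem_gradC {g : R.L × R.L} {c : R.Cfun} : c ∈ R.gradC g ↔
    (∀ l u, RestrictedDual.eval R.Cq c (R.k l * u) =
      R.χ l (-g.1) * RestrictedDual.eval R.Cq c u) ∧
    (∀ l u, RestrictedDual.eval R.Cq c (u * R.k l) =
      R.χ l g.2 * RestrictedDual.eval R.Cq c u) := by
  constructor
  · rintro ⟨h1, h2⟩
    constructor
    · intro l u
      rw [← RestrictedDual.eval_transL, R.mem_eigen.mp h1 l, map_smul]; rfl
    · intro l u
      rw [← RestrictedDual.eval_transR, R.mem_eigen.mp h2 l, map_smul]; rfl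
  · rintro ⟨h1, h2⟩
    constructor
    · intro l
      refine RestrictedDual.eval_ext _ fun u => ?_
      rw [RestrictedDual.eval_transL, h1, map_smul]; rfl
    · intro l
      refine RestrictedDual.eval_ext _ fun u => ?_
      rw [RestrictedDual.eval_transR, h2, map_smul]; rfl

theorem iSupIndep_gradC : iSupIndep R.gradC := by
  refine R.iSupIndep_eigen₂ _ _ ?_ ?_ ?_ <;>
  · intro l l'
    refine LinearMap.ext fun c => RestrictedDual.eval_ext _ fun u => ?_
    simp only [Module.End.mul_apply, RestrictedDual.eval_transL, RestrictedDual.eval_transR]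
    first
      | rw [← mul_assoc, ← mul_assoc, (R.paramU.k_commute l l').eq]
      | rw [mul_assoc, mul_assoc, (R.paramU.k_commute l l').eq]
      | rw [mul_assoc]

instance : SetLike.GradedMonoid R.gradC where
  one_mem := by
    rw [mem_gradC]
    constructor
    · intro l u
      rw [RestrictedDual.eval_one, RestrictedDual.eval_one, Bialgebra.counit_mul,
        R.counit_k, Prod.fst_zero, neg_zero, R.χ_zero_right]
    · intro l u
      rw [RestrictedDual.eval_one, RestrictedDual.eval_one, Bialgebra.counit_mul,
        R.counit_k, Prod.snd_zero, R.χ_zero_right, mul_comm]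
  mul_mem g h c c' hc hc' := by
    rw [mem_gradC] at *
    have e' : ∀ (x : R.U), RestrictedDual.eval R.Cq (c * c') x = LinearMap.mul' ℂ ℂ
      (TensorProduct.map (RestrictedDual.eval R.Cq c) (RestrictedDual.eval R.Cq c')
        (Coalgebra.comul (R := ℂ) x)) := fun x => rfl
    have key : ∀ (l : R.L) (w : R.U ⊗[ℂ] R.U),
        LinearMap.mul' ℂ ℂ (TensorProduct.map (RestrictedDual.eval R.Cq c)
          (RestrictedDual.eval R.Cq c') (R.k l ⊗ₜ R.k l * w)) =
          R.χ l (-(g + h).1) * LinearMap.mul' ℂ ℂ (TensorProduct.map (RestrictedDual.eval R.Cq c)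
          (RestrictedDual.eval R.Cq c') w) ∧
        LinearMap.mul' ℂ ℂ (TensorProduct.map (RestrictedDual.eval R.Cq c)
          (RestrictedDual.eval R.Cq c') (w * R.k l ⊗ₜ R.k l)) =
          R.χ l (g + h).2 * LinearMap.mul' ℂ ℂ (TensorProduct.map (RestrictedDual.eval R.Cq c)
          (RestrictedDual.eval R.Cq c') w) := by
      intro l w
      induction w using TensorProduct.induction_on with
      | zero => simp
      | add x y hx hy =>
        simp only [mul_add, add_mul, map_add, hx.1, hy.1, hx.2, hy.2, and_self]
      | tmul x y =>
        simp only [Algebra.TensorProduct.tmul_mul_tmul, TensorProduct.map_tmul,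
          LinearMap.mul'_apply, hc.1, hc.2, hc'.1, hc'.2, Prod.fst_add, Prod.snd_add, neg_add,
          R.χ_add_right]
        constructor <;> ring
    constructor
    · intro l u
      rw [e', e', Bialgebra.comul_mul, R.comul_k, (key l _).1]
    · intro l u
      rw [e', e', Bialgebra.comul_mul, R.comul_k, (key l _).2]

/-- Auxiliary: the homogeneous elements with homogeneous comultiplication. -/
def gradC' (g : R.L × R.L) : Submodule ℂ R.Cfun :=
  R.gradC g ⊓ (bigradedTensor R.gradC g.1 g.2).comap (Coalgebra.comul (R := ℂ))

theorem coord_mem_gradC {X : HRep ℂ R.U} (hX : R.Cq X) {g : R.L × R.L} {f : Module.Dual ℂ X.V}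
    {v : X.V} (hf : ∀ l x, f (X.ρ (R.k l) x) = R.χ l (-g.1) * f x) (hv : v ∈ R.wt X g.2) :
    RestrictedDual.coord hX (Cq.finite R hX) f v ∈ R.gradC g := by
  rw [mem_gradC]
  constructor
  · intro l u
    rw [RestrictedDual.eval_coord, RestrictedDual.eval_coord, map_mul, Module.End.mul_apply, hf]
  · intro l u
    rw [RestrictedDual.eval_coord, RestrictedDual.eval_coord, map_mul, Module.End.mul_apply,
      R.mem_wt.mp hv l, map_smul, map_smul, smul_eq_mul]

theorem comul_coord {X : HRep ℂ R.U} (hX : R.Cq X) {ι : Type*} [Fintype ι]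
    (b : Module.Basis ι ℂ X.V) (f : Module.Dual ℂ X.V) (v : X.V) :
    Coalgebra.comul (R := ℂ) (RestrictedDual.coord hX (Cq.finite R hX) f v) =
      ∑ i, RestrictedDual.coord hX (Cq.finite R hX) f (b i) ⊗ₜ[ℂ] RestrictedDual.coord hX (Cq.finite R hX) (b.coord i) v := by
  refine RestrictedDual.ev₂_injective R.Cq ?_
  funext u w
  rw [RestrictedDual.ev₂_comul, map_sum, Finset.sum_apply, Finset.sum_apply]
  simp only [RestrictedDual.ev₂_tmul, RestrictedDual.eval_coord]
  rw [map_mul, Module.End.mul_apply]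
  conv_lhs => rw [← b.sum_repr (X.ρ w v)]
  simp only [map_sum, map_smul, smul_eq_mul]
  exact Finset.sum_congr rfl fun i _ => mul_comm _ _

theorem iSup_gradC' : ⨆ g, R.gradC' g = ⊤ := by
  rw [eq_top_iff]
  rintro c -
  induction c using RestrictedDual.induction with
  | hr r =>
    rw [Algebra.algebraMap_eq_smul_one]
    refine Submodule.smul_mem _ _ (Submodule.mem_iSup_of_mem 0 ⟨SetLike.GradedOne.one_mem, ?_⟩)
    change Coalgebra.comul (R := ℂ) (1 : R.Cfun) ∈ bigradedTensor R.gradC 0 0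
    rw [Bialgebra.comul_one, Algebra.TensorProduct.one_def]
    refine Submodule.subset_span ⟨0, _, SetLike.GradedOne.one_mem, _, ?_, rfl⟩
    rw [neg_zero]
    exact SetLike.GradedOne.one_mem
  | hadd x y hx hy => exact add_mem hx hy
  | hmul x y hx hy =>
    induction hx using Submodule.iSup_induction' with
    | zero => rw [zero_mul]; exact zero_mem _
    | add x x' _ _ h1 h2 => rw [add_mul]; exact add_mem h1 h2
    | mem g x hx =>
    induction hy using Submodule.iSup_induction' with
    | zero => rw [mul_zero]; exact zero_mem _
    | add x x' _ _ h1 h2 => rw [mul_add]; exact add_mem h1 h2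
    | mem h y hy =>
    refine Submodule.mem_iSup_of_mem (g + h) ⟨SetLike.mul_mem_graded hx.1 hy.1, ?_⟩
    change Coalgebra.comul (R := ℂ) (x * y) ∈ bigradedTensor R.gradC (g + h).1 (g + h).2
    rw [Bialgebra.comul_mul]
    exact mul_mem_bigradedTensor R.gradC hx.2 hy.2
  | hc X hX hfin f v =>
    classical
    have hint := Cq.isInternal_wt R hX
    let b := hint.collectedBasis fun m => Module.Basis.ofVectorSpace ℂ (R.wt X m)
    have hb : ∀ i, b i ∈ R.wt X i.1 := hint.collectedBasis_mem _
    have : Fintype (Σ m, Module.Basis.ofVectorSpaceIndex ℂ (R.wt X m)) :=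
      @Fintype.ofFinite _ (Module.Finite.finite_basis b)
    have hco : ∀ i l x, b.coord i (X.ρ (R.k l) x) = R.χ l i.1 * b.coord i x := by
      intro i l x
      have : b.coord i ∘ₗ X.ρ (R.k l) = R.χ l i.1 • b.coord i := by
        refine b.ext fun j => ?_
        rw [LinearMap.comp_apply, R.mem_wt.mp (hb j) l, map_smul, LinearMap.smul_apply]
        by_cases hij : j = i
        · rw [hij]
        · simp [hij]
      exact LinearMap.congr_fun this x
    have hpiece : ∀ i j, RestrictedDual.coord hX (Cq.finite R hX) (b.coord i) (b j) ∈ ⨆ g, R.gradC' g := by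
      intro i j
      refine Submodule.mem_iSup_of_mem (-i.1, j.1) ⟨?_, ?_⟩
      · refine R.coord_mem_gradC hX (fun l x => ?_) (hb j)
        rw [neg_neg]; exact hco i l x
      · change Coalgebra.comul (R := ℂ) (RestrictedDual.coord hX (Cq.finite R hX) (b.coord i) (b j)) ∈
          bigradedTensor R.gradC (-i.1) j.1
        rw [R.comul_coord hX b]
        refine sum_mem fun s _ => Submodule.subset_span ⟨s.1, _, ?_, _, ?_, rfl⟩
        · refine R.coord_mem_gradC hX (fun l x => ?_) (hb s)
          rw [neg_neg]; exact hco i l x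
        · refine R.coord_mem_gradC hX (fun l x => ?_) (hb j)
          rw [neg_neg]; exact hco s l x
    have hsum : RestrictedDual.coord hX hfin f v = ∑ i, ∑ j, (f (b i) * b.coord j v) •
        RestrictedDual.coord hX (Cq.finite R hX) (b.coord i) (b j) := by
      refine RestrictedDual.eval_ext _ fun u => ?_
      simp only [map_sum, map_smul, LinearMap.sum_apply, LinearMap.smul_apply,
        RestrictedDual.eval_coord]
      conv_lhs => rw [← b.sum_repr v]
      simp only [map_sum, map_smul]
      rw [Finset.sum_comm]
      refine Finset.sum_congr rfl fun j _ => ?_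
      conv_lhs => rw [← b.sum_repr (X.ρ u (b j))]
      simp only [map_sum, map_smul, smul_eq_mul, Finset.mul_sum, Module.Basis.coord_apply]
      refine Finset.sum_congr rfl fun i _ => ?_
      ring
    rw [hsum]
    exact sum_mem fun i _ => sum_mem fun j _ => Submodule.smul_mem _ _ (hpiece i j)

theorem isInternal_gradC : DirectSum.IsInternal R.gradC :=
  DirectSum.isInternal_submodule_of_iSupIndep_of_iSup_eq_top R.iSupIndep_gradC
    (top_le_iff.mp (R.iSup_gradC'.symm.le.trans (iSup_mono fun _ => inf_le_left)))

instance : DirectSum.Decomposition R.gradC := R.isInternal_gradC.chooseDecomposition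

instance : GradedAlgebra R.gradC where

theorem gradC_le (g : R.L × R.L) : R.gradC g ≤ R.gradC' g := by
  have key : ∀ c ∈ ⨆ g, R.gradC' g, ((DirectSum.decompose R.gradC c g : R.gradC g) : R.Cfun) ∈
      R.gradC' g := by
    intro c hc
    induction hc using Submodule.iSup_induction' with
    | zero => rw [DirectSum.decompose_zero]; exact zero_mem _
    | add x y _ _ h1 h2 =>
      rw [DirectSum.decompose_add, DirectSum.add_apply, Submodule.coe_add]; exact add_mem h1 h2
    | mem h x hx =>
      by_cases e : h = g
      · subst e
        rw [DirectSum.decompose_of_mem_same R.gradC hx.1]; exact hx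
      · rw [DirectSum.decompose_of_mem_ne R.gradC hx.1 e]; exact zero_mem _
  intro c hc
  have := key c (by rw [R.iSup_gradC']; trivial)
  rwa [DirectSum.decompose_of_mem_same R.gradC hc] at this

instance : IsBigraded R.gradC where
  comul_mem l m _ ha := (R.gradC_le (l, m) ha).2
  counit_eq_zero l m c hc hlm := by
    rw [mem_gradC] at hc
    rw [RestrictedDual.counit_apply]
    by_contra h0
    refine hlm (neg_injective (R.χ_separates fun s => ?_))
    have h1 := hc.1 s 1
    have h2 := hc.2 s 1
    rw [mul_one] at h1
    rw [one_mul, h1] at h2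
    rw [neg_neg]
    exact mul_right_cancel₀ h0 h2

variable (p : Bichar R.L ℂ)

/-- The multiparameter quantized function algebra `ℂ_{q,p}[G]`. -/
abbrev Cpfun : Type := Twist R.gradC p

/-- The pairing `⟨a, u⟩ = a(π u)` of `ℂ_q[G]` and `D_q(𝔤)`. -/
def pairing : R.Cfun →ₗ[ℂ] R.D →ₗ[ℂ] ℂ :=
  (LinearMap.lcomp ℂ ℂ R.π.toLinearMap) ∘ₗ RestrictedDual.eval R.Cq

theorem pairing_apply (a : R.Cfun) (u : R.D) :
    R.pairing a u = RestrictedDual.eval R.Cq a (R.π u) := rfl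

/-- The pairing `⟨a, u⟩_p = p(λ, γ) p(μ, δ) ⟨a, u⟩` of `ℂ_{q,p}[G]` and `D_{q,p⁻¹}(𝔤)`, for
`a ∈ ℂ_{q,p}[G]_{λ,μ}` and `u ∈ D_{q,p⁻¹}(𝔤)_{γ,δ}`. -/
def pairingP : R.Cpfun p →ₗ[ℂ] R.Dp p →ₗ[ℂ] ℂ :=
  (twistBilin R.gradC R.degD.grading R.pairing
    fun g h => ((p g.1 h.1 * p g.2 h.2 : ℂˣ) : ℂ)).compl₁₂
      (Twist.of R.gradC p).symm.toLinearMap (Twist.of R.degD.grading p⁻¹).symm.toLinearMap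

theorem pairingP_of {g h : R.L × R.L} {a : R.Cfun} {u : R.D} (ha : a ∈ R.gradC g)
    (hu : u ∈ R.degD.grading h) : R.pairingP p (Twist.of _ _ a) (Twist.of _ _ u) =
      ((p g.1 h.1 * p g.2 h.2 : ℂˣ) : ℂ) * R.pairing a u :=
  twistBilin_apply R.gradC R.degD.grading R.pairing _ ha hu

end Datum

/-- The linear map `S` is an antipode of the bialgebra `A`, i.e. a convolution inverse of the
identity. -/
structure IsAntipode {K A : Type*} [Field K] [Ring A] [Bialgebra K A] (S : A →ₗ[K] A) : Prop where
  left : LinearMap.mul' K A ∘ₗ S.rTensor A ∘ₗ Coalgebra.comul =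
    Algebra.linearMap K A ∘ₗ Coalgebra.counit
  right : LinearMap.mul' K A ∘ₗ S.lTensor A ∘ₗ Coalgebra.comul =
    Algebra.linearMap K A ∘ₗ Coalgebra.counit

end QG

end

/-! The twist by `p` only inserts scalars depending on degrees, so everything comparing twisted with
untwisted objects reduces to identities between values of a bicharacter. The real content is that
`Cq`, defined as finite direct sums of simple highest weight modules, is closed under tensor
products. This needs a form of complete reducibility, proved here with a quantum Casimir operator.

Complete reducibility. The vector space on words in the simple roots carries the quantum shuffle
form `pair`, for which prepending or appending a letter is adjoint to a skew derivation. Its radical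
is a two-sided ideal stable under both derivations, and a coideal for a twisted coproduct. On a
simple module `W` of `Cq` the radical, evaluated in the `e_i`, acts by zero. Indeed its image spans
a submodule, because commutators with `f_i` are governed by the derivations, and this submodule lies
in `∑ e_i W`, which cannot be all of a nonzero `W` since long words act by zero. The same holds on
the side of the `f_i`. So modules in `Cq` satisfy `IsRadicalFree`, a property inherited by tensor
products because the radical is a coideal. No comparison of the radical with the quantum Serre ideal
is needed.

Conversely, a finite dimensional, radical-free sum of weight spaces lies in `Cq`
(`Cq.of_isRadicalFree`). The form is nondegenerate modulo its radical, so there is a canonical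
element in words tensor endomorphisms (`exists_canonical`), and contracting it gives a Casimir
operator. On `f_w v`, with `v` singular of weight `l` and `f_w v` of weight `m`, it acts by `q` to
the power `(l+ρ, l+ρ) - (m+ρ, m+ρ)`. For dominant `l`, `m` and nonempty `w` this exponent is
positive, so the scalar differs from `1`. Hence a singular vector generates a simple submodule and
these submodules span the module. Duals are handled by annihilators of submodules, and rigidity
follows because the antipode is bijective.

The twisted category. The map `x ⊗ y ↦ p(μ, λ) x ⊗ y` on weight vectors intertwines the two actions
of the twisted double (`tensorTwist_comm`) and is coherent since `p` is multiplicative in each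
entry. The elements `s_λ t_λ` have degree `(0, 0)`, so they act on the twisted module exactly as
`k_{2λ}`. They therefore detect weights, morphisms of twisted modules preserve weights, the scalars
cancel, and the functor is fully faithful. Passing to the essential image gives a monoidal
equivalence, along which rigidity is transported.

The function algebra. The untwisted pairing vanishes unless `λ + μ = γ + δ`. Under this constraint
the scalar of the twisted pairing equals that of the twisted action (`pairingP_coord`), and the
twisted product is dual to the coproduct (`pairingP_map`). Coordinate functions span both algebras
because the categories are monoidal, which gives surjectivity; injectivity again comes from
separating degrees by `s_λ t_λ`. -/

open scoped TensorProduct DirectSum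

noncomputable section

namespace QG

/-! ### The quantum shuffle form on words -/

namespace Words

variable {K ι : Type*} [Field K] [DecidableEq ι] (d : ι → K) (c : ι → ι → K)

/-- The linear map prepending the letter `i` to every word. -/
def cons (i : ι) : (List ι →₀ K) →ₗ[K] (List ι →₀ K) := Finsupp.lmapDomain K K (List.cons i)

/-- The linear map appending the letter `i` to every word. -/
def snoc (i : ι) : (List ι →₀ K) →ₗ[K] (List ι →₀ K) :=
  Finsupp.lmapDomain K K fun w => w ++ [i]

/-- The scalar `∏_l d(w_l)`. -/
def weight (w : List ι) : K := (w.map d).prod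

/-- The rescaling `w ↦ (∏_l d(w_l)) w`. -/
def scale : (List ι →₀ K) →ₗ[K] (List ι →₀ K) :=
  Finsupp.linearCombination K fun w => Finsupp.single w (weight d w)

/-- The left skew derivation on words. -/
def derivLWord (i : ι) : List ι → (List ι →₀ K)
  | [] => 0
  | j :: w => (if i = j then Finsupp.single w 1 else 0) + c i j • cons j (derivLWord i w)

/-- The right skew derivation on words. -/
def derivRWord (i : ι) : List ι → (List ι →₀ K)
  | [] => 0
  | j :: w => (if i = j then Finsupp.single w (weight (c i) w) else 0) + cons j (derivRWord i w)

/-- The left skew derivation `∂_i`. -/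
def derivL (i : ι) : (List ι →₀ K) →ₗ[K] (List ι →₀ K) :=
  Finsupp.linearCombination K (derivLWord c i)

/-- The right skew derivation `∂'_i`. -/
def derivR (i : ι) : (List ι →₀ K) →ₗ[K] (List ι →₀ K) :=
  Finsupp.linearCombination K (derivRWord c i)

/-- The form with a word in the first entry. -/
def pairWord : List ι → (List ι →₀ K) →ₗ[K] K
  | [] => Finsupp.lapply []
  | i :: w => pairWord w ∘ₗ derivL c i

/-- The quantum shuffle form. -/
def pair : (List ι →₀ K) →ₗ[K] (List ι →₀ K) →ₗ[K] K := Finsupp.linearCombination K (pairWord c)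

omit [DecidableEq ι] in
theorem cons_single (i : ι) (w : List ι) (r : K) :
    cons i (Finsupp.single w r) = Finsupp.single (i :: w) r := by
  simp [cons]
omit [DecidableEq ι] in
theorem snoc_single (i : ι) (w : List ι) (r : K) :
    snoc i (Finsupp.single w r) = Finsupp.single (w ++ [i]) r := by
  simp [snoc]
omit [DecidableEq ι] in
theorem scale_single (w : List ι) (r : K) :
    scale d (Finsupp.single w r) = Finsupp.single w (r * weight d w) := by
  simp [scale]
omit [DecidableEq ι] in
theorem weight_cons (j : ι) (w : List ι) : weight d (j :: w) = d j * weight d w := by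
  simp [weight]

theorem derivL_word (i : ι) (w : List ι) :
    derivL c i (Finsupp.single w 1) = derivLWord c i w := by simp [derivL]
theorem derivR_word (i : ι) (w : List ι) :
    derivR c i (Finsupp.single w 1) = derivRWord c i w := by simp [derivR]
theorem pair_word (w : List ι) : pair c (Finsupp.single w 1) = pairWord c w := by simp [pair]

omit [DecidableEq ι] in
/-- Linear maps on words agree if they agree on words. -/
theorem lhom_ext {M : Type*} [AddCommGroup M] [Module K M] {f g : (List ι →₀ K) →ₗ[K] M}
    (h : ∀ w, f (Finsupp.single w 1) = g (Finsupp.single w 1)) : f = g :=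
  Finsupp.lhom_ext' fun w => LinearMap.ext_ring (h w)

omit [DecidableEq ι] in
theorem scale_cons (j : ι) (x : List ι →₀ K) :
    scale d (cons j x) = d j • cons j (scale d x) := by
  have : scale d ∘ₗ cons j = d j • (cons j ∘ₗ scale d) := by
    refine lhom_ext fun w => ?_
    simp [cons_single, scale_single, weight_cons]
  exact LinearMap.congr_fun this x

theorem derivL_cons (i j : ι) (x : List ι →₀ K) : derivL c i (cons j x) =
    (if i = j then x else 0) + c i j • cons j (derivL c i x) := by
  have : derivL c i ∘ₗ cons j =
      (if i = j then LinearMap.id else 0) + c i j • (cons j ∘ₗ derivL c i) := by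
    refine lhom_ext fun w => ?_
    simp only [LinearMap.comp_apply, LinearMap.add_apply, LinearMap.smul_apply, cons_single,
      derivL_word, derivLWord]
    split_ifs <;> simp
  refine (LinearMap.congr_fun this x).trans ?_
  split_ifs <;> simp

theorem derivR_cons (i j : ι) (x : List ι →₀ K) : derivR c i (cons j x) =
    (if i = j then scale (c i) x else 0) + cons j (derivR c i x) := by
  have : derivR c i ∘ₗ cons j =
      (if i = j then scale (c i) else 0) + cons j ∘ₗ derivR c i := by
    refine lhom_ext fun w => ?_
    simp only [LinearMap.comp_apply, LinearMap.add_apply, cons_single,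
      derivR_word, derivRWord]
    split_ifs <;> simp [scale_single]
  refine (LinearMap.congr_fun this x).trans ?_
  split_ifs <;> simp

theorem pair_cons_left (i : ι) (x y : List ι →₀ K) :
    pair c (cons i x) y = pair c x (derivL c i y) := by
  have : (pair c) ∘ₗ cons i = LinearMap.lcomp K K (derivL c i) ∘ₗ pair c := by
    refine lhom_ext fun w => ?_
    rw [LinearMap.comp_apply, LinearMap.comp_apply, cons_single, pair_word, pair_word]
    rfl
  exact LinearMap.congr_fun (LinearMap.congr_fun this x) y

/-- The definition provides the adjunction in the first entry only. By induction on the first word,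
both sides split into a Kronecker term and a term in which the letters `i` and `j` pass each other;
the latter agree because `c` is symmetric. -/
theorem pair_cons_right (j : ι) (hc : ∀ i j, c i j = c j i) (x y : List ι →₀ K) :
    pair c x (cons j y) = pair c (derivL c j x) y := by
  have : LinearMap.lcomp K K (cons j) ∘ₗ pair c = pair c ∘ₗ derivL c j := by
    refine lhom_ext fun w => LinearMap.ext fun y => ?_
    simp only [LinearMap.comp_apply, LinearMap.lcomp_apply]
    induction w generalizing y with
    | nil =>
      rw [pair_word, derivL_word]
      simp only [derivLWord, map_zero, LinearMap.zero_apply, pairWord, Finsupp.lapply_apply]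
      exact Finsupp.mapDomain_of_notMem_range _ _ (by simp)
    | cons i w ih =>
      rw [← cons_single, pair_cons_left, derivL_cons, derivL_cons, hc j i]
      simp only [LinearMap.add_apply, map_add, LinearMap.smul_apply, map_smul, ih, pair_cons_left]
      congr 1
      by_cases h : i = j
      · simp [h]
      · simp [h, Ne.symm h]
  exact LinearMap.congr_fun (LinearMap.congr_fun this x) y

theorem pair_symm (hc : ∀ i j, c i j = c j i) (x y : List ι →₀ K) : pair c x y = pair c y x := by
  have : pair c = (pair c).flip := by
    refine lhom_ext fun w => LinearMap.ext fun y => ?_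
    rw [LinearMap.flip_apply]
    induction w generalizing y with
    | nil =>
      have : pair c (Finsupp.single [] 1) = (pair c).flip (Finsupp.single [] 1) := by
        refine lhom_ext fun w => ?_
        rw [LinearMap.flip_apply]
        cases w with
        | nil => rfl
        | cons i w =>
          rw [← cons_single, pair_cons_right c i hc, pair_cons_left]
          simp [derivL_word, derivLWord]
      exact LinearMap.congr_fun this y
    | cons i w ih => rw [← cons_single, pair_cons_left, pair_cons_right c i hc, ih]
  exact LinearMap.congr_fun (LinearMap.congr_fun this x) y

theorem derivL_scale (j : ι) (x : List ι →₀ K) :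
    derivL c j (scale d x) = d j • scale d (derivL c j x) := by
  have hd : derivL c j ∘ₗ scale d = d j • (scale d ∘ₗ derivL c j) := by
    refine lhom_ext fun w => ?_
    simp only [LinearMap.comp_apply, LinearMap.smul_apply]
    induction w with
    | nil => simp [derivLWord, scale_single, weight, derivL]
    | cons k w ih =>
      rw [← cons_single, scale_cons, map_smul, derivL_cons, derivL_cons, ih, map_add]
      simp only [map_smul, scale_cons]
      split_ifs with h
      · subst h
        simp only [smul_add, smul_smul, mul_comm]
      · simp only [map_zero, zero_add, smul_smul]
        congr 1; ring
  exact LinearMap.congr_fun hd x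

/-- Removing the letter `j` from either entry costs the same factor `d j`, so rescalings are
self-adjoint. This makes the radical stable under conjugation by torus elements. -/
theorem pair_scale (x y : List ι →₀ K) :
    pair c (scale d x) y = pair c x (scale d y) := by
  have : pair c ∘ₗ scale d = LinearMap.lcomp K K (scale d) ∘ₗ pair c := by
    refine lhom_ext fun w => LinearMap.ext fun y => ?_
    simp only [LinearMap.comp_apply, LinearMap.lcomp_apply]
    induction w generalizing y with
    | nil =>
      have : pair c (scale d (Finsupp.single [] 1)) =
          pair c (Finsupp.single [] 1) ∘ₗ scale d := by
        refine lhom_ext fun w => ?_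
        rw [LinearMap.comp_apply, scale_single, scale_single, pair_word]
        simp only [weight, List.map_nil, List.prod_nil, mul_one, one_mul, pair_word, pairWord,
          Finsupp.lapply_apply, Finsupp.single_apply]
        split_ifs with h <;> simp [h]
      exact LinearMap.congr_fun this y
    | cons k w ih =>
      rw [← cons_single, scale_cons, map_smul, LinearMap.smul_apply, pair_cons_left,
        pair_cons_left, ih, derivL_scale, map_smul]
  exact LinearMap.congr_fun (LinearMap.congr_fun this x) y

/-- Deleting a letter from the left and deleting one from the right do not interfere: the factors of
`c` picked up in either order agree by symmetry. This carries adjunctions from the left end of words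
over to the right end. -/
theorem derivL_derivR (hc : ∀ i j, c i j = c j i) (i j : ι) (x : List ι →₀ K) :
    derivL c j (derivR c i x) = derivR c i (derivL c j x) := by
  have : derivL c j ∘ₗ derivR c i = derivR c i ∘ₗ derivL c j := by
    refine lhom_ext fun w => ?_
    simp only [LinearMap.comp_apply]
    induction w with
    | nil => simp [derivL_word, derivLWord, derivR_word, derivRWord]
    | cons k w ih =>
      rw [← cons_single, derivR_cons, derivL_cons, map_add, derivL_cons, map_add, map_smul,
        derivR_cons, ih]
      have e5 : derivL c j (if i = k then scale (c i) (Finsupp.single w 1) else 0) =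
          c j k • (if i = k then scale (c i) (derivL c j (Finsupp.single w 1)) else 0) := by
        split_ifs with h
        · subst h; rw [derivL_scale, hc j i]
        · simp
      have e6 : (if j = k then derivR c i (Finsupp.single w 1) else 0) =
          derivR c i (if j = k then Finsupp.single w 1 else 0) := by
        split_ifs <;> simp
      rw [e5, smul_add, e6]
      abel
  exact LinearMap.congr_fun this x

/-- For the empty word both derivations extract the coefficient of the one-letter word; longer words
follow because left and right derivations commute. -/
theorem pair_snoc_left (hc : ∀ i j, c i j = c j i) (i : ι) (x y : List ι →₀ K) :
    pair c (snoc i x) y = pair c x (derivR c i y) := by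
  have : pair c ∘ₗ snoc i = LinearMap.lcomp K K (derivR c i) ∘ₗ pair c := by
    refine lhom_ext fun w => LinearMap.ext fun y => ?_
    simp only [LinearMap.comp_apply, LinearMap.lcomp_apply, snoc_single]
    induction w generalizing y with
    | nil =>
      have : pair c (Finsupp.single ([] ++ [i]) 1) =
          pair c (Finsupp.single [] 1) ∘ₗ derivR c i := by
        refine lhom_ext fun w => ?_
        rw [List.nil_append, ← cons_single, pair_cons_left, LinearMap.comp_apply]
        cases w with
        | nil => simp [derivL_word, derivLWord, derivR_word, derivRWord]
        | cons j w =>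
          have hz : ∀ x, pair c (Finsupp.single [] 1) (cons j x) = 0 := fun x => by
            rw [pair_cons_right c j hc]; simp [derivL_word, derivLWord]
          rw [derivL_word, derivR_word, derivLWord, derivRWord, map_add, map_add, map_smul, hz, hz]
          simp only [pair_word, pairWord, smul_zero, Finsupp.lapply_apply]
          split_ifs
          · cases w <;> simp [weight]
          · simp
      exact LinearMap.congr_fun this y
    | cons j w ih =>
      rw [List.cons_append, ← cons_single, pair_cons_left, ih, ← cons_single, pair_cons_left,
        derivL_derivR c hc]
  exact LinearMap.congr_fun (LinearMap.congr_fun this x) y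

theorem pair_snoc_right (hc : ∀ i j, c i j = c j i) (i : ι) (x y : List ι →₀ K) :
    pair c x (snoc i y) = pair c (derivR c i x) y := by
  rw [pair_symm c hc, pair_snoc_left c hc, pair_symm c hc]

/-- Words with different contents are orthogonal. -/
theorem perm_of_pair_ne_zero {w w' : List ι}
    (h : pair c (Finsupp.single w 1) (Finsupp.single w' 1) ≠ 0) : w.Perm w' := by
  -- Every word occurring in `∂_i w'` is `w'` with one occurrence of `i` deleted.
  have hd : ∀ (i : ι) (w' : List ι), ∀ u ∈ (derivLWord c i w').support, (i :: u).Perm w' := by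
    intro i w'
    induction w' with
    | nil => simp [derivLWord]
    | cons j w ih =>
      intro u hu
      rw [derivLWord] at hu
      rcases Finset.mem_union.mp (Finsupp.support_add hu) with h | h
      · split_ifs at h with hij
        · subst hij
          have := Finsupp.support_single_subset h
          rw [Finset.mem_singleton.mp this]
        · simp at h
      · have h := Finsupp.support_smul h
        have h := Finsupp.mapDomain_support h
        obtain ⟨v, hv, rfl⟩ := Finset.mem_image.mp h
        exact (List.Perm.swap j i v).trans ((ih v hv).cons j)
  induction w generalizing w' with
  | nil =>
    rw [pair_word] at h
    simp only [pairWord, Finsupp.lapply_apply, Finsupp.single_apply] at h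
    split_ifs at h with e
    · rw [e]
    · simp at h
  | cons i w ih =>
    rw [← cons_single, pair_cons_left, derivL_word, ← Finsupp.sum_single (derivLWord c i w'),
      Finsupp.sum, map_sum] at h
    obtain ⟨u, hu, hne⟩ := Finset.exists_ne_zero_of_sum_ne_zero h
    refine List.Perm.trans (List.Perm.cons i (ih (w' := u) fun h0 => hne ?_)) (hd i w' u hu)
    rw [← mul_one ((derivLWord c i w') u), ← smul_eq_mul, ← Finsupp.smul_single, map_smul, h0,
      smul_zero]

/-- The linear map `x ↦ ∑_w ⟨x, w⟩ w`. -/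
def dualMap : (List ι →₀ K) →ₗ[K] (List ι →₀ K) :=
  Finsupp.linearCombination K fun w =>
    -- The support is finite because a word pairs nontrivially only with its rearrangements.
    Finsupp.onFinset w.permutations.toFinset
      (fun w' => pair c (Finsupp.single w 1) (Finsupp.single w' 1)) fun w' h => by
        rw [List.mem_toFinset, List.mem_permutations]
        exact (perm_of_pair_ne_zero c h).symm

theorem dualMap_apply (x : List ι →₀ K) (w : List ι) :
    dualMap c x w = pair c x (Finsupp.single w 1) := by
  have : Finsupp.lapply w ∘ₗ dualMap c = (pair c).flip (Finsupp.single w 1) := by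
    refine lhom_ext fun w' => ?_
    simp [dualMap]
  exact LinearMap.congr_fun this x

/-- The radical of the quantum shuffle form. -/
def radical : Submodule K (List ι →₀ K) := LinearMap.ker (dualMap c)

theorem mem_radical {x : List ι →₀ K} : x ∈ radical c ↔ ∀ y, pair c x y = 0 := by
  rw [radical, LinearMap.mem_ker]
  constructor
  · intro h
    refine LinearMap.congr_fun (lhom_ext (f := pair c x) (g := 0) fun w => ?_)
    rw [← dualMap_apply, h]; rfl
  · intro h
    ext w
    rw [dualMap_apply, h]; rfl

theorem mem_radical' (hc : ∀ i j, c i j = c j i) {x : List ι →₀ K} :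
    x ∈ radical c ↔ ∀ y, pair c y x = 0 := by
  simp only [mem_radical, pair_symm c hc x]

/-! ### The radical as an ideal stable under derivations and rescalings -/

section Ideal

variable {c} (hc : ∀ i j, c i j = c j i) {x : List ι →₀ K} (hx : x ∈ radical c) (i : ι)

include hx in
theorem scale_mem_radical (d : ι → K) : scale d x ∈ radical c := by
  rw [mem_radical] at *
  intro y; rw [pair_scale, hx]

include hx in
theorem cons_mem_radical : cons i x ∈ radical c := by
  rw [mem_radical] at *
  intro y; rw [pair_cons_left, hx]

include hc hx in
theorem snoc_mem_radical : snoc i x ∈ radical c := by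
  rw [mem_radical] at *
  intro y; rw [pair_snoc_left c hc, hx]

include hc hx in
theorem derivL_mem_radical : derivL c i x ∈ radical c := by
  rw [mem_radical] at *
  intro y; rw [← pair_cons_right c i hc, hx]

include hc hx in
theorem derivR_mem_radical : derivR c i x ∈ radical c := by
  rw [mem_radical] at *
  intro y; rw [← pair_snoc_right c hc, hx]

include hx in
/-- The radical contains no constants. -/
theorem apply_nil_of_mem_radical (hc : ∀ i j, c i j = c j i) : x [] = 0 := by
  have := (mem_radical' c hc).mp hx (Finsupp.single [] 1)
  rwa [pair_word] at this

end Ideal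

/-- A linear map killing the radical factors through `dualMap`. -/
theorem exists_factor {M : Type*} [AddCommGroup M] [Module K M] (f : (List ι →₀ K) →ₗ[K] M)
    (hf : ∀ x ∈ radical c, f x = 0) : ∃ E : (List ι →₀ K) →ₗ[K] M, f = E ∘ₗ dualMap c := by
  -- The quotient by the radical is the range of `dualMap`; the induced map on this range is
  -- extended arbitrarily to the whole space.
  obtain ⟨E, hE⟩ := LinearMap.exists_extend (p := LinearMap.range (dualMap c))
    ((LinearMap.ker (dualMap c)).liftQ f (fun x hx => hf x hx) ∘ₗ
      (dualMap c).quotKerEquivRange.symm.toLinearMap)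
  refine ⟨E, LinearMap.ext fun x => ?_⟩
  have := LinearMap.congr_fun hE ((dualMap c).quotKerEquivRange (Submodule.Quotient.mk x))
  rw [LinearMap.comp_apply, LinearMap.comp_apply, LinearEquiv.coe_coe,
    LinearEquiv.symm_apply_apply] at this
  exact this.symm

/-- Contraction of the first factor of `F ⊗ A` against the word combination `x`. -/
def contract (A : Type*) [AddCommGroup A] [Module K A] (x : List ι →₀ K) :
    (List ι →₀ K) ⊗[K] A →ₗ[K] A :=
  TensorProduct.lid K A ∘ₗ (pair c x).rTensor A

theorem contract_tmul {A : Type*} [AddCommGroup A] [Module K A] (x y : List ι →₀ K) (a : A) :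
    contract c A x (y ⊗ₜ a) = pair c x y • a := by simp [contract]

/-- The form is nondegenerate modulo its radical, so contractions against words determine an element
of the tensor product modulo the radical in its first factor. Concretely, `f` factors through
`dualMap`, and these contractions are the coordinates of `Z` after `dualMap` is applied. This plays
the role of dual bases of the quotient by the radical. -/
theorem rTensor_eq_zero (hc : ∀ i j, c i j = c j i) {A M : Type*} [AddCommGroup A] [Module K A]
    [AddCommGroup M] [Module K M] {f : (List ι →₀ K) →ₗ[K] M} (hf : ∀ x ∈ radical c, f x = 0)
    {Z : (List ι →₀ K) ⊗[K] A} (hZ : ∀ w, contract c A (Finsupp.single w 1) Z = 0) :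
    f.rTensor A Z = 0 := by
  obtain ⟨E, rfl⟩ := exists_factor c f hf
  rw [LinearMap.rTensor_comp, LinearMap.comp_apply]
  suffices h : (dualMap c).rTensor A Z = 0 by rw [h, map_zero]
  apply (TensorProduct.finsuppScalarLeft K A (List ι)).injective
  rw [map_zero]
  ext w
  refine Eq.trans ?_ (hZ w)
  clear hZ
  induction Z using TensorProduct.induction_on with
  | zero => simp
  | add x y hx hy => simp only [map_add, Finsupp.add_apply, hx, hy]
  | tmul x a =>
    rw [LinearMap.rTensor_tmul, TensorProduct.finsuppScalarLeft_apply_tmul_apply, contract_tmul,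
      dualMap_apply, pair_symm c hc]

theorem rTensor_congr (hc : ∀ i j, c i j = c j i) {A M : Type*} [AddCommGroup A] [Module K A]
    [AddCommGroup M] [Module K M] {f : (List ι →₀ K) →ₗ[K] M} (hf : ∀ x ∈ radical c, f x = 0)
    {Z Z' : (List ι →₀ K) ⊗[K] A}
    (hZ : ∀ w, contract c A (Finsupp.single w 1) Z = contract c A (Finsupp.single w 1) Z') :
    f.rTensor A Z = f.rTensor A Z' := by
  rw [← sub_eq_zero, ← map_sub]
  exact rTensor_eq_zero c hc hf fun w => by rw [map_sub, hZ, sub_self]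

/-! ### Words in an algebra -/

section Eval

variable {A B : Type*} [Ring A] [Algebra K A] [Ring B] [Algebra K B]

/-- The linear map `w ↦ x_{w_1} ⋯ x_{w_r}`. -/
def eval (x : ι → A) : (List ι →₀ K) →ₗ[K] A :=
  Finsupp.linearCombination K fun w => (w.map x).prod

omit [DecidableEq ι] in
theorem eval_word (x : ι → A) (w : List ι) :
    eval (K := K) x (Finsupp.single w 1) = (w.map x).prod := by simp [eval]

omit [DecidableEq ι] in
theorem eval_cons (x : ι → A) (i : ι) (y : List ι →₀ K) :
    eval x (cons i y) = x i * eval x y := by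
  have : eval x ∘ₗ cons i = LinearMap.mulLeft K (x i) ∘ₗ eval (K := K) x :=
    lhom_ext fun w => by simp [cons_single, eval_word]
  exact LinearMap.congr_fun this y

omit [DecidableEq ι] in
theorem eval_snoc (x : ι → A) (i : ι) (y : List ι →₀ K) :
    eval x (snoc i y) = eval x y * x i := by
  have : eval x ∘ₗ snoc i = LinearMap.mulRight K (x i) ∘ₗ eval (K := K) x :=
    lhom_ext fun w => by simp [snoc_single, eval_word]
  exact LinearMap.congr_fun this y

omit [DecidableEq ι] in
theorem map_eval (φ : A →ₐ[K] B) (x : ι → A) (y : List ι →₀ K) :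
    φ (eval x y) = eval (fun i => φ (x i)) y := by
  have : φ.toLinearMap ∘ₗ eval x = eval (K := K) (fun i => φ (x i)) :=
    lhom_ext fun w => by simp [eval_word, map_list_prod, Function.comp_def]
  exact LinearMap.congr_fun this y

omit [DecidableEq ι] in
theorem commute_eval {x : ι → A} {k : A} {d : ι → K} (h : ∀ j, k * x j = d j • (x j * k))
    (y : List ι →₀ K) : k * eval x y = eval x (scale d y) * k := by
  have : LinearMap.mulLeft K k ∘ₗ eval x =
      LinearMap.mulRight K k ∘ₗ eval (K := K) x ∘ₗ scale d := by
    refine lhom_ext fun w => ?_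
    simp only [LinearMap.comp_apply, LinearMap.mulLeft_apply, LinearMap.mulRight_apply]
    induction w with
    | nil => simp [eval_word, scale_single, weight]
    | cons j w ih =>
      rw [← cons_single, eval_cons, ← mul_assoc, h, smul_mul_assoc, mul_assoc, ih, scale_cons,
        map_smul, eval_cons, smul_mul_assoc, mul_assoc]
  exact LinearMap.congr_fun this y

omit [DecidableEq ι] in
theorem eval_mul_comm {x : ι → A} {k : A} {d : ι → K} (h : ∀ j, x j * k = d j • (k * x j))
    (y : List ι →₀ K) : eval x y * k = k * eval x (scale d y) := by
  have : LinearMap.mulRight K k ∘ₗ eval x =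
      LinearMap.mulLeft K k ∘ₗ eval (K := K) x ∘ₗ scale d := by
    refine lhom_ext fun w => ?_
    simp only [LinearMap.comp_apply, LinearMap.mulLeft_apply, LinearMap.mulRight_apply]
    induction w with
    | nil => simp [eval_word, scale_single, weight]
    | cons j w ih =>
      rw [← cons_single, eval_cons, mul_assoc, ih, ← mul_assoc, h, smul_mul_assoc, scale_cons,
        map_smul, eval_cons, mul_smul_comm, mul_assoc]
  exact LinearMap.congr_fun this y

/-- Concatenation of words, extended bilinearly. -/
def concat : (List ι →₀ K) →ₗ[K] (List ι →₀ K) →ₗ[K] (List ι →₀ K) :=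
  Finsupp.linearCombination K fun w => Finsupp.lmapDomain K K fun w' => w ++ w'

omit [DecidableEq ι] in
theorem concat_nil (y : List ι →₀ K) : concat (Finsupp.single [] 1) y = y := by
  simp [concat, Finsupp.mapDomain]

omit [DecidableEq ι] in
theorem concat_cons (i : ι) (x y : List ι →₀ K) : concat (cons i x) y = cons i (concat x y) := by
  have : concat ∘ₗ cons i = (LinearMap.compRight K (cons (K := K) i) :
      ((List ι →₀ K) →ₗ[K] (List ι →₀ K)) →ₗ[K] _) ∘ₗ concat := by
    refine lhom_ext fun w => lhom_ext fun w' => ?_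
    simp [concat, cons_single]
  exact LinearMap.congr_fun (LinearMap.congr_fun this x) y

/-- Skew Leibniz rule: the derivation reaches `y` only after passing `x`, which rescales every
letter of `x`. -/
theorem derivL_concat (i : ι) (x y : List ι →₀ K) : derivL c i (concat x y) =
    concat (derivL c i x) y + concat (scale (c i) x) (derivL c i y) := by
  have : derivL c i ∘ₗ concat.flip y =
      concat.flip y ∘ₗ derivL c i + concat.flip (derivL c i y) ∘ₗ scale (c i) := by
    refine lhom_ext fun w => ?_
    simp only [LinearMap.comp_apply, LinearMap.add_apply, LinearMap.flip_apply]
    induction w with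
    | nil => simp [concat_nil, derivL_word, derivLWord, scale_single, weight]
    | cons j w ih =>
      rw [← cons_single, concat_cons, derivL_cons, ih, derivL_cons, scale_cons]
      simp only [map_add, map_smul, smul_add, LinearMap.add_apply, LinearMap.smul_apply,
        concat_cons, add_assoc]
      congr 1
      split_ifs <;> simp
  exact LinearMap.congr_fun this x

/-- The twisted deconcatenation `Δ(i w) = (i ⊗ 1 + σ_i ⊗ i) Δ(w)` on words. -/
def coprodWord : List ι → (List ι →₀ K) ⊗[K] (List ι →₀ K)
  | [] => Finsupp.single [] 1 ⊗ₜ Finsupp.single [] 1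
  | i :: w => (cons i).rTensor _ (coprodWord w) + TensorProduct.map (scale (c i)) (cons i) (coprodWord w)

/-- The twisted coproduct. -/
def coprod : (List ι →₀ K) →ₗ[K] (List ι →₀ K) ⊗[K] (List ι →₀ K) :=
  Finsupp.linearCombination K (coprodWord c)

/-- The form on the tensor square. -/
def pairTensor (x y : List ι →₀ K) : (List ι →₀ K) ⊗[K] (List ι →₀ K) →ₗ[K] K :=
  LinearMap.mul' K K ∘ₗ TensorProduct.map ((pair c).flip x) ((pair c).flip y)

/-- The twisted coproduct is the adjoint of concatenation; its recursion on words mirrors the skew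
Leibniz rule. -/
theorem pairTensor_coprod (x y z : List ι →₀ K) :
    pairTensor c x y (coprod c z) = pair c z (concat x y) := by
  have : pairTensor c x y ∘ₗ coprod c = (pair c).flip (concat x y) := by
    refine lhom_ext fun w => ?_
    have hw : coprod c (Finsupp.single w 1) = coprodWord c w := by simp [coprod]
    rw [LinearMap.comp_apply, hw, LinearMap.flip_apply]
    clear hw
    induction w generalizing x y with
    | nil =>
      -- The empty word arises only as the concatenation of two empty words.
      have : ∀ x y : List ι →₀ K, (concat x y) [] = x [] * y [] := by
        intro x y
        have : (LinearMap.compRight K (Finsupp.lapply []) :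
            ((List ι →₀ K) →ₗ[K] (List ι →₀ K)) →ₗ[K] _) ∘ₗ concat =
            (LinearMap.mul K K).compl₁₂ (Finsupp.lapply (R := K) (M := K) ([] : List ι))
              (Finsupp.lapply []) := by
          refine lhom_ext fun w => lhom_ext fun w' => ?_
          simp only [concat, LinearMap.comp_apply, LinearMap.compRight_apply,
            Finsupp.linearCombination_single, one_smul, Finsupp.lmapDomain_apply,
            Finsupp.mapDomain_single, Finsupp.lapply_apply, LinearMap.compl₁₂_apply,
            LinearMap.mul_apply', Finsupp.single_apply, List.append_eq_nil_iff]
          by_cases h : w = [] <;> by_cases h' : w' = [] <;> simp [h, h']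
        exact LinearMap.congr_fun (LinearMap.congr_fun this x) y
      simp [coprodWord, pairTensor, pair_word, pairWord, this]
    | cons i w ih =>
      have h1 : ∀ z, pairTensor c x y ((cons i).rTensor _ z) =
          pairTensor c (derivL c i x) y z := by
        intro z
        induction z using TensorProduct.induction_on with
        | zero => simp
        | add a b ha hb => simp only [map_add, ha, hb]
        | tmul a b => simp [pairTensor, pair_cons_left]
      have h2 : ∀ z, pairTensor c x y (TensorProduct.map (scale (c i)) (cons i) z) =
          pairTensor c (scale (c i) x) (derivL c i y) z := by
        intro z
        induction z using TensorProduct.induction_on with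
        | zero => simp
        | add a b ha hb => simp only [map_add, ha, hb]
        | tmul a b => simp [pairTensor, pair_cons_left, pair_scale]
      rw [coprodWord, map_add, h1, h2, ih, ih, ← map_add, ← derivL_concat,
        ← pair_cons_left, cons_single]
  exact LinearMap.congr_fun this z

/-- The radical is a coideal: what is orthogonal to all words is orthogonal to all concatenations,
and those pairings are the coordinates of the coproduct after `dualMap` on both factors. -/
theorem dualMap_coprod {z : List ι →₀ K} (hz : z ∈ radical c) :
    TensorProduct.map (dualMap c) (dualMap c) (coprod c z) = 0 := by
  apply (finsuppTensorFinsupp' K (List ι) (List ι)).injective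
  rw [map_zero]
  ext ⟨u, v⟩
  have : ∀ Z, finsuppTensorFinsupp' K (List ι) (List ι)
      (TensorProduct.map (dualMap c) (dualMap c) Z) (u, v) =
      pairTensor c (Finsupp.single u 1) (Finsupp.single v 1) Z := by
    intro Z
    induction Z using TensorProduct.induction_on with
    | zero => simp
    | add x y hx hy => simp only [map_add, Finsupp.add_apply, hx, hy]
    | tmul x y => simp [pairTensor, dualMap_apply]
  rw [this, pairTensor_coprod, (mem_radical c).mp hz, Finsupp.zero_apply]

omit [DecidableEq ι] in
theorem prod_map_eq_of_perm {k : ι → A} (hk : ∀ i j, Commute (k i) (k j)) {w w' : List ι}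
    (h : w.Perm w') : (w.map k).prod = (w'.map k).prod := by
  induction h with
  | nil => rfl
  | cons x _ ih => simp [ih]
  | swap x y l => simp only [List.map_cons, List.prod_cons, ← mul_assoc, (hk y x).eq]
  | trans _ _ ih1 ih2 => rw [ih1, ih2]

/-- The part of the radical of a given content lies in the radical. -/
theorem filter_mem_radical {x : List ι →₀ K} (hx : x ∈ radical c) (u : List ι) :
    x.filter (fun w => w.Perm u) ∈ radical c := by
  -- Words of different content being orthogonal, truncating `x` to the content of `u` keeps its
  -- pairings with words of that content and kills the others.
  have hp : ∀ (w : List ι), pair c (x.filter fun w => w.Perm u) (Finsupp.single w 1) =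
      if w.Perm u then pair c x (Finsupp.single w 1) else 0 := by
    intro w
    clear hx
    induction x using Finsupp.induction_linear with
    | zero => simp [Finsupp.filter_zero]
    | add x y hx hy =>
      rw [Finsupp.filter_add, map_add, LinearMap.add_apply, hx, hy, map_add, LinearMap.add_apply]
      split_ifs <;> simp
    | single v r =>
      have hr : ∀ r, pair c (Finsupp.single v r) = r • pair c (Finsupp.single v 1) := fun r => by
        rw [← map_smul, Finsupp.smul_single, smul_eq_mul, mul_one]
      by_cases hv : v.Perm u
      · rw [Finsupp.filter_single_of_pos (p := fun w : List ι => w.Perm u) hv, hr]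
        split_ifs with hw
        · rfl
        · by_contra h0
          exact hw ((perm_of_pair_ne_zero c (right_ne_zero_of_mul h0)).symm.trans hv)
      · rw [Finsupp.filter_single_of_neg (p := fun w : List ι => w.Perm u) hv, hr]
        split_ifs with hw
        · by_contra h0
          exact hv ((perm_of_pair_ne_zero c (right_ne_zero_of_mul (Ne.symm h0))).trans hw)
        · simp
  rw [mem_radical] at *
  refine LinearMap.congr_fun (lhom_ext (g := 0) fun w => ?_)
  rw [hp, hx]
  simp

/-- Since the `k i` commute, `(w.map k).prod` depends only on the content of `w`, hence is constant
on each homogeneous part of `x` and can be pulled out there. Each part lies in the radical again, so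
the claim follows by splitting off one content at a time. -/
theorem eval_mul_eq_zero {k y : ι → B} (hk : ∀ i j, Commute (k i) (k j))
    (hy : ∀ x ∈ radical c, eval (K := K) y x = 0) {M : Type*} [AddCommGroup M] [Module K M]
    (T : B →ₗ[K] B →ₗ[K] M) {x : List ι →₀ K} (hx : x ∈ radical c) :
    Finsupp.linearCombination K (fun w => T (w.map k).prod (w.map y).prod) x = 0 := by
  classical
  induction hn : x.support.card using Nat.strong_induction_on generalizing x with
  | _ n ih =>
  by_cases h0 : x = 0
  · rw [h0, map_zero]
  obtain ⟨u, hu⟩ := Finsupp.support_nonempty_iff.mpr h0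
  rw [← Finsupp.filter_add_filter_not x (fun w => w.Perm u), map_add]
  have h1 := filter_mem_radical c hx u
  have h2 : x.filter (fun w => ¬ w.Perm u) ∈ radical c := by
    have : x.filter (fun w => ¬ w.Perm u) = x - x.filter (fun w => w.Perm u) := by
      rw [eq_sub_iff_add_eq, add_comm, Finsupp.filter_add_filter_not]
    rw [this]; exact sub_mem hx h1
  rw [ih _ ?_ h2 rfl, add_zero]
  · have h3 := hy _ h1
    rw [Finsupp.linearCombination_apply, Finsupp.sum]
    have h4 : ∀ w ∈ (x.filter fun w => w.Perm u).support,
        (x.filter fun w => w.Perm u) w • T (w.map k).prod (w.map y).prod =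
        T (u.map k).prod ((x.filter fun w => w.Perm u) w • (w.map y).prod) := by
      intro w hw
      rw [Finsupp.support_filter, Finset.mem_filter] at hw
      rw [map_smul, prod_map_eq_of_perm hk hw.2]
    rw [Finset.sum_congr rfl h4, ← map_sum]
    rw [eval, Finsupp.linearCombination_apply, Finsupp.sum] at h3
    rw [h3, map_zero]
  · rw [← hn]
    refine Finset.card_lt_card ?_
    rw [Finsupp.support_filter, Finset.filter_ssubset]
    exact ⟨u, hu, by simp⟩

/-- If the words in the `x_i` and those in the `y_i` satisfy the relations given by the radical,
then so do the words in `x_i ⊗ 1 + k_i ⊗ y_i`. -/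
theorem eval_tensor_eq_zero {x k : ι → A} {y : ι → B} (hk : ∀ i j, Commute (k i) (k j))
    (hkx : ∀ i j, k i * x j = c i j • (x j * k i))
    (hx : ∀ z ∈ radical c, eval (K := K) x z = 0) (hy : ∀ z ∈ radical c, eval (K := K) y z = 0)
    {z : List ι →₀ K} (hz : z ∈ radical c) :
    eval (K := K) (fun i => x i ⊗ₜ[K] (1 : B) + k i ⊗ₜ[K] y i) z = 0 := by
  -- The second factor of the coproduct is evaluated together with the torus elements accumulated in
  -- front of it: `w ↦ k_w ⊗ y_w`.
  let y' : (List ι →₀ K) →ₗ[K] A ⊗[K] B :=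
    Finsupp.linearCombination K fun w => (w.map k).prod ⊗ₜ[K] (w.map y).prod
  have hy' : ∀ z ∈ radical c, y' z = 0 := by
    intro z hz
    have hk' : ∀ i j, Commute (k i ⊗ₜ[K] (1 : B)) (k j ⊗ₜ[K] (1 : B)) := fun i j => by
      rw [Commute, SemiconjBy, Algebra.TensorProduct.tmul_mul_tmul,
        Algebra.TensorProduct.tmul_mul_tmul, (hk i j).eq]
    have h1 := eval_mul_eq_zero c (k := fun i => k i ⊗ₜ[K] (1 : B))
      (y := fun i => (1 : A) ⊗ₜ[K] y i) hk'
      (fun z hz => by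
        have := map_eval (Algebra.TensorProduct.includeRight (R := K) (A := A) (B := B)) y z
        simp only [Algebra.TensorProduct.includeRight_apply] at this
        rw [← this, hy z hz, TensorProduct.tmul_zero])
      (LinearMap.mul K (A ⊗[K] B)) hz
    rw [← h1]
    refine LinearMap.congr_fun (lhom_ext fun w => ?_) z
    simp only [y', Finsupp.linearCombination_single, one_smul]
    have e1 := (map_list_prod (Algebra.TensorProduct.includeLeft (R := K) (S := K) (A := A)
      (B := B)) (w.map k)).symm
    have e2 := (map_list_prod (Algebra.TensorProduct.includeRight (R := K) (A := A)
      (B := B)) (w.map y)).symm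
    rw [List.map_map] at e1 e2
    simp only [Function.comp_def, Algebra.TensorProduct.includeLeft_apply,
      Algebra.TensorProduct.includeRight_apply] at e1 e2
    rw [LinearMap.mul_apply', e1, e2, Algebra.TensorProduct.tmul_mul_tmul, mul_one, one_mul]
  obtain ⟨E, hE⟩ := exists_factor c _ hx
  obtain ⟨E', hE'⟩ := exists_factor c _ hy'
  let m : A →ₗ[K] (A ⊗[K] B) →ₗ[K] A ⊗[K] B :=
    LinearMap.mul K (A ⊗[K] B) ∘ₗ
      (Algebra.TensorProduct.includeLeft (R := K) (S := K) (A := A) (B := B)).toLinearMap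
  let Ψ : (List ι →₀ K) ⊗[K] (List ι →₀ K) →ₗ[K] A ⊗[K] B :=
    TensorProduct.lift (m.compl₁₂ (eval x) y')
  have hΨ : ∀ u v, Ψ (u ⊗ₜ v) = (eval x u ⊗ₜ[K] (1 : B)) * y' v := fun u v => by
    simp [Ψ, m]
  -- Multiplication by `x i ⊗ 1 + k i ⊗ y i` reproduces the recursion of `coprodWord`: moving `k i`
  -- past a word in the `x j` causes exactly the rescaling by `c i`.
  have h1 : ∀ i Z, Ψ ((cons i).rTensor _ Z + TensorProduct.map (scale (c i)) (cons i) Z) =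
      (x i ⊗ₜ[K] (1 : B) + k i ⊗ₜ[K] y i) * Ψ Z := by
    intro i Z
    induction Z using TensorProduct.induction_on with
    | zero => simp
    | add a b ha hb =>
      rw [map_add ((cons i).rTensor _), map_add (TensorProduct.map _ _), add_add_add_comm, map_add Ψ,
        ha, hb, map_add Ψ, mul_add]
    | tmul u v =>
      have hy1 : y' (cons i v) = (k i ⊗ₜ[K] y i) * y' v := by
        have : y' ∘ₗ cons i = LinearMap.mulLeft K (k i ⊗ₜ[K] y i) ∘ₗ y' :=
          lhom_ext fun w => by simp [cons_single, y']
        exact LinearMap.congr_fun this v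
      rw [LinearMap.rTensor_tmul, TensorProduct.map_tmul, map_add, hΨ, hΨ, hΨ,
        hy1, eval_cons, add_mul, ← mul_assoc, ← mul_assoc, ← mul_assoc,
        Algebra.TensorProduct.tmul_mul_tmul, Algebra.TensorProduct.tmul_mul_tmul,
        Algebra.TensorProduct.tmul_mul_tmul, commute_eval (hkx i)]
      simp only [mul_one, one_mul]
  have h2 : eval (K := K) (fun i => x i ⊗ₜ[K] (1 : B) + k i ⊗ₜ[K] y i) = Ψ ∘ₗ coprod c := by
    refine lhom_ext fun w => ?_
    have hw : coprod c (Finsupp.single w 1) = coprodWord c w := by simp [coprod]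
    rw [LinearMap.comp_apply, hw]
    clear hw
    induction w with
    | nil =>
      rw [coprodWord, hΨ, eval_word, eval_word]
      simp [y', Algebra.TensorProduct.one_def]
    | cons i w ih => rw [coprodWord, h1, ← ih, ← cons_single, eval_cons]
  -- Both evaluations kill the radical, so `Ψ` factors through `dualMap` on each side and vanishes
  -- on coproducts of the radical.
  have h3 : Ψ = TensorProduct.lift (m.compl₁₂ E E') ∘ₗ
      TensorProduct.map (dualMap c) (dualMap c) := by
    refine TensorProduct.ext' fun u v => ?_
    simp only [Ψ, TensorProduct.lift.tmul, LinearMap.compl₁₂_apply, LinearMap.comp_apply,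
      TensorProduct.map_tmul, hE, hE']
  rw [h2, LinearMap.comp_apply, h3, LinearMap.comp_apply, dualMap_coprod c hz, map_zero]

/-- A nilpotent word map killing the radical is given by a canonical element. -/
theorem exists_canonical [Finite ι] {x : ι → A} (hx : ∀ z ∈ radical c, eval (K := K) x z = 0)
    {N : ℕ} (hN : ∀ w : List ι, N ≤ w.length → (w.map x).prod = 0) :
    ∃ Z : (List ι →₀ K) ⊗[K] A, ∀ z, contract c A z Z = eval x z := by
  classical
  obtain ⟨E, hE⟩ := exists_factor c _ hx
  have hfin : {w : List ι | w.length < N}.Finite := List.finite_length_lt ι N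
  -- With `eval x = E ∘ dualMap`, the element is `∑ u ⊗ E(u)`, whose contraction with `z` is `∑ ⟨z,
  -- u⟩ E(u) = E (dualMap z)`. Truncating to words shorter than `N` makes the sum finite; longer
  -- words evaluate to zero anyway.
  refine ⟨∑ u ∈ hfin.toFinset, Finsupp.single u 1 ⊗ₜ E (Finsupp.single u 1), fun z => ?_⟩
  have : ∀ z, contract c A z (∑ u ∈ hfin.toFinset, Finsupp.single u 1 ⊗ₜ E (Finsupp.single u 1)) =
      ∑ u ∈ hfin.toFinset, dualMap c z u • E (Finsupp.single u 1) := fun z => by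
    simp only [map_sum, contract_tmul, dualMap_apply]
  rw [this]
  have h2 : ∑ u ∈ hfin.toFinset, LinearMap.toSpanSingleton K A (E (Finsupp.single u 1)) ∘ₗ
      (Finsupp.lapply u : (List ι →₀ K) →ₗ[K] K) ∘ₗ dualMap c = eval x := by
    refine lhom_ext fun w => ?_
    simp only [LinearMap.sum_apply, LinearMap.comp_apply, Finsupp.lapply_apply,
      LinearMap.toSpanSingleton_apply]
    have hs : ∀ u, dualMap c (Finsupp.single w 1) u ≠ 0 → u.length = w.length := fun u hu => by
      rw [dualMap_apply] at hu
      exact (perm_of_pair_ne_zero c hu).length_eq.symm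
    by_cases hw : N ≤ w.length
    · rw [eval_word, hN w hw]
      refine Finset.sum_eq_zero fun u hu => ?_
      rw [hfin.mem_toFinset] at hu
      by_contra h0
      have := hs u fun h => h0 (by rw [h, zero_smul])
      change u.length < N at hu
      omega
    · rw [hE, LinearMap.comp_apply]
      conv_rhs => rw [← Finsupp.sum_single (dualMap c (Finsupp.single w 1)), Finsupp.sum, map_sum]
      symm
      refine (Finset.sum_congr rfl fun u _ => ?_).trans
        (Finset.sum_subset (f := fun u => dualMap c (Finsupp.single w 1) u • E (Finsupp.single u 1))
          ?_ ?_)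
      · rw [← map_smul, Finsupp.smul_single, smul_eq_mul, mul_one]
      · intro u hu
        rw [hfin.mem_toFinset]
        have := hs u (Finsupp.mem_support_iff.mp hu)
        change u.length < N
        omega
      · intro u _ hu
        rw [Finsupp.notMem_support_iff.mp hu, zero_smul]
  rw [← h2]
  simp

end Eval

end Words

end QG

end

/-! ### Commutation of words with the opposite generators -/

noncomputable section

namespace QG

open Words MulOpposite

/-- Elements `e_i`, `f_i`, `k_i^{±1}` of an algebra that satisfy the relations of a quantized
enveloping algebra, except for the Serre relations. -/
structure IsTriple {K ι A : Type*} [Field K] [DecidableEq ι] [Ring A] [Algebra K A]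
    (c : ι → ι → K) (γ : ι → K) (e f k k' : ι → A) : Prop where
  c_symm : ∀ i j, c i j = c j i
  c_ne_zero : ∀ i j, c i j ≠ 0
  k_k' : ∀ i, k i * k' i = 1
  k'_k : ∀ i, k' i * k i = 1
  k_comm : ∀ i j, Commute (k i) (k j)
  k_e : ∀ i j, k i * e j = c i j • (e j * k i)
  f_k : ∀ i j, f j * k i = c i j • (k i * f j)
  e_f : ∀ i j, e i * f j - f j * e i = if i = j then γ i • (k i - k' i) else 0

namespace IsTriple

variable {K ι A : Type*} [Field K] [DecidableEq ι] [Ring A] [Algebra K A]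
  {c : ι → ι → K} {γ : ι → K} {e f k k' : ι → A} (h : IsTriple c γ e f k k')

include h

theorem e_k' (i j : ι) : e j * k' i = c i j • (k' i * e j) := by
  calc e j * k' i = (k' i * k i) * e j * k' i := by rw [h.k'_k, one_mul]
    _ = k' i * (k i * e j) * k' i := by simp only [mul_assoc]
    _ = c i j • (k' i * (e j * (k i * k' i))) := by
      rw [h.k_e]; simp only [mul_smul_comm, smul_mul_assoc, mul_assoc]
    _ = _ := by rw [h.k_k', mul_one]

theorem k'_f (i j : ι) : k' i * f j = c i j • (f j * k' i) := by
  calc k' i * f j = k' i * f j * (k i * k' i) := by rw [h.k_k', mul_one]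
    _ = k' i * (f j * k i) * k' i := by simp only [mul_assoc]
    _ = c i j • ((k' i * k i) * f j * k' i) := by
      rw [h.f_k]; simp only [mul_smul_comm, smul_mul_assoc, mul_assoc]
    _ = _ := by rw [h.k'_k, one_mul]

theorem commute_k' {i : ι} {a : A} (ha : Commute (k i) a) : Commute (k' i) a := by
  calc k' i * a = k' i * (a * k i) * k' i := by rw [mul_assoc, mul_assoc, h.k_k', mul_one]
    _ = a * k' i := by rw [← ha.eq, ← mul_assoc, h.k'_k, one_mul]

theorem k'_comm (i j : ι) : Commute (k' i) (k' j) :=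
  h.commute_k' (h.commute_k' (h.k_comm j i)).symm

/-- The Chevalley involution. -/
theorem swap : IsTriple c γ f e k' k where
  c_symm := h.c_symm
  c_ne_zero := h.c_ne_zero
  k_k' := h.k'_k
  k'_k := h.k_k'
  k_comm := h.k'_comm
  k_e := h.k'_f
  f_k := h.e_k'
  e_f i j := by
    have := h.e_f j i
    rw [← neg_sub, this]
    by_cases hij : i = j
    · subst hij; simp [← smul_neg]
    · simp [hij, Ne.symm hij]

/-- Commuting `f i` through a word in the `e j` deletes one occurrence of `i`, leaving `k i` or `k'
i` in its place. Moving `k i` to the right end and `k' i` to the left end collects the scalars that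
define the right and left skew derivations. -/
theorem eval_mul_f (i : ι) (z : List ι →₀ K) : eval e z * f i - f i * eval e z =
    γ i • (eval e (derivR c i z) * k i - k' i * eval e (derivL c i z)) := by
  have : LinearMap.mulRight K (f i) ∘ₗ eval e - LinearMap.mulLeft K (f i) ∘ₗ eval e =
      γ i • (LinearMap.mulRight K (k i) ∘ₗ eval e ∘ₗ derivR c i -
        LinearMap.mulLeft K (k' i) ∘ₗ eval (K := K) e ∘ₗ derivL c i) := by
    refine lhom_ext fun w => ?_
    simp only [LinearMap.sub_apply, LinearMap.comp_apply, LinearMap.mulLeft_apply,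
      LinearMap.mulRight_apply, LinearMap.smul_apply]
    induction w with
    | nil => simp [eval_word, derivL_word, derivR_word, derivLWord, derivRWord]
    | cons j w ih =>
      rw [← cons_single, eval_cons, derivR_cons, derivL_cons, map_add, map_add, map_smul, eval_cons,
        eval_cons]
      rw [sub_eq_iff_eq_add] at ih
      have h1 := h.e_f j i
      rw [sub_eq_iff_eq_add] at h1
      have h2 := h.e_k' i j
      rw [mul_assoc, ih, mul_add, ← mul_assoc (e j) (f i), h1, mul_smul_comm, mul_sub,
        ← mul_assoc (e j) (k' i), h2]
      by_cases hij : i = j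
      · subst hij
        rw [if_pos rfl, if_pos rfl, if_pos rfl]
        simp only [smul_mul_assoc, mul_smul_comm, add_mul, mul_add, sub_mul, smul_sub, smul_add,
          mul_assoc]
        rw [commute_eval (h.k_e i)]
        abel
      · rw [if_neg hij, if_neg hij, if_neg (Ne.symm hij)]
        simp only [smul_mul_assoc, mul_smul_comm, smul_sub, mul_assoc, map_zero, zero_add]
        abel
  exact LinearMap.congr_fun this z

theorem eval_f_mul_e (i : ι) (z : List ι →₀ K) : eval f z * e i - e i * eval f z =
    γ i • (eval f (derivR c i z) * k' i - k i * eval f (derivL c i z)) := h.swap.eval_mul_f i z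

/-- The relations in the opposite algebra for `γ_i⁻¹ f_i k_i` and `k_i⁻¹ e_i`. -/
theorem opp (hγ : ∀ i, γ i ≠ 0) : IsTriple c (fun _ => 1)
    (fun i => op ((γ i)⁻¹ • (f i * k i))) (fun i => op (k' i * e i)) (fun i => op (k i))
    (fun i => op (k' i)) where
  c_symm := h.c_symm
  c_ne_zero := h.c_ne_zero
  k_k' i := by rw [← op_mul, h.k'_k, op_one]
  k'_k i := by rw [← op_mul, h.k_k', op_one]
  k_comm i j := by rw [Commute, SemiconjBy, ← op_mul, ← op_mul, (h.k_comm i j).eq]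
  k_e i j := by
    rw [← op_mul, ← op_mul, smul_mul_assoc, mul_assoc, (h.k_comm j i).eq, ← mul_assoc, h.f_k,
      ← op_smul, mul_smul_comm, smul_mul_assoc, smul_comm, mul_assoc]
  f_k i j := by
    have hk := (h.commute_k' (h.k_comm j i)).symm
    rw [← op_mul, ← op_mul, ← op_smul, ← mul_assoc, hk.eq, mul_assoc, h.k_e, mul_smul_comm,
      mul_assoc]
  e_f i j := by
    -- Both products are brought to the form `k' j * (·) * k i`, so that only the commutator of `e
    -- j` and `f i` remains.
    have e1 : f i * k i * (k' j * e j) = k' j * (f i * e j) * k i := by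
      have hk := (h.commute_k' (h.k_comm j i)).symm
      calc f i * k i * (k' j * e j) = f i * (k i * k' j) * e j := by simp only [mul_assoc]
        _ = f i * k' j * (k i * e j) := by rw [hk.eq]; simp only [mul_assoc]
        _ = (c j i • (f i * k' j)) * e j * k i := by
          rw [h.k_e, h.c_symm]; simp only [mul_smul_comm, smul_mul_assoc, mul_assoc]
        _ = _ := by rw [← h.k'_f]; simp only [mul_assoc]
    have h3 := h.e_f j i
    rw [sub_eq_iff_eq_add] at h3
    rw [← op_mul, ← op_mul, ← op_sub, mul_smul_comm, smul_mul_assoc, e1,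
      show k' j * e j * (f i * k i) = k' j * (e j * f i) * k i by simp only [mul_assoc], h3,
      ← smul_sub, mul_add, add_mul, add_sub_cancel_right]
    by_cases hij : i = j
    · subst hij
      rw [if_pos rfl, if_pos rfl, one_smul, mul_smul_comm, smul_mul_assoc, smul_smul,
        inv_mul_cancel₀ (hγ i), one_smul, mul_sub, sub_mul, h.k'_k, one_mul, mul_assoc, h.k'_k,
        mul_one, op_sub]
    · rw [if_neg hij, if_neg (Ne.symm hij), mul_zero, zero_mul, smul_zero, op_zero]

end IsTriple

/-! ### The Casimir operator -/

section Casimir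

variable {K ι A : Type*} [Field K] [DecidableEq ι] [Ring A] [Algebra K A]

/-- The linear map `w ↦ g_{w_r} ⋯ g_{w_1}`. -/
def antiEval (g : ι → A) : (List ι →₀ K) →ₗ[K] A :=
  (opLinearEquiv K).symm.toLinearMap ∘ₗ eval fun i => op (g i)

omit [DecidableEq ι] in
theorem op_antiEval (g : ι → A) (z : List ι →₀ K) :
    op (antiEval g z) = eval (fun i => op (g i)) z := rfl

omit [DecidableEq ι] in
theorem antiEval_cons (g : ι → A) (i : ι) (z : List ι →₀ K) :
    antiEval g (cons i z) = antiEval g z * g i := by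
  apply op_injective
  rw [op_mul, op_antiEval, op_antiEval, eval_cons]

omit [DecidableEq ι] in
theorem antiEval_snoc (g : ι → A) (i : ι) (z : List ι →₀ K) :
    antiEval g (snoc i z) = g i * antiEval g z := by
  apply op_injective
  rw [op_mul, op_antiEval, op_antiEval, eval_snoc]

omit [DecidableEq ι] in
theorem antiEval_nil (g : ι → A) : antiEval (K := K) g (Finsupp.single [] 1) = 1 := by
  apply op_injective
  rw [op_antiEval, eval_word]; rfl

/-- The value `∑ P(x) C(y)` for `Z = ∑ x ⊗ y`. -/
def mapMul {F : Type*} [AddCommGroup F] [Module K F] (P : F →ₗ[K] A)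
    (C : A →ₗ[K] A) : F ⊗[K] A →ₗ[K] A :=
  LinearMap.mul' K A ∘ₗ TensorProduct.map P C

theorem mapMul_tmul {F : Type*} [AddCommGroup F] [Module K F] (P : F →ₗ[K] A)
    (C : A →ₗ[K] A) (x : F) (a : A) : mapMul P C (x ⊗ₜ a) = P x * C a := by
  simp [mapMul]

theorem contract_map {c : ι → ι → K} {z z' : List ι →₀ K}
    {B : (List ι →₀ K) →ₗ[K] (List ι →₀ K)} (hB : ∀ x, pair c z (B x) = pair c z' x)
    (C : A →ₗ[K] A) (Z : (List ι →₀ K) ⊗[K] A) :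
    contract c A z (TensorProduct.map B C Z) = C (contract c A z' Z) := by
  induction Z using TensorProduct.induction_on with
  | zero => simp
  | add x y hx hy => simp only [map_add, hx, hy]
  | tmul x a => rw [TensorProduct.map_tmul, contract_tmul, contract_tmul, hB, map_smul]

variable {c : ι → ι → K} {γ : ι → K} {e f k k' : ι → A}

/-- The Casimir operator attached to a canonical element. -/
def casimir (γ : ι → K) (f k : ι → A) (Z : (List ι →₀ K) ⊗[K] A) : A :=
  mapMul (antiEval fun i => (γ i)⁻¹ • (f i * k i)) LinearMap.id Z

namespace IsTriple

variable (h : IsTriple c γ e f k k') {Z : (List ι →₀ K) ⊗[K] A}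
  (hZ : ∀ z, contract c A z Z = eval e z)

omit [DecidableEq ι] in
theorem mapMul_id_comp (P : (List ι →₀ K) →ₗ[K] A) (C : A →ₗ[K] A) (Z : (List ι →₀ K) ⊗[K] A) :
    mapMul P LinearMap.id (TensorProduct.map LinearMap.id C Z) = mapMul P C Z := by
  induction Z using TensorProduct.induction_on with
  | zero => simp
  | add x y hx hy => simp only [map_add, hx, hy]
  | tmul x a => simp [mapMul_tmul]

section

variable {P : (List ι →₀ K) →ₗ[K] A} (hP : ∀ z ∈ radical c, P z = 0)


include h hP in
-- When `P` kills the radical, the value `∑ P(x) y` depends on `∑ x ⊗ y` only through its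
-- contractions.
theorem mapMul_congr {T T' : (List ι →₀ K) ⊗[K] A}
    (hT : ∀ z, contract c A z T = contract c A z T') :
    mapMul P LinearMap.id T = mapMul P LinearMap.id T' := by
  have := rTensor_congr c h.c_symm hP (Z := T) (Z' := T') fun w => hT _
  exact congrArg (LinearMap.mul' K A) this

omit [DecidableEq ι] in
theorem mapMul_comp (P : (List ι →₀ K) →ₗ[K] A) (B : (List ι →₀ K) →ₗ[K] (List ι →₀ K))
    (C : A →ₗ[K] A) (Z : (List ι →₀ K) ⊗[K] A) :
    mapMul P LinearMap.id (TensorProduct.map B C Z) = mapMul (P ∘ₗ B) C Z := by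
  induction Z using TensorProduct.induction_on with
  | zero => simp
  | add x y hx hy => simp only [map_add, hx, hy]
  | tmul x a => simp [mapMul_tmul]

include h hP hZ in
-- An operator on the word factor may be traded for its adjoint, which for the canonical element
-- acts on words in the `e i`. In this way derivations on the `f` side turn into multiplications by
-- `e i`.
theorem mapMul_comp_congr {B b : (List ι →₀ K) →ₗ[K] (List ι →₀ K)}
    (hB : ∀ z x, pair c z (B x) = pair c (b z) x) {C C' : A →ₗ[K] A}
    (H : ∀ z, C (eval e (b z)) = C' (eval e z)) :
    mapMul (P ∘ₗ B) C Z = mapMul P C' Z := by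
  rw [← mapMul_comp, ← mapMul_id_comp P C']
  refine h.mapMul_congr hP fun z => ?_
  rw [contract_map (hB z), contract_map (z' := z) (fun _ => rfl), hZ, hZ, H]

end

section

variable (hP : ∀ z ∈ radical c, antiEval (K := K) (fun i => (γ i)⁻¹ • (f i * k i)) z = 0)
  (hγ : ∀ i, γ i ≠ 0)

theorem mapMul_mulLeft_comp {F : Type*} [AddCommGroup F] [Module K F] (P : F →ₗ[K] A)
    (C : A →ₗ[K] A) (a : A) (Z : F ⊗[K] A) :
    mapMul (LinearMap.mulLeft K a ∘ₗ P) C Z = a * mapMul P C Z := by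
  induction Z using TensorProduct.induction_on with
  | zero => simp
  | add x y hx hy => simp only [map_add, hx, hy, mul_add]
  | tmul x b => simp [mapMul_tmul, mul_assoc]

theorem mapMul_mulRight_comp {F : Type*} [AddCommGroup F] [Module K F] (P : F →ₗ[K] A)
    (C : A →ₗ[K] A) (a : A) (Z : F ⊗[K] A) :
    mapMul P (LinearMap.mulRight K a ∘ₗ C) Z = mapMul P C Z * a := by
  induction Z using TensorProduct.induction_on with
  | zero => simp
  | add x y hx hy => simp only [map_add, hx, hy, add_mul]
  | tmul x b => simp [mapMul_tmul, mul_assoc]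

omit [DecidableEq ι] in
theorem mapMul_mulRight (P : (List ι →₀ K) →ₗ[K] A) (a : A) (Z : (List ι →₀ K) ⊗[K] A) :
    mapMul P (LinearMap.mulRight K a) Z = mapMul P LinearMap.id Z * a := by
  rw [← mapMul_mulRight_comp, LinearMap.comp_id]

theorem mapMul_mulRight_mulLeft {F : Type*} [AddCommGroup F] [Module K F] (P : F →ₗ[K] A)
    (C : A →ₗ[K] A) (a : A) (Z : F ⊗[K] A) :
    mapMul (LinearMap.mulRight K a ∘ₗ P) C Z = mapMul P (LinearMap.mulLeft K a ∘ₗ C) Z := by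
  induction Z using TensorProduct.induction_on with
  | zero => simp
  | add x y hx hy => simp only [map_add, hx, hy]
  | tmul x b => simp [mapMul_tmul, mul_assoc]

theorem mapMul_add_left {F : Type*} [AddCommGroup F] [Module K F] (P P' : F →ₗ[K] A)
    (C : A →ₗ[K] A) (Z : F ⊗[K] A) : mapMul (P + P') C Z = mapMul P C Z + mapMul P' C Z := by
  rw [mapMul, TensorProduct.map_add_left, LinearMap.comp_add, LinearMap.add_apply]; rfl

theorem mapMul_sub_left {F : Type*} [AddCommGroup F] [Module K F] (P P' : F →ₗ[K] A)
    (C : A →ₗ[K] A) (Z : F ⊗[K] A) : mapMul (P - P') C Z = mapMul P C Z - mapMul P' C Z := by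
  rw [eq_sub_iff_add_eq, ← mapMul_add_left, sub_add_cancel]

include h hγ in
-- This is the commutator formula `eval_mul_f` for the triple `opp`, read back in the original
-- algebra.
theorem mul_antiEval (i : ι) (z : List ι →₀ K) :
    k' i * e i * antiEval (fun i => (γ i)⁻¹ • (f i * k i)) z =
      antiEval (fun i => (γ i)⁻¹ • (f i * k i)) z * (k' i * e i) +
      (k i * antiEval (fun i => (γ i)⁻¹ • (f i * k i)) (derivR c i z) -
        antiEval (fun i => (γ i)⁻¹ • (f i * k i)) (derivL c i z) * k' i) := by
  have := (h.opp hγ).eval_mul_f i z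
  rw [one_smul, sub_eq_iff_eq_add'] at this
  apply op_injective
  simpa only [op_mul, op_antiEval, op_add, op_sub] using this

include h hP hZ hγ in
-- Passing `k' i * e i` through the first factor produces the two derivation terms of
-- `mul_antiEval`. By adjunction the right derivation becomes right multiplication of the second
-- factor by `e i`. The left one becomes left multiplication by `k' i * e i`, and cancels the term
-- in which `k' i * e i` has crossed to the second factor.
theorem e_mul_casimir (i : ι) : e i * casimir γ f k Z = k i * k i * casimir γ f k Z * e i := by
  set g : ι → A := fun i => (γ i)⁻¹ • (f i * k i) with hg
  have hk : k' i * e i * casimir γ f k Z = k i * casimir γ f k Z * e i := by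
    have h1 : LinearMap.mulLeft K (k' i * e i) ∘ₗ antiEval g =
        LinearMap.mulRight K (k' i * e i) ∘ₗ antiEval g +
        (LinearMap.mulLeft K (k i) ∘ₗ antiEval g ∘ₗ derivR c i -
          LinearMap.mulRight K (k' i) ∘ₗ antiEval (K := K) g ∘ₗ derivL c i) :=
      LinearMap.ext fun z => h.mul_antiEval hγ i z
    have h2 : mapMul (antiEval g ∘ₗ derivR c i) LinearMap.id Z = casimir γ f k Z * e i := by
      rw [casimir, ← mapMul_mulRight_comp, LinearMap.comp_id]
      refine h.mapMul_comp_congr hZ hP (b := snoc i)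
        (fun z x => (pair_snoc_left c h.c_symm i z x).symm) fun z => ?_
      simp [eval_snoc]
    have h3 : mapMul (antiEval g ∘ₗ derivL c i) (LinearMap.mulLeft K (k' i) ∘ₗ LinearMap.id) Z =
        mapMul (antiEval g) (LinearMap.mulLeft K (k' i * e i) ∘ₗ LinearMap.id) Z := by
      refine h.mapMul_comp_congr hZ hP (b := cons i) (fun z x => (pair_cons_left c i z x).symm) fun z => ?_
      simp [eval_cons]
    rw [casimir, ← mapMul_mulLeft_comp, h1, mapMul_add_left, mapMul_sub_left,
      mapMul_mulRight_mulLeft, mapMul_mulRight_mulLeft, mapMul_mulLeft_comp, h2, h3, casimir,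
      mul_assoc]
    abel
  calc e i * casimir γ f k Z = k i * (k' i * e i * casimir γ f k Z) := by
        rw [mul_assoc, ← mul_assoc (k i), h.k_k', one_mul]
    _ = _ := by rw [hk]; simp only [mul_assoc]

include h hP hZ hγ in
-- The mirror argument: moving `f i` to the left through the second factor gives the derivations of
-- `eval_mul_f`, whose adjoints append or prepend a letter in the first factor. The prepending term
-- cancels the product with `f i` standing in the middle.
theorem casimir_mul_f (i : ι) : casimir γ f k Z * f i = f i * k i * casimir γ f k Z * k i := by
  set g : ι → A := fun i => (γ i)⁻¹ • (f i * k i) with hg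
  have h1 : mapMul (antiEval g) (LinearMap.mulRight K (f i)) Z =
      mapMul (antiEval g) (LinearMap.mulLeft K (f i)) Z +
      γ i • (mapMul (antiEval g ∘ₗ snoc i) (LinearMap.mulRight K (k i)) Z -
        mapMul (antiEval g ∘ₗ cons i) (LinearMap.mulLeft K (k' i)) Z) := by
    rw [← mapMul_comp (antiEval g) (snoc i), ← mapMul_comp (antiEval g) (cons i),
      ← mapMul_id_comp _ (LinearMap.mulRight K (f i)),
      ← mapMul_id_comp _ (LinearMap.mulLeft K (f i)), ← map_sub, ← map_smul, ← map_add]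
    refine h.mapMul_congr hP fun z => ?_
    rw [map_add, map_smul, map_sub, contract_map (z' := z) (fun _ => rfl),
      contract_map (z' := z) (fun _ => rfl),
      contract_map (z' := derivR c i z) (fun x => pair_snoc_right c h.c_symm i z x),
      contract_map (z' := derivL c i z) (fun x => pair_cons_right c i h.c_symm z x)]
    simp only [hZ, LinearMap.mulRight_apply, LinearMap.mulLeft_apply]
    rw [← h.eval_mul_f]
    abel
  have h2 : antiEval g ∘ₗ snoc i = LinearMap.mulLeft K (g i) ∘ₗ antiEval (K := K) g :=
    LinearMap.ext fun z => antiEval_snoc g i z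
  have h3 : antiEval g ∘ₗ cons i = LinearMap.mulRight K (g i) ∘ₗ antiEval (K := K) g :=
    LinearMap.ext fun z => antiEval_cons g i z
  have h4 : LinearMap.mulLeft K (g i) ∘ₗ LinearMap.mulLeft K (k' i) =
      (γ i)⁻¹ • LinearMap.mulLeft K (f i) := by
    ext a
    simp only [LinearMap.comp_apply, LinearMap.mulLeft_apply, LinearMap.smul_apply, hg,
      smul_mul_assoc]
    rw [mul_assoc, ← mul_assoc (k i), h.k_k', one_mul]
  have h5 : mapMul (antiEval g) ((γ i)⁻¹ • LinearMap.mulLeft K (f i)) Z =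
      (γ i)⁻¹ • mapMul (antiEval g) (LinearMap.mulLeft K (f i)) Z := by
    rw [mapMul, TensorProduct.map_smul_right, LinearMap.comp_smul]; rfl
  rw [h2, h3, mapMul_mulLeft_comp, mapMul_mulRight_mulLeft, h4, h5, smul_sub, smul_smul,
    mul_inv_cancel₀ (hγ i), one_smul, add_sub_cancel,
    mapMul_mulRight, mapMul_mulRight] at h1
  rw [casimir, h1, ← mul_assoc, hg]
  simp only [smul_mul_assoc, smul_smul, mul_inv_cancel₀ (hγ i), one_smul]

include h hP hZ in
-- The two factors of the Casimir operator have opposite weights: the rescaling caused by `l` on one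
-- side is self-adjoint for the form and undoes the one on the other side.
theorem commute_casimir {l : A} {d : ι → K} (he : ∀ j, e j * l = d j • (l * e j))
    (hf : ∀ j, l * f j = d j • (f j * l)) (hl : ∀ j, Commute l (k j)) :
    Commute l (casimir γ f k Z) := by
  set g : ι → A := fun i => (γ i)⁻¹ • (f i * k i) with hg
  have hgl : ∀ j, l * g j = d j • (g j * l) := fun j => by
    simp only [hg, mul_smul_comm, smul_mul_assoc]
    rw [smul_comm, ← mul_assoc, hf, smul_mul_assoc, mul_assoc, (hl j).eq, mul_assoc]
  have h1 : LinearMap.mulLeft K l ∘ₗ antiEval g =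
      LinearMap.mulRight K l ∘ₗ antiEval g ∘ₗ scale d := by
    refine LinearMap.ext fun z => ?_
    apply op_injective
    exact eval_mul_comm (x := fun i => op (g i)) (k := op l) (d := d)
      (fun j => congrArg op (hgl j)) z
  have h2 : mapMul (antiEval g ∘ₗ scale d) (LinearMap.mulLeft K l) Z =
      mapMul (antiEval g) (LinearMap.mulRight K l) Z := by
    refine h.mapMul_comp_congr hZ hP (b := scale d)
        (fun z x => (pair_scale d c z x).symm) fun z => ?_
    exact (eval_mul_comm he z).symm
  rw [← LinearMap.comp_id (LinearMap.mulLeft K l), mapMul_mulRight, ← mapMul_mulRight_mulLeft,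
    ← h1, mapMul_mulLeft_comp] at h2
  exact h2

end

end IsTriple

end Casimir

end QG

end

/-! ### The Casimir operator modulo a submodule; nilpotency on words -/

noncomputable section

namespace QG

open Words MulOpposite

theorem apply_mem_of_words {K ι V : Type*} [Field K] [AddCommGroup V] [Module K V]
    {P : (List ι →₀ K) →ₗ[K] Module.End K V} {S : Submodule K V} {y : V}
    (h : ∀ w, w ≠ [] → P (Finsupp.single w 1) y ∈ S) {z : List ι →₀ K} (hz : z [] = 0) :
    P z y ∈ S := by
  rw [← Finsupp.sum_single z, Finsupp.sum, map_sum, LinearMap.sum_apply]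
  refine Submodule.sum_mem _ fun w hw => ?_
  have hw0 : w ≠ [] := fun h0 => (Finsupp.mem_support_iff.mp hw) (h0 ▸ hz)
  have : Finsupp.single w (z w) = z w • Finsupp.single w (1 : K) := by simp
  rw [this, map_smul, LinearMap.smul_apply]
  exact S.smul_mem _ (h w hw0)

/-- A Nakayama-type argument: iterating the hypothesis places `W` in the sum of its images under
words of any prescribed length, and long words are zero. -/
theorem eq_bot_of_le_iSup_map {K ι V : Type*} [Field K] [AddCommGroup V] [Module K V]
    {x : ι → Module.End K V} {N : ℕ} (hN : ∀ w : List ι, N ≤ w.length → (w.map x).prod = 0)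
    {W : Submodule K V} (hW : W ≤ ⨆ i, W.map (x i)) : W = ⊥ := by
  have h : ∀ r, W ≤ ⨆ (w : List ι) (_ : w.length = r), W.map (w.map x).prod := by
    intro r
    induction r with
    | zero =>
      refine le_iSup₂_of_le [] rfl ?_
      rw [List.map_nil, List.prod_nil]
      exact (Submodule.map_id W).ge
    | succ r ih =>
      refine hW.trans (iSup_le fun i => (Submodule.map_mono ih).trans ?_)
      simp only [Submodule.map_iSup]
      refine iSup₂_le fun w hw => le_iSup₂_of_le (i :: w) (by simp [hw]) ?_
      rw [List.map_cons, List.prod_cons, Module.End.mul_eq_comp, Submodule.map_comp]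
  rw [eq_bot_iff]
  refine (h N).trans (iSup₂_le fun w hw => ?_)
  rw [hN w hw.ge]
  simp

namespace IsTriple

/-- If all `e_i x` lie in the stable subspace `N`, the Casimir operator fixes `x` modulo `N`. -/
theorem casimir_sub_mem {K ι V : Type*} [Field K] [DecidableEq ι] [AddCommGroup V] [Module K V]
    {c : ι → ι → K} {γ : ι → K} {e f k k' : ι → Module.End K V} (h : IsTriple c γ e f k k')
    {Z : (List ι →₀ K) ⊗[K] Module.End K V}
    (hZ : ∀ z, contract c (Module.End K V) z Z = eval e z)
    (hP : ∀ z ∈ radical c, antiEval (K := K) (fun i => (γ i)⁻¹ • (f i * k i)) z = 0)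
    {N : Submodule K V} (he : ∀ i, ∀ y ∈ N, e i y ∈ N) (hf : ∀ i, ∀ y ∈ N, f i y ∈ N)
    (hk : ∀ i, ∀ y ∈ N, k i y ∈ N) {x : V} (hx : ∀ i, e i x ∈ N) :
    casimir γ f k Z x - x ∈ N := by
  set g : ι → Module.End K V := fun i => (γ i)⁻¹ • (f i * k i) with hg
  have hgN : ∀ z : List ι →₀ K, ∀ y ∈ N, antiEval g z y ∈ N := by
    intro z y hy
    have hw : ∀ w, antiEval (K := K) g (Finsupp.single w 1) y ∈ N := by
      intro w
      induction w using List.reverseRecOn with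
      | nil => rw [antiEval_nil]; exact hy
      | append_singleton w i ih =>
        rw [← snoc_single, antiEval_snoc]
        exact N.smul_mem _ (hf i _ (hk i _ ih))
    rw [← Finsupp.sum_single z, Finsupp.sum, map_sum, LinearMap.sum_apply]
    refine Submodule.sum_mem _ fun w _ => ?_
    have : Finsupp.single w (z w) = z w • Finsupp.single w (1 : K) := by simp
    rw [this, map_smul, LinearMap.smul_apply]
    exact N.smul_mem _ (hw w)
  have heN : ∀ w, w ≠ [] → (w.map e).prod x ∈ N := by
    intro w
    induction w with
    | nil => exact fun h => absurd rfl h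
    | cons i w ih =>
      intro _
      rw [List.map_cons, List.prod_cons]
      rcases eq_or_ne w [] with rfl | h0
      · simpa using hx i
      · exact he i _ (ih h0)
  -- The first factors preserve `N` and therefore act on the quotient by `N`.
  let P : (List ι →₀ K) →ₗ[K] ((V ⧸ N) →ₗ[K] (V ⧸ N)) :=
    { toFun := fun z => N.mapQ N (antiEval g z) (hgN z)
      map_add' := fun a b => by ext; simp
      map_smul' := fun r a => by ext; simp }
  have hPr : ∀ z ∈ radical c, P z = 0 := fun z hz => by
    ext y
    change N.mkQ (antiEval g z y) = 0
    rw [hP z hz]; simp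
  let T : (List ι →₀ K) ⊗[K] Module.End K V →ₗ[K] (List ι →₀ K) ⊗[K] (V ⧸ N) :=
    (N.mkQ ∘ₗ LinearMap.applyₗ x).lTensor _
  -- Nonempty words in the `e i` send `x` into `N`. Modulo `N`, the canonical element applied to `x`
  -- has therefore the same contractions as the empty word tensor `x`.
  have hT : P.rTensor (V ⧸ N) (T Z) =
      P.rTensor (V ⧸ N) (Finsupp.single [] 1 ⊗ₜ N.mkQ x) := by
    refine rTensor_congr c h.c_symm hPr fun w => ?_
    have h1 : ∀ Z, contract c (V ⧸ N) (Finsupp.single w 1) (T Z) =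
        N.mkQ (contract c (Module.End K V) (Finsupp.single w 1) Z x) := by
      intro Z
      induction Z using TensorProduct.induction_on with
      | zero => simp
      | add x y hx hy => simp only [map_add, hx, hy, LinearMap.add_apply]
      | tmul z a => simp [T, contract_tmul]
    rw [h1, hZ, contract_tmul, eval_word, pair_symm c h.c_symm, pair_word, pairWord,
      Finsupp.lapply_apply, Finsupp.single_apply]
    split_ifs with hw
    · subst hw; simp
    · rw [zero_smul, Submodule.mkQ_apply, Submodule.Quotient.mk_eq_zero]
      exact heN w hw
  have h2 : ∀ Z, TensorProduct.lift LinearMap.id (P.rTensor (V ⧸ N) (T Z)) =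
      N.mkQ (casimir γ f k Z x) := by
    intro Z
    induction Z using TensorProduct.induction_on with
    | zero => simp [casimir]
    | add a b ha hb =>
      rw [map_add, map_add, map_add, ha, hb, casimir, casimir, casimir, map_add,
        LinearMap.add_apply, map_add]
    | tmul z a => simp [T, P, casimir, mapMul_tmul, hg]
  have h3 := h2 Z
  rw [hT, LinearMap.rTensor_tmul, TensorProduct.lift.tmul, LinearMap.id_apply] at h3
  rw [← Submodule.Quotient.mk_eq_zero, ← Submodule.mkQ_apply, map_sub, ← h3]
  change N.mkQ (antiEval g (Finsupp.single [] 1) x) - _ = 0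
  rw [antiEval_nil]
  simp

end IsTriple

/-! ### Operators and weights of a module over the quantized enveloping algebra -/

namespace Datum

variable {n : ℕ} (R : Datum n)

/-- The scalars `q^{(α_i, α_j)}`. -/
def rootχ (i j : Fin n) : ℂ := R.χ (R.α i) (R.α j)

/-- The scalars `(q_i - q_i⁻¹)⁻¹`. -/
def efScalar (i : Fin n) : ℂ := (R.qpow (R.d i) - (R.qpow (R.d i))⁻¹)⁻¹

theorem efScalar_ne_zero (i : Fin n) : R.efScalar i ≠ 0 := by
  refine inv_ne_zero (sub_ne_zero.mpr fun h => R.qpow_d_pow_ne_one i 2 (by norm_num) ?_)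
  rw [pow_two]
  conv_lhs => lhs; rw [h]
  exact inv_mul_cancel₀ (R.qpow_ne_zero _)

variable (X : HRep ℂ R.U)

/-- The action of `e_i`. -/
def actE (i : Fin n) : Module.End ℂ X.V := X.ρ (R.paramU.e i)
/-- The action of `f_i`. -/
def actF (i : Fin n) : Module.End ℂ X.V := X.ρ (R.paramU.f i)
/-- The action of `k_λ`. -/
def actK (l : R.L) : Module.End ℂ X.V := X.ρ (R.k l)
/-- The action of `(q_i - q_i⁻¹) f_i k_{α_i}`. -/
def actG (i : Fin n) : Module.End ℂ X.V := (R.efScalar i)⁻¹ • (R.actF X i * R.actK X (R.α i))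

theorem actK_mul_actE (l : R.L) (i : Fin n) :
    R.actK X l * R.actE X i = R.χ l (R.α i) • (R.actE X i * R.actK X l) := by
  have := congrArg X.ρ (R.paramU.isRep.k_e l i)
  rwa [map_mul, map_smul, map_mul] at this

theorem actK_mul_actF (l : R.L) (i : Fin n) :
    R.actK X l * R.actF X i = (R.χ l (R.α i))⁻¹ • (R.actF X i * R.actK X l) := by
  have := congrArg X.ρ (R.paramU.isRep.k_f l i)
  rwa [map_mul, map_smul, map_mul] at this

theorem actK_comm (l m : R.L) : Commute (R.actK X l) (R.actK X m) := by
  rw [Commute, SemiconjBy, actK, actK, ← map_mul, ← map_mul, (R.paramU.k_commute l m).eq]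

theorem actK_neg_mul (l : R.L) : R.actK X (-l) * R.actK X l = 1 := by
  rw [actK, actK, ← map_mul, ← map_one X.ρ]; exact congrArg X.ρ (R.paramU.k_neg_mul l)

theorem actK_mul_neg (l : R.L) : R.actK X l * R.actK X (-l) = 1 := by
  rw [actK, actK, ← map_mul, ← map_one X.ρ]; exact congrArg X.ρ (R.paramU.k_mul_neg l)

theorem rootχ_symm (i j : Fin n) : R.rootχ i j = R.rootχ j i := by
  rw [rootχ, rootχ, R.χ_root, R.χ_root, R.qpow_symm]

theorem isTriple : IsTriple R.rootχ R.efScalar (R.actE X) (R.actF X)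
    (fun i => R.actK X (R.α i)) (fun i => R.actK X (-R.α i)) where
  c_symm := R.rootχ_symm
  c_ne_zero i j := R.χ_ne_zero _ _
  k_k' i := R.actK_mul_neg X _
  k'_k i := R.actK_neg_mul X _
  k_comm i j := R.actK_comm X _ _
  k_e i j := R.actK_mul_actE X _ _
  f_k i j := by
    rw [R.actK_mul_actF, smul_smul, rootχ, mul_inv_cancel₀ (R.χ_ne_zero _ _), one_smul]
  e_f i j := by
    have := congrArg X.ρ (R.paramU.isRep.e_f i j)
    rw [map_sub, map_mul, map_mul] at this
    refine this.trans ?_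
    split_ifs with hij
    · rw [map_smul, map_sub]; rfl
    · rw [map_zero]

variable {R X}

theorem isInvariant_of_generators {W : Submodule ℂ X.V} (hk : ∀ l, ∀ x ∈ W, R.actK X l x ∈ W)
    (he : ∀ i, ∀ x ∈ W, R.actE X i x ∈ W) (hf : ∀ i, ∀ x ∈ W, R.actF X i x ∈ W) :
    R.IsInvariant X W := by
  intro u
  induction u using R.paramU.alg_induction with
  | hr r => intro x hx; rw [AlgHom.commutes]; exact W.smul_mem r hx
  | hk l => exact hk l
  | he i => exact he i
  | hf i => exact hf i
  | hmul u v hu hv => intro x hx; rw [map_mul]; exact hu _ (hv x hx)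
  | hadd u v hu hv => intro x hx; rw [map_add]; exact add_mem (hu x hx) (hv x hx)

variable (R)

/-- The height of a weight. -/
def height : R.L →+ ℚ where
  toFun m := ∑ i, (R.aℚ⁻¹.mulVec fun j => ((m : Fin n → ℤ) j : ℚ)) i
  map_zero' := by
    have : (fun j => (((0 : R.L) : Fin n → ℤ) j : ℚ)) = 0 := by funext j; simp
    rw [this, Matrix.mulVec_zero]; simp
  map_add' l m := by
    have : (fun j => (((l + m : R.L) : Fin n → ℤ) j : ℚ)) =
      (fun j => ((l : Fin n → ℤ) j : ℚ)) + fun j => ((m : Fin n → ℤ) j : ℚ) := by funext j; simp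
    rw [this, Matrix.mulVec_add]; simp [Finset.sum_add_distrib]

/-- The inverse Cartan matrix passes from fundamental-weight coordinates to simple-root coordinates,
whose sum is the height. Hence each `e_i` raises the height by one. -/
theorem height_α (j : Fin n) : R.height (R.α j) = 1 := by
  have h : R.aℚ⁻¹.mulVec (fun i => ((R.α j : Fin n → ℤ) i : ℚ)) = Pi.single j 1 := by
    rw [R.aℚ_col, ← Matrix.mulVec_single_one, Matrix.mulVec_mulVec,
      Matrix.nonsing_inv_mul _ R.isUnit_det, Matrix.one_mulVec]
  change ∑ i, (R.aℚ⁻¹.mulVec (fun i => ((R.α j : Fin n → ℤ) i : ℚ))) i = 1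
  rw [h]
  simp

theorem actE_mem {m : R.L} {x : X.V} (hx : x ∈ R.wt X m) (i : Fin n) :
    R.actE X i x ∈ R.wt X (m + R.α i) := R.e_mem_wt hx i
theorem actF_mem {m : R.L} {x : X.V} (hx : x ∈ R.wt X m) (i : Fin n) :
    R.actF X i x ∈ R.wt X (m - R.α i) := R.f_mem_wt hx i
theorem actK_apply {m : R.L} {x : X.V} (hx : x ∈ R.wt X m) (l : R.L) :
    R.actK X l x = R.χ l m • x := hx l
theorem actG_mem {m : R.L} {x : X.V} (hx : x ∈ R.wt X m) (i : Fin n) :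
    R.actG X i x ∈ R.wt X (m - R.α i) := by
  rw [actG, LinearMap.smul_apply, Module.End.mul_apply, R.actK_apply hx, map_smul]
  exact Submodule.smul_mem _ _ (Submodule.smul_mem _ _ (R.actF_mem hx i))

theorem finite_weights (hX : Module.Finite ℂ X.V) : {m | R.wt X m ≠ ⊥}.Finite :=
  WellFoundedGT.finite_ne_bot_of_iSupIndep (R.iSupIndep_wt X)

/-- Long words in operators shifting weights in the same direction vanish. -/
theorem exists_nilpotent (hX : Module.Finite ℂ X.V) (hwt : ⨆ m, R.wt X m = ⊤)
    {x : Fin n → Module.End ℂ X.V} (t : R.L →+ ℚ) {δ : Fin n → R.L} (hδ : ∀ i, t (δ i) = 1)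
    (hx : ∀ i, ∀ {m v}, v ∈ R.wt X m → x i v ∈ R.wt X (m + δ i)) :
    ∃ N : ℕ, ∀ w : List (Fin n), N ≤ w.length → (w.map x).prod = 0 := by
  obtain ⟨B, hB⟩ := ((R.finite_weights hX).image fun m => |t m|).bddAbove
  -- On the finitely many occurring weights `t` takes values in `[-B, B]`, while a word of length
  -- `N` shifts `t` by `N`; beyond `2 * B` no weight is left.
  obtain ⟨N, hN⟩ := exists_nat_gt (2 * B)
  refine ⟨N, fun w hw => ?_⟩
  have h1 : ∀ (w : List (Fin n)) (m : R.L) (v : X.V), v ∈ R.wt X m → ∃ m', t m' = t m + w.length ∧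
      (w.map x).prod v ∈ R.wt X m' := by
    intro w m v hv
    induction w with
    | nil => exact ⟨m, by simp, by simpa using hv⟩
    | cons i w ih =>
      obtain ⟨m', h1, h2⟩ := ih
      refine ⟨m' + δ i, ?_, hx i h2⟩
      rw [map_add, h1, hδ]
      push_cast [List.length_cons]
      ring
  rw [← LinearMap.ker_eq_top, eq_top_iff, ← hwt]
  refine iSup_le fun m v hv => ?_
  rw [LinearMap.mem_ker]
  obtain ⟨m', h2, h3⟩ := h1 w m v hv
  by_contra h0
  have hm : R.wt X m ≠ ⊥ := fun hb => by
    rw [hb, Submodule.mem_bot] at hv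
    rw [hv, map_zero] at h0
    exact h0 rfl
  have hm' : R.wt X m' ≠ ⊥ := fun hb => by
    rw [hb, Submodule.mem_bot] at h3
    exact h0 h3
  have b1 := hB ⟨m, hm, rfl⟩
  have b2 := hB ⟨m', hm', rfl⟩
  simp only [abs_le] at b1 b2
  have : (N : ℚ) ≤ w.length := by exact_mod_cast hw
  linarith [b1.1, b2.2]

theorem exists_nilpotent_actE (hX : Module.Finite ℂ X.V) (hwt : ⨆ m, R.wt X m = ⊤) :
    ∃ N : ℕ, ∀ w : List (Fin n), N ≤ w.length → (w.map (R.actE X)).prod = 0 :=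
  R.exists_nilpotent hX hwt R.height R.height_α fun i _ _ hv => R.actE_mem hv i

theorem exists_nilpotent_actF (hX : Module.Finite ℂ X.V) (hwt : ⨆ m, R.wt X m = ⊤) :
    ∃ N : ℕ, ∀ w : List (Fin n), N ≤ w.length → (w.map (R.actF X)).prod = 0 :=
  R.exists_nilpotent hX hwt (-R.height) (δ := fun i => -R.α i)
    (fun i => by simp [R.height_α]) fun i m v hv => by
      rw [← sub_eq_add_neg]; exact R.actF_mem hv i

theorem exists_nilpotent_actG (hX : Module.Finite ℂ X.V) (hwt : ⨆ m, R.wt X m = ⊤) :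
    ∃ N : ℕ, ∀ w : List (Fin n), N ≤ w.length → (w.map (R.actG X)).prod = 0 :=
  R.exists_nilpotent hX hwt (-R.height) (δ := fun i => -R.α i)
    (fun i => by simp [R.height_α]) fun i m v hv => by
      rw [← sub_eq_add_neg]; exact R.actG_mem hv i

end Datum

end QG

end

/-! ### Vanishing of the radical on modules in `Cq` -/

noncomputable section

namespace QG

open Words MulOpposite CategoryTheory

namespace Datum

variable {n : ℕ} (R : Datum n) {X : HRep ℂ R.U}

theorem actK_mul_eval (l : R.L) (z : List (Fin n) →₀ ℂ) : R.actK X l * eval (R.actE X) z =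
    eval (R.actE X) (scale (fun j => R.χ l (R.α j)) z) * R.actK X l :=
  commute_eval (fun j => R.actK_mul_actE X l j) z

theorem actK_mul_actG (l : R.L) (j : Fin n) :
    R.actK X l * R.actG X j = (R.χ l (R.α j))⁻¹ • (R.actG X j * R.actK X l) := by
  rw [actG, mul_smul_comm, smul_mul_assoc, ← mul_assoc, R.actK_mul_actF, smul_mul_assoc, smul_comm,
    mul_assoc, (R.actK_comm X l _).eq, mul_assoc]

theorem actK_mul_antiEval (l : R.L) (z : List (Fin n) →₀ ℂ) :
    R.actK X l * antiEval (R.actG X) z =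
      antiEval (R.actG X) (scale (fun j => (R.χ l (R.α j))⁻¹) z) * R.actK X l := by
  apply op_injective
  exact eval_mul_comm (x := fun i => op (R.actG X i)) (k := op (R.actK X l))
    (fun j => congrArg op (R.actK_mul_actG l j)) z

theorem actF_eq (i : Fin n) : R.actF X i = R.efScalar i • (R.actG X i * R.actK X (-R.α i)) := by
  rw [actG, smul_mul_assoc, smul_smul, mul_inv_cancel₀ (R.efScalar_ne_zero i), one_smul, mul_assoc,
    R.actK_mul_neg, mul_one]

/-- The subspace spanned by `P(z) x` for `z` in the radical and `x ∈ W`. -/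
def radicalSpan (P : (List (Fin n) →₀ ℂ) →ₗ[ℂ] Module.End ℂ X.V) (W : Submodule ℂ X.V) :
    Submodule ℂ X.V := Submodule.span ℂ {y | ∃ z ∈ radical R.rootχ, ∃ x ∈ W, P z x = y}

theorem mem_radicalSpan {P : (List (Fin n) →₀ ℂ) →ₗ[ℂ] Module.End ℂ X.V} {W : Submodule ℂ X.V}
    {z : List (Fin n) →₀ ℂ} (hz : z ∈ radical R.rootχ) {x : X.V} (hx : x ∈ W) :
    P z x ∈ R.radicalSpan P W := Submodule.subset_span ⟨z, hz, x, hx, rfl⟩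

theorem radicalSpan_stable {P : (List (Fin n) →₀ ℂ) →ₗ[ℂ] Module.End ℂ X.V} {W : Submodule ℂ X.V}
    {T : Module.End ℂ X.V}
    (h : ∀ z ∈ radical R.rootχ, ∀ x ∈ W, T (P z x) ∈ R.radicalSpan P W) :
    ∀ y ∈ R.radicalSpan P W, T y ∈ R.radicalSpan P W := by
  intro y hy
  have : R.radicalSpan P W ≤ (R.radicalSpan P W).comap T := by
    refine Submodule.span_le.mpr ?_
    rintro _ ⟨z, hz, x, hx, rfl⟩
    exact h z hz x hx
  exact this hy

/-- The radical is stable under prepending letters, which handles `e_i`, and under rescalings, which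
handles the torus. For `f_i` the commutator formula leaves the two derivations, which preserve the
radical too. -/
theorem isInvariant_radicalSpan_eval {W : Submodule ℂ X.V} (hW : R.IsInvariant X W) :
    R.IsInvariant X (R.radicalSpan (eval (R.actE X)) W) := by
  have hk : ∀ l, ∀ y ∈ R.radicalSpan (eval (R.actE X)) W,
      R.actK X l y ∈ R.radicalSpan (eval (R.actE X)) W := fun l =>
    R.radicalSpan_stable fun z hz x hx => by
      rw [← Module.End.mul_apply, R.actK_mul_eval]
      exact R.mem_radicalSpan (scale_mem_radical hz _) (hW _ _ hx)
  refine isInvariant_of_generators hk (fun i => R.radicalSpan_stable fun z hz x hx => ?_)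
    fun i => R.radicalSpan_stable fun z hz x hx => ?_
  · rw [← Module.End.mul_apply, ← eval_cons]
    exact R.mem_radicalSpan (cons_mem_radical hz i) hx
  · have h := (R.isTriple X).eval_mul_f i z
    rw [sub_eq_iff_eq_add, ← sub_eq_iff_eq_add'] at h
    rw [← Module.End.mul_apply, ← h, LinearMap.sub_apply, LinearMap.smul_apply,
      LinearMap.sub_apply]
    refine sub_mem (R.mem_radicalSpan hz (hW _ _ hx)) (Submodule.smul_mem _ _ (sub_mem ?_ ?_))
    · exact R.mem_radicalSpan (derivR_mem_radical R.rootχ_symm hz i) (hW _ _ hx)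
    · exact hk _ _ (R.mem_radicalSpan (derivL_mem_radical R.rootχ_symm hz i) hx)

/-- On this side words are read backwards, so appending a letter is left multiplication by `actG`.
The operator `f_i` is a torus multiple of `actG`, and `e_i` is controlled by `mul_antiEval`. -/
theorem isInvariant_radicalSpan_antiEval {W : Submodule ℂ X.V} (hW : R.IsInvariant X W) :
    R.IsInvariant X (R.radicalSpan (antiEval (R.actG X)) W) := by
  have hk : ∀ l, ∀ y ∈ R.radicalSpan (antiEval (R.actG X)) W,
      R.actK X l y ∈ R.radicalSpan (antiEval (R.actG X)) W := fun l =>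
    R.radicalSpan_stable fun z hz x hx => by
      rw [← Module.End.mul_apply, R.actK_mul_antiEval]
      exact R.mem_radicalSpan (scale_mem_radical hz _) (hW _ _ hx)
  have hg : ∀ i, ∀ y ∈ R.radicalSpan (antiEval (R.actG X)) W,
      R.actG X i y ∈ R.radicalSpan (antiEval (R.actG X)) W := fun i =>
    R.radicalSpan_stable fun z hz x hx => by
      rw [← Module.End.mul_apply, ← antiEval_snoc]
      exact R.mem_radicalSpan (snoc_mem_radical R.rootχ_symm hz i) hx
  refine isInvariant_of_generators hk (fun i => R.radicalSpan_stable fun z hz x hx => ?_)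
    fun i y hy => ?_
  · have h := (R.isTriple X).mul_antiEval R.efScalar_ne_zero i z
    have h2 : R.actE X i = R.actK X (R.α i) * (R.actK X (-R.α i) * R.actE X i) := by
      rw [← mul_assoc, R.actK_mul_neg, one_mul]
    rw [h2, Module.End.mul_apply]
    refine hk _ _ ?_
    rw [← Module.End.mul_apply]
    change (R.actK X (-R.α i) * R.actE X i * antiEval (fun i => (R.efScalar i)⁻¹ •
      (R.actF X i * R.actK X (R.α i))) z) x ∈ _
    rw [h, LinearMap.add_apply, LinearMap.sub_apply]
    refine add_mem (R.mem_radicalSpan hz (hW _ _ (hW _ _ hx))) (sub_mem ?_ ?_)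
    · exact hk _ _ (R.mem_radicalSpan (derivR_mem_radical R.rootχ_symm hz i) hx)
    · exact R.mem_radicalSpan (derivL_mem_radical R.rootχ_symm hz i) (hW _ _ hx)
  · rw [R.actF_eq, LinearMap.smul_apply]
    exact Submodule.smul_mem _ _ (hg i _ (hk _ _ hy))

/-- The elements of the radical act by zero. -/
structure IsRadicalFree (X : HRep ℂ R.U) : Prop where
  eval_eq_zero : ∀ z ∈ radical R.rootχ, eval (R.actE X) z = 0
  antiEval_eq_zero : ∀ z ∈ radical R.rootχ, antiEval (R.actG X) z = 0

/-- Elements of the radical have no constant term, so only nonempty words have to be checked. -/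
theorem radicalSpan_le {P : (List (Fin n) →₀ ℂ) →ₗ[ℂ] Module.End ℂ X.V} {W S : Submodule ℂ X.V}
    (h : ∀ w, w ≠ [] → ∀ x ∈ W, P (Finsupp.single w 1) x ∈ S) : R.radicalSpan P W ≤ S := by
  refine Submodule.span_le.mpr ?_
  rintro _ ⟨z, hz, x, hx, rfl⟩
  exact apply_mem_of_words (fun w hw => h w hw x hx) (apply_nil_of_mem_radical hz R.rootχ_symm)

theorem IsInvariant.eval_mem {W : Submodule ℂ X.V} (hW : R.IsInvariant X W)
    (w : List (Fin n)) {x : X.V} (hx : x ∈ W) : eval (K := ℂ) (R.actE X) (Finsupp.single w 1) x ∈ W := by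
  rw [eval_word]
  induction w with
  | nil => exact hx
  | cons i w ih =>
    rw [List.map_cons, List.prod_cons]
    exact hW _ _ ih

theorem IsInvariant.actG_mem {W : Submodule ℂ X.V} (hW : R.IsInvariant X W)
    (i : Fin n) {x : X.V} (hx : x ∈ W) : R.actG X i x ∈ W :=
  W.smul_mem _ (hW _ _ (hW _ _ hx))

theorem IsInvariant.antiEval_mem {W : Submodule ℂ X.V} (hW : R.IsInvariant X W)
    (w : List (Fin n)) {x : X.V} (hx : x ∈ W) :
    antiEval (K := ℂ) (R.actG X) (Finsupp.single w 1) x ∈ W := by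
  induction w using List.reverseRecOn with
  | nil => rw [antiEval_nil]; exact hx
  | append_singleton w i ih =>
    rw [← snoc_single, antiEval_snoc]
    exact IsInvariant.actG_mem R hW i ih

/-- The span is a submodule of `W` contained in `∑ e_i W`. By simplicity it is zero or equal to `W`;
in the latter case `W ≤ ∑ e_i W`, and nilpotency of long words makes `W` itself zero. -/
theorem radicalSpan_eval_eq_bot (hX : Module.Finite ℂ X.V) (hwt : ⨆ m, R.wt X m = ⊤)
    {W : Submodule ℂ X.V} (hW : R.IsInvariant X W)
    (hs : ∀ N ≤ W, R.IsInvariant X N → N = ⊥ ∨ N = W) :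
    R.radicalSpan (eval (R.actE X)) W = ⊥ := by
  have hle : R.radicalSpan (eval (R.actE X)) W ≤ ⨆ i, W.map (R.actE X i) := by
    refine R.radicalSpan_le fun w hw x hx => ?_
    cases w with
    | nil => exact absurd rfl hw
    | cons i w =>
      rw [← cons_single, eval_cons]
      exact Submodule.mem_iSup_of_mem i ⟨_, IsInvariant.eval_mem R hW w hx, rfl⟩
  rcases hs _ (R.radicalSpan_le fun w _ x hx => IsInvariant.eval_mem R hW w hx)
    (R.isInvariant_radicalSpan_eval hW) with h | h
  · exact h
  · obtain ⟨N, hN⟩ := R.exists_nilpotent_actE hX hwt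
    rw [h]
    exact eq_bot_of_le_iSup_map hN (h.ge.trans hle)

theorem radicalSpan_antiEval_eq_bot (hX : Module.Finite ℂ X.V) (hwt : ⨆ m, R.wt X m = ⊤)
    {W : Submodule ℂ X.V} (hW : R.IsInvariant X W)
    (hs : ∀ N ≤ W, R.IsInvariant X N → N = ⊥ ∨ N = W) :
    R.radicalSpan (antiEval (R.actG X)) W = ⊥ := by
  have hle : R.radicalSpan (antiEval (R.actG X)) W ≤ ⨆ i, W.map (R.actG X i) := by
    refine R.radicalSpan_le fun w hw x hx => ?_
    induction w using List.reverseRecOn with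
    | nil => exact absurd rfl hw
    | append_singleton w i ih =>
      rw [← snoc_single, antiEval_snoc]
      exact Submodule.mem_iSup_of_mem i ⟨_, IsInvariant.antiEval_mem R hW w hx, rfl⟩
  rcases hs _ (R.radicalSpan_le fun w _ x hx => IsInvariant.antiEval_mem R hW w hx)
    (R.isInvariant_radicalSpan_antiEval hW) with h | h
  · exact h
  · obtain ⟨N, hN⟩ := R.exists_nilpotent_actG hX hwt
    rw [h]
    exact eq_bot_of_le_iSup_map hN (h.ge.trans hle)

/-- The assertion may be checked on each simple summand. It makes the relations of the radical
available without knowing that they are generated by the quantum Serre relations. -/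
theorem Cq.isRadicalFree (hX : R.Cq X) : R.IsRadicalFree X := by
  have hwt := Cq.iSup_wt R hX
  obtain ⟨hfin, r, W, l, hW, h⟩ := hX
  have key : ∀ P : (List (Fin n) →₀ ℂ) →ₗ[ℂ] Module.End ℂ X.V,
      (∀ s, R.radicalSpan P (W s) = ⊥) → ∀ z ∈ radical R.rootχ, P z = 0 := by
    intro P hP z hz
    rw [← LinearMap.ker_eq_top, eq_top_iff, ← hW.submodule_iSup_eq_top]
    refine iSup_le fun s x hx => ?_
    have := R.mem_radicalSpan (P := P) hz hx
    rw [hP, Submodule.mem_bot] at this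
    exact this
  exact ⟨key _ fun s => R.radicalSpan_eval_eq_bot hfin hwt (h s).2.invariant (h s).2.simple,
    key _ fun s => R.radicalSpan_antiEval_eq_bot hfin hwt (h s).2.invariant (h s).2.simple⟩

/-! ### Tensor products -/

/-- The algebra map `End V ⊗ End W → End (V ⊗ W)`. -/
def endTensor (V W : Type) [AddCommGroup V] [Module ℂ V] [AddCommGroup W] [Module ℂ W] :
    Module.End ℂ V ⊗[ℂ] Module.End ℂ W →ₐ[ℂ] Module.End ℂ (V ⊗[ℂ] W) :=
  Module.endTensorEndAlgHom (R := ℂ) (S := ℂ) (A := ℂ) (M := V) (N := W)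

open MonoidalCategory in
theorem tensor_ρ (X Y : HRep ℂ R.U) (u : R.U) : (X ⊗ Y : HRep ℂ R.U).ρ u =
    endTensor X.V Y.V (Algebra.TensorProduct.map X.ρ Y.ρ (Coalgebra.comul (R := ℂ) u)) := rfl

open MonoidalCategory in
-- Both `e_i` and `g_i = (q_i - q_i⁻¹) f_i k_{α_i}` have coproduct of the shape `x_i ⊗ 1 + k_{α_i} ⊗
-- x_i`, so the coideal property in the form `eval_tensor_eq_zero` applies to each, for `g_i` in the
-- opposite algebras.
theorem IsRadicalFree.tensor {X Y : HRep ℂ R.U} (hX : R.IsRadicalFree X)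
    (hY : R.IsRadicalFree Y) : R.IsRadicalFree (X ⊗ Y) where
  eval_eq_zero z hz := by
    have h := eval_tensor_eq_zero R.rootχ (x := R.actE X) (k := fun i => R.actK X (R.α i))
      (y := R.actE Y) (fun i j => R.actK_comm X _ _) (fun i j => R.actK_mul_actE X _ _)
      hX.eval_eq_zero hY.eval_eq_zero hz
    have h2 := map_eval (K := ℂ) (A := Module.End ℂ X.V ⊗[ℂ] Module.End ℂ Y.V)
      (B := Module.End ℂ (X.V ⊗[ℂ] Y.V)) (endTensor X.V Y.V)
      (fun i => R.actE X i ⊗ₜ 1 + R.actK X (R.α i) ⊗ₜ R.actE Y i) z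
    rw [h, map_zero] at h2
    replace h2 := h2.symm
    refine Eq.trans ?_ h2
    congr 2
    funext i
    rw [actE, tensor_ρ, QParam.comul_e, map_add, Algebra.TensorProduct.map_tmul,
      Algebra.TensorProduct.map_tmul, map_one]
    rfl
  antiEval_eq_zero z hz := by
    have h := eval_tensor_eq_zero R.rootχ (x := fun i => op (R.actG X i))
      (k := fun i => op (R.actK X (R.α i)))
      (y := fun i => op (R.actG Y i))
      (fun i j => by rw [Commute, SemiconjBy, ← op_mul, ← op_mul, (R.actK_comm X _ _).eq])
      (fun i j => by
        rw [← op_mul, ← op_mul, R.actK_mul_actG, ← op_smul, smul_smul]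
        rw [rootχ, mul_inv_cancel₀ (R.χ_ne_zero _ _), one_smul])
      (fun z hz => congrArg op (hX.antiEval_eq_zero z hz))
      (fun z hz => congrArg op (hY.antiEval_eq_zero z hz)) hz
    -- Words in the `g_i` are evaluated in reverse order, so the comparison with endomorphisms of
    -- the tensor product goes through opposite algebras.
    let Φ := (AlgHom.op (endTensor X.V Y.V)).comp
      (Algebra.TensorProduct.opAlgEquiv ℂ ℂ _ _).toAlgHom
    have h2 := map_eval (K := ℂ) (A := (Module.End ℂ X.V)ᵐᵒᵖ ⊗[ℂ] (Module.End ℂ Y.V)ᵐᵒᵖ)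
      (B := (Module.End ℂ (X.V ⊗[ℂ] Y.V))ᵐᵒᵖ) Φ
      (fun i => op (R.actG X i) ⊗ₜ 1 + op (R.actK X (R.α i)) ⊗ₜ op (R.actG Y i)) z
    rw [h, map_zero] at h2
    replace h2 := h2.symm
    apply op_injective
    rw [op_antiEval]
    refine Eq.trans ?_ h2
    congr 2
    funext i
    apply unop_injective
    -- Multiplying `Δ f_i = f_i ⊗ k_{α_i}⁻¹ + 1 ⊗ f_i` by `k_{α_i} ⊗ k_{α_i}` cancels the torus
    -- element in the second factor of the first term.
    have h3 : R.actG (X ⊗ Y) i = endTensor X.V Y.V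
        (R.actG X i ⊗ₜ 1 + R.actK X (R.α i) ⊗ₜ R.actG Y i) := by
      rw [actG, actF, actK, tensor_ρ, tensor_ρ, ← map_mul, ← map_mul, QParam.comul_f,
        R.comul_k, ← map_smul]
      congr 1
      rw [add_mul, map_add, Algebra.TensorProduct.tmul_mul_tmul, Algebra.TensorProduct.tmul_mul_tmul,
        Algebra.TensorProduct.map_tmul, Algebra.TensorProduct.map_tmul, one_mul, map_mul, map_mul,
        smul_add, TensorProduct.smul_tmul', ← TensorProduct.tmul_smul]
      congr 2
      · exact R.actK_neg_mul Y (R.α i)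
      · rw [map_mul]; rfl
    rw [h3]
    rfl

open MonoidalCategory in
theorem isRadicalFree_unit : R.IsRadicalFree (𝟙_ (HRep ℂ R.U)) where
  eval_eq_zero z hz := by
    have h : ∀ w, w ≠ [] → ∀ x, eval (K := ℂ) (R.actE (𝟙_ (HRep ℂ R.U))) (Finsupp.single w 1) x ∈
        (⊥ : Submodule ℂ ℂ) := by
      intro w hw x
      cases w with
      | nil => exact absurd rfl hw
      | cons i w =>
        rw [← cons_single, eval_cons]
        exact (congrArg (· * _) (R.paramU.counit_e i)).trans (zero_mul _)
    refine LinearMap.ext fun x => ?_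
    exact apply_mem_of_words (S := ⊥) (fun w hw => h w hw x)
      (apply_nil_of_mem_radical hz R.rootχ_symm)
  antiEval_eq_zero z hz := by
    have h : ∀ w, w ≠ [] → ∀ x, antiEval (K := ℂ) (R.actG (𝟙_ (HRep ℂ R.U)))
        (Finsupp.single w 1) x ∈ (⊥ : Submodule ℂ ℂ) := by
      intro w hw x
      induction w using List.reverseRecOn with
      | nil => exact absurd rfl hw
      | append_singleton w i ih =>
        rw [← snoc_single, antiEval_snoc]
        refine Submodule.smul_mem _ _ ?_
        exact (congrArg (· * _) (R.paramU.counit_f i)).trans (zero_mul _)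
    refine LinearMap.ext fun x => ?_
    exact apply_mem_of_words (S := ⊥) (fun w hw => h w hw x)
      (apply_nil_of_mem_radical hz R.rootχ_symm)

end Datum

end QG

end

/-! ### Complete reducibility by means of the Casimir operator -/

noncomputable section

namespace QG

open Words MulOpposite CategoryTheory

/-- A vector of degree `m` in the span of homogeneous vectors lies in the span of those of
degree `m`. -/
theorem mem_span_of_iSupIndep {K V G ι : Type*} [Field K] [AddCommGroup V] [Module K V]
    {p : G → Submodule K V} (hp : iSupIndep p) {y : ι → V} {s : Set ι} {μ : ι → G}
    (hy : ∀ w ∈ s, y w ∈ p (μ w)) {m : G} {x : V} (hx : x ∈ p m)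
    (hxs : x ∈ Submodule.span K (y '' s)) : x ∈ Submodule.span K (y '' {w ∈ s | μ w = m}) := by
  have hs : s = {w ∈ s | μ w = m} ∪ {w ∈ s | μ w ≠ m} := by
    ext w
    simp only [Set.mem_union, Set.mem_ofPred_eq]
    tauto
  rw [hs, Set.image_union, Submodule.span_union, Submodule.mem_sup] at hxs
  obtain ⟨a, ha, b, hb, rfl⟩ := hxs
  have ha' : a ∈ p m := by
    refine Submodule.span_le.mpr ?_ ha
    rintro _ ⟨w, ⟨hw, rfl⟩, rfl⟩
    exact hy w hw
  have hb' : b ∈ ⨆ (j) (_ : j ≠ m), p j := by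
    refine Submodule.span_le.mpr ?_ hb
    rintro _ ⟨w, ⟨hw, hne⟩, rfl⟩
    exact Submodule.mem_iSup_of_mem (μ w) (Submodule.mem_iSup_of_mem hne (hy w hw))
  have hb0 : b ∈ p m := by simpa using sub_mem hx ha'
  have := (Submodule.disjoint_def.mp (hp m)) b hb0 hb'
  rw [this, add_zero]
  exact ha

/-- An eigenvector in the span of eigenvectors with other eigenvalues is zero. -/
theorem eq_zero_of_eigen {V ι : Type*} [AddCommGroup V] [Module ℂ V] {C : Module.End ℂ V}
    {y : ι → V} {s : Set ι} {μ : ι → ℂ} (hy : ∀ w ∈ s, C (y w) = μ w • y w) {m : ℂ} {x : V}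
    (hx : C x = m • x) (hxs : x ∈ Submodule.span ℂ (y '' s)) (hm : ∀ w ∈ s, μ w ≠ m) : x = 0 := by
  have := mem_span_of_iSupIndep (Module.End.eigenspaces_iSupIndep C)
    (fun w hw => Module.End.mem_eigenspace_iff.mpr (hy w hw)) (Module.End.mem_eigenspace_iff.mpr hx)
    hxs
  have he : {w ∈ s | μ w = m} = ∅ := by
    ext w
    simp only [Set.mem_ofPred_eq, Set.mem_empty_iff_false, iff_false, not_and]
    exact hm w
  simpa [he] using this

namespace Datum

variable {n : ℕ} (R : Datum n) {X : HRep ℂ R.U}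

/-- Homogeneous components of elements of a submodule lie in the submodule. -/
theorem wt_mem_of_sum_mem {N : Submodule ℂ X.V} (hN : ∀ l, ∀ x ∈ N, R.actK X l x ∈ N)
    (s : Finset R.L) (x : R.L → X.V) (hx : ∀ m ∈ s, x m ∈ R.wt X m) (hs : ∑ m ∈ s, x m ∈ N) :
    ∀ m ∈ s, x m ∈ N := by
  -- The torus acts on the quotient by `N`, where eigenspaces for distinct weights are again
  -- independent. A sum of components that vanishes there vanishes termwise.
  have hi := R.iSupIndep_eigen (fun l => N.mapQ N (R.actK X l) (hN l)) fun l l' => by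
    refine LinearMap.ext fun y => ?_
    obtain ⟨y, rfl⟩ := N.mkQ_surjective y
    exact congrArg N.mkQ (LinearMap.congr_fun (R.actK_comm X l l').eq y)
  intro m hm
  rw [← Submodule.Quotient.mk_eq_zero]
  refine (iSupIndep_iff_finsetSum_eq_zero_imp_eq_zero _).mp hi s (fun m => N.mkQ (x m)) ?_ ?_ m hm
  · intro m hm l
    change N.mkQ (R.actK X l (x m)) = _
    rw [R.actK_apply (hx m hm), map_smul]
  · rw [← map_sum]
    exact (Submodule.Quotient.mk_eq_zero N).mpr hs

/-- If `M ≰ N`, some weight vector of `M` outside `N` is mapped to `N` by all `e_i`. -/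
theorem exists_singular_mod (hX : Module.Finite ℂ X.V) (hwt : ⨆ m, R.wt X m = ⊤)
    {M N : Submodule ℂ X.V} (hM : R.IsInvariant X M) (hMN : ¬ M ≤ N) :
    ∃ m, ∃ x ∈ R.wt X m, x ∈ M ∧ x ∉ N ∧ ∀ i, R.actE X i x ∈ N := by
  have hne : {m | ∃ x ∈ R.wt X m, x ∈ M ∧ x ∉ N}.Nonempty := by
    by_contra h0
    rw [Set.not_nonempty_iff_eq_empty, Set.eq_empty_iff_forall_notMem] at h0
    refine hMN fun x hx => ?_
    have hxt : x ∈ ⨆ m, R.wt X m := hwt ▸ Submodule.mem_top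
    rw [Submodule.mem_iSup_iff_exists_finsupp] at hxt
    obtain ⟨y, hy, rfl⟩ := hxt
    refine Submodule.sum_mem _ fun m hm => ?_
    by_contra h1
    exact h0 m ⟨y m, hy m, R.wt_mem_of_sum_mem (fun l => hM (R.k l)) y.support y
      (fun m _ => hy m) hx m hm, h1⟩
  have hfin : {m | ∃ x ∈ R.wt X m, x ∈ M ∧ x ∉ N}.Finite := by
    refine (R.finite_weights hX).subset ?_
    rintro m ⟨x, hx, _, hxN⟩ h0
    rw [h0, Submodule.mem_bot] at hx
    exact hxN (hx ▸ N.zero_mem)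
  -- Choose such a weight of maximal height: `e_i x` has larger height, hence cannot lie outside
  -- `N`.
  obtain ⟨m, ⟨x, hx, hxM, hxN⟩, hmax⟩ := Set.exists_max_image _ R.height hfin hne
  refine ⟨m, x, hx, hxM, hxN, fun i => ?_⟩
  by_contra h0
  have := hmax (m + R.α i) ⟨_, R.actE_mem hx i, hM _ _ hxM, h0⟩
  rw [map_add, R.height_α] at this
  linarith

theorem actF_pow_mem {m : R.L} {x : X.V} (hx : x ∈ R.wt X m) (i : Fin n) (r : ℕ) :
    (R.actF X i ^ r) x ∈ R.wt X (m - r • R.α i) := by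
  induction r with
  | zero => simpa using hx
  | succ r ih =>
    rw [pow_succ', Module.End.mul_apply, succ_nsmul, ← sub_sub]
    exact R.actF_mem ih i

theorem χ_α (i : Fin n) (m : R.L) : R.χ (R.α i) m = R.qpow (R.d i) ^ (m : Fin n → ℤ) i := by
  rw [χ, R.form_root_left, R.qpow_zpow]

/-- A weight vector that is singular modulo an invariant subspace has dominant weight. -/
theorem isDominant_of_singular_mod (hX : Module.Finite ℂ X.V) (hwt : ⨆ m, R.wt X m = ⊤)
    {N : Submodule ℂ X.V} (hN : R.IsInvariant X N) {m : R.L} {x : X.V} (hx : x ∈ R.wt X m)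
    (hxN : x ∉ N) (he : ∀ i, R.actE X i x ∈ N) : R.IsDominant m := by
  intro i
  set t := R.qpow (R.d i) with ht
  have ht0 : t ≠ 0 := R.qpow_ne_zero _
  set b := t ^ (m : Fin n → ℤ) i with hb
  have hb0 : b ≠ 0 := zpow_ne_zero _ ht0
  -- The `sl₂` computation modulo `N`: `e_i f_i^r x` is a multiple of `f_i^{r-1} x` whose
  -- coefficient is, in quantum integers at `t = q_i`, `[r] [m_i + 1 - r]`. Here `b = t^{m_i}`; for
  -- `r = 0` the truncated exponent `r - 1` is harmless, the coefficient being zero.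
  have key : ∀ r : ℕ, ∃ c : ℂ, (t - t⁻¹) * c = (t ^ r - (t ^ r)⁻¹) *
      (b * t / t ^ r - t ^ r / (b * t)) ∧
      R.actE X i ((R.actF X i ^ r) x) - (R.efScalar i * c) • (R.actF X i ^ (r - 1)) x ∈ N := by
    intro r
    induction r with
    | zero => exact ⟨0, by simp, by simpa using he i⟩
    | succ r ih =>
      obtain ⟨c, hc, h⟩ := ih
      refine ⟨c + (b / (t ^ r * t ^ r) - (t ^ r * t ^ r) / b), ?_, ?_⟩
      · rw [mul_add, hc]
        have ha : t ^ r ≠ 0 := pow_ne_zero _ ht0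
        rw [pow_succ]
        generalize t ^ r = a at *
        field_simp
        ring
      · have h1 := R.actF_pow_mem hx i r
        have h2 := (R.isTriple X).e_f i i
        rw [if_pos rfl, sub_eq_iff_eq_add] at h2
        have h3 : R.χ (R.α i) (m - r • R.α i) = b / (t ^ r * t ^ r) := by
          rw [R.χ_α, ← ht, hb, ← pow_add, ← zpow_natCast, ← zpow_sub₀ ht0]
          congr 1
          have : ((m - r • R.α i : R.L) : Fin n → ℤ) i = (m : Fin n → ℤ) i - r * R.a i i := by
            simp [α]
          rw [this, R.a_diag]
          push_cast
          ring
        have h4 : R.χ (-R.α i) (m - r • R.α i) = (t ^ r * t ^ r) / b := by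
          rw [R.χ_neg_left, h3, inv_div]
        rw [pow_succ', Module.End.mul_apply, ← Module.End.mul_apply, h2, LinearMap.add_apply,
          LinearMap.smul_apply, LinearMap.sub_apply, R.actK_apply h1, R.actK_apply h1, h3, h4,
          ← sub_smul, smul_smul, Nat.add_sub_cancel, mul_add, add_smul, add_comm,
          add_sub_add_right_eq_sub]
        -- At `r = 0` the previous coefficient vanishes and `f_i e_i x` lies in `N`; for `r > 0` the
        -- congruence is multiplied by `f_i`.
        rcases Nat.eq_zero_or_pos r with rfl | hr
        · have hc0 : c = 0 := by
            have h5 : t - t⁻¹ ≠ 0 := fun h5 => R.efScalar_ne_zero i (by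
              rw [efScalar, ← ht, h5, inv_zero])
            simpa [h5] using hc
          rw [hc0]
          have h6 : R.actF X i (R.actE X i x) ∈ N := hN (R.paramU.f i) _ (he i)
          simpa using h6
        · have h6 := hN (R.paramU.f i) _ h
          obtain ⟨r, rfl⟩ := Nat.exists_eq_add_of_lt hr
          rw [map_sub, map_smul] at h6
          rw [zero_add, pow_succ', Module.End.mul_apply]
          rw [zero_add, Nat.add_sub_cancel, pow_succ', Module.End.mul_apply] at h6
          exact h6
  obtain ⟨B, hB⟩ := R.exists_nilpotent_actF hX hwt
  have hex : ∃ r, (R.actF X i ^ r) x ∈ N := by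
    refine ⟨B, ?_⟩
    have := hB (List.replicate B i) (by simp)
    rw [List.map_replicate, List.prod_replicate] at this
    rw [this]
    exact N.zero_mem
  classical
  -- Let `r + 1` be the least exponent with `f_i^{r+1} x ∈ N`. Applying `e_i` shows that the
  -- coefficient of `f_i^r x` vanishes. As `q_i` is not a root of unity this forces `m_i = r`, which
  -- is nonnegative.
  have hpos : 0 < Nat.find hex := by
    rw [Nat.find_pos]
    simpa using hxN
  obtain ⟨r, hr⟩ := Nat.exists_eq_add_of_lt hpos
  rw [zero_add] at hr
  have h1 := Nat.find_spec hex
  have h2 : (R.actF X i ^ r) x ∉ N := Nat.find_min hex (by omega)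
  rw [hr] at h1
  obtain ⟨c, hc, h3⟩ := key (r + 1)
  rw [Nat.add_sub_cancel] at h3
  have h4 : (R.efScalar i * c) • (R.actF X i ^ r) x ∈ N := by
    have := sub_mem (hN (R.paramU.e i) _ h1) h3
    simpa [actE] using this
  have hc0 : c = 0 := by
    by_contra hc0
    exact h2 ((N.smul_mem_iff (mul_ne_zero (R.efScalar_ne_zero i) hc0)).mp h4)
  rw [hc0, mul_zero, eq_comm, mul_eq_zero] at hc
  have hroot : ∀ z : ℤ, t ^ z = 1 → z = 0 := by
    intro z hz
    by_contra h0
    rw [ht, R.qpow_zpow] at hz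
    refine R.qpow_intCast_ne_one (m := R.d i * z) (mul_ne_zero ?_ h0) ?_
    · exact_mod_cast (R.d_pos i).ne'
    · rw [← hz]; congr 1; push_cast; rfl
  have ha : t ^ (r + 1) ≠ 0 := pow_ne_zero _ ht0
  rcases hc with hc | hc
  · exfalso
    have h5 : t ^ (r + 1) * t ^ (r + 1) = 1 := by
      conv_lhs => lhs; rw [sub_eq_zero.mp hc]
      exact inv_mul_cancel₀ ha
    rw [← pow_add, ← zpow_natCast] at h5
    have := hroot _ h5
    omega
  · rw [sub_eq_zero, div_eq_div_iff ha (mul_ne_zero hb0 ht0)] at hc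
    have h5 : t ^ (2 * ((m : Fin n → ℤ) i - r)) = 1 := by
      have h6 : b * b = t ^ r * t ^ r := by
        have : (b * b) * (t * t) = (t ^ r * t ^ r) * (t * t) := by
          rw [pow_succ] at hc
          linear_combination hc
        exact mul_right_cancel₀ (mul_ne_zero ht0 ht0) this
      rw [two_mul, zpow_add₀ ht0, zpow_sub₀ ht0, ← hb, zpow_natCast, div_mul_div_comm, h6,
        div_self (mul_ne_zero (pow_ne_zero _ ht0) (pow_ne_zero _ ht0))]
    have := hroot _ h5
    omega

/-- A Casimir operator exists when the radical acts by zero. -/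
theorem exists_casimir (hX : Module.Finite ℂ X.V) (hwt : ⨆ m, R.wt X m = ⊤)
    (hrad : R.IsRadicalFree X) : ∃ C : Module.End ℂ X.V, (∀ l, Commute (R.actK X l) C) ∧
      (∀ i, R.actE X i * C = R.actK X (R.α i) * R.actK X (R.α i) * C * R.actE X i) ∧
      (∀ i, C * R.actF X i = R.actF X i * R.actK X (R.α i) * C * R.actK X (R.α i)) ∧
      ∀ N, R.IsInvariant X N → ∀ x, (∀ i, R.actE X i x ∈ N) → C x - x ∈ N := by
  obtain ⟨B, hB⟩ := R.exists_nilpotent_actE hX hwt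
  -- The relations on the `e` side and nilpotency give the canonical element; those on the `f` side
  -- make the contracted operator well behaved.
  obtain ⟨Z, hZ⟩ := exists_canonical R.rootχ hrad.eval_eq_zero hB
  have h := R.isTriple X
  refine ⟨casimir R.efScalar (R.actF X) (fun i => R.actK X (R.α i)) Z, fun l => ?_,
    h.e_mul_casimir hZ hrad.antiEval_eq_zero R.efScalar_ne_zero,
    h.casimir_mul_f hZ hrad.antiEval_eq_zero R.efScalar_ne_zero, fun N hN x hx => ?_⟩
  · refine h.commute_casimir hZ hrad.antiEval_eq_zero (d := fun j => (R.χ l (R.α j))⁻¹)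
      (fun j => ?_) (fun j => R.actK_mul_actF X l j) fun j => R.actK_comm X _ _
    rw [R.actK_mul_actE, smul_smul, inv_mul_cancel₀ (R.χ_ne_zero _ _), one_smul]
  · exact h.casimir_sub_mem hZ hrad.antiEval_eq_zero (fun i => hN _) (fun i => hN _)
      (fun i => hN _) hx

/-- The weight of a word. -/
def wordSum (w : List (Fin n)) : R.L := (w.map R.α).sum

/-- The word `f_{w_1} ⋯ f_{w_r}` applied to a vector. -/
def wordF (w : List (Fin n)) (v : X.V) : X.V := (w.map (R.actF X)).prod v

theorem wordF_cons (i : Fin n) (w : List (Fin n)) (v : X.V) :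
    R.wordF (i :: w) v = R.actF X i (R.wordF w v) := by
  rw [wordF, List.map_cons, List.prod_cons]; rfl

theorem wordF_mem {l : R.L} {v : X.V} (hv : v ∈ R.wt X l) (w : List (Fin n)) :
    R.wordF w v ∈ R.wt X (l - R.wordSum w) := by
  induction w with
  | nil => simpa [wordF, wordSum] using hv
  | cons i w ih =>
    have : l - R.wordSum (i :: w) = l - R.wordSum w - R.α i := by
      simp only [wordSum, List.map_cons, List.sum_cons]; abel
    rw [wordF_cons, this]
    exact R.actF_mem ih i

/-- The exponent of the Casimir eigenvalue on `f_{w_1} ⋯ f_{w_r} v` for `v` singular. -/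
def casimirExp (l : R.L) (w : List (Fin n)) : ℤ :=
  (w.map fun j => R.d j * (2 * (l : Fin n → ℤ) j - (R.wordSum w : Fin n → ℤ) j + 2)).sum

/-- With `m = l - wordSum w` the exponent is `(l+ρ, l+ρ) - (m+ρ, m+ρ)`. Replacing `m` by `m - α_i`
changes it by `2 (α_i, m)`, since `2 (α_i, ρ) = (α_i, α_i)`. -/
theorem casimirExp_cons (l : R.L) (i : Fin n) (w : List (Fin n)) : R.casimirExp l (i :: w) =
    R.casimirExp l w + 2 * (R.d i * (l - R.wordSum w : Fin n → ℤ) i) := by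
  have h1 : (w.map fun j => (R.d j : ℤ) * (R.α i : Fin n → ℤ) j).sum =
      R.d i * (R.wordSum w : Fin n → ℤ) i := by
    induction w with
    | nil => simp [wordSum]
    | cons j w ih =>
      rw [List.map_cons, List.sum_cons, ih, wordSum, wordSum, List.map_cons, List.sum_cons,
        AddSubgroup.coe_add, Pi.add_apply, mul_add]
      congr 1
      exact R.symm j i
  have h2 : (R.wordSum (i :: w) : Fin n → ℤ) = R.α i + R.wordSum w := by
    rw [wordSum, wordSum, List.map_cons, List.sum_cons, AddSubgroup.coe_add]
  have h3 : (R.α i : Fin n → ℤ) i = 2 := R.a_diag i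
  have h4 : (w.map fun j => (R.d j : ℤ) * (2 * (l : Fin n → ℤ) j -
        (R.wordSum (i :: w) : Fin n → ℤ) j + 2)).sum =
      (w.map fun j => (R.d j : ℤ) * (2 * (l : Fin n → ℤ) j -
        (R.wordSum w : Fin n → ℤ) j + 2)).sum -
      (w.map fun j => (R.d j : ℤ) * (R.α i : Fin n → ℤ) j).sum := by
    clear h1
    rw [h2]
    clear h2
    generalize R.wordSum w = s
    induction w with
    | nil => simp
    | cons j w ih =>
      simp only [List.map_cons, List.sum_cons, Pi.add_apply] at ih ⊢
      rw [ih]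
      ring
  rw [casimirExp, List.map_cons, List.sum_cons, h4, h1, casimirExp, h2, Pi.add_apply, h3,
    Pi.sub_apply]
  ring

/-- For `m = l - wordSum w`, the summand of a letter `j` is `d_j (l_j + m_j + 2)`, positive when `l`
and `m` are dominant. -/
theorem casimirExp_pos {l : R.L} {w : List (Fin n)} (hw : w ≠ []) (hl : R.IsDominant l)
    (hm : R.IsDominant (l - R.wordSum w)) : 0 < R.casimirExp l w := by
  refine List.sum_pos _ (fun y hy => ?_) (by simpa using hw)
  obtain ⟨j, _, rfl⟩ := List.mem_map.mp hy
  have h1 := hl j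
  have h2 := hm j
  rw [AddSubgroup.coe_sub, Pi.sub_apply] at h2
  have h3 : (0 : ℤ) < R.d j := by exact_mod_cast R.d_pos j
  refine mul_pos h3 ?_
  linarith

/-- The properties of the Casimir operator used for complete reducibility. -/
structure IsCasimir (C : Module.End ℂ X.V) : Prop where
  comm : ∀ l, Commute (R.actK X l) C
  e_mul : ∀ i, R.actE X i * C = R.actK X (R.α i) * R.actK X (R.α i) * C * R.actE X i
  mul_f : ∀ i, C * R.actF X i = R.actF X i * R.actK X (R.α i) * C * R.actK X (R.α i)
  sub_mem : ∀ N, R.IsInvariant X N → ∀ x, (∀ i, R.actE X i x ∈ N) → C x - x ∈ N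

/-- `v` is a singular vector of weight `l`. -/
structure IsSingular (v : X.V) (l : R.L) : Prop where
  mem : v ∈ R.wt X l
  e_eq_zero : ∀ i, R.actE X i v = 0

variable {R}

theorem isInvariant_bot : R.IsInvariant X ⊥ := fun u x hx => by
  rw [Submodule.mem_bot] at hx ⊢; rw [hx, map_zero]

theorem IsSingular.isDominant (hX : Module.Finite ℂ X.V) (hwt : ⨆ m, R.wt X m = ⊤) {v : X.V}
    {l : R.L} (hv : R.IsSingular v l) (h0 : v ≠ 0) : R.IsDominant l :=
  R.isDominant_of_singular_mod hX hwt isInvariant_bot hv.mem (by simpa using h0) fun i => by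
    rw [hv.e_eq_zero]; exact zero_mem _

namespace IsCasimir

variable {C : Module.End ℂ X.V} (hC : R.IsCasimir C)

include hC

theorem mem_wt {m : R.L} {x : X.V} (hx : x ∈ R.wt X m) : C x ∈ R.wt X m := fun l => by
  change (R.actK X l * C) x = _
  rw [(hC.comm l).eq, Module.End.mul_apply, R.actK_apply hx, map_smul]

theorem apply_singular {v : X.V} {l : R.L} (hv : R.IsSingular v l) : C v = v := by
  have := hC.sub_mem ⊥ isInvariant_bot v fun i => by rw [hv.e_eq_zero]; exact zero_mem _
  rwa [Submodule.mem_bot, sub_eq_zero] at this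

/-- The relation `mul_f` multiplies the eigenvalue by `q^{2 (α_i, m)}`, with `m` the weight of the
shorter vector. This is the increment of `casimirExp_cons`, starting from `1` on the singular
vector. -/
theorem apply_wordF {v : X.V} {l : R.L} (hv : R.IsSingular v l) (w : List (Fin n)) :
    C (R.wordF w v) = R.qpow (R.casimirExp l w) • R.wordF w v := by
  induction w with
  | nil =>
    have : R.casimirExp l [] = 0 := rfl
    rw [this, Int.cast_zero, R.qpow_zero, one_smul]
    exact hC.apply_singular hv
  | cons i w ih =>
    have h1 := R.wordF_mem hv.mem w
    rw [wordF_cons, ← Module.End.mul_apply, hC.mul_f]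
    simp only [Module.End.mul_apply]
    rw [R.actK_apply h1, map_smul, map_smul, ih, map_smul, map_smul, R.actK_apply h1, map_smul, map_smul,
      smul_smul, smul_smul, casimirExp_cons, χ, R.form_root_left, ← R.qpow_add,
      ← R.qpow_add]
    congr 2
    rw [AddSubgroup.coe_sub]
    push_cast
    ring

end IsCasimir

variable (R) in
theorem wordSum_ne_zero {w : List (Fin n)} (hw : w ≠ []) : R.wordSum w ≠ 0 := by
  intro h
  have h1 : ∀ w : List (Fin n), R.height (R.wordSum w) = w.length := fun w => by
    induction w with
    | nil => simp [wordSum]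
    | cons i w ih =>
      have : R.wordSum (i :: w) = R.α i + R.wordSum w := rfl
      rw [this, map_add, ih, R.height_α, List.length_cons]
      push_cast
      ring
  have h2 := h1 w
  rw [h, map_zero, eq_comm, Nat.cast_eq_zero, List.length_eq_zero_iff] at h2
  exact hw h2

/-- The submodule generated by a singular vector. -/
def cyc (R : Datum n) {X : HRep ℂ R.U} (v : X.V) : Submodule ℂ X.V :=
  Submodule.span ℂ ((fun w => R.wordF w v) '' Set.univ)

theorem wordF_mem_cyc (w : List (Fin n)) (v : X.V) : R.wordF w v ∈ cyc R v :=
  Submodule.subset_span ⟨w, trivial, rfl⟩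

theorem self_mem_cyc (v : X.V) : v ∈ cyc R v := wordF_mem_cyc [] v

/-- Only stability under `e_i` needs an argument. The commutator formula with `e` and `f`
interchanged expresses `e_i f_w v` through words in the `f_j` applied to `v` and torus elements,
because `e_i v = 0`. -/
theorem IsSingular.isInvariant_cyc {v : X.V} {l : R.L} (hv : R.IsSingular v l) :
    R.IsInvariant X (cyc R v) := by
  have hs : ∀ T : Module.End ℂ X.V, (∀ w, T (R.wordF w v) ∈ cyc R v) →
      ∀ x ∈ cyc R v, T x ∈ cyc R v := by
    intro T hT x hx
    have : cyc R v ≤ (cyc R v).comap T := by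
      refine Submodule.span_le.mpr ?_
      rintro _ ⟨w, -, rfl⟩
      exact hT w
    exact this hx
  have hk : ∀ l, ∀ x ∈ cyc R v, R.actK X l x ∈ cyc R v := fun l => hs _ fun w => by
    rw [R.actK_apply (R.wordF_mem hv.mem w)]
    exact Submodule.smul_mem _ _ (wordF_mem_cyc w v)
  have hev : ∀ z, eval (K := ℂ) (R.actF X) z v ∈ cyc R v := by
    intro z
    rw [← Finsupp.sum_single z, Finsupp.sum, map_sum, LinearMap.sum_apply]
    refine Submodule.sum_mem _ fun w _ => ?_
    have : Finsupp.single w (z w) = z w • Finsupp.single w (1 : ℂ) := by simp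
    rw [this, map_smul, LinearMap.smul_apply, eval_word]
    exact Submodule.smul_mem _ _ (wordF_mem_cyc w v)
  refine isInvariant_of_generators hk (fun i => hs _ fun w => ?_) fun i => hs _ fun w => ?_
  · have h := (R.isTriple X).eval_f_mul_e i (Finsupp.single w 1)
    rw [sub_eq_iff_eq_add, ← sub_eq_iff_eq_add'] at h
    have h2 := LinearMap.congr_fun h v
    rw [Module.End.mul_apply, eval_word] at h2
    change R.actE X i ((w.map (R.actF X)).prod v) ∈ _
    rw [← h2, LinearMap.sub_apply, LinearMap.smul_apply, LinearMap.sub_apply, Module.End.mul_apply,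
      Module.End.mul_apply, Module.End.mul_apply, hv.e_eq_zero, map_zero,
      R.actK_apply hv.mem, map_smul]
    exact sub_mem (zero_mem _) (Submodule.smul_mem _ _
      (sub_mem (Submodule.smul_mem _ _ (hev _)) (hk _ _ (hev _))))
  · rw [← wordF_cons]
    exact wordF_mem_cyc _ v

/-! ### Simple submodules generated by singular vectors -/

section Semisimple

variable (hX : Module.Finite ℂ X.V) (hwt : ⨆ m, R.wt X m = ⊤)

include hX hwt

/-- A singular vector generates a simple submodule. -/
theorem IsCasimir.simple {C : Module.End ℂ X.V} (hC : R.IsCasimir C) {v : X.V} {l : R.L}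
    (hv : R.IsSingular v l) (N : Submodule ℂ X.V) (hN : N ≤ cyc R v) (hinv : R.IsInvariant X N) :
    N = ⊥ ∨ N = cyc R v := by
  rcases eq_or_ne v 0 with rfl | hv0
  · left
    refine le_bot_iff.mp (hN.trans (Submodule.span_le.mpr ?_))
    rintro _ ⟨w, -, rfl⟩
    simp [wordF]
  by_cases h0 : N ≤ ⊥
  · exact Or.inl (le_bot_iff.mp h0)
  right
  -- Taken modulo the zero submodule, this is a genuine nonzero singular vector of `N`.
  obtain ⟨m, x, hx, hxN, hx0, hxe⟩ := R.exists_singular_mod hX hwt hinv h0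
  have hxs : R.IsSingular x m := ⟨hx, fun i => by simpa using hxe i⟩
  rw [Submodule.mem_bot] at hx0
  have hl := hv.isDominant hX hwt hv0
  have hm := hxs.isDominant hX hwt hx0
  have h1 := mem_span_of_iSupIndep (R.iSupIndep_wt X) (s := Set.univ)
    (fun w _ => R.wordF_mem hv.mem w) hx (hN hxN)
  -- If `m = l`, only the empty word contributes and `x` is a nonzero multiple of `v`. Otherwise `x`
  -- is a combination of vectors `f_w v` of weight `m`, on which the Casimir operator has
  -- eigenvalues different from `1`, although it fixes `x`.
  have hvN : v ∈ N := by
    by_cases hlm : m = l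
    · have h2 : {w ∈ (Set.univ : Set (List (Fin n))) | l - R.wordSum w = m} ⊆ {[]} := by
        rintro w ⟨-, hw⟩
        rw [Set.mem_singleton_iff]
        by_contra hw0
        exact R.wordSum_ne_zero hw0 (by rw [hlm] at hw; simpa using hw)
      have h3 := Submodule.span_mono (Set.image_mono h2) h1
      rw [Set.image_singleton, Submodule.mem_span_singleton] at h3
      obtain ⟨r, hr⟩ := h3
      have hr0 : r ≠ 0 := fun h => hx0 (by rw [← hr, h, zero_smul])
      rw [← N.smul_mem_iff hr0]
      rw [← hr] at hxN
      exact hxN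
    · exfalso
      refine hx0 (eq_zero_of_eigen (C := C) (μ := fun w => R.qpow (R.casimirExp l w))
        (fun w _ => hC.apply_wordF hv w) (m := 1) ?_ h1 ?_)
      · rw [one_smul, hC.apply_singular hxs]
      · rintro w ⟨-, hw⟩
        refine R.qpow_intCast_ne_one (R.casimirExp_pos ?_ hl (hw ▸ hm)).ne'
        rintro rfl
        exact hlm (by rw [← hw]; simp [wordSum])
  refine le_antisymm hN (Submodule.span_le.mpr ?_)
  rintro _ ⟨w, -, rfl⟩
  change R.wordF w v ∈ N
  induction w with
  | nil => exact hvN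
  | cons i w ih => rw [wordF_cons]; exact hinv _ _ ih

/-- The module is the sum of the submodules generated by its singular vectors. -/
theorem IsCasimir.span_singular {C : Module.End ℂ X.V} (hC : R.IsCasimir C) :
    ⨆ (p : {p : X.V × R.L // R.IsSingular p.1 p.2 ∧ p.1 ≠ 0}), cyc R p.1.1 = ⊤ := by
  set ι := {p : X.V × R.L // R.IsSingular p.1 p.2 ∧ p.1 ≠ 0} with hι
  set N : Submodule ℂ X.V := ⨆ (p : ι), cyc R p.1.1 with hNdef
  -- `N` is spanned by these vectors, which are at once weight vectors and Casimir eigenvectors.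
  let y : ι × List (Fin n) → X.V := fun p => R.wordF p.2 p.1.1.1
  let μ : ι × List (Fin n) → R.L := fun p => p.1.1.2 - R.wordSum p.2
  have hy : ∀ p ∈ Set.univ, y p ∈ R.wt X (μ p) := fun p _ => R.wordF_mem p.1.2.1.mem p.2
  have hNspan : N = Submodule.span ℂ (y '' Set.univ) := by
    apply le_antisymm
    · refine iSup_le fun p => Submodule.span_le.mpr ?_
      rintro _ ⟨w, -, rfl⟩
      exact Submodule.subset_span ⟨(p, w), trivial, rfl⟩
    · refine Submodule.span_le.mpr ?_
      rintro _ ⟨p, -, rfl⟩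
      exact Submodule.mem_iSup_of_mem p.1 (wordF_mem_cyc _ _)
  have hNinv : R.IsInvariant X N := by
    intro u x hx
    have : N ≤ N.comap (X.ρ u) := iSup_le fun p x hx =>
      Submodule.mem_iSup_of_mem p (p.2.1.isInvariant_cyc u x hx)
    exact this hx
  have hsing : ∀ v l, R.IsSingular v l → v ∈ N := fun v l hv => by
    rcases eq_or_ne v 0 with rfl | h0
    · exact zero_mem _
    · exact Submodule.mem_iSup_of_mem (⟨(v, l), hv, h0⟩ : ι) (self_mem_cyc v)
  have hdom : ∀ p : ι, R.IsDominant p.1.2 := fun p => p.2.1.isDominant hX hwt p.2.2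
  have hCy : ∀ p, C (y p) = R.qpow (R.casimirExp p.1.1.2 p.2) • y p := fun p =>
    hC.apply_wordF p.1.2.1 p.2
  by_contra hne
  obtain ⟨m, x, hx, -, hxN, hxe⟩ := R.exists_singular_mod (M := ⊤) (N := N) hX hwt
    (fun _ _ _ => trivial) fun h => hne (top_le_iff.mp h)
  have hm := R.isDominant_of_singular_mod hX hwt hNinv hx hxN hxe
  have h1 := hC.sub_mem N hNinv x hxe
  have h1m : C x - x ∈ R.wt X m := _root_.sub_mem (hC.mem_wt hx) hx
  rw [hNspan] at h1
  have h2 := mem_span_of_iSupIndep (R.iSupIndep_wt X) hy h1m h1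
  -- The vector `C x - x` lies in `N` and has weight `m`. Empty words contribute a singular part
  -- `a`, nonempty words a part `b`.
  have hsplit : {p ∈ Set.univ | μ p = m} ⊆
      {p : ι × List (Fin n) | μ p = m ∧ p.2 = []} ∪ {p | μ p = m ∧ p.2 ≠ []} := by
    rintro p ⟨-, hp⟩
    by_cases h : p.2 = []
    exacts [Or.inl ⟨hp, h⟩, Or.inr ⟨hp, h⟩]
  have h3 := Submodule.span_mono (Set.image_mono hsplit) h2
  rw [Set.image_union, Submodule.span_union, Submodule.mem_sup] at h3
  obtain ⟨a, ha, b, hb, hab⟩ := h3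
  have ha' : ∀ i, R.actE X i a = 0 := by
    intro i
    rw [← LinearMap.mem_ker]
    refine Submodule.span_le.mpr ?_ ha
    rintro _ ⟨⟨p, w⟩, ⟨-, rfl : w = []⟩, rfl⟩
    exact p.2.1.e_eq_zero i
  -- On nonempty words of dominant weight `m` the Casimir eigenvalue is not `1`, so `C - 1` can be
  -- inverted there.
  have hb' : b ∈ (N ⊓ R.wt X m).map (C - 1) := by
    refine Submodule.span_le.mpr ?_ hb
    rintro _ ⟨p, ⟨hp, hw⟩, rfl⟩
    have hs : R.qpow (R.casimirExp p.1.1.2 p.2) - 1 ≠ 0 := sub_ne_zero.mpr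
      (R.qpow_intCast_ne_one (R.casimirExp_pos hw (hdom p.1) (by
        change R.IsDominant (μ p); rw [hp]; exact hm)).ne')
    refine ⟨(R.qpow (R.casimirExp p.1.1.2 p.2) - 1)⁻¹ • y p, ⟨?_, ?_⟩, ?_⟩
    · rw [hNspan]
      exact Submodule.smul_mem _ _ (Submodule.subset_span ⟨p, trivial, rfl⟩)
    · exact Submodule.smul_mem _ _ (hp ▸ hy p trivial)
    · rw [map_smul, LinearMap.sub_apply, hCy, Module.End.one_apply]
      nth_rewrite 2 [← one_smul ℂ (y p)]
      rw [← sub_smul, smul_smul, inv_mul_cancel₀ hs, one_smul]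
  -- Correcting `x` by `z` does not change it modulo `N` and removes `b`: now `C (x - z) - (x - z) =
  -- a`, which all `e_i` kill.
  obtain ⟨z, ⟨hzN, hzm⟩, rfl⟩ := hb'
  have hx'm : x - z ∈ R.wt X m := _root_.sub_mem hx hzm
  have hx'C : C (x - z) = (x - z) + a := by
    rw [map_sub]
    rw [LinearMap.sub_apply, Module.End.one_apply] at hab
    have : C x = x + (a + (C z - z)) := by rw [hab]; abel
    rw [this]
    abel
  -- By `e_mul`, `e_i (x - z)` is a Casimir eigenvector in `N` of weight `m + α_i` with eigenvalue
  -- `q^{-2 (α_i, m + α_i)}`. A spanning vector `f_w v` of that weight with this eigenvalue would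
  -- give the word `i :: w` the Casimir eigenvalue `1` at the dominant weight `m`, contradicting
  -- positivity. Hence `e_i (x - z) = 0`.
  have hx' : R.IsSingular (x - z) m := by
    refine ⟨hx'm, fun i => ?_⟩
    have hzi : R.actE X i (x - z) ∈ N := by
      rw [map_sub]
      exact _root_.sub_mem (hxe i) (hNinv _ _ hzN)
    have hzwt : R.actE X i (x - z) ∈ R.wt X (m + R.α i) := R.actE_mem hx'm i
    have h4 := LinearMap.congr_fun (hC.e_mul i) (x - z)
    simp only [Module.End.mul_apply] at h4
    rw [hx'C, map_add, ha', add_zero, R.actK_apply (hC.mem_wt hzwt), map_smul,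
      R.actK_apply (hC.mem_wt hzwt), smul_smul] at h4
    set χ₀ := R.χ (R.α i) (m + R.α i) with hχ
    have hχ0 : χ₀ ≠ 0 := R.χ_ne_zero _ _
    have h5 : C (R.actE X i (x - z)) = (χ₀ * χ₀)⁻¹ • R.actE X i (x - z) := by
      conv_rhs => rw [h4]
      rw [smul_smul, inv_mul_cancel₀ (mul_ne_zero hχ0 hχ0), one_smul]
    rw [hNspan] at hzi
    refine eq_zero_of_eigen (fun p _ => hCy p) h5
      (mem_span_of_iSupIndep (R.iSupIndep_wt X) hy hzwt hzi) ?_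
    rintro p ⟨-, hp⟩ heq
    have h6 : p.1.1.2 - R.wordSum (i :: p.2) = m := by
      have : R.wordSum (i :: p.2) = R.α i + R.wordSum p.2 := rfl
      rw [this]
      have hp' : p.1.1.2 - R.wordSum p.2 = m + R.α i := hp
      rw [add_comm, ← sub_sub, hp', add_sub_cancel_right]
    refine R.qpow_intCast_ne_one (R.casimirExp_pos (l := p.1.1.2) (w := i :: p.2)
      (List.cons_ne_nil _ _) (hdom p.1) (h6.symm ▸ hm)).ne' ?_
    have h7 : ((p.1.1.2 : Fin n → ℤ) - R.wordSum p.2) i = ((m + R.α i : R.L) : Fin n → ℤ) i := by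
      rw [← AddSubgroup.coe_sub]
      exact congrArg (fun l : R.L => (l : Fin n → ℤ) i) hp
    rw [R.casimirExp_cons, h7]
    push_cast
    rw [R.qpow_add, heq, two_mul, R.qpow_add]
    have h8 : R.qpow (R.d i * ((m + R.α i : R.L) : Fin n → ℤ) i) = χ₀ := by
      rw [hχ, χ, R.form_root_left]
    rw [AddSubgroup.coe_add] at h8
    rw [h8]
    exact inv_mul_cancel₀ (mul_ne_zero hχ0 hχ0)
  refine hxN ?_
  have := add_mem (hsing _ _ hx') hzN
  simpa using this

end Semisimple

end Datum

end QG

end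

/-! ### A criterion for membership in `Cq`, and closure under tensor products -/

noncomputable section

namespace QG

open Words MulOpposite CategoryTheory

namespace HRep

variable {K H : Type} [Field K] [Ring H] [Algebra K H] (X : HRep K H)

/-- The underlying space of a representation is a module over the algebra. -/
abbrev module : Module H X.V := Module.compHom X.V (X.ρ : H →+* Module.End K X.V)

attribute [local instance] module

theorem isScalarTower : IsScalarTower K H X.V where
  smul_assoc r u x := by
    change X.ρ (r • u) x = r • X.ρ u x
    rw [map_smul, LinearMap.smul_apply]

end HRep

attribute [local instance] HRep.module HRep.isScalarTower

namespace Datum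

variable {n : ℕ} {R : Datum n} {X : HRep ℂ R.U}

/-- Invariant subspaces are submodules. -/
def IsInvariant.toSubmodule {W : Submodule ℂ X.V} (hW : R.IsInvariant X W) :
    Submodule R.U X.V where
  carrier := W
  add_mem' := W.add_mem
  zero_mem' := W.zero_mem
  smul_mem' := fun u x hx => hW u x hx

theorem isInvariant_restrictScalars (N : Submodule R.U X.V) :
    R.IsInvariant X (N.restrictScalars ℂ : Submodule ℂ X.V) := fun u _ hx => N.smul_mem u hx

/-- A finite dimensional semisimple module is a finite direct sum of simple ones. Each simple
summand contains a weight vector of maximal height, which is singular and has dominant weight. -/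
theorem Cq.of_isSemisimpleModule (hX : Module.Finite ℂ X.V) (hwt : ⨆ m, R.wt X m = ⊤)
    [IsSemisimpleModule R.U X.V] : R.Cq X := by
  have : IsNoetherian R.U X.V := isNoetherian_of_tower ℂ inferInstance
  obtain ⟨s, hs, htop, hsim⟩ := IsSemisimpleModule.exists_sSupIndep_sSup_simples_eq_top R.U X.V
  have hfin : s.Finite := WellFoundedGT.finite_of_sSupIndep hs
  have := hfin.to_subtype
  obtain ⟨r, ⟨e⟩⟩ := Finite.exists_equiv_fin s
  have hint : DirectSum.IsInternal fun j : Fin r => (e.symm j : Submodule R.U X.V) := by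
    refine DirectSum.isInternal_submodule_of_iSupIndep_of_iSup_eq_top ?_ ?_
    · exact ((sSupIndep_iff (s := s)).mp hs).comp e.symm.injective
    · rw [← htop, sSup_eq_iSup']
      exact e.symm.surjective.iSup_comp (g := fun m : s => (m : Submodule R.U X.V))
  have hhw : ∀ j : Fin r, ∃ l, R.IsDominant l ∧ R.IsSimpleHW X
      ((e.symm j : Submodule R.U X.V).restrictScalars ℂ : Submodule ℂ X.V) l := by
    intro j
    set W : Submodule R.U X.V := (e.symm j).1 with hW
    have hWs : IsSimpleModule R.U W := hsim _ (e.symm j).2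
    have hWinv := isInvariant_restrictScalars W
    have hWa : IsAtom W := isSimpleModule_iff_isAtom.mp hWs
    have hne : ¬ (W.restrictScalars ℂ : Submodule ℂ X.V) ≤ ⊥ := by
      intro h
      refine hWa.1 (le_bot_iff.mp fun x hx => ?_)
      simpa using h hx
    obtain ⟨l, v, hv, hvW, hv0, hve⟩ := R.exists_singular_mod hX hwt hWinv hne
    have hvs : R.IsSingular v l := ⟨hv, fun i => by simpa using hve i⟩
    rw [Submodule.mem_bot] at hv0
    refine ⟨l, hvs.isDominant hX hwt hv0, hWinv, fun N hN hinv => ?_,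
      v, hvW, hv0, hv, fun i => hvs.e_eq_zero i⟩
    have h1 : hinv.toSubmodule ≤ W := fun x hx => hN hx
    rcases hWa.le_iff.mp h1 with h | h
    · left
      rw [eq_bot_iff]
      intro x hx
      have : x ∈ hinv.toSubmodule := hx
      rw [h] at this
      simpa using this
    · right
      ext x
      change x ∈ hinv.toSubmodule ↔ _
      rw [h]
      rfl
  choose l hl using hhw
  exact ⟨hX, r, _, l, hint, hl⟩

/-- Complete reducibility: the radical relations give a Casimir operator, and this operator shows
that the singular vectors generate simple submodules which together span the module. Unlike the
definition of `Cq`, the three hypotheses are visibly inherited by tensor products. -/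
theorem Cq.of_isRadicalFree (hX : Module.Finite ℂ X.V) (hwt : ⨆ m, R.wt X m = ⊤)
    (hrad : R.IsRadicalFree X) : R.Cq X := by
  obtain ⟨C, h1, h2, h3, h4⟩ := R.exists_casimir hX hwt hrad
  have hC : R.IsCasimir C := ⟨h1, h2, h3, h4⟩
  have hspan := hC.span_singular hX hwt
  have : IsSemisimpleModule R.U X.V := by
    refine IsSemisimpleModule.of_sSup_simples_eq_top (top_le_iff.mp fun x _ => ?_)
    have hx : x ∈ ⨆ (p : {p : X.V × R.L // R.IsSingular p.1 p.2 ∧ p.1 ≠ 0}), cyc R p.1.1 := by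
      rw [hspan]; trivial
    set S := sSup {m : Submodule R.U X.V | IsSimpleModule R.U m} with hS
    suffices h : (⨆ (p : {p : X.V × R.L // R.IsSingular p.1 p.2 ∧ p.1 ≠ 0}), cyc R p.1.1) ≤
      (S.restrictScalars ℂ : Submodule ℂ X.V) from h hx
    refine iSup_le fun p => ?_
    have hinv := p.2.1.isInvariant_cyc
    have hle : hinv.toSubmodule ≤ S := by
      refine le_sSup ?_
      rw [Set.mem_ofPred_eq, isSimpleModule_iff_isAtom]
      refine ⟨fun h => ?_, fun N hN => ?_⟩
      · have : p.1.1 ∈ hinv.toSubmodule := self_mem_cyc _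
        rw [h] at this
        exact p.2.2 (by simpa using this)
      · have h5 : (N.restrictScalars ℂ : Submodule ℂ X.V) ≤ cyc R p.1.1 := fun y hy => hN.le hy
        rcases hC.simple hX hwt p.2.1 _ h5 (isInvariant_restrictScalars N) with h | h
        · rw [eq_bot_iff]
          intro y hy
          have : y ∈ (N.restrictScalars ℂ : Submodule ℂ X.V) := hy
          rw [h] at this
          simpa using this
        · exfalso
          refine hN.not_ge fun y hy => ?_
          have : y ∈ (N.restrictScalars ℂ : Submodule ℂ X.V) := by rw [h]; exact hy
          exact this
    exact fun y hy => hle hy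
  exact Cq.of_isSemisimpleModule hX hwt

theorem Cq.isSemisimpleModule (hX : R.Cq X) : IsSemisimpleModule R.U X.V := by
  obtain ⟨hfin, r, W, l, hW, h⟩ := hX
  refine IsSemisimpleModule.of_sSup_simples_eq_top (top_le_iff.mp fun x _ => ?_)
  have hx : x ∈ ⨆ s, W s := by rw [hW.submodule_iSup_eq_top]; trivial
  set S := sSup {m : Submodule R.U X.V | IsSimpleModule R.U m} with hS
  suffices h : (⨆ s, W s) ≤ (S.restrictScalars ℂ : Submodule ℂ X.V) from h hx
  refine iSup_le fun s => ?_
  have hle : (h s).2.invariant.toSubmodule ≤ S := by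
    refine le_sSup ?_
    rw [Set.mem_ofPred_eq, isSimpleModule_iff_isAtom]
    obtain ⟨v, hv, hv0, -⟩ := (h s).2.highest
    refine ⟨fun hb => ?_, fun N hN => ?_⟩
    · have : v ∈ (h s).2.invariant.toSubmodule := hv
      rw [hb] at this
      exact hv0 (by simpa using this)
    · have h5 : (N.restrictScalars ℂ : Submodule ℂ X.V) ≤ W s := fun y hy => hN.le hy
      rcases (h s).2.simple _ h5 (isInvariant_restrictScalars N) with h | h
      · rw [eq_bot_iff]
        intro y hy
        have : y ∈ (N.restrictScalars ℂ : Submodule ℂ X.V) := hy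
        rw [h] at this
        simpa using this
      · exfalso
        refine hN.not_ge fun y hy => ?_
        have : y ∈ (N.restrictScalars ℂ : Submodule ℂ X.V) := by rw [h]; exact hy
        exact this
  exact fun y hy => hle hy

open MonoidalCategory

theorem tmul_mem_wt {X Y : HRep ℂ R.U} {m m' : R.L} {x : X.V} {y : Y.V} (hx : x ∈ R.wt X m)
    (hy : y ∈ R.wt Y m') : x ⊗ₜ[ℂ] y ∈ R.wt (X ⊗ Y) (m + m') := by
  intro l
  change (X ⊗ Y : HRep ℂ R.U).ρ (R.k l) _ = _
  rw [tensor_ρ, R.comul_k, Algebra.TensorProduct.map_tmul]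
  change (X.ρ (R.k l) x) ⊗ₜ[ℂ] (Y.ρ (R.k l) y) = _
  rw [R.mem_wt.mp hx l, R.mem_wt.mp hy l, TensorProduct.smul_tmul_smul, R.χ_add_right]

theorem iSup_wt_tensor {X Y : HRep ℂ R.U} (hX : ⨆ m, R.wt X m = ⊤) (hY : ⨆ m, R.wt Y m = ⊤) :
    ⨆ m, R.wt (X ⊗ Y) m = ⊤ := by
  rw [eq_top_iff]
  rintro z -
  change X.V ⊗[ℂ] Y.V at z
  induction z using TensorProduct.induction_on with
  | zero => exact zero_mem _
  | add a b ha hb => exact add_mem ha hb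
  | tmul x y =>
    have hx : x ∈ ⨆ m, R.wt X m := hX ▸ Submodule.mem_top
    have hy : y ∈ ⨆ m, R.wt Y m := hY ▸ Submodule.mem_top
    induction hx using Submodule.iSup_induction' with
    | zero => rw [TensorProduct.zero_tmul]; exact zero_mem _
    | add a b _ _ ha hb => rw [TensorProduct.add_tmul]; exact add_mem ha hb
    | mem m x hx =>
    induction hy using Submodule.iSup_induction' with
    | zero => rw [TensorProduct.tmul_zero]; exact zero_mem _
    | add a b _ _ ha hb => rw [TensorProduct.tmul_add]; exact add_mem ha hb
    | mem m' y hy => exact Submodule.mem_iSup_of_mem _ (tmul_mem_wt hx hy)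

/-- Each hypothesis of `Cq.of_isRadicalFree` passes to the tensor product: dimensions multiply,
weights add, and the radical is a coideal. -/
theorem Cq.tensor {X Y : HRep ℂ R.U} (hX : R.Cq X) (hY : R.Cq Y) : R.Cq (X ⊗ Y) := by
  have := hX.1
  have := hY.1
  exact Cq.of_isRadicalFree (inferInstanceAs (Module.Finite ℂ (X.V ⊗[ℂ] Y.V)))
    (iSup_wt_tensor (Cq.iSup_wt R hX) (Cq.iSup_wt R hY))
    (IsRadicalFree.tensor R (Cq.isRadicalFree R hX) (Cq.isRadicalFree R hY))

theorem Cq.unit : R.Cq (𝟙_ (HRep ℂ R.U)) := by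
  refine Cq.of_isRadicalFree (inferInstanceAs (Module.Finite ℂ ℂ)) ?_ (R.isRadicalFree_unit)
  rw [eq_top_iff]
  rintro z -
  refine Submodule.mem_iSup_of_mem 0 fun l => ?_
  rw [R.χ_zero_right, one_smul]
  have : ∀ z : ℂ, Coalgebra.counit (R := ℂ) (R.k l) * z = z := fun z => by
    rw [R.counit_k, one_mul]
  exact this z

theorem isMonoidal_Cq : R.Cq.IsMonoidal where
  prop_unit := Cq.unit
  prop_tensor _ _ hX hY := Cq.tensor hX hY

end Datum

end QG

end

/-! ### Evaluation and coevaluation for contragredient modules -/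

noncomputable section

namespace QG

open Words MulOpposite CategoryTheory MonoidalCategory

namespace HRep

variable {K H : Type} [Field K] [Ring H] [HopfAlgebra K H]

section Duality

variable {V Z : Type} [AddCommGroup V] [Module K V] [AddCommGroup Z] [Module K Z]
  (e : Z ≃ₗ[K] Module.Dual K V)

/-- The map `v ⊗ z ↦ (y ↦ e z y • v)`. -/
def toEnd : V ⊗[K] Z →ₗ[K] Module.End K V :=
  (dualTensorHom K V V) ∘ₗ (TensorProduct.comm K V (Module.Dual K V)).toLinearMap ∘ₗ
    (e.toLinearMap.lTensor V)

theorem toEnd_tmul (v : V) (z : Z) (y : V) : toEnd e (v ⊗ₜ z) y = e z y • v := by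
  simp [toEnd]

theorem toEnd_bijective [Module.Finite K V] : Function.Bijective (toEnd e) := by
  have h1 : Function.Bijective (e.toLinearMap.lTensor V) := (e.lTensor V).bijective
  have h2 : Function.Bijective (dualTensorHom K V V) := (dualTensorHomEquiv K V V).bijective
  exact (h2.comp (TensorProduct.comm K V (Module.Dual K V)).bijective).comp h1

variable {ρ : H →ₐ[K] Module.End K V} {σ : H →ₐ[K] Module.End K Z}
  (he : ∀ u z x, e (σ u z) x = e z (ρ (HopfAlgebra.antipode K u) x))

include he

/-- Evaluation is equivariant because `S(u₁) u₂ = ε(u)`. -/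
theorem lift_tensorρ (u : H) (t : Z ⊗[K] V) :
    TensorProduct.lift e.toLinearMap (tensorρ σ ρ u t) =
      unitρ K H u (TensorProduct.lift e.toLinearMap t) := by
  have key : ∀ (w : H ⊗[K] H) (z : Z) (x : V),
      TensorProduct.lift e.toLinearMap (act₂ σ ρ w (z ⊗ₜ x)) =
      e z (ρ (LinearMap.mul' K H ((HopfAlgebra.antipode K).rTensor H w)) x) := by
    intro w z x
    induction w using TensorProduct.induction_on with
    | zero => simp
    | add a b ha hb => simp only [map_add, LinearMap.add_apply, ha, hb]
    | tmul a b => simp [act₂_tmul, he]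
  induction t using TensorProduct.induction_on with
  | zero => simp
  | add a b ha hb => simp only [map_add, ha, hb]
  | tmul z x =>
    rw [tensorρ_apply, key, HopfAlgebra.mul_antipode_rTensor_comul_apply, AlgHom.commutes,
      unitρ_apply]
    simp [Module.algebraMap_end_apply]

/-- Coevaluation is equivariant because `u₁ S(u₂) = ε(u)`: a pure tensor `a ⊗ b` acts on
endomorphisms by `ρ(a) (·) ρ(S b)`, and `t` corresponds to the identity. -/
theorem tensorρ_toEnd (u : H) {t : V ⊗[K] Z} (ht : toEnd e t = 1) :
    toEnd e (tensorρ ρ σ u t) = Coalgebra.counit (R := K) u • (1 : Module.End K V) := by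
  have key : ∀ (a b : H) (s : V ⊗[K] Z), toEnd e (act₂ ρ σ (a ⊗ₜ b) s) =
      ρ a * toEnd e s * ρ (HopfAlgebra.antipode K b) := by
    intro a b s
    induction s using TensorProduct.induction_on with
    | zero => simp
    | add x y hx hy => simp only [map_add, hx, hy, mul_add, add_mul]
    | tmul v z =>
      ext y
      simp [act₂_tmul, toEnd_tmul, he]
  have key2 : ∀ w : H ⊗[K] H, toEnd e (act₂ ρ σ w t) =
      ρ (LinearMap.mul' K H ((HopfAlgebra.antipode K).lTensor H w)) := by
    intro w
    induction w using TensorProduct.induction_on with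
    | zero => simp
    | add a b ha hb => simp only [map_add, LinearMap.add_apply, ha, hb]
    | tmul a b => simp [key, ht]
  rw [tensorρ_apply, key2, HopfAlgebra.mul_antipode_lTensor_comul_apply, AlgHom.commutes,
    Algebra.algebraMap_eq_smul_one]

end Duality

/-- A contragredient pairing of finite dimensional modules is an exact pairing. -/
theorem exists_exactPairing (X Z : HRep K H) [Module.Finite K X.V]
    (e : Z.V ≃ₗ[K] Module.Dual K X.V)
    (he : ∀ u z x, e (Z.ρ u z) x = e z (X.ρ (HopfAlgebra.antipode K u) x)) :
    Nonempty (ExactPairing X Z) := by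
  obtain ⟨t, ht⟩ := (toEnd_bijective e).2 1
  let η : 𝟙_ (HRep K H) ⟶ X ⊗ Z :=
    ⟨ModuleCat.ofHom (LinearMap.toSpanSingleton K (X.V ⊗[K] Z.V) t), fun u r => by
      change (Coalgebra.counit (R := K) u * r) • t = tensorρ X.ρ Z.ρ u (r • t)
      refine (toEnd_bijective e).1 ?_
      rw [map_smul, map_smul, map_smul, tensorρ_toEnd e he u ht, ht, smul_smul, mul_comm]⟩
  let ε : Z ⊗ X ⟶ 𝟙_ (HRep K H) :=
    ⟨ModuleCat.ofHom (TensorProduct.lift e.toLinearMap), fun u s => lift_tensorρ e he u s⟩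
  -- Both zigzag composites amount to applying the endomorphism attached to `s`; for `s = t` this is
  -- the identity.
  have h1 : ∀ (z : Z.V) (s : X.V ⊗[K] Z.V) (y : X.V), e (TensorProduct.lid K Z.V
      ((TensorProduct.lift e.toLinearMap).rTensor Z.V
        ((TensorProduct.assoc K Z.V X.V Z.V).symm (z ⊗ₜ s)))) y = e z (toEnd e s y) := by
    intro z s y
    induction s using TensorProduct.induction_on with
    | zero => simp
    | add a b ha hb => simp only [TensorProduct.tmul_add, map_add, LinearMap.add_apply, ha, hb]
    | tmul v w => simp [toEnd_tmul, mul_comm]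
  have h2 : ∀ (x : X.V) (s : X.V ⊗[K] Z.V), TensorProduct.rid K X.V
      ((TensorProduct.lift e.toLinearMap).lTensor X.V
        (TensorProduct.assoc K X.V Z.V X.V (s ⊗ₜ x))) = toEnd e s x := by
    intro x s
    induction s using TensorProduct.induction_on with
    | zero => simp
    | add a b ha hb => simp only [TensorProduct.add_tmul, map_add, LinearMap.add_apply, ha, hb]
    | tmul v w => simp [toEnd_tmul]
  refine ⟨⟨η, ε, ?_, ?_⟩⟩
  · refine hom_ext (ModuleCat.hom_ext (TensorProduct.ext' fun z r => ?_))
    change (TensorProduct.lift e.toLinearMap).rTensor Z.V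
        ((TensorProduct.assoc K Z.V X.V Z.V).symm (z ⊗ₜ (r • t))) =
      (TensorProduct.lid K Z.V).symm (r • z)
    refine (TensorProduct.lid K Z.V).injective (e.injective (LinearMap.ext fun y => ?_))
    rw [h1, LinearEquiv.apply_symm_apply, map_smul, ht]
    simp
  · refine hom_ext (ModuleCat.hom_ext (TensorProduct.ext' fun r x => ?_))
    change (TensorProduct.lift e.toLinearMap).lTensor X.V
        (TensorProduct.assoc K X.V Z.V X.V ((r • t) ⊗ₜ x)) =
      (TensorProduct.rid K X.V).symm (r • x)
    refine (TensorProduct.rid K X.V).injective ?_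
    rw [h2, LinearEquiv.apply_symm_apply, map_smul, ht]
    simp

end HRep

/-! ### Bijectivity of the antipode -/

namespace QParam

variable {n : ℕ} (P : QParam n)

/-- The antipode as an algebra map to the opposite algebra. -/
def antipodeOp : P.Alg →ₐ[ℂ] P.Algᵐᵒᵖ := lift P.isRep_antipode

/-- The square of the antipode rescales the generators; on `e_i` and `f_i` it acts as
conjugation by `k_{-κ i}` and `k_{κ' i}`. -/
theorem antipodeMap_antipodeMap_e (i : Fin n) : P.antipodeMap (P.antipodeMap (P.e i)) =
    (P.χ (-P.κ i) i) • P.e i := by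
  rw [antipodeMap_e, map_neg, antipodeMap_mul, antipodeMap_e, antipodeMap_k, neg_neg, neg_mul,
    neg_neg, P.isRep.k_e, smul_mul_assoc, mul_assoc, P.k_neg_mul, mul_one]

theorem antipodeMap_antipodeMap_f (i : Fin n) : P.antipodeMap (P.antipodeMap (P.f i)) =
    (P.χ (-P.κ' i) i)⁻¹ • P.f i := by
  rw [antipodeMap_f, map_neg, antipodeMap_mul, antipodeMap_f, antipodeMap_k, mul_neg, neg_neg,
    ← mul_assoc, P.isRep.k_f, smul_mul_assoc, mul_assoc, P.k_neg_mul, mul_one]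

end QParam

namespace QParam

variable {n : ℕ} (P : QParam n)

theorem serre_smul_smul {B : Type*} [Ring B] [Algebra ℂ B] (t a b : ℂ) (m : ℕ) (x y : B) :
    serre t m (a • x) (b • y) = (a ^ m * b) • serre t m x y := by
  rw [serre, serre, Finset.smul_sum]
  refine Finset.sum_congr rfl fun k hk => ?_
  rw [Finset.mem_range, Nat.lt_succ_iff] at hk
  simp only [smul_pow, smul_mul_assoc, mul_smul_comm, smul_smul]
  congr 1
  nth_rewrite 3 [← Nat.sub_add_cancel hk]
  rw [pow_add]
  ring

theorem IsRep.rescale {P : QParam n} {B : Type*} [Ring B] [Algebra ℂ B] {k : P.Γ → B}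
    {e f : Fin n → B} (h : P.IsRep k e f) {c : Fin n → ℂ} (hc : ∀ i, c i ≠ 0) :
    P.IsRep k (fun i => c i • e i) (fun i => (c i)⁻¹ • f i) where
  k_zero := h.k_zero
  k_add := h.k_add
  k_e g j := by rw [mul_smul_comm, h.k_e, smul_mul_assoc, smul_comm]
  k_f g j := by rw [mul_smul_comm, h.k_f, smul_mul_assoc, smul_comm]
  e_f i j := by
    rw [smul_mul_smul_comm, smul_mul_smul_comm, mul_comm (c j)⁻¹, ← smul_sub, h.e_f]
    split_ifs with hij
    · subst hij
      rw [mul_inv_cancel₀ (hc i), one_smul]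
    · rw [smul_zero]
  serre_e i j hij := by rw [serre_smul_smul, h.serre_e i j hij, smul_zero]
  serre_f i j hij := by rw [serre_smul_smul, h.serre_f i j hij, smul_zero]

/-- The inverse of the square of the antipode. -/
def antipodeSqInv : P.Alg →ₐ[ℂ] P.Alg :=
  lift (P.isRep.rescale (c := fun i => P.χ (P.κ i) i) fun _ => P.χ_ne_zero _ _)

/-- The square of the antipode fixes the torus and multiplies `e_i` and `f_i` by mutually inverse
scalars, since `κ i` and `κ' i` give `e_i` the same weight. Such a rescaling is undone by the
inverse one, which again respects the relations. -/
theorem antipodeSqInv_antipodeMap (u : P.Alg) :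
    P.antipodeSqInv (P.antipodeMap (P.antipodeMap u)) = u := by
  induction u using P.alg_induction with
  | hr r => simp [Algebra.algebraMap_eq_smul_one, antipodeMap_one]
  | hk g => rw [antipodeMap_k, antipodeMap_k, neg_neg, antipodeSqInv, lift_k]
  | he i =>
    rw [antipodeMap_antipodeMap_e, map_smul, antipodeSqInv, lift_e, smul_smul, P.χ_neg,
      inv_mul_cancel₀ (P.χ_ne_zero _ _), one_smul]
  | hf i =>
    rw [antipodeMap_antipodeMap_f, map_smul, antipodeSqInv, lift_f, smul_smul, P.χ_neg, inv_inv,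
      P.χ_κ, P.χ_κ', mul_inv_cancel₀ (zpow_ne_zero _ (P.t_ne_zero i)), one_smul]
  | hmul x y hx hy =>
    rw [antipodeMap_mul, antipodeMap_mul, map_mul, hx, hy]
  | hadd x y hx hy => simp only [map_add, hx, hy]

theorem antipodeMap_injective : Function.Injective P.antipodeMap := fun x y h => by
  rw [← P.antipodeSqInv_antipodeMap x, h, P.antipodeSqInv_antipodeMap]

theorem antipodeMap_surjective : Function.Surjective P.antipodeMap := by
  intro u
  induction u using P.alg_induction with
  | hr r => exact ⟨algebraMap ℂ _ r, by simp [Algebra.algebraMap_eq_smul_one, antipodeMap_one]⟩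
  | hk g => exact ⟨P.k (-g), by rw [antipodeMap_k, neg_neg]⟩
  | he i => exact ⟨-(P.e i * P.k (-P.κ i)), by
      rw [map_neg, antipodeMap_mul, antipodeMap_k, antipodeMap_e, neg_neg, mul_neg, neg_neg,
        ← mul_assoc, P.k_mul_neg, one_mul]⟩
  | hf i => exact ⟨-(P.k (P.κ' i) * P.f i), by
      rw [map_neg, antipodeMap_mul, antipodeMap_k, antipodeMap_f, neg_mul, neg_neg,
        mul_assoc, P.k_mul_neg, mul_one]⟩
  | hmul x y hx hy =>
    obtain ⟨x, rfl⟩ := hx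
    obtain ⟨y, rfl⟩ := hy
    exact ⟨y * x, P.antipodeMap_mul _ _⟩
  | hadd x y hx hy =>
    obtain ⟨x, rfl⟩ := hx
    obtain ⟨y, rfl⟩ := hy
    exact ⟨x + y, map_add _ _ _⟩

/-- The antipode as an anti-automorphism. -/
def antipodeEquiv : P.Alg ≃ₐ[ℂ] P.Algᵐᵒᵖ :=
  AlgEquiv.ofBijective P.antipodeOp
    ⟨fun x y h => P.antipodeMap_injective (congrArg unop h), fun y => by
      obtain ⟨x, hx⟩ := P.antipodeMap_surjective (unop y)
      exact ⟨x, unop_injective hx⟩⟩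

/-- The inverse of the antipode as an anti-automorphism. -/
def antipodeInvEquiv : P.Alg ≃ₐ[ℂ] P.Algᵐᵒᵖ := (AlgEquiv.opComm P.antipodeEquiv).symm

theorem antipode_antipodeInvEquiv (u : P.Alg) :
    HopfAlgebra.antipode ℂ (unop (P.antipodeInvEquiv u)) = u :=
  (AlgEquiv.opComm P.antipodeEquiv).apply_symm_apply u

theorem antipodeInvEquiv_antipode (u : P.Alg) :
    unop (P.antipodeInvEquiv (HopfAlgebra.antipode ℂ u)) = u :=
  P.antipodeMap_injective (P.antipode_antipodeInvEquiv _)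

end QParam

/-! ### Dual modules and rigidity of `Cq` -/

namespace HRep

variable {K H : Type} [Field K] [Ring H] [Algebra K H]

/-- The dual of a module, acted on through an anti-automorphism. -/
def dual (X : HRep K H) (s : H ≃ₐ[K] Hᵐᵒᵖ) : HRep K H where
  V := ModuleCat.of K (Module.Dual K X.V)
  ρ := AlgHom.ofLinearMap
    ((Module.Dual.transpose (R := K) (M := X.V) (M' := X.V)) ∘ₗ X.ρ.toLinearMap ∘ₗ
      (MulOpposite.opLinearEquiv K).symm.toLinearMap ∘ₗ s.toLinearMap)
    (LinearMap.ext fun f => LinearMap.ext fun x => by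
      change f (X.ρ (unop (s 1)) x) = f x
      rw [map_one, unop_one, map_one, Module.End.one_apply])
    (fun u v => LinearMap.ext fun f => LinearMap.ext fun x => by
      change f (X.ρ (unop (s (u * v))) x) = f (X.ρ (unop (s v)) (X.ρ (unop (s u)) x))
      rw [map_mul, unop_mul, map_mul, Module.End.mul_apply])

/-- The underlying space of the dual. -/
def dualEquiv (X : HRep K H) (s : H ≃ₐ[K] Hᵐᵒᵖ) : (X.dual s).V ≃ₗ[K] Module.Dual K X.V :=
  LinearEquiv.refl K _

theorem finite_dual (X : HRep K H) [Module.Finite K X.V] (s : H ≃ₐ[K] Hᵐᵒᵖ) :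
    Module.Finite K (X.dual s).V := Module.Finite.equiv (X.dualEquiv s).symm

theorem dual_ρ_apply (X : HRep K H) (s : H ≃ₐ[K] Hᵐᵒᵖ) (u : H) (f : (X.dual s).V) (x : X.V) :
    X.dualEquiv s ((X.dual s).ρ u f) x = X.dualEquiv s f (X.ρ (unop (s u)) x) := rfl

end HRep

attribute [local instance] HRep.module HRep.isScalarTower

namespace Datum

variable {n : ℕ} {R : Datum n} {X : HRep ℂ R.U}

/-- The dual of a weight basis consists of weight vectors of opposite weights, and semisimplicity is
transferred by annihilators. Allowing any anti-automorphism that inverts the torus covers the duals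
formed with the antipode and with its inverse. -/
theorem Cq.dual (hX : R.Cq X) (s : R.U ≃ₐ[ℂ] R.Uᵐᵒᵖ) (hs : ∀ l, unop (s (R.k l)) = R.k (-l)) :
    R.Cq (X.dual s) := by
  have hfin : Module.Finite ℂ X.V := hX.1
  have hsemi := hX.isSemisimpleModule
  have hwt : ⨆ m, R.wt (X.dual s) m = ⊤ := by
    classical
    have hint := Cq.isInternal_wt R hX
    let b := hint.collectedBasis fun m => Module.finBasis ℂ (R.wt X m)
    have := Module.Finite.finite_basis b
    have := Fintype.ofFinite (Σ m, Fin (Module.finrank ℂ (R.wt X m)))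
    rw [eq_top_iff]
    rintro f -
    obtain ⟨f, rfl⟩ := (X.dualEquiv s).symm.surjective f
    have hf : f = ∑ j, f (b j) • b.coord j := by
      refine b.ext fun j => ?_
      simp
    rw [hf, map_sum]
    refine Submodule.sum_mem _ fun j _ => ?_
    rw [map_smul]
    refine Submodule.smul_mem _ _ ?_
    refine Submodule.mem_iSup_of_mem (-j.1) fun l => ?_
    refine b.ext fun j' => ?_
    have hj' : X.ρ (R.k (-l)) (b j') = R.χ (-l) j'.1 • b j' :=
      hint.collectedBasis_mem (fun m => Module.finBasis ℂ (R.wt X m)) j' (-l)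
    change b.coord j (X.ρ (unop (s (R.k l))) (b j')) = R.χ l (-j.1) • b.coord j (b j')
    rw [hs, hj', map_smul]
    rw [Module.Basis.coord_apply, Module.Basis.repr_self, Finsupp.single_apply]
    split_ifs with h
    · subst h
      rw [R.χ_neg_left, R.χ_neg_right]
    · simp
  have : IsSemisimpleModule R.U (X.dual s).V := by
    refine @IsSemisimpleModule.mk _ _ _ _ _ ⟨fun N => ?_⟩
    let N' : Submodule ℂ (Module.Dual ℂ X.V) := N.restrictScalars ℂ
    -- Complement of a submodule `N` of the dual: its coannihilator is a submodule of `X`, by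
    -- surjectivity of `s`, and so has a complement there. The annihilator of that complement is
    -- complementary to `N`.
    have hA : R.IsInvariant X N'.dualCoannihilator := by
      intro u x hx
      rw [Submodule.mem_dualCoannihilator] at hx ⊢
      intro f hf
      obtain ⟨w, hw⟩ := s.surjective (op u)
      have h1 := hx ((X.dual s).ρ w f) (N.smul_mem w hf)
      change f (X.ρ (unop (s w)) x) = 0 at h1
      rwa [hw, unop_op] at h1
    obtain ⟨P, hP⟩ := exists_isCompl hA.toSubmodule
    let P' : Submodule ℂ X.V := P.restrictScalars ℂ
    have hP' : IsCompl N'.dualCoannihilator P' := by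
      constructor
      · rw [disjoint_iff, eq_bot_iff]
        rintro x ⟨h1, h2⟩
        have : x ∈ hA.toSubmodule ⊓ P := ⟨h1, h2⟩
        rw [hP.inf_eq_bot] at this
        simpa using this
      · rw [codisjoint_iff, eq_top_iff]
        rintro x -
        have : x ∈ hA.toSubmodule ⊔ P := by rw [hP.sup_eq_top]; trivial
        obtain ⟨y, hy, z, hz, rfl⟩ := Submodule.mem_sup.mp this
        exact Submodule.add_mem_sup hy hz
    have hB : R.IsInvariant (X.dual s) P'.dualAnnihilator := by
      intro u f hf
      refine (Submodule.mem_dualAnnihilator _).mpr fun x hx => ?_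
      exact (Submodule.mem_dualAnnihilator _).mp hf _ (P.smul_mem (unop (s u)) hx)
    have hN : N'.dualCoannihilator.dualAnnihilator = N' :=
      Subspace.dualCoannihilator_dualAnnihilator_eq
    refine ⟨hB.toSubmodule, ?_, ?_⟩
    · rw [disjoint_iff, eq_bot_iff]
      rintro f ⟨h1, h2⟩
      have h3 : (f : Module.Dual ℂ X.V) ∈ N'.dualCoannihilator.dualAnnihilator ⊓
          P'.dualAnnihilator := ⟨hN.ge h1, h2⟩
      rw [← Submodule.dualAnnihilator_sup_eq, hP'.sup_eq_top, Submodule.dualAnnihilator_top] at h3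
      exact h3
    · rw [codisjoint_iff, eq_top_iff]
      rintro f -
      have h3 : X.dualEquiv s f ∈ N' ⊔ P'.dualAnnihilator := by
        rw [← hN, ← Subspace.dualAnnihilator_inf_eq, hP'.inf_eq_bot, Submodule.dualAnnihilator_bot]
        exact Submodule.mem_top
      obtain ⟨y, hy, z, hz, hyz⟩ := Submodule.mem_sup.mp h3
      exact Submodule.mem_sup.mpr ⟨y, hy, z, hz, hyz⟩
  exact Cq.of_isSemisimpleModule (X.finite_dual s) hwt

theorem unop_antipodeEquiv_k (l : R.L) : unop (R.paramU.antipodeEquiv (R.k l)) = R.k (-l) :=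
  R.paramU.antipodeMap_k l

theorem unop_antipodeInvEquiv_k (l : R.L) : unop (R.paramU.antipodeInvEquiv (R.k l)) = R.k (-l) := by
  have h : HopfAlgebra.antipode ℂ (R.k (-l)) = R.k l :=
    (R.paramU.antipodeMap_k (-l)).trans (congrArg R.paramU.k (neg_neg l))
  rw [← h, R.paramU.antipodeInvEquiv_antipode]

theorem exists_rightDual (hX : R.Cq X) :
    ∃ Z, R.Cq Z ∧ Nonempty (ExactPairing X Z) := by
  have := hX.1
  refine ⟨X.dual R.paramU.antipodeEquiv, hX.dual _ unop_antipodeEquiv_k, ?_⟩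
  exact HRep.exists_exactPairing X _ (LinearEquiv.refl ℂ (Module.Dual ℂ X.V)) fun u z x => rfl

/-- The dual is formed with the inverse of the antipode, so that `X` becomes, through the double
dual, the contragredient of its dual with respect to the antipode itself. -/
theorem exists_leftDual (hX : R.Cq X) :
    ∃ Z, R.Cq Z ∧ Nonempty (ExactPairing Z X) := by
  have := hX.1
  have := X.finite_dual R.paramU.antipodeInvEquiv
  refine ⟨X.dual R.paramU.antipodeInvEquiv, hX.dual _ unop_antipodeInvEquiv_k, ?_⟩
  refine HRep.exists_exactPairing _ X (Module.evalEquiv ℂ X.V) fun u x f => ?_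
  change X.dualEquiv R.paramU.antipodeInvEquiv f (X.ρ u x) =
    X.dualEquiv R.paramU.antipodeInvEquiv f (X.ρ (unop (R.paramU.antipodeInvEquiv (HopfAlgebra.antipode ℂ u))) x)
  rw [R.paramU.antipodeInvEquiv_antipode]

theorem exists_exactPairing_fullSubcategory {C : Type*} [Category* C] [MonoidalCategory C]
    (Q : ObjectProperty C) [Q.IsMonoidal] {X Z : Q.FullSubcategory}
    (h : Nonempty (ExactPairing X.obj Z.obj)) : Nonempty (ExactPairing X Z) := by
  obtain ⟨h⟩ := h
  have : ExactPairing (Q.ι.obj X) (Q.ι.obj Z) := h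
  exact ⟨ExactPairing.ofFullyFaithful Q.ι X Z⟩

/-- The category `𝒞_q` is rigid. -/
theorem nonempty_rigidCategory_Cq (R : Datum n) [R.Cq.IsMonoidal] :
    Nonempty (RigidCategory R.Cq.FullSubcategory) := by
  have hr : ∀ X : R.Cq.FullSubcategory, Nonempty (HasRightDual X) := fun X => by
    obtain ⟨Z, hZ, h⟩ := exists_rightDual X.property
    obtain ⟨h⟩ := exists_exactPairing_fullSubcategory R.Cq (X := X) (Z := ⟨Z, hZ⟩) h
    exact ⟨⟨⟨Z, hZ⟩⟩⟩
  have hl : ∀ X : R.Cq.FullSubcategory, Nonempty (HasLeftDual X) := fun X => by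
    obtain ⟨Z, hZ, h⟩ := exists_leftDual X.property
    obtain ⟨h⟩ := exists_exactPairing_fullSubcategory R.Cq (X := ⟨Z, hZ⟩) (Z := X) h
    exact ⟨⟨⟨Z, hZ⟩⟩⟩
  exact ⟨{ rightDual := fun X => (hr X).some, leftDual := fun X => (hl X).some }⟩

end Datum

end QG

end

/-! ### Compatibility of the twist with tensor products -/

noncomputable section

namespace QG

open CategoryTheory MonoidalCategory

namespace Datum

variable {n : ℕ} (R : Datum n) (p : Bichar R.L ℂ) {X Y Z : HRep ℂ R.U}

section Ext

variable {R} {C : Type*} [AddCommGroup C] [Module ℂ C]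

theorem ext_wt (hX : R.Cq X) {f g : X.V →ₗ[ℂ] C} (h : ∀ l, ∀ x ∈ R.wt X l, f x = g x) :
    f = g := by
  have : (⊤ : Submodule ℂ X.V) ≤ LinearMap.eqLocus f g := by
    rw [← Cq.iSup_wt R hX]
    exact iSup_le h
  exact LinearMap.ext fun x => this trivial

theorem ext_wt_tensor (hX : R.Cq X) (hY : R.Cq Y) {f g : X.V ⊗[ℂ] Y.V →ₗ[ℂ] C}
    (h : ∀ l, ∀ x ∈ R.wt X l, ∀ m, ∀ y ∈ R.wt Y m, f (x ⊗ₜ y) = g (x ⊗ₜ y)) : f = g :=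
  TensorProduct.ext (ext_wt hX fun l x hx => ext_wt hY fun m y hy => h l x hx m y hy)

theorem ext_wt_tensor₃ (hX : R.Cq X) (hY : R.Cq Y) (hZ : R.Cq Z)
    {f g : (X.V ⊗[ℂ] Y.V) ⊗[ℂ] Z.V →ₗ[ℂ] C}
    (h : ∀ l, ∀ x ∈ R.wt X l, ∀ m, ∀ y ∈ R.wt Y m, ∀ k, ∀ z ∈ R.wt Z k,
      f ((x ⊗ₜ y) ⊗ₜ z) = g ((x ⊗ₜ y) ⊗ₜ z)) : f = g :=
  TensorProduct.ext (ext_wt_tensor hX hY fun l x hx m y hy =>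
    ext_wt hZ fun k z hz => h l x hx m y hy k z hz)

end Ext

theorem π_surjective : Function.Surjective R.π := by
  intro u
  induction u using R.paramU.alg_induction with
  | hr r => exact ⟨algebraMap ℂ _ r, AlgHom.commutes _ r⟩
  | hk l => exact ⟨R.paramD.k (l, (0 : R.L)), (R.π_k (l, (0 : R.L))).trans
      (congrArg R.paramU.k (add_zero l))⟩
  | he i => exact ⟨_, R.π_e i⟩
  | hf i => exact ⟨_, R.π_f i⟩
  | hmul x y hx hy =>
    obtain ⟨x, rfl⟩ := hx
    obtain ⟨y, rfl⟩ := hy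
    exact ⟨x * y, map_mul _ _ _⟩
  | hadd x y hx hy =>
    obtain ⟨x, rfl⟩ := hx
    obtain ⟨y, rfl⟩ := hy
    exact ⟨x + y, map_add _ _ _⟩

/-- The map `(λ, μ) ↦ λ + μ` on the torus parts. -/
def sumΓ (g : R.paramD.Γ) : R.paramU.Γ := (Prod.fst (α := R.L) (β := R.L) g + Prod.snd (α := R.L) g : R.L)

theorem π_k_eq (g : R.paramD.Γ) : R.π (R.paramD.k g) = R.paramU.k (R.sumΓ g) := R.π_k g
theorem sumΓ_neg (g : R.paramD.Γ) : R.sumΓ (-g) = -R.sumΓ g :=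
  (neg_add (Prod.fst (α := R.L) (β := R.L) g) (Prod.snd (α := R.L) g)).symm
theorem sumΓ_κ (i : Fin n) : R.sumΓ (R.paramD.κ i) = R.paramU.κ i := add_zero (R.α i)
theorem sumΓ_κ' (i : Fin n) : R.sumΓ (R.paramD.κ' i) = R.paramU.κ' i := zero_add (R.α i)

theorem comul_π (u : R.D) : Coalgebra.comul (R := ℂ) (R.π u) =
    Algebra.TensorProduct.map R.π R.π (Coalgebra.comul (R := ℂ) u) := by
  have h : (Bialgebra.comulAlgHom ℂ R.U).comp R.π =
      (Algebra.TensorProduct.map R.π R.π).comp (Bialgebra.comulAlgHom ℂ R.D) :=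
    R.paramD.algHom_ext (fun g => by simp [π_k_eq])
      (fun i => by simp [π_k_eq, π_e, sumΓ_κ])
      (fun i => by simp [π_k_eq, π_f, sumΓ_neg, sumΓ_κ'])
  exact AlgHom.congr_fun h u

theorem counit_π (u : R.D) : Coalgebra.counit (R := ℂ) (R.π u) = Coalgebra.counit (R := ℂ) u := by
  have h : (Bialgebra.counitAlgHom ℂ R.U).comp R.π = Bialgebra.counitAlgHom ℂ R.D :=
    R.paramD.algHom_ext (fun g => by simp [π_k_eq]) (fun i => by simp [R.π_e])
      (fun i => by simp [R.π_f])
  exact AlgHom.congr_fun h u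

theorem antipode_π (u : R.D) : HopfAlgebra.antipode ℂ (R.π u) =
    R.π (HopfAlgebra.antipode ℂ u) := by
  change R.paramU.antipodeMap (R.π u) = R.π (R.paramD.antipodeMap u)
  induction u using R.paramD.alg_induction with
  | hr r => simp [Algebra.algebraMap_eq_smul_one, QParam.antipodeMap_one]
  | hk g => simp [QParam.antipodeMap_k, π_k_eq, sumΓ_neg]
  | he i => simp [QParam.antipodeMap_e, π_k_eq, π_e, sumΓ_neg, sumΓ_κ]
  | hf i => simp [QParam.antipodeMap_f, π_k_eq, π_f, sumΓ_κ']
  | hmul x y hx hy =>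
    rw [map_mul, QParam.antipodeMap_mul, QParam.antipodeMap_mul, map_mul, hx, hy]
  | hadd x y hx hy => simp only [map_add, hx, hy]

/-! ### The comparison of tensor products -/

/-- The map `x ⊗ y ↦ p(μ, λ) x ⊗ y` for `x ∈ X_λ`, `y ∈ Y_μ`. -/
def tensorTwist (hX : R.Cq X) (hY : R.Cq Y) : X.V ⊗[ℂ] Y.V →ₗ[ℂ] X.V ⊗[ℂ] Y.V :=
  letI := Cq.decomposition R hX
  letI := Cq.decomposition R hY
  TensorProduct.lift (twistBilin (R.wt X) (R.wt Y) (TensorProduct.mk ℂ X.V Y.V)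
    fun l m => (p m l : ℂ))

variable {R}

theorem tensorTwist_tmul (hX : R.Cq X) (hY : R.Cq Y) {l m : R.L} {x : X.V} {y : Y.V}
    (hx : x ∈ R.wt X l) (hy : y ∈ R.wt Y m) :
    R.tensorTwist p hX hY (x ⊗ₜ y) = (p m l : ℂ) • x ⊗ₜ y := by
  let _ := Cq.decomposition R hX
  let _ := Cq.decomposition R hY
  exact twistBilin_apply (R.wt X) (R.wt Y) (TensorProduct.mk ℂ X.V Y.V) _ hx hy

theorem tensorTwist_inv_comp (hX : R.Cq X) (hY : R.Cq Y) :
    R.tensorTwist p⁻¹ hX hY ∘ₗ R.tensorTwist p hX hY = LinearMap.id := by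
  refine ext_wt_tensor hX hY fun l x hx m y hy => ?_
  rw [LinearMap.comp_apply, tensorTwist_tmul p hX hY hx hy, map_smul,
    tensorTwist_tmul p⁻¹ hX hY hx hy, smul_smul, Bichar.inv_apply, Units.mul_inv, one_smul]
  rfl

theorem tensorTwist_comp_inv (hX : R.Cq X) (hY : R.Cq Y) :
    R.tensorTwist p hX hY ∘ₗ R.tensorTwist p⁻¹ hX hY = LinearMap.id := by
  refine ext_wt_tensor hX hY fun l x hx m y hy => ?_
  rw [LinearMap.comp_apply, tensorTwist_tmul p⁻¹ hX hY hx hy, map_smul,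
    tensorTwist_tmul p hX hY hx hy, smul_smul, Bichar.inv_apply, Units.inv_mul, one_smul]
  rfl

variable (R) in
/-- The action of `D_{q,p⁻¹}(𝔤)` on the space underlying `X`. -/
def breveρ (hX : R.Cq X) : R.Dp p →ₐ[ℂ] Module.End ℂ X.V := (R.breveObj p X hX).ρ

theorem breveρ_apply (hX : R.Cq X) {g : R.L × R.L} {l : R.L} {u : R.D} {x : X.V}
    (hu : u ∈ R.degD.grading g) (hx : x ∈ R.wt X l) :
    R.breveρ p hX (Twist.of _ _ u) x =
      ((p l (g.2 - g.1) * p g.2 g.1 : ℂˣ) : ℂ) • X.ρ (R.π u) x := R.breveObj_apply p hX hu hx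

variable (R) in
/-- The action of `D_{q,p⁻¹}(𝔤)` on the space underlying `X ⊗ Y`. -/
def breveTensorρ (hX : R.Cq X) (hY : R.Cq Y) : R.Dp p →ₐ[ℂ] Module.End ℂ (X.V ⊗[ℂ] Y.V) :=
  R.breveρ p (hX.tensor hY)

theorem breveTensorρ_apply (hX : R.Cq X) (hY : R.Cq Y) {g : R.L × R.L} {l m : R.L} {u : R.D}
    {x : X.V} {y : Y.V} (hu : u ∈ R.degD.grading g) (hx : x ∈ R.wt X l) (hy : y ∈ R.wt Y m) :
    R.breveTensorρ p hX hY (Twist.of _ _ u) (x ⊗ₜ y) =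
      ((p (l + m) (g.2 - g.1) * p g.2 g.1 : ℂˣ) : ℂ) • HRep.tensorρ X.ρ Y.ρ (R.π u) (x ⊗ₜ y) :=
  breveρ_apply p (hX.tensor hY) hu (tmul_mem_wt hx hy)

/-- On a component of degrees `(γ, ν)` and `(-ν, δ)` the scalars of the two actions combine with
that of `tensorTwist` on the shifted weights. All dependence on `ν` cancels, leaving `p m l` times
the scalar by which degree `(γ, δ)` acts on the twisted tensor product. -/
theorem tensorTwist_act₂ (hX : R.Cq X) (hY : R.Cq Y) {γ δ l m : R.L} {w : R.D ⊗[ℂ] R.D}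
    (hw : w ∈ bigradedTensor R.degD.grading γ δ) {x : X.V} {y : Y.V}
    (hx : x ∈ R.wt X l) (hy : y ∈ R.wt Y m) :
    R.tensorTwist p hX hY (HRep.act₂ (R.breveρ p hX) (R.breveρ p hY)
      (TensorProduct.map (Twist.of R.degD.grading p⁻¹).toLinearMap
        (Twist.of R.degD.grading p⁻¹).toLinearMap w) (x ⊗ₜ y)) =
    ((p m l * (p (l + m) (δ - γ) * p δ γ) : ℂˣ) : ℂ) •
      HRep.act₂ X.ρ Y.ρ (Algebra.TensorProduct.map R.π R.π w) (x ⊗ₜ y) := by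
  induction hw using Submodule.span_induction with
  | zero => simp
  | add x y _ _ h1 h2 => simp only [map_add, LinearMap.add_apply, h1, h2, smul_add]
  | smul r x _ h => simp only [map_smul, LinearMap.smul_apply, h, smul_comm r]
  | mem w hw =>
  obtain ⟨ν, u, hu, v, hv, rfl⟩ := hw
  rw [TensorProduct.map_tmul, Algebra.TensorProduct.map_tmul, HRep.act₂_tmul, HRep.act₂_tmul,
    TensorProduct.map_tmul, TensorProduct.map_tmul, LinearEquiv.coe_coe,
    breveρ_apply p hX hu hx, breveρ_apply p hY hv hy, TensorProduct.smul_tmul_smul, map_smul,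
    tensorTwist_tmul p hX hY (R.π_mem_wt X hu hx) (R.π_mem_wt Y hv hy), smul_smul]
  congr 1
  rw [← Units.val_mul, ← Units.val_mul]
  congr 1
  simp only [p.add_left, p.sub_left, p.sub_right, p.neg_left, p.neg_right]
  rw [p.swap l ν, p.swap l γ, p.swap l δ, p.self_eq_one ν]
  have h0 : ∀ u : ℂˣ, (u : ℂ) ≠ 0 := fun u => u.ne_zero
  refine Units.ext ?_
  push_cast
  have := h0 (p m l)
  have := h0 (p ν l)
  have := h0 (p δ l)
  have := h0 (p γ l)
  have := h0 (p m ν)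
  have := h0 (p m γ)
  have := h0 (p m δ)
  have := h0 (p ν γ)
  have := h0 (p δ γ)
  have := h0 (p δ ν)
  field_simp

theorem tensorTwist_comm (hX : R.Cq X) (hY : R.Cq Y) (u : R.Dp p) (z : X.V ⊗[ℂ] Y.V) :
    R.tensorTwist p hX hY (HRep.tensorρ (R.breveρ p hX) (R.breveρ p hY) u z) =
      R.breveTensorρ p hX hY u (R.tensorTwist p hX hY z) := by
  obtain ⟨u, rfl⟩ := (Twist.of R.degD.grading p⁻¹).surjective u
  have key : ∀ u, R.tensorTwist p hX hY ∘ₗ HRep.tensorρ (R.breveρ p hX)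
        (R.breveρ p hY) (Twist.of R.degD.grading p⁻¹ u) =
      R.breveTensorρ p hX hY (Twist.of R.degD.grading p⁻¹ u) ∘ₗ R.tensorTwist p hX hY := by
    intro u
    induction u using DirectSum.Decomposition.inductionOn R.degD.grading with
    | zero => simp
    | add a b ha hb =>
      rw [map_add, map_add, map_add, LinearMap.comp_add, LinearMap.add_comp, ha, hb]
    | @homogeneous g u =>
    refine ext_wt_tensor hX hY fun l x hx m y hy => ?_
    have h1 := tensorTwist_act₂ p hX hY (IsBigraded.comul_mem (𝒜 := R.degD.grading) g.1 g.2 _ u.2)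
      hx hy
    rw [← Twist.comul_of] at h1
    refine h1.trans ?_
    rw [LinearMap.comp_apply, tensorTwist_tmul p hX hY hx hy, map_smul,
      breveTensorρ_apply p hX hY u.2 hx hy, ← comul_π, Units.val_mul, ← smul_smul]
    rfl
  exact LinearMap.congr_fun (key u) z

end Datum


namespace Datum

variable {n : ℕ} {R : Datum n} (p : Bichar R.L ℂ) {X Y Z : HRep ℂ R.U}

theorem one_mem_wt_unit (r : (𝟙_ (HRep ℂ R.U) : HRep ℂ R.U).V) :
    r ∈ R.wt (𝟙_ (HRep ℂ R.U)) 0 := by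
  intro l
  rw [R.χ_zero_right, one_smul]
  change Coalgebra.counit (R := ℂ) (R.k l) * (show ℂ from r) = r
  rw [R.counit_k, one_mul]

/-- The counit vanishes except on degrees `(-δ, δ)`, where the scalar `p(0, ·) p(δ, -δ)` is `1`. -/
theorem breveρ_unit (u : R.Dp p) (r : (𝟙_ (HRep ℂ R.U) : HRep ℂ R.U).V) :
    R.breveρ p Cq.unit u r = Coalgebra.counit (R := ℂ) u • r := by
  obtain ⟨u, rfl⟩ := (Twist.of R.degD.grading p⁻¹).surjective u
  induction u using DirectSum.Decomposition.inductionOn R.degD.grading with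
  | zero => simp
  | add a b ha hb => simp only [map_add, LinearMap.add_apply, ha, hb, add_smul]
  | @homogeneous g u =>
  rw [breveρ_apply p Cq.unit u.2 (one_mem_wt_unit r), Twist.counit_of]
  change _ • (Coalgebra.counit (R := ℂ) (R.π u) • r) = _
  rw [R.counit_π]
  by_cases h : g.1 = -g.2
  · rw [h, p.zero_left, p.neg_right, p.self_eq_one]
    simp
  · rw [IsBigraded.counit_eq_zero (𝒜 := R.degD.grading) g.1 g.2 _ u.2 h]
    simp

theorem tensorTwist_unit_left (hX : R.Cq X) (r : (𝟙_ (HRep ℂ R.U) : HRep ℂ R.U).V) (x : X.V) :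
    R.tensorTwist p Cq.unit hX (r ⊗ₜ x) = r ⊗ₜ x := by
  refine LinearMap.congr_fun (f := R.tensorTwist p Cq.unit hX ∘ₗ TensorProduct.mk ℂ _ X.V r)
    (g := TensorProduct.mk ℂ _ X.V r) (ext_wt hX fun m x hx => ?_) x
  rw [LinearMap.comp_apply, TensorProduct.mk_apply,
    tensorTwist_tmul p _ _ (one_mem_wt_unit r) hx, p.zero_right, Units.val_one, one_smul]

theorem tensorTwist_unit_right (hX : R.Cq X) (r : (𝟙_ (HRep ℂ R.U) : HRep ℂ R.U).V) (x : X.V) :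
    R.tensorTwist p hX Cq.unit (x ⊗ₜ r) = x ⊗ₜ r := by
  refine LinearMap.congr_fun
    (f := R.tensorTwist p hX Cq.unit ∘ₗ (TensorProduct.mk ℂ X.V _).flip r)
    (g := (TensorProduct.mk ℂ X.V _).flip r) (ext_wt hX fun m x hx => ?_) x
  rw [LinearMap.comp_apply, LinearMap.flip_apply, TensorProduct.mk_apply,
    tensorTwist_tmul p _ _ hx (one_mem_wt_unit r), p.zero_left, Units.val_one, one_smul]

/-- The comparison isomorphism `M̆ ⊗ N̆ ≅ (M ⊗ N)˘`. -/
def breveTensorIso (hX : R.Cq X) (hY : R.Cq Y) :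
    R.breveObj p X hX ⊗ R.breveObj p Y hY ≅ R.breveObj p (X ⊗ Y) (hX.tensor hY) :=
  HRep.mkIso (LinearEquiv.toModuleIso (LinearEquiv.ofLinearMap (R.tensorTwist p hX hY)
    (R.tensorTwist p⁻¹ hX hY) (tensorTwist_comp_inv p hX hY) (tensorTwist_inv_comp p hX hY)))
    (tensorTwist_comm p hX hY)

/-- The comparison isomorphism of the units. -/
def breveUnitIso : 𝟙_ (HRep ℂ (R.Dp p)) ≅ R.breveObj p (𝟙_ (HRep ℂ R.U)) Cq.unit :=
  HRep.mkIso (Iso.refl _) fun u r => (breveρ_unit p u r).symm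

instance : R.Cq.IsMonoidal := isMonoidal_Cq

/-- The functor `M ↦ M̆` to all modules is monoidal. -/
def breveCoreMonoidal : (R.breve p).CoreMonoidal where
  εIso := breveUnitIso p
  μIso X Y := breveTensorIso p X.property Y.property
  μIso_hom_natural_left {X Y} f Z := by
    refine HRep.hom_ext (ModuleCat.hom_ext
      (ext_wt_tensor X.property Z.property fun l x hx m z hz => ?_))
    change R.tensorTwist p Y.property Z.property (f.hom.hom.hom x ⊗ₜ z) =
      f.hom.hom.hom.rTensor Z.obj.V (R.tensorTwist p X.property Z.property (x ⊗ₜ z))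
    rw [tensorTwist_tmul p _ _ hx hz, map_smul, LinearMap.rTensor_tmul,
      tensorTwist_tmul p _ _ (R.map_mem_wt f.hom hx) hz]
  μIso_hom_natural_right {X Y} Z f := by
    refine HRep.hom_ext (ModuleCat.hom_ext
      (ext_wt_tensor Z.property X.property fun l z hz m x hx => ?_))
    change R.tensorTwist p Z.property Y.property (z ⊗ₜ f.hom.hom.hom x) =
      f.hom.hom.hom.lTensor Z.obj.V (R.tensorTwist p Z.property X.property (z ⊗ₜ x))
    rw [tensorTwist_tmul p _ _ hz hx, map_smul, LinearMap.lTensor_tmul,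
      tensorTwist_tmul p _ _ hz (R.map_mem_wt f.hom hx)]
  associativity X Y Z := by
    refine HRep.hom_ext (ModuleCat.hom_ext
      (ext_wt_tensor₃ X.property Y.property Z.property fun l x hx m y hy k z hz => ?_))
    change TensorProduct.assoc ℂ X.obj.V Y.obj.V Z.obj.V
        (R.tensorTwist p (X.property.tensor Y.property) Z.property
          (R.tensorTwist p X.property Y.property (x ⊗ₜ y) ⊗ₜ z)) =
      R.tensorTwist p X.property (Y.property.tensor Z.property)
        (x ⊗ₜ (R.tensorTwist p Y.property Z.property (y ⊗ₜ z)))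
    rw [tensorTwist_tmul p _ _ hx hy, tensorTwist_tmul p _ _ hy hz, ← TensorProduct.smul_tmul',
      TensorProduct.tmul_smul, map_smul, map_smul, map_smul]
    have h1 := tensorTwist_tmul p (X.property.tensor Y.property) Z.property (tmul_mem_wt hx hy) hz
    have h2 := tensorTwist_tmul p X.property (Y.property.tensor Z.property) hx (tmul_mem_wt hy hz)
    refine (congrArg (fun t => (p m l : ℂ) • TensorProduct.assoc ℂ X.obj.V Y.obj.V Z.obj.V t)
      h1).trans (Eq.trans ?_ (congrArg (fun t => (p k m : ℂ) • t) h2).symm)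
    change (p m l : ℂ) • (p k (l + m) : ℂ) • (x ⊗ₜ[ℂ] (y ⊗ₜ[ℂ] z)) =
      (p k m : ℂ) • (p (m + k) l : ℂ) • (x ⊗ₜ[ℂ] (y ⊗ₜ[ℂ] z))
    -- Coherence is the identity `p(m, l) p(k, l + m) = p(k, m) p(m + k, l)`, immediate from
    -- multiplicativity in each entry.
    rw [smul_smul, smul_smul, p.add_right, p.add_left]
    congr 1
    push_cast
    ring
  left_unitality X := by
    refine HRep.hom_ext (ModuleCat.hom_ext
      (TensorProduct.ext' fun r x => ?_))
    change r • x = TensorProduct.lid ℂ X.obj.V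
      (R.tensorTwist p Cq.unit X.property (r ⊗ₜ x))
    exact (congrArg (TensorProduct.lid ℂ X.obj.V) (tensorTwist_unit_left p X.property r x)).symm
  right_unitality X := by
    refine HRep.hom_ext (ModuleCat.hom_ext
      (TensorProduct.ext' fun x r => ?_))
    change r • x = TensorProduct.rid ℂ X.obj.V
      (R.tensorTwist p X.property Cq.unit (x ⊗ₜ r))
    exact (congrArg (TensorProduct.rid ℂ X.obj.V) (tensorTwist_unit_right p X.property r x)).symm

end Datum

end QG

end

/-! ### The monoidal equivalence onto the twisted category -/

noncomputable section

namespace QG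

open CategoryTheory MonoidalCategory

section EssImage

variable {C D : Type*} [Category* C] [MonoidalCategory C] [Category* D] [MonoidalCategory D]
  (F : C ⥤ D) (h : F.CoreMonoidal)

include h

/-- The essential image of a monoidal functor is monoidal. -/
theorem isMonoidal_essImage : F.essImage.IsMonoidal where
  prop_unit := ⟨_, ⟨h.εIso.symm⟩⟩
  prop_tensor := by
    rintro X Y ⟨A, ⟨e⟩⟩ ⟨B, ⟨f⟩⟩
    exact ⟨A ⊗ B, ⟨(h.μIso A B).symm ≪≫ (e ⊗ᵢ f)⟩⟩

/-- The corestriction of a monoidal functor to its essential image is monoidal. -/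
def coreMonoidalToEssImage [F.essImage.IsMonoidal] : F.toEssImage.CoreMonoidal where
  εIso := F.essImage.isoMk h.εIso
  μIso X Y := F.essImage.isoMk (h.μIso X Y)
  μIso_hom_natural_left f X' := ObjectProperty.hom_ext _ (h.μIso_hom_natural_left f X')
  μIso_hom_natural_right X' f := ObjectProperty.hom_ext _ (h.μIso_hom_natural_right X' f)
  associativity X Y Z := ObjectProperty.hom_ext _ (h.associativity X Y Z)
  left_unitality X := ObjectProperty.hom_ext _ (h.left_unitality X)
  right_unitality X := ObjectProperty.hom_ext _ (h.right_unitality X)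

end EssImage

/-- Rigidity is transported along a monoidal equivalence. -/
theorem nonempty_rigidCategory_of_isEquivalence {C D : Type*} [Category* C] [MonoidalCategory C]
    [Category* D] [MonoidalCategory D] (F : C ⥤ D) [hF : F.Monoidal] [F.IsEquivalence]
    [RigidCategory C] : Nonempty (RigidCategory D) := by
  let _ : F.asEquivalence.functor.Monoidal := hF
  let _ : F.asEquivalence.inverse.Monoidal := F.asEquivalence.inverseMonoidal
  exact ⟨rigidCategoryOfEquivalence F.asEquivalence.symm.toAdjunction⟩

/-- A spanning family inside an independent one exhausts it: a vector of `F i` decomposes along the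
`W j`, and its part outside `W i` is zero by independence. -/
theorem eq_of_iSupIndep_of_le {K V ι : Type*} [Field K] [AddCommGroup V] [Module K V]
    {W F : ι → Submodule K V} (hF : iSupIndep F) (hle : ∀ i, W i ≤ F i) (hW : ⨆ i, W i = ⊤)
    (i : ι) : F i = W i := by
  refine le_antisymm (fun x hx => ?_) (hle i)
  have h : x ∈ W i ⊔ ⨆ (j) (_ : j ≠ i), W j := by
    have : (⨆ j, W j) ≤ W i ⊔ ⨆ (j) (_ : j ≠ i), W j := by
      refine iSup_le fun j => ?_
      by_cases hj : j = i
      · subst hj; exact le_sup_left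
      · exact (le_iSup₂_of_le (f := fun j (_ : j ≠ i) => W j) j hj le_rfl).trans le_sup_right
    exact this (hW ▸ Submodule.mem_top)
  obtain ⟨a, ha, b, hb, rfl⟩ := Submodule.mem_sup.mp h
  have hb' : b ∈ ⨆ (j) (_ : j ≠ i), F j := (iSup₂_mono fun j _ => hle j) hb
  have : b = 0 := Submodule.disjoint_def.mp (hF i) b
    ((Submodule.add_mem_iff_right _ (hle i ha)).mp hx) hb'
  rw [this, add_zero]
  exact ha

/-! ### Full faithfulness of the twist -/

namespace Datum

variable {n : ℕ} {R : Datum n} (p : Bichar R.L ℂ) {X Y : HRep ℂ R.U}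

/-- Weight spaces are already determined by the elements `k_{2λ}`. -/
theorem mem_wt_of_double (hX : R.Cq X) {m : R.L} {x : X.V}
    (hx : ∀ l, X.ρ (R.k (l + l)) x = R.χ (l + l) m • x) : x ∈ R.wt X m := by
  -- Doubling is injective on `L`, so the eigenspaces of the `k_{2λ}` attached to the various `m`
  -- are independent. They contain the weight spaces, which already span.
  have hF : iSupIndep fun m : R.L => R.eigen (fun l => X.ρ (R.k (l + l))) (m + m) := by
    refine (R.iSupIndep_eigen (fun l => X.ρ (R.k (l + l))) fun l l' => ?_).comp
      (f := fun m : R.L => m + m) fun m m' h => ?_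
    · rw [Commute, SemiconjBy, ← map_mul, ← map_mul, (R.paramU.k_commute (l + l : R.L)
        (l' + l' : R.L)).eq]
    · refine Subtype.ext (funext fun i => ?_)
      have := congrFun (congrArg Subtype.val h) i
      change m.1 i + m.1 i = m'.1 i + m'.1 i at this
      omega
  have hχ : ∀ l m : R.L, R.χ (l + l) m = R.χ l (m + m) := fun l m => by
    rw [R.χ_add_left, R.χ_add_right]
  rw [← eq_of_iSupIndep_of_le (W := R.wt X) hF (fun m x hx l => ?_) (Cq.iSup_wt R hX) m]
  · intro l
    rw [hx, hχ]
  · rw [← hχ]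
    exact R.mem_wt.mp hx _

/-- The element `s_l t_l` has degree `(0, 0)`, so its action is not altered by the twist. -/
theorem breveρ_k (hX : R.Cq X) (l : R.L) :
    R.breveρ p hX (Twist.of R.degD.grading p⁻¹ (R.paramD.k (l, l))) = X.ρ (R.k (l + l)) := by
  refine ext_wt hX fun m x hx => ?_
  have h := R.degD.k_mem (l, l)
  have h0 : R.degD.θ (l, l) = 0 := sub_self l
  rw [h0, neg_zero] at h
  rw [breveρ_apply p hX h hx, R.π_k]
  simp [p.zero_right]

/-- A morphism of twisted modules commutes with the untwisted action of all `k_{2λ}`, and these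
detect weights. -/
theorem hom_mem_wt (hX : R.Cq X) (hY : R.Cq Y) (g : R.breveObj p X hX ⟶ R.breveObj p Y hY)
    {m : R.L} {x : X.V} (hx : x ∈ R.wt X m) : g.hom.hom x ∈ R.wt Y m := by
  refine mem_wt_of_double hY fun l => ?_
  have h := g.comm (Twist.of R.degD.grading p⁻¹ (R.paramD.k (l, l))) x
  change g.hom.hom (R.breveρ p hX _ x) = R.breveρ p hY _ (g.hom.hom x) at h
  rw [breveρ_k, breveρ_k, R.mem_wt.mp hx] at h
  refine h.symm.trans ?_
  exact map_smul g.hom.hom (R.χ (l + l) m) x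

/-- For homogeneous `u` and a weight vector `x`, the twisting scalars on the two sides agree because
`g` preserves weights. Being units they cancel, so `g` is linear for the untwisted action. This is
the fullness of the functor. -/
theorem hom_comm (hX : R.Cq X) (hY : R.Cq Y) (g : R.breveObj p X hX ⟶ R.breveObj p Y hY)
    (u : R.U) (x : X.V) : g.hom.hom (X.ρ u x) = Y.ρ u (g.hom.hom x) := by
  obtain ⟨u, rfl⟩ := R.π_surjective u
  let G : X.V →ₗ[ℂ] Y.V := g.hom.hom
  have key : ∀ u, G ∘ₗ X.ρ (R.π u) = Y.ρ (R.π u) ∘ₗ G := by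
    intro u
    induction u using DirectSum.Decomposition.inductionOn R.degD.grading with
    | zero => simp
    | add a b ha hb =>
      rw [map_add, map_add, map_add, LinearMap.comp_add, LinearMap.add_comp, ha, hb]
    | @homogeneous h u =>
    refine ext_wt hX fun m x hx => ?_
    have h1 : G (R.breveρ p hX (Twist.of R.degD.grading p⁻¹ u) x) =
      R.breveρ p hY (Twist.of R.degD.grading p⁻¹ u) (G x) := g.comm _ x
    rw [breveρ_apply p hX u.2 hx,
      breveρ_apply p hY u.2 (show G x ∈ _ from hom_mem_wt p hX hY g hx), map_smul] at h1
    exact smul_right_injective _ (Units.ne_zero _) h1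
  exact LinearMap.congr_fun (key u) x

instance : (R.breve p).Faithful where
  map_injective h := ObjectProperty.hom_ext _ 
    (HRep.hom_ext (congrArg (HRep.forget ℂ (R.Dp p)).map h))

instance : (R.breve p).Full where
  map_surjective {X Y} g := ⟨ObjectProperty.homMk
    ⟨g.hom, hom_comm p X.property Y.property g⟩, rfl⟩

instance : (R.Cqp p).IsMonoidal := isMonoidal_essImage _ (breveCoreMonoidal p)

instance : (R.breveFunctor p).Monoidal :=
  (coreMonoidalToEssImage _ (breveCoreMonoidal p)).toMonoidal

instance : (R.breveFunctor p).IsEquivalence where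

theorem nonempty_rigidCategory_Cqp : Nonempty (RigidCategory (R.Cqp p).FullSubcategory) := by
  obtain ⟨h⟩ := nonempty_rigidCategory_Cq R
  exact nonempty_rigidCategory_of_isEquivalence (R.breveFunctor p)

end Datum

end QG

end

/-! ### Spanning by coordinate functions, and antipodes of restricted duals -/

noncomputable section

namespace QG

open MulOpposite CategoryTheory MonoidalCategory

namespace RestrictedDual

section Bialgebra

variable {K H : Type} [Field K] [Ring H] [Bialgebra K H] (Q : ObjectProperty (HRep K H))

/-- Both sides apply `f ⊗ g` to the coproduct of `u` acting on `v ⊗ w`. For a monoidal class of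
modules, products of coordinate functions are therefore again coordinate functions. -/
theorem coord_tensor {X Y : HRep K H} (f : Module.Dual K X.V) (v : X.V) (g : Module.Dual K Y.V)
    (w : Y.V) : QG.coord X f v * QG.coord Y g w =
      QG.coord (X ⊗ Y) (TensorProduct.lid K K ∘ₗ TensorProduct.map f g) (v ⊗ₜ w) := by
  refine WithConv.ofConv_injective (LinearMap.ext fun u => ?_)
  change LinearMap.mul' K K (TensorProduct.map (QG.coord X f v).ofConv (QG.coord Y g w).ofConv
    (Coalgebra.comul (R := K) u)) = TensorProduct.lid K K (TensorProduct.map f g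
      (HRep.act₂ X.ρ Y.ρ (Coalgebra.comul (R := K) u) (v ⊗ₜ w)))
  generalize Coalgebra.comul (R := K) u = z
  induction z using TensorProduct.induction_on with
  | zero => simp
  | add x y hx hy => simp only [map_add, LinearMap.add_apply, hx, hy]
  | tmul x y =>
    rw [HRep.act₂_tmul, TensorProduct.map_tmul, TensorProduct.map_tmul, TensorProduct.map_tmul,
      coord_apply, coord_apply, LinearMap.mul'_apply, TensorProduct.lid_tmul, smul_eq_mul]

/-- The restricted dual of a monoidal class of modules is spanned by the coordinate functions. -/
theorem span_coord [Q.IsMonoidal] : Submodule.span K {c : RestrictedDual Q |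
    ∃ (X : HRep K H) (hX : Q X) (hfin : Module.Finite K X.V) (f : Module.Dual K X.V) (v : X.V),
      c = coord hX hfin f v} = ⊤ := by
  rw [eq_top_iff]
  rintro c -
  induction c using RestrictedDual.induction with
  | hc X hX hfin f v => exact Submodule.subset_span ⟨X, hX, hfin, f, v, rfl⟩
  | hr r =>
    rw [Algebra.algebraMap_eq_smul_one]
    refine Submodule.smul_mem _ _ (Submodule.subset_span ⟨𝟙_ (HRep K H), Q.prop_unit,
      inferInstanceAs (Module.Finite K K), (LinearMap.id : K →ₗ[K] K), (1 : K), ?_⟩)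
    refine eval_ext Q fun u => ?_
    rw [eval_one, eval_coord]
    exact (mul_one (Coalgebra.counit (R := K) u)).symm
  | hadd x y hx hy => exact add_mem hx hy
  | hmul x y hx hy =>
    induction hx using Submodule.span_induction with
    | zero => rw [zero_mul]; exact zero_mem _
    | add x x' _ _ h1 h2 => rw [add_mul]; exact add_mem h1 h2
    | smul r x _ h => rw [smul_mul_assoc]; exact Submodule.smul_mem _ _ h
    | mem x hx =>
    induction hy using Submodule.span_induction with
    | zero => rw [mul_zero]; exact zero_mem _
    | add x x' _ _ h1 h2 => rw [mul_add]; exact add_mem h1 h2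
    | smul r x _ h => rw [mul_smul_comm]; exact Submodule.smul_mem _ _ h
    | mem y hy =>
    obtain ⟨X, hX, hfin, f, v, rfl⟩ := hx
    obtain ⟨Y, hY, hfin', g, w, rfl⟩ := hy
    exact Submodule.subset_span ⟨X ⊗ Y, Q.prop_tensor hX hY,
      inferInstanceAs (Module.Finite K (X.V ⊗[K] Y.V)), _, v ⊗ₜ w,
      Subtype.ext (coord_tensor f v g w)⟩

theorem span_induction [Q.IsMonoidal] {C : RestrictedDual Q → Prop}
    (hc : ∀ (X : HRep K H) (hX : Q X) (hfin : Module.Finite K X.V) (f : Module.Dual K X.V) (v : X.V),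
      C (RestrictedDual.coord hX hfin f v))
    (h0 : C 0) (hadd : ∀ x y, C x → C y → C (x + y)) (hsmul : ∀ (r : K) x, C x → C (r • x))
    (c : RestrictedDual Q) : C c := by
  have h : c ∈ (⊤ : Submodule K (RestrictedDual Q)) := trivial
  rw [← span_coord Q] at h
  induction h using Submodule.span_induction with
  | zero => exact h0
  | add x y _ _ hx hy => exact hadd x y hx hy
  | smul r x _ hx => exact hsmul r x hx
  | mem x hx =>
    obtain ⟨X, hX, hfin, f, v, rfl⟩ := hx
    exact hc X hX hfin f v

/-- Linear maps into the restricted dual, from maps into the full dual. -/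
def liftEval {A : Type*} [AddCommGroup A] [Module K A] (φ : A →ₗ[K] H →ₗ[K] K)
    (hφ : ∀ a, ∃ c, eval Q c = φ a) : A →ₗ[K] RestrictedDual Q :=
  (LinearEquiv.ofInjective (eval Q) (eval_injective Q)).symm.toLinearMap ∘ₗ
    φ.codRestrict (LinearMap.range (eval Q)) hφ

theorem eval_liftEval {A : Type*} [AddCommGroup A] [Module K A] (φ : A →ₗ[K] H →ₗ[K] K)
    (hφ : ∀ a, ∃ c, eval Q c = φ a) (a : A) : eval Q (liftEval Q φ hφ a) = φ a :=
  congrArg Subtype.val ((LinearEquiv.ofInjective (eval Q) (eval_injective Q)).apply_symm_apply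
    (φ.codRestrict (LinearMap.range (eval Q)) hφ a))

theorem eval_mul' (z : RestrictedDual Q ⊗[K] RestrictedDual Q) (u : H) {ι : Type*}
    (r : Coalgebra.Repr K u ι) : eval Q (LinearMap.mul' K _ z) u =
      ∑ i ∈ r.index, ev₂ Q z (r.left i) (r.right i) := by
  induction z using TensorProduct.induction_on with
  | zero => simp
  | add x y hx hy => simp only [map_add, LinearMap.add_apply, Pi.add_apply, hx, hy,
      Finset.sum_add_distrib]
  | tmul a b => simp only [LinearMap.mul'_apply, eval_mul Q a b u r, ev₂_tmul]

end Bialgebra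

section Hopf

variable {K H : Type} [Field K] [Ring H] [HopfAlgebra K H] (Q : ObjectProperty (HRep K H))

/-- A map dual to the antipode of `H` is an antipode of the restricted dual. -/
theorem isAntipode {S : RestrictedDual Q →ₗ[K] RestrictedDual Q}
    (hS : ∀ c u, eval Q (S c) u = eval Q c (HopfAlgebra.antipode K u)) : IsAntipode S := by
  have h1 : ∀ (z : RestrictedDual Q ⊗[K] RestrictedDual Q) (u v : H),
      ev₂ Q (S.rTensor _ z) u v = ev₂ Q z (HopfAlgebra.antipode K u) v := by
    intro z u v
    induction z using TensorProduct.induction_on with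
    | zero => simp
    | add x y hx hy => simp only [map_add, Pi.add_apply, hx, hy]
    | tmul a b => rw [LinearMap.rTensor_tmul, ev₂_tmul, ev₂_tmul, hS]
  have h2 : ∀ (z : RestrictedDual Q ⊗[K] RestrictedDual Q) (u v : H),
      ev₂ Q (S.lTensor _ z) u v = ev₂ Q z u (HopfAlgebra.antipode K v) := by
    intro z u v
    induction z using TensorProduct.induction_on with
    | zero => simp
    | add x y hx hy => simp only [map_add, Pi.add_apply, hx, hy]
    | tmul a b => rw [LinearMap.lTensor_tmul, ev₂_tmul, ev₂_tmul, hS]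
  have h3 : ∀ (c : RestrictedDual Q) (u : H), eval Q (algebraMap K _ (Coalgebra.counit (R := K) c)) u =
      eval Q c (algebraMap K H (Coalgebra.counit (R := K) u)) := by
    intro c u
    rw [Algebra.algebraMap_eq_smul_one, Algebra.algebraMap_eq_smul_one, map_smul, map_smul,
      LinearMap.smul_apply, eval_one, counit_apply, smul_eq_mul, smul_eq_mul, mul_comm]
  constructor
  · refine LinearMap.ext fun c => eval_ext Q fun u => ?_
    have r := Coalgebra.Repr.arbitrary K u
    simp only [LinearMap.comp_apply, Algebra.linearMap_apply]
    rw [h3, eval_mul' Q _ u r]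
    simp only [h1, ev₂_comul]
    rw [← map_sum, ← HopfAlgebra.sum_antipode_mul_eq_algebraMap_counit r]
  · refine LinearMap.ext fun c => eval_ext Q fun u => ?_
    have r := Coalgebra.Repr.arbitrary K u
    simp only [LinearMap.comp_apply, Algebra.linearMap_apply]
    rw [h3, eval_mul' Q _ u r]
    simp only [h2, ev₂_comul]
    rw [← map_sum, ← HopfAlgebra.sum_mul_antipode_eq_algebraMap_counit r]

end Hopf

end RestrictedDual

end QG

end

noncomputable section

namespace QG

open MulOpposite CategoryTheory MonoidalCategory

namespace Datum

variable {n : ℕ} (R : Datum n) {X : HRep ℂ R.U}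

/-! ### The Hopf algebra structure on the function algebra -/

/-- Composing `c_{f,v}` with the antipode gives the coordinate function of the dual module at the
vector `f` and the functional evaluation at `v`; such functions span. -/
theorem exists_antipode_Cfun (c : R.Cfun) : ∃ c' : R.Cfun,
    RestrictedDual.eval R.Cq c' = RestrictedDual.eval R.Cq c ∘ₗ HopfAlgebra.antipode ℂ := by
  induction c using RestrictedDual.span_induction with
  | h0 => exact ⟨0, by simp⟩
  | hadd x y hx hy =>
    obtain ⟨x', hx⟩ := hx
    obtain ⟨y', hy⟩ := hy
    exact ⟨x' + y', by rw [map_add, map_add, LinearMap.add_comp, hx, hy]⟩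
  | hsmul r x hx =>
    obtain ⟨x', hx⟩ := hx
    exact ⟨r • x', by rw [map_smul, map_smul, LinearMap.smul_comp, hx]⟩
  | hc X hX hfin f v =>
    exact ⟨RestrictedDual.coord (hX.dual R.paramU.antipodeEquiv unop_antipodeEquiv_k)
      (X.finite_dual _) (Module.Dual.eval ℂ X.V v) f, rfl⟩

/-- The antipode of `ℂ_q[G]`. -/
def antipodeC : R.Cfun →ₗ[ℂ] R.Cfun :=
  RestrictedDual.liftEval R.Cq
    ((LinearMap.lcomp ℂ ℂ (HopfAlgebra.antipode ℂ)) ∘ₗ RestrictedDual.eval R.Cq)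
    R.exists_antipode_Cfun

theorem eval_antipodeC (c : R.Cfun) (u : R.U) : RestrictedDual.eval R.Cq (R.antipodeC c) u =
    RestrictedDual.eval R.Cq c (HopfAlgebra.antipode ℂ u) :=
  LinearMap.congr_fun (RestrictedDual.eval_liftEval R.Cq _ R.exists_antipode_Cfun c) u

instance : HopfAlgebra ℂ R.Cfun :=
  { (inferInstance : Bialgebra ℂ R.Cfun) with
    antipode := R.antipodeC
    mul_antipode_rTensor_comul := (RestrictedDual.isAntipode R.Cq R.eval_antipodeC).left
    mul_antipode_lTensor_comul := (RestrictedDual.isAntipode R.Cq R.eval_antipodeC).right }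

theorem eval_antipode (c : R.Cfun) (u : R.U) :
    RestrictedDual.eval R.Cq (HopfAlgebra.antipode ℂ c) u =
      RestrictedDual.eval R.Cq c (HopfAlgebra.antipode ℂ u) := R.eval_antipodeC c u

instance : IsBigradedHopf R.gradC where
  antipode_mem l m c hc := by
    have hk : ∀ s : R.L, HopfAlgebra.antipode ℂ (R.k s) = R.k (-s) := R.paramU.antipodeMap_k
    have hm : ∀ x y : R.U, HopfAlgebra.antipode ℂ (x * y) =
      HopfAlgebra.antipode ℂ y * HopfAlgebra.antipode ℂ x := R.paramU.antipodeMap_mul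
    rw [mem_gradC] at hc ⊢
    constructor
    · intro s u
      rw [eval_antipode, eval_antipode, hm, hk, hc.2, R.χ_neg_left, R.χ_neg_right]
    · intro s u
      rw [eval_antipode, eval_antipode, hm, hk, hc.1, R.χ_neg_left, R.χ_neg_right, inv_inv]

/-! ### The twisted pairing -/

/-- An element of degree `(γ, δ)` has weight `-(γ + δ)` for conjugation by the torus. -/
theorem k_mul_π {g : R.L × R.L} {u : R.D} (hu : u ∈ R.degD.grading g) : ∀ l : R.L,
    R.k l * R.π u = R.χ l (-(g.1 + g.2)) • (R.π u * R.k l) := by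
  refine R.degD.grading_induction (C := fun g u => ∀ l : R.L,
    R.k l * R.π u = R.χ l (-(g.1 + g.2)) • (R.π u * R.k l)) ?_ ?_ ?_ ?_ ?_ ?_ ?_ ?_ hu
  · intro g l
    simp
  · intro l
    simp [R.χ_zero_right]
  · intro g l
    have e : -(-R.degD.θ g + R.degD.θ g) = 0 := by abel
    dsimp only
    rw [e, R.χ_zero_right, one_smul, π_k_eq, (R.paramU.k_commute l _).eq]
  · intro i l
    have e : -(-R.degD.α i + 0) = R.α i := by rw [add_zero, neg_neg]; rfl
    dsimp only
    rw [e, R.π_e]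
    exact R.paramU.isRep.k_e l i
  · intro i l
    have e : -(0 + R.degD.α i) = -R.α i := by rw [zero_add]; rfl
    dsimp only
    rw [e, R.π_f, R.χ_neg_right]
    exact R.paramU.isRep.k_f l i
  · intro g h u v hu hv l
    have e : -((g + h).1 + (g + h).2) = -(g.1 + g.2) + -(h.1 + h.2) := by
      rw [Prod.fst_add, Prod.snd_add]; abel
    rw [map_mul, ← mul_assoc, hu, smul_mul_assoc, mul_assoc, hv, mul_smul_comm, smul_smul, e,
      R.χ_add_right, mul_assoc]
  · intro g u v hu hv l
    rw [map_add, mul_add, add_mul, hu, hv, smul_add]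
  · intro g r u hu l
    rw [map_smul, mul_smul_comm, hu, smul_mul_assoc, smul_comm]

/-- The pairing only pairs matching degrees. -/
theorem degree_eq_of_pairing_ne_zero {g h : R.L × R.L} {a : R.Cfun} {u : R.D} (ha : a ∈ R.gradC g)
    (hu : u ∈ R.degD.grading h) (h0 : R.pairing a u ≠ 0) : g.1 + g.2 = h.1 + h.2 := by
  rw [mem_gradC] at ha
  -- The value of `a` at `k_l π(u)` is computed in two ways: by the left degree of `a`, and by
  -- moving `k_l` to the right and using the right degree.
  have key : -g.1 = -(h.1 + h.2) + g.2 := R.χ_separates fun l => by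
    have h1 := ha.1 l (R.π u)
    rw [R.k_mul_π hu, map_smul, ha.2, smul_eq_mul, ← mul_assoc] at h1
    rw [R.χ_add_right]
    exact (mul_right_cancel₀ h0 h1).symm
  have h2 : g.1 + g.2 = g.2 - -g.1 := by abel
  rw [h2, key]
  abel

/-- The coordinate functions as a bilinear map. -/
def coordL (hX : R.Cq X) : Module.Dual ℂ X.V →ₗ[ℂ] X.V →ₗ[ℂ] R.Cfun :=
  LinearMap.mk₂ ℂ (fun f v => RestrictedDual.coord hX (Cq.finite R hX) f v)
    (fun f g v => RestrictedDual.eval_ext _ fun u => by simp [RestrictedDual.eval_coord])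
    (fun r f v => RestrictedDual.eval_ext _ fun u => by simp [RestrictedDual.eval_coord])
    (fun f v w => RestrictedDual.eval_ext _ fun u => by simp [RestrictedDual.eval_coord])
    (fun r f v => RestrictedDual.eval_ext _ fun u => by simp [RestrictedDual.eval_coord])

variable (p : Bichar R.L ℂ)

/-- Under the twisted pairing, coordinate functions of `M` are coordinate functions of `M̆`. -/
theorem pairingP_coord (hX : R.Cq X) (f : Module.Dual ℂ X.V) (v : X.V) (u : R.Dp p) :
    R.pairingP p (Twist.of R.gradC p (RestrictedDual.coord hX (Cq.finite R hX) f v)) u =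
      f (R.breveρ p hX u v) := by
  obtain ⟨u, rfl⟩ := (Twist.of R.degD.grading p⁻¹).surjective u
  -- The dual module lies in `Cq`, hence is spanned by its weight vectors; this allows `f` to be
  -- taken homogeneous.
  let s := R.paramU.antipodeEquiv
  have hD : R.Cq (X.dual s) := hX.dual s unop_antipodeEquiv_k
  have key : ∀ u : R.D, ((R.coordL hX).compr₂ ((R.pairingP p).flip (Twist.of _ p⁻¹ u) ∘ₗ
        (Twist.of R.gradC p).toLinearMap)) ∘ₗ (X.dualEquiv s).toLinearMap =
      LinearMap.lcomp ℂ ℂ (R.breveρ p hX (Twist.of _ p⁻¹ u)) ∘ₗ (X.dualEquiv s).toLinearMap := by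
    intro u
    refine ext_wt hD fun l f hf => ext_wt hX fun m v hv => ?_
    change R.pairingP p (Twist.of R.gradC p (RestrictedDual.coord hX (Cq.finite R hX)
      (X.dualEquiv s f) v)) (Twist.of _ p⁻¹ u) =
      X.dualEquiv s f (R.breveρ p hX (Twist.of _ p⁻¹ u) v)
    have hf' : ∀ m x, X.dualEquiv s f (X.ρ (R.k m) x) = R.χ m (-l) * X.dualEquiv s f x := by
      intro m x
      have h1 := LinearMap.congr_fun (congrArg (X.dualEquiv s) (R.mem_wt.mp hf (-m))) x
      rw [HRep.dual_ρ_apply, unop_antipodeEquiv_k, neg_neg, map_smul, LinearMap.smul_apply,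
        smul_eq_mul, R.χ_neg_left, ← R.χ_neg_right] at h1
      exact h1
    have hc : RestrictedDual.coord hX (Cq.finite R hX) (X.dualEquiv s f) v ∈ R.gradC (l, m) :=
      R.coord_mem_gradC hX (g := (l, m)) hf' hv
    induction u using DirectSum.Decomposition.inductionOn R.degD.grading with
    | zero => simp
    | add a b ha hb => simp only [map_add, LinearMap.add_apply, ha, hb]
    | @homogeneous h u =>
    rw [R.pairingP_of p hc u.2, breveρ_apply p hX u.2 hv, map_smul, smul_eq_mul]
    change _ * R.pairing (RestrictedDual.coord hX (Cq.finite R hX) (X.dualEquiv s f) v) u =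
      _ * R.pairing (RestrictedDual.coord hX (Cq.finite R hX) (X.dualEquiv s f) v) u
    by_cases h0 : R.pairing (RestrictedDual.coord hX (Cq.finite R hX) (X.dualEquiv s f) v) u = 0
    · rw [h0, mul_zero, mul_zero]
    -- Nonvanishing forces `l + m = γ + δ`, and then `p(l, γ) p(m, δ) = p(m, δ - γ) p(δ, γ)` because
    -- `p(γ, γ) = 1`.
    have hdeg : l + m = h.1 + h.2 := R.degree_eq_of_pairing_ne_zero hc u.2 h0
    have hl : l = h.1 + h.2 - m := by rw [← hdeg]; abel
    congr 2
    dsimp only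
    rw [hl, p.sub_left, p.add_left, p.sub_right, p.self_eq_one, one_mul]
    rw [mul_comm, mul_comm (p h.2 h.1), mul_assoc]
  exact LinearMap.congr_fun (LinearMap.congr_fun (key u) ((X.dualEquiv s).symm f)) v

/-- Where both factors are nonzero, the degree condition determines the middle degree `ν` and ties
`δ` to the degrees of `a` and `b`. With these substitutions the scalar of the product of pairings
becomes the cocycle times the scalar of the pairing with the product `a b`. -/
theorem pairingP_map {g g' : R.L × R.L} {a b : R.Cfun} (ha : a ∈ R.gradC g) (hb : b ∈ R.gradC g')
    {γ δ : R.L} {w : R.D ⊗[ℂ] R.D} (hw : w ∈ bigradedTensor R.degD.grading γ δ) :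
    LinearMap.mul' ℂ ℂ (TensorProduct.map (R.pairingP p (Twist.of _ p a))
      (R.pairingP p (Twist.of _ p b)) (TensorProduct.map (Twist.of R.degD.grading p⁻¹).toLinearMap
        (Twist.of R.degD.grading p⁻¹).toLinearMap w)) =
    ((p.tilde g g' * (p (g + g').1 γ * p (g + g').2 δ) : ℂˣ) : ℂ) *
      LinearMap.mul' ℂ ℂ (TensorProduct.map (R.pairing a) (R.pairing b) w) := by
  induction hw using Submodule.span_induction with
  | zero => simp
  | add x y _ _ h1 h2 => simp only [map_add, h1, h2, mul_add]
  | smul r x _ h => simp only [map_smul, h, smul_eq_mul, mul_left_comm]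
  | mem w hw =>
  obtain ⟨ν, u, hu, v, hv, rfl⟩ := hw
  simp only [TensorProduct.map_tmul, LinearEquiv.coe_coe, LinearMap.mul'_apply]
  rw [R.pairingP_of p ha hu, R.pairingP_of p hb hv, mul_mul_mul_comm, ← Units.val_mul]
  by_cases h1 : R.pairing a u = 0
  · rw [h1, zero_mul, mul_zero, mul_zero]
  by_cases h2 : R.pairing b v = 0
  · rw [h2, mul_zero, mul_zero, mul_zero]
  have e1 := R.degree_eq_of_pairing_ne_zero ha hu h1
  have e2 := R.degree_eq_of_pairing_ne_zero hb hv h2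
  dsimp only at e1 e2
  have e3 : ν = g.1 + g.2 - γ := by rw [e1]; abel
  have e4 : δ = g'.1 + g'.2 + (g.1 + g.2 - γ) := by rw [e2, e3]; abel
  congr 2
  subst e3 e4
  simp only [Bichar.tilde, Prod.fst_add, Prod.snd_add, p.add_left, p.add_right, p.sub_right,
    p.neg_right, p.self_eq_one]
  rw [p.swap g.2 g.1, p.swap g'.1 g.1, p.swap g'.1 g.2, p.swap g'.2 g'.1, p.swap g'.2 g.1,
    p.swap g'.2 g.2]
  have h0 : ∀ u : ℂˣ, (u : ℂ) ≠ 0 := fun u => u.ne_zero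
  refine Units.ext ?_
  push_cast
  have := h0 (p g.1 γ)
  have := h0 (p g.2 γ)
  have := h0 (p g'.1 γ)
  have := h0 (p g'.2 γ)
  have := h0 (p g.1 g.2)
  have := h0 (p g.1 g'.1)
  have := h0 (p g.1 g'.2)
  have := h0 (p g.2 g'.1)
  have := h0 (p g.2 g'.2)
  have := h0 (p g'.1 g'.2)
  field_simp

end Datum

end QG

end

/-! ### The isomorphism with the restricted dual of the twisted category -/

noncomputable section

namespace QG

open MulOpposite CategoryTheory MonoidalCategory

namespace Datum

variable {n : ℕ} (R : Datum n) (p : Bichar R.L ℂ)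

theorem exists_eval_eq_pairingP (a : R.Cpfun p) :
    ∃ c, RestrictedDual.eval (R.Cqp p) c = R.pairingP p a := by
  obtain ⟨a, rfl⟩ := (Twist.of R.gradC p).surjective a
  induction a using RestrictedDual.span_induction with
  | h0 => exact ⟨0, by simp⟩
  | hadd x y hx hy =>
    obtain ⟨x', hx⟩ := hx
    obtain ⟨y', hy⟩ := hy
    exact ⟨x' + y', by rw [map_add, map_add, map_add, hx, hy]⟩
  | hsmul r x hx =>
    obtain ⟨x', hx⟩ := hx
    exact ⟨r • x', by rw [map_smul, map_smul, map_smul, hx]⟩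
  | hc X hX hfin f v =>
    exact ⟨RestrictedDual.coord (X := R.breveObj p X hX)
      ((R.breve p).obj_mem_essImage ⟨X, hX⟩) hfin f v,
      LinearMap.ext fun u => (R.pairingP_coord p hX f v u).symm⟩

/-- The map `a ↦ ⟨a, ·⟩_p` to the restricted dual of `𝒞_{q,p}`. -/
def toRestrictedDual : R.Cpfun p →ₗ[ℂ] RestrictedDual (R.Cqp p) :=
  RestrictedDual.liftEval _ (R.pairingP p) (R.exists_eval_eq_pairingP p)

theorem eval_toRestrictedDual (a : R.Cpfun p) (u : R.Dp p) :
    RestrictedDual.eval (R.Cqp p) (R.toRestrictedDual p a) u = R.pairingP p a u :=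
  LinearMap.congr_fun (RestrictedDual.eval_liftEval _ _ (R.exists_eval_eq_pairingP p) a) u

/-- Coordinate functions span the target, and one belonging to a module isomorphic to a twisted
module is transported along the isomorphism. -/
theorem toRestrictedDual_surjective : Function.Surjective (R.toRestrictedDual p) := by
  intro c
  induction c using RestrictedDual.span_induction with
  | h0 => exact ⟨0, map_zero _⟩
  | hadd x y hx hy =>
    obtain ⟨x, rfl⟩ := hx
    obtain ⟨y, rfl⟩ := hy
    exact ⟨x + y, map_add _ _ _⟩
  | hsmul r x hx =>
    obtain ⟨x, rfl⟩ := hx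
    exact ⟨r • x, map_smul _ _ _⟩
  | hc Y hY hfin f v =>
    obtain ⟨⟨X, hX⟩, ⟨i⟩⟩ := hY
    refine ⟨Twist.of R.gradC p (RestrictedDual.coord hX (Cq.finite R hX) (f ∘ₗ i.hom.hom.hom)
      (i.inv.hom.hom v)), RestrictedDual.eval_ext _ fun u => ?_⟩
    have h : i.hom.hom.hom (i.inv.hom.hom v) = v :=
      LinearMap.congr_fun (congrArg (fun g : Y ⟶ Y => g.hom.hom) i.inv_hom_id) v
    refine (R.eval_toRestrictedDual p _ u).trans ((R.pairingP_coord p hX _ _ u).trans ?_)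
    change f (i.hom.hom.hom (((R.breve p).obj ⟨X, hX⟩).ρ u (i.inv.hom.hom v))) = f (Y.ρ u v)
    rw [i.hom.comm, h]

/-- Multiplication by `s_l t_l` is not affected by the twist, its degree being `(0, 0)`, and under
`π` it becomes multiplication by `k_{2l}`. Translations by these elements therefore read off twice
the bidegree of `a`. -/
theorem pairingP_k {g : R.L × R.L} {a : R.Cfun} (ha : a ∈ R.gradC g) (l : R.L) (u : R.Dp p) :
    R.pairingP p (Twist.of _ p a) (Twist.of R.degD.grading p⁻¹ (R.paramD.k (l, l)) * u) =
      R.χ l (-(g + g).1) * R.pairingP p (Twist.of _ p a) u ∧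
    R.pairingP p (Twist.of _ p a) (u * Twist.of R.degD.grading p⁻¹ (R.paramD.k (l, l))) =
      R.χ l (g + g).2 * R.pairingP p (Twist.of _ p a) u := by
  obtain ⟨u, rfl⟩ := (Twist.of R.degD.grading p⁻¹).surjective u
  have hk := R.degD.k_mem (l, l)
  have h0 : R.degD.θ (l, l) = 0 := sub_self l
  rw [h0, neg_zero] at hk
  have ha' := R.mem_gradC.mp ha
  have hπ : R.π (R.paramD.k (l, l)) = R.k (l + l) := R.π_k (l, l)
  generalize R.paramD.k (l, l) = kk at hk hπ ⊢
  induction u using DirectSum.Decomposition.inductionOn R.degD.grading with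
  | zero => simp
  | add a b ha hb => simp only [map_add, mul_add, add_mul, ha.1, hb.1, ha.2, hb.2, and_self]
  | @homogeneous h u =>
  have m1 := SetLike.mul_mem_graded hk u.2
  have m2 := SetLike.mul_mem_graded u.2 hk
  have e1 : ((0 : R.L), (0 : R.L)) + h = h := zero_add h
  have e2 : h + ((0 : R.L), (0 : R.L)) = h := add_zero h
  rw [e1] at m1
  rw [e2] at m2
  rw [Twist.of_mul_of _ _ hk u.2, Twist.of_mul_of _ _ u.2 hk, map_smul, map_smul,
    R.pairingP_of p ha m1, R.pairingP_of p ha m2, R.pairingP_of p ha u.2, pairing_apply,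
    pairing_apply, pairing_apply, map_mul R.π, map_mul R.π, hπ, ha'.1, ha'.2]
  have t1 := (p⁻¹).tilde_zero_left h
  have t2 := (p⁻¹).tilde_zero_right h
  rw [show (p⁻¹).tilde ((0 : R.L), (0 : R.L)) h = 1 from t1,
    show (p⁻¹).tilde h ((0 : R.L), (0 : R.L)) = 1 from t2, R.χ_add_left, R.χ_add_left,
    Prod.fst_add, Prod.snd_add, neg_add, R.χ_add_right, R.χ_add_right]
  simp only [Units.val_one, one_smul]
  constructor <;> ring

/-- Translations by the `s_l t_l` on the full dual separate bidegrees, so the functionals of the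
homogeneous components of a kernel element vanish one by one. On a homogeneous component the twisted
and untwisted pairings with homogeneous elements differ by units, and `π` is surjective, so the
component is zero. -/
theorem toRestrictedDual_injective : Function.Injective (R.toRestrictedDual p) := by
  rw [injective_iff_map_eq_zero]
  intro a ha
  obtain ⟨a, rfl⟩ := (Twist.of R.gradC p).surjective a
  rw [LinearEquiv.map_eq_zero_iff]
  -- These are the elements `s_l t_l`; having degree `(0, 0)`, they commute in the twisted algebra
  -- as well.
  let K : R.L → R.Dp p := fun l => Twist.of R.degD.grading p⁻¹ (R.paramD.k (l, l))
  have hK : ∀ l l', K l * K l' = K l' * K l := by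
    intro l l'
    have h0 : ∀ l, R.paramD.k (l, l) ∈ R.degD.grading (0, 0) := fun l => by
      have hk := R.degD.k_mem (l, l)
      have h0 : R.degD.θ (l, l) = 0 := sub_self l
      rwa [h0, neg_zero] at hk
    change Twist.of _ _ _ * Twist.of _ _ _ = Twist.of _ _ _ * Twist.of _ _ _
    rw [Twist.of_mul_of _ _ (h0 l) (h0 l'), Twist.of_mul_of _ _ (h0 l') (h0 l)]
    exact congrArg (fun x => ((p⁻¹.tilde (0, 0) (0, 0) : ℂˣ) : ℂ) • Twist.of R.degD.grading p⁻¹ x)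
      (R.paramD.k_commute (l, l) (l', l')).eq
  let T : R.L → Module.End ℂ (R.Dp p →ₗ[ℂ] ℂ) := fun l =>
    LinearMap.lcomp ℂ ℂ (LinearMap.mulLeft ℂ (K l))
  let T' : R.L → Module.End ℂ (R.Dp p →ₗ[ℂ] ℂ) := fun l =>
    LinearMap.lcomp ℂ ℂ (LinearMap.mulRight ℂ (K l))
  have hind : iSupIndep fun g : R.L × R.L => R.eigen₂ T T' (g + g) := by
    refine (R.iSupIndep_eigen₂ T T' ?_ ?_ ?_).comp (f := fun g : R.L × R.L => g + g) ?_
    · intro l l'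
      refine LinearMap.ext fun φ => LinearMap.ext fun u => ?_
      change φ (K l' * (K l * u)) = φ (K l * (K l' * u))
      rw [← mul_assoc, ← mul_assoc, hK]
    · intro l l'
      refine LinearMap.ext fun φ => LinearMap.ext fun u => ?_
      change φ ((u * K l) * K l') = φ ((u * K l') * K l)
      rw [mul_assoc, mul_assoc, hK]
    · intro l l'
      refine LinearMap.ext fun φ => LinearMap.ext fun u => ?_
      change φ (K l * u * K l') = φ (K l * (u * K l'))
      rw [mul_assoc]
    · have hL : ∀ m m' : R.L, m + m = m' + m' → m = m' := fun m m' h => by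
        refine Subtype.ext (funext fun i => ?_)
        have := congrFun (congrArg Subtype.val h) i
        change m.1 i + m.1 i = m'.1 i + m'.1 i at this
        omega
      intro g g' h
      exact Prod.ext (hL _ _ (congrArg Prod.fst h)) (hL _ _ (congrArg Prod.snd h))
  let P : R.Cfun →ₗ[ℂ] R.Dp p →ₗ[ℂ] ℂ := R.pairingP p ∘ₗ (Twist.of R.gradC p).toLinearMap
  have hP : P a = 0 := LinearMap.ext fun u => by
    change R.pairingP p (Twist.of R.gradC p a) u = 0
    rw [← R.eval_toRestrictedDual p, ha]
    simp
  classical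
  have hsum := DirectSum.sum_support_decompose R.gradC a
  have hz := (iSupIndep_iff_finsetSum_eq_zero_imp_eq_zero _).mp hind
    (DirectSum.decompose R.gradC a).support
    (fun g => P (DirectSum.decompose R.gradC a g)) (fun g _ => ⟨fun l => ?_, fun l => ?_⟩)
    (by rw [← map_sum, hsum, hP])
  · rw [← hsum]
    refine Finset.sum_eq_zero fun g hg => RestrictedDual.eval_ext _ fun u => ?_
    obtain ⟨u, rfl⟩ := R.π_surjective u
    rw [← pairing_apply]
    set b : R.Cfun := ((DirectSum.decompose R.gradC a) g : R.Cfun) with hb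
    have hbg : b ∈ R.gradC g := SetLike.coe_mem _
    induction u using DirectSum.Decomposition.inductionOn R.degD.grading with
    | zero => simp
    | add u v hu hv => simp only [map_add, hu, hv]
    | @homogeneous h u =>
    have h1 : R.pairingP p (Twist.of _ p b) (Twist.of _ p⁻¹ u) = 0 :=
      LinearMap.congr_fun (hz g hg) _
    rw [R.pairingP_of p hbg u.2, mul_eq_zero] at h1
    rcases h1 with h1 | h1
    · exact absurd h1 (Units.ne_zero _)
    · rw [h1]; simp
  · exact LinearMap.ext fun u => (R.pairingP_k p (SetLike.coe_mem _) l u).1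
  · exact LinearMap.ext fun u => (R.pairingP_k p (SetLike.coe_mem _) l u).2

/-- On homogeneous elements the cocycle of the twisted product is the scalar found in
`pairingP_map`, and what remains is the untwisted duality, valid because `π` respects coproducts. -/
theorem toRestrictedDual_mul (a b : R.Cpfun p) : R.toRestrictedDual p (a * b) =
    R.toRestrictedDual p a * R.toRestrictedDual p b := by
  obtain ⟨a, rfl⟩ := (Twist.of R.gradC p).surjective a
  obtain ⟨b, rfl⟩ := (Twist.of R.gradC p).surjective b
  refine RestrictedDual.eval_ext _ fun u => ?_
  have h1 : RestrictedDual.eval (R.Cqp p) (R.toRestrictedDual p (Twist.of R.gradC p a) *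
      R.toRestrictedDual p (Twist.of R.gradC p b)) u = LinearMap.mul' ℂ ℂ (TensorProduct.map
        (RestrictedDual.eval _ (R.toRestrictedDual p (Twist.of R.gradC p a)))
        (RestrictedDual.eval _ (R.toRestrictedDual p (Twist.of R.gradC p b)))
        (Coalgebra.comul (R := ℂ) u)) := rfl
  have h2 : ∀ a, RestrictedDual.eval _ (R.toRestrictedDual p a) = R.pairingP p a :=
    RestrictedDual.eval_liftEval _ _ (R.exists_eval_eq_pairingP p)
  rw [h1, h2, h2, h2]
  clear h1 h2
  obtain ⟨u, rfl⟩ := (Twist.of R.degD.grading p⁻¹).surjective u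
  induction u using DirectSum.Decomposition.inductionOn R.degD.grading with
  | zero => simp
  | add u v hu hv => simp only [map_add, hu, hv]
  | @homogeneous h u =>
  induction a using DirectSum.Decomposition.inductionOn R.gradC with
  | zero => simp
  | add a a' h1 h2 =>
    simp only [map_add, add_mul, LinearMap.add_apply, h1, h2, TensorProduct.map_add_left]
  | @homogeneous g a =>
  induction b using DirectSum.Decomposition.inductionOn R.gradC with
  | zero => simp
  | add b b' h1 h2 =>
    simp only [map_add, mul_add, LinearMap.add_apply, h1, h2, TensorProduct.map_add_right]
  | @homogeneous g' b =>
  rw [Twist.comul_of, R.pairingP_map p a.2 b.2 (IsBigraded.comul_mem (𝒜 := R.degD.grading)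
    h.1 h.2 _ u.2), Twist.of_mul_of _ _ a.2 b.2, map_smul, LinearMap.smul_apply,
    R.pairingP_of p (SetLike.mul_mem_graded a.2 b.2) u.2, smul_eq_mul, ← mul_assoc,
    ← Units.val_mul]
  congr 1
  change LinearMap.mul' ℂ ℂ (TensorProduct.map (RestrictedDual.eval R.Cq a)
    (RestrictedDual.eval R.Cq b) (Coalgebra.comul (R := ℂ) (R.π u))) = _
  rw [R.comul_π]
  generalize Coalgebra.comul (R := ℂ) (u : R.D) = w
  induction w using TensorProduct.induction_on with
  | zero => simp
  | add x y hx hy => simp only [map_add, hx, hy]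
  | tmul x y => rfl

theorem toRestrictedDual_one : R.toRestrictedDual p 1 = 1 := by
  refine RestrictedDual.eval_ext _ fun u => ?_
  rw [eval_toRestrictedDual, RestrictedDual.eval_one]
  obtain ⟨u, rfl⟩ := (Twist.of R.degD.grading p⁻¹).surjective u
  induction u using DirectSum.Decomposition.inductionOn R.degD.grading with
  | zero => simp
  | add u v hu hv => simp only [map_add, hu, hv]
  | @homogeneous h u =>
  rw [Twist.one_def, R.pairingP_of p SetLike.GradedOne.one_mem u.2, Prod.fst_zero, Prod.snd_zero,
    p.zero_left, p.zero_left, one_mul, Units.val_one, one_mul, pairing_apply,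
    RestrictedDual.eval_one, R.counit_π, Twist.counit_of]

theorem counit_toRestrictedDual (a : R.Cpfun p) :
    Coalgebra.counit (R := ℂ) (R.toRestrictedDual p a) = Coalgebra.counit (R := ℂ) a := by
  obtain ⟨a, rfl⟩ := (Twist.of R.gradC p).surjective a
  rw [Twist.counit_of, RestrictedDual.counit_apply, RestrictedDual.counit_apply]
  induction a using RestrictedDual.span_induction with
  | h0 => simp
  | hadd x y hx hy => simp only [map_add, LinearMap.add_apply, hx, hy]
  | hsmul r x hx => simp only [map_smul, LinearMap.smul_apply, hx]
  | hc X hX hfin f v =>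
    rw [eval_toRestrictedDual, pairingP_coord, RestrictedDual.eval_coord, map_one, map_one]

/-- It suffices to treat coordinate functions. Those of a module and of its twist obey the same
matrix-coefficient formula, because the underlying space, and hence a basis of it, is unchanged. -/
theorem comul_toRestrictedDual (a : R.Cpfun p) :
    Coalgebra.comul (R := ℂ) (R.toRestrictedDual p a) =
      TensorProduct.map (R.toRestrictedDual p) (R.toRestrictedDual p)
        (Coalgebra.comul (R := ℂ) a) := by
  obtain ⟨a, rfl⟩ := (Twist.of R.gradC p).surjective a
  rw [Twist.comul_of]
  induction a using RestrictedDual.span_induction with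
  | h0 => simp
  | hadd x y hx hy => simp only [map_add, hx, hy]
  | hsmul r x hx => simp only [map_smul, hx]
  | hc X hX hfin f v =>
    refine RestrictedDual.ev₂_injective _ (funext fun u => funext fun w => ?_)
    rw [RestrictedDual.ev₂_comul, eval_toRestrictedDual, pairingP_coord, map_mul,
      R.comul_coord hX (Module.finBasis ℂ X.V)]
    simp only [map_sum, TensorProduct.map_tmul, LinearEquiv.coe_coe, Finset.sum_apply,
      RestrictedDual.ev₂_tmul, eval_toRestrictedDual, pairingP_coord]
    rw [Module.End.mul_apply]
    conv_lhs => rw [← (Module.finBasis ℂ X.V).sum_repr (R.breveρ p hX w v)]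
    simp only [map_sum, map_smul, smul_eq_mul]
    exact Finset.sum_congr rfl fun i _ => mul_comm _ _

/-- The bialgebra isomorphism from `ℂ_{q,p}[G]` to the restricted dual of `𝒞_{q,p}`. -/
def restrictedDualEquiv : R.Cpfun p ≃ₐc[ℂ] RestrictedDual (R.Cqp p) :=
  BialgEquiv.ofAlgEquiv
    (AlgEquiv.ofLinearEquiv (LinearEquiv.ofBijective (R.toRestrictedDual p)
      ⟨R.toRestrictedDual_injective p, R.toRestrictedDual_surjective p⟩)
      (R.toRestrictedDual_one p) (R.toRestrictedDual_mul p))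
    (AlgHom.ext fun a => R.counit_toRestrictedDual p a)
    (AlgHom.ext fun a => (R.comul_toRestrictedDual p a).symm)

theorem eval_restrictedDualEquiv (a : R.Cpfun p) (u : R.Dp p) :
    RestrictedDual.eval (R.Cqp p) (R.restrictedDualEquiv p a) u = R.pairingP p a u :=
  R.eval_toRestrictedDual p a u

/-- Both antipodes interchange the two degrees, so for `a` of degree `(λ, μ)` and `u` of degree `(γ,
δ)` each side carries the scalar `p(λ, δ) p(μ, γ)`. -/
theorem pairingP_antipode (a : R.Cpfun p) (u : R.Dp p) :
    R.pairingP p (HopfAlgebra.antipode ℂ a) u = R.pairingP p a (HopfAlgebra.antipode ℂ u) := by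
  obtain ⟨a, rfl⟩ := (Twist.of R.gradC p).surjective a
  obtain ⟨u, rfl⟩ := (Twist.of R.degD.grading p⁻¹).surjective u
  change R.pairingP p (Twist.of R.gradC p (HopfAlgebra.antipode ℂ a)) _ =
    R.pairingP p _ (Twist.of R.degD.grading p⁻¹ (HopfAlgebra.antipode ℂ u))
  induction u using DirectSum.Decomposition.inductionOn R.degD.grading with
  | zero => simp
  | add u v hu hv => simp only [map_add, hu, hv]
  | @homogeneous h u =>
  induction a using DirectSum.Decomposition.inductionOn R.gradC with
  | zero => simp
  | add a a' h1 h2 => simp only [map_add, LinearMap.add_apply, h1, h2]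
  | @homogeneous g a =>
  rw [R.pairingP_of p (IsBigradedHopf.antipode_mem (𝒜 := R.gradC) g.1 g.2 _ a.2) u.2,
    R.pairingP_of p a.2 (IsBigradedHopf.antipode_mem (𝒜 := R.degD.grading) h.1 h.2 _ u.2),
    pairing_apply, pairing_apply, eval_antipode, antipode_π, mul_comm (p g.2 h.1)]

end Datum

end QG

end

theorem theorem3p7 {n : ℕ} (R : QG.Datum n) (p : QG.Bichar R.L ℂ) :
    (∃ (_ : R.Cq.IsMonoidal) (_ : (R.Cqp p).IsMonoidal),
      Nonempty (CategoryTheory.RigidCategory R.Cq.FullSubcategory) ∧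
      Nonempty (CategoryTheory.RigidCategory (R.Cqp p).FullSubcategory) ∧
      (R.breveFunctor p).IsEquivalence ∧
      Nonempty (R.breveFunctor p).Monoidal) ∧
    ∃ Θ : R.Cpfun p ≃ₐc[ℂ] QG.RestrictedDual (R.Cqp p),
      (∀ (a : R.Cpfun p) (u : R.Dp p),
        QG.RestrictedDual.eval (R.Cqp p) (Θ a) u = R.pairingP p a u) ∧
      (∀ (M : QG.HRep ℂ R.U) (hM : R.Cq M) (f : Module.Dual ℂ M.V) (v : M.V) (u : R.Dp p),
        R.pairingP p (QG.Twist.of R.gradC p (QG.RestrictedDual.coord hM hM.finite f v)) u =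
          f ((R.breveObj p M hM).ρ u v)) ∧
      ∃ (S : R.Cpfun p →ₗ[ℂ] R.Cpfun p)
        (S' : QG.RestrictedDual (R.Cqp p) →ₗ[ℂ] QG.RestrictedDual (R.Cqp p)),
        QG.IsAntipode S ∧ QG.IsAntipode S' ∧ (∀ a, Θ (S a) = S' (Θ a)) ∧
        ∀ (a : R.Cpfun p) (u : R.Dp p),
          R.pairingP p (S a) u = R.pairingP p a (HopfAlgebra.antipode ℂ u) := by
  -- The antipode of the restricted dual is the transport of that of `Cpfun`. It is an antipode
  -- because it is dual to the antipode of the twisted double.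
  have hS : ∀ a : R.Cpfun p, R.restrictedDualEquiv p (HopfAlgebra.antipode ℂ a) =
      ((R.restrictedDualEquiv p).toLinearEquiv.toLinearMap ∘ₗ HopfAlgebra.antipode ℂ ∘ₗ
        (R.restrictedDualEquiv p).toLinearEquiv.symm.toLinearMap) (R.restrictedDualEquiv p a) :=
    fun a => congrArg (fun x => R.restrictedDualEquiv p (HopfAlgebra.antipode ℂ x))
      ((R.restrictedDualEquiv p).toLinearEquiv.symm_apply_apply a).symm
  refine ⟨⟨inferInstance, inferInstance, QG.Datum.nonempty_rigidCategory_Cq R,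
    QG.Datum.nonempty_rigidCategory_Cqp p, inferInstance, ⟨inferInstance⟩⟩,
    R.restrictedDualEquiv p, R.eval_restrictedDualEquiv p,
    fun M hM f v u => R.pairingP_coord p hM f v u, HopfAlgebra.antipode ℂ, _,
    ⟨HopfAlgebra.mul_antipode_rTensor_comul, HopfAlgebra.mul_antipode_lTensor_comul⟩,
    QG.RestrictedDual.isAntipode (R.Cqp p) fun c u => ?_, hS, R.pairingP_antipode p⟩
  obtain ⟨a, rfl⟩ := (R.restrictedDualEquiv p).toLinearEquiv.surjective c
  exact (congrArg (fun c => QG.RestrictedDual.eval (R.Cqp p) c u) (hS a)).symm.trans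
    ((R.eval_restrictedDualEquiv p _ u).trans ((R.pairingP_antipode p a u).trans
      (R.eval_restrictedDualEquiv p a _).symm))
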